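/- **Setting.** $\mathbb H$ is the Hamilton quaternion algebra, $|\beta|=\sqrt{\beta\bar\beta}$, $\mathcal O=\mathbb Z+\mathbb Zi+\mathbb Zj+\mathbb Z\frac{1+i+j+ij}2$, $S=\mathbb Z(1-ij)+\mathbb Z(-i-ij)+\mathbb Z(-j-ij)+\mathbb Z\,2ij$, $\varpi_2=1+i$ (so that $S=\varpi_2\mathcal O=\mathcal O\varpi_2$), and $\varpi_2^m\mid\beta$ means $\beta\in\varpi_2^m\mathcal O$. Let $S^{\rm prim}$ be the set of $\beta\in S\setminus\{0\}$ with $\varpi_2\mid\beta$, $\varpi_2^2\nmid\beta$ and $\beta\notin dS$ for all odd integers $d\ne\pm1$. Let $r\in\mathbb C$ and let $f$ be a Maass cusp form of weight $0$ for $\Gamma_0(2)$ on the upper half plane $\mathfrak h$ with $-y^2(\partial_x^2+\partial_y^2)f=(\frac14+\frac{r^2}4)f$ and Fourier expansion $f(x+iy)=\sum_{n\ne0}c(n)W_{0,ir/2}(4\pi|n|y)e^{2\pi inx}$, where $W_{0,\mu}(y)=\sqrt{y/\pi}\,K_\mu(y/2)$ is the Whittaker function, and suppose $f(-1/(2z))=\epsilon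 f(z)$ with $\epsilon\in\{\pm1\}$. For a homogeneous harmonic polynomial $P$ of degree $l\ge0$ on $\mathbb H\cong\mathbb R^4$ (complex coefficients) put $\hat P(x)=P(\bar x)$ and $$\xi(s,P)=\pi^{-2s}\,\Gamma\!\left(s+\tfrac{ir}2\right)\Gamma\!\left(s-\tfrac{ir}2\right)\sum_{\beta\in S\setminus\{0\}}A(\beta)\frac{P(\beta)}{|\beta|^{2s}},\qquad \Theta_P(z)=\sum_{\beta\in S}P(\beta)e^{2\pi i\frac{|\beta|^2}2z}.$$ For even $l$ let $\Gamma_\infty=\{\pm\begin{pmatrix}1&m\\0&1\end{pmatrix}\mid m\in\mathbb Z\}$ and, for $\operatorname{Re}s>1$ and with $(c,d)$ the bottom row of $\gamma$, $$\tilde E_\infty(z,s)=(4\pi)^{l/2}\,\pi^{-s}\,\Gamma\!\left(s+\tfrac l2+1\right)\zeta(2s)\cdot\frac12\sum_{\gamma\in\Gamma_\infty\backslash\Gamma_0(2)}\left(\frac{cz+d}{|cz+d|}\right)^{l+2}\left(\frac{\operatorname{Im}z}{|cz+d|^2}\right)^s,$$ continued meromorphically in $s$ to $\mathbb C$, and $$I(s)=I_P(s)=\int_{\Gamma_0(2)\backslash\mathfrak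 h}f(z)\,\Theta_P(z)\,\tilde E_\infty(z,s)\,y^{\frac{l+2}2}\,\frac{dx\,dy}{y^2}.$$ **Proposition 4.2.** Every $\beta\in S\setminus\{0\}$ can be written as $\beta=\varpi_2^u\,d\,\beta_0$ with an integer $u\ge0$, an odd integer $d$ and $\beta_0\in S^{\rm prim}$, and $$A(\beta)=|\beta|\sum_{t=0}^u\ \sum_{n\mid d,\,n\ge1}(-\epsilon)^t\,c\!\left(-\frac{|\beta|^2}{2^{t+1}n^2}\right)$$ does not depend on the choice of this expression. There is $\kappa>0$ with $A(\beta)=O(|\beta|^\kappa)$, and for every $l$ and every homogeneous harmonic $P$ of degree $l$ the series $\xi(s,P)$ converges absolutely for $\operatorname{Re}s>\frac{l+4+\kappa}2$. Now let $P=P_{l,\nu}\neq0$ be homogeneous harmonic of degree $l$ with $P(\frac{1+i}{\sqrt2}x)=\epsilon_{l,\nu}P(x)$ for all $x\in\mathbb H$ (for instance, a member of a basis of such eigenvectors of the space of harmonic polynomials of degree $l$). Then: 1. $\xi(s,P_{l,\nu})$ and $\xi(s,\hat P_{l,\nu})$ continue to entire functions of $s$; 2. $\xi(s,P_{l,\nu})$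 is bounded on every vertical strip; 3. $\xi(2+l-s,P_{l,\nu})=(-1)^l\,\xi(s,\hat P_{l,\nu})$; 4. if $\epsilon_{l,\nu}\in\{\pm1\}$ (which forces $l$ to be even), then $\tilde E_\infty(z,\cdot)$ has, for every $z\in\mathfrak h$, a meromorphic continuation to $\mathbb C$ that is holomorphic where $2^{2s}\ne1$; for all $s\in\mathbb C$ with $2^{2s}\neq1$ the integral $I(s)$ converges absolutely and $$\xi\!\left(s+\tfrac l2+\tfrac12,P_{l,\nu}\right)=2^{1-\frac l2}\,\pi^{-(l+1)}\,(2^s-\epsilon\,\epsilon_{l,\nu})\,I(s);$$ 5. if $\epsilon_{l,\nu}\notin\{\pm1\}$, then $\xi(s+\frac l2+\frac12,P_{l,\nu})=0$ for all $s\in\mathbb C$. -/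

import Mathlib

open scoped ContDiff MatrixGroups Quaternion

noncomputable section

namespace MaassLift

/-! ## Maass cusp forms for `Γ₀(2)` -/

/-- The modified Bessel function `K_α(y) = ∫₀^∞ exp(-y cosh t) cosh(α t) dt` (`y > 0`). -/
def besselK (α : ℂ) (y : ℝ) : ℂ :=
  ∫ t in Set.Ioi (0 : ℝ), Complex.exp (-((y * Real.cosh t : ℝ) : ℂ)) * Complex.cosh (α * t)

/-- The Whittaker function `W_{0,μ}(y) = √(y/π) K_μ(y/2)` (`y > 0`). -/
def whittakerW0 (μ : ℂ) (y : ℝ) : ℂ := (Real.sqrt (y / Real.pi) : ℂ) * besselK μ (y / 2)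

/-- `f` is a weight `0` Maass cusp form for `Γ₀(2)` on which the (positive) hyperbolic Laplacian
`-y²(∂²/∂x² + ∂²/∂y²)` has eigenvalue `1/4 + r²/4`. The matrices `γ ∈ SL₂(ℤ)` in the last two
conditions carry `∞` to all the cusps of `Γ₀(2)`, whose widths divide `2`. -/
structure IsMaassCuspForm (r : ℂ) (f : UpperHalfPlane → ℂ) : Prop where
  smooth : ContDiffOn ℝ ∞ (fun w : ℂ => f (UpperHalfPlane.ofComplex w)) {w : ℂ | 0 < w.im}
  invariant : ∀ γ ∈ CongruenceSubgroup.Gamma0 2, ∀ z : UpperHalfPlane, f (γ • z) = f z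
  eigen : ∀ z : UpperHalfPlane,
    -((z.im ^ 2 : ℝ) : ℂ) *
        Laplacian.laplacian (fun w : ℂ => f (UpperHalfPlane.ofComplex w)) (z : ℂ)
      = (1 / 4 + r ^ 2 / 4) * f z
  moderate : ∀ γ : SL(2, ℤ), ∃ C N : ℝ, ∀ z : UpperHalfPlane, 1 ≤ z.im →
    ‖f (γ • z)‖ ≤ C * z.im ^ N
  cuspidal : ∀ γ : SL(2, ℤ), ∀ y : ℝ, 0 < y →
    ∫ x in (0 : ℝ)..2, f (γ • UpperHalfPlane.ofComplex (x + y * Complex.I)) = 0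

/-- `f(-1/(2z)) = ε f(z)`: eigenfunction of the Atkin–Lehner involution with eigenvalue `ε`. -/
def HasAtkinLehnerEigenvalue (f : UpperHalfPlane → ℂ) (ε : ℂ) : Prop :=
  ∀ z : UpperHalfPlane, f (UpperHalfPlane.ofComplex (-1 / (2 * (z : ℂ)))) = ε * f z

/-- The `c(n)`, `n ≠ 0`, are the Fourier coefficients of `f`:
`f(x + iy) = ∑_{n ≠ 0} c(n) W_{0,ir/2}(4π|n|y) e^{2πinx}`. -/
def HasFourierCoeffs (r : ℂ) (f : UpperHalfPlane → ℂ) (c : ℤ → ℂ) : Prop :=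
  ∀ z : UpperHalfPlane,
    HasSum (fun n : {n : ℤ // n ≠ 0} =>
      c n * whittakerW0 (Complex.I * r / 2) (4 * Real.pi * |((n : ℤ) : ℝ)| * z.im) *
        Complex.exp (2 * Real.pi * Complex.I * ((n : ℤ) : ℂ) * (z.re : ℂ))) (f z)

/-! ## Quaternions: the Hurwitz order, the lattice `S`, primitive elements.
On `ℍ[ℝ]` the norm `‖β‖` is `√(β β̄) = |β|`. -/

/-- The quaternion `a + b i + c j + d ij`. -/
def quat (a b c d : ℝ) : ℍ[ℝ] := ⟨a, b, c, d⟩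

@[simp] theorem quat_re (a b c d : ℝ) : (quat a b c d).re = a := rfl
@[simp] theorem quat_imI (a b c d : ℝ) : (quat a b c d).imI = b := rfl
@[simp] theorem quat_imJ (a b c d : ℝ) : (quat a b c d).imJ = c := rfl
@[simp] theorem quat_imK (a b c d : ℝ) : (quat a b c d).imK = d := rfl

/-- The Hurwitz order `ℤ + ℤi + ℤj + ℤ(1+i+j+ij)/2`. -/
def hurwitzOrder : Submodule ℤ ℍ[ℝ] :=
  Submodule.span ℤ {quat 1 0 0 0, quat 0 1 0 0, quat 0 0 1 0, quat (1 / 2) (1 / 2) (1 / 2) (1 / 2)}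

/-- `S = ℤ(1-ij) + ℤ(-i-ij) + ℤ(-j-ij) + ℤ·2ij`. -/
def latticeS : Submodule ℤ ℍ[ℝ] :=
  Submodule.span ℤ {quat 1 0 0 (-1), quat 0 (-1) 0 (-1), quat 0 0 (-1) (-1), quat 0 0 0 2}

/-- The set `S ∖ {0}`. -/
abbrev LatticeSNonzero : Type := {β : ℍ[ℝ] // β ∈ latticeS ∧ β ≠ 0}

/-- `ϖ₂ = 1 + i`. -/
def varpi : ℍ[ℝ] := quat 1 1 0 0

/-- `ϖ₂^m ∣ β` in the Hurwitz order. -/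
def VarpiPowDvd (m : ℕ) (β : ℍ[ℝ]) : Prop := ∃ γ ∈ hurwitzOrder, β = varpi ^ m * γ

/-- The set of primitive elements of `S`: non-zero, divisible by `ϖ₂` but not by `ϖ₂²`, and not
in `d S` for any odd integer `d ≠ ±1`. -/
def primS : Set ℍ[ℝ] :=
  {β | β ∈ latticeS ∧ β ≠ 0 ∧ VarpiPowDvd 1 β ∧ ¬ VarpiPowDvd 2 β ∧
    ∀ d : ℤ, Odd d → d ≠ 1 → d ≠ -1 → ¬ ∃ γ ∈ latticeS, β = (d : ℍ[ℝ]) * γ}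

/-- `β = ϖ₂^u d β₀` with `u ≥ 0`, `d` an odd integer and `β₀` primitive. -/
def IsPrimDecomp (β : ℍ[ℝ]) (u : ℕ) (d : ℤ) (β₀ : ℍ[ℝ]) : Prop :=
  Odd d ∧ β₀ ∈ primS ∧ β = varpi ^ u * (d : ℍ[ℝ]) * β₀

/-- `|β| ∑_{t=0}^u ∑_{n ∣ d} (-ε)^t c(-|β|²/(2^{t+1} n²))`, `n` running through the positive
divisors of `d`. For `β = ϖ₂^u d β₀` the argument of `c` is an integer, so that the floor, which
is there only to land in `ℤ`, changes nothing. -/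
def liftSum (ε : ℂ) (c : ℤ → ℂ) (β : ℍ[ℝ]) (u : ℕ) (d : ℤ) : ℂ :=
  (‖β‖ : ℂ) * ∑ t ∈ Finset.range (u + 1), ∑ n ∈ d.natAbs.divisors,
    (-ε) ^ t * c ⌊-(‖β‖ ^ 2 / (2 ^ (t + 1) * (n : ℝ) ^ 2))⌋

open Classical in
/-- The coefficient `A(β)`, through any decomposition `β = ϖ₂^u d β₀`. -/
def liftCoeff (ε : ℂ) (c : ℤ → ℂ) (β : ℍ[ℝ]) : ℂ :=
  if h : ∃ p : ℕ × ℤ × ℍ[ℝ], IsPrimDecomp β p.1 p.2.1 p.2.2 then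
    liftSum ε c β h.choose.1 h.choose.2.1
  else 0

/-! ## Harmonic polynomials -/

/-- `P` is a harmonic polynomial of degree `l` in four variables: homogeneous of degree `l` and
annihilated by the Laplace operator. -/
def IsHarmonicPoly (l : ℕ) (P : MvPolynomial (Fin 4) ℂ) : Prop :=
  P.IsHomogeneous l ∧ ∑ i : Fin 4, MvPolynomial.pderiv i (MvPolynomial.pderiv i P) = 0

/-- The value of a polynomial in four variables at a quaternion. -/
def evalQ (P : MvPolynomial (Fin 4) ℂ) (x : ℍ[ℝ]) : ℂ :=
  MvPolynomial.eval ![(x.re : ℂ), (x.imI : ℂ), (x.imJ : ℂ), (x.imK : ℂ)] P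

/-- `(1+i)/√2`, of multiplicative order `8`. -/
def zeta8 : ℍ[ℝ] := quat (1 / Real.sqrt 2) (1 / Real.sqrt 2) 0 0

/-- `P(((1+i)/√2) x) = ε_P P(x)` for all `x`. -/
def IsEigenPoly (P : MvPolynomial (Fin 4) ℂ) (εP : ℂ) : Prop :=
  ∀ x : ℍ[ℝ], evalQ P (zeta8 * x) = εP * evalQ P x

/-! ## The Dirichlet series of the converse theorem -/

/-- The term `A(β) P(β) / |β|^{2s}`. -/
def xiTerm (A : ℍ[ℝ] → ℂ) (P : ℍ[ℝ] → ℂ) (s : ℂ) (β : LatticeSNonzero) : ℂ :=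
  A β * P β / (‖(β : ℍ[ℝ])‖ : ℂ) ^ (2 * s)

/-- `π^{-2s} Γ(s + ir/2) Γ(s - ir/2) ∑_{β ∈ S∖{0}} A(β) P(β) / |β|^{2s}`. -/
def xiSeries (r : ℂ) (A : ℍ[ℝ] → ℂ) (P : ℍ[ℝ] → ℂ) (s : ℂ) : ℂ :=
  (Real.pi : ℂ) ^ (-2 * s) * Complex.Gamma (s + Complex.I * r / 2) *
    Complex.Gamma (s - Complex.I * r / 2) * ∑' β : LatticeSNonzero, xiTerm A P s β

/-- For `Re s > (l+4+κ)/2` the series `ξ(s, P)` converges absolutely, and `Ξ` is an entire function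
that agrees with it there (its analytic continuation, unique by the identity theorem). -/
def IsXiContinuation (r : ℂ) (A : ℍ[ℝ] → ℂ) (κ : ℝ) (l : ℕ) (P : ℍ[ℝ] → ℂ) (Ξ : ℂ → ℂ) : Prop :=
  Differentiable ℂ Ξ ∧
    ∀ s : ℂ, ((l : ℝ) + 4 + κ) / 2 < s.re → Summable (xiTerm A P s) ∧ Ξ s = xiSeries r A P s

/-- Boundedness on every vertical strip. -/
def BoundedOnVerticalStrips (Ξ : ℂ → ℂ) : Prop :=
  ∀ a b : ℝ, ∃ M : ℝ, ∀ s : ℂ, a ≤ s.re → s.re ≤ b → ‖Ξ s‖ ≤ M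

/-! ## The zeta integral -/

/-- `Θ(z) = ∑_{β ∈ S} P(β) e^{2πi (|β|²/2) z}`. -/
def theta (P : ℍ[ℝ] → ℂ) (z : UpperHalfPlane) : ℂ :=
  ∑' β : latticeS, P β *
    Complex.exp (2 * Real.pi * Complex.I * ((‖(β : ℍ[ℝ])‖ ^ 2 / 2 : ℝ) : ℂ) * (z : ℂ))

/-- The stabilizer `Γ_∞` of the cusp `∞` in `Γ₀(2)`, that is, the matrices `± (1 m; 0 1)`. -/
def GammaInf : Subgroup (CongruenceSubgroup.Gamma0 2) :=
  (Subgroup.closure {-1, ModularGroup.T}).subgroupOf (CongruenceSubgroup.Gamma0 2)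

/-- `((cz+d)/|cz+d|)^{l+2} (Im z/|cz+d|²)^s` for `γ = (a b; c d)`. -/
def eisTerm (l : ℕ) (z : UpperHalfPlane) (s : ℂ) (γ : SL(2, ℤ)) : ℂ :=
  (((γ 1 0 : ℤ) * (z : ℂ) + (γ 1 1 : ℤ)) / (‖((γ 1 0 : ℤ) * (z : ℂ) + (γ 1 1 : ℤ))‖ : ℂ)) ^ (l + 2) *
    ((z.im / ‖((γ 1 0 : ℤ) * (z : ℂ) + (γ 1 1 : ℤ))‖ ^ 2 : ℝ) : ℂ) ^ s

/-- The term of the Eisenstein series at a coset of `Γ_∞ \ Γ₀(2)` (for even `l` the choice of the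
representative does not matter). -/
def eisCosetTerm (l : ℕ) (z : UpperHalfPlane) (s : ℂ)
    (q : Quotient (QuotientGroup.rightRel GammaInf)) : ℂ :=
  eisTerm l z s (q.out : CongruenceSubgroup.Gamma0 2)

/-- `Ẽ_∞(z,s) = (4π)^{l/2} π^{-s} Γ(s + l/2 + 1) ζ(2s) · ½ ∑_{γ ∈ Γ_∞ \ Γ₀(2)}
((cz+d)/|cz+d|)^{l+2} (Im z/|cz+d|²)^s`, for `Re s > 1`. -/
def eisSeries (l : ℕ) (z : UpperHalfPlane) (s : ℂ) : ℂ :=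
  ((4 * Real.pi : ℝ) : ℂ) ^ ((l : ℂ) / 2) * (Real.pi : ℂ) ^ (-s) *
    Complex.Gamma (s + (l : ℂ) / 2 + 1) * riemannZeta (2 * s) *
    (1 / 2 * ∑' q, eisCosetTerm l z s q)

/-- `E(z, ·)` is the meromorphic continuation of `Ẽ_∞(z, ·)` to `ℂ`, holomorphic where
`2^{2s} ≠ 1`. It is determined by `Ẽ_∞` on this connected open set. -/
def IsEisContinuation (l : ℕ) (E : UpperHalfPlane → ℂ → ℂ) : Prop :=
  ∀ z : UpperHalfPlane,
    MeromorphicOn (E z) Set.univ ∧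
    DifferentiableOn ℂ (E z) {s : ℂ | (2 : ℂ) ^ (2 * s) ≠ 1} ∧
    ∀ s : ℂ, 1 < s.re → Summable (eisCosetTerm l z s) ∧ E z s = eisSeries l z s

/-- The Ford fundamental domain of `Γ₀(2)`. -/
def fordDomain : Set UpperHalfPlane :=
  {z | |z.re| ≤ 1 / 2 ∧ 1 ≤ ‖2 * (z : ℂ) - 1‖ ∧ 1 ≤ ‖2 * (z : ℂ) + 1‖}

/-- The `Γ₀(2)`-invariant integrand `f(z) Θ(z) E(z,s) y^{(l+2)/2}`. -/
def zetaIntegrand (l : ℕ) (f : UpperHalfPlane → ℂ) (P : ℍ[ℝ] → ℂ) (E : UpperHalfPlane → ℂ → ℂ)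
    (s : ℂ) (z : UpperHalfPlane) : ℂ :=
  f z * theta P z * E z s * ((z.im ^ (((l : ℝ) + 2) / 2) : ℝ) : ℂ)

/-- `I(s) = ∫_{Γ₀(2)\𝔥} f(z) Θ(z) E(z,s) y^{(l+2)/2} dx dy / y²`; the measure on the upper half
plane is `dx dy / y²`. -/
def zetaIntegral (l : ℕ) (f : UpperHalfPlane → ℂ) (P : ℍ[ℝ] → ℂ) (E : UpperHalfPlane → ℂ → ℂ)
    (s : ℂ) : ℂ :=
  ∫ z in fordDomain, zetaIntegrand l f P E s z

end MaassLift

end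

noncomputable section

namespace MaassLift

/-! ## Arithmetic of the lattice `S` -/

/-! Put η = -ε ε_P. Arithmetic of A(β): S consists of the integer quadruples with even coordinate
sum, and ϖ₂ lies over the ramified prime, so divisibility by its powers is read off the norm: β ∈
ϖ₂^t S exactly when 2^(t+1) divides |β|² (`exists_eq_varpi_pow_mul`). Hence the pairs (t,n) that
index A(β) are those with n odd and β ∈ ϖ₂^t n S (`divisorPairs_eq`), a set attached to β alone.
This gives independence of the decomposition, invariance of A under conjugation and under left
multiplication by i, and a bijection between the (β,(t,n)) and all ((t,n),γ), where β = ϖ₂^t n γ. An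
eigenvector P of (1+i)/√2 is multiplied by a scalar under x ↦ ϖ₂x, so the Dirichlet series at w = s
+ l/2 + 1/2 factors into a geometric series in η 2^(-s), the odd part of ζ(2s), and ∑ c(-|γ|²/2)
P(γ) |γ|^(1-2w) (`hasSum_xiTerm`).

If ε_P² ≠ 1, the substitution β ↦ iβ multiplies the sum by ε_P², so it is zero (`xiSeries_eq_zero`).

If ε_P = ±1, then l is even. Poisson summation with harmonic weights, where the Gaussian transform
of a harmonic polynomial is the polynomial itself by a heat equation, gives the behaviour of Θ under
z ↦ -1/(2z); as Γ₀(2) is generated by -1, T and the Fricke conjugate of T⁻¹, Θ has weight l+2. Thus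
H = f Θ y^((l+2)/2) has the automorphy factor dual to that of the Eisenstein series, is multiplied
by η and such a factor under the Fricke involution, and decays rapidly. Unfolding turns the integral
of H against the Eisenstein series into a strip integral: the constant Fourier term of fΘ matches n
= -|γ|²/2, and the integral over y is the Mellin transform of K_μ(x)e^(-x), a quotient of Gamma
functions. The zeta factor 1 - 2^(-2s) divided by 1 - η 2^(-s) leaves the factor 2^s + η of the
formula.

For the continuation, set k = l+2 and let θ_z(t) = ∑ v^k exp(-πt|v|²) over ℤz+ℤ rescaled to covolume
1. As k > 0 the zero vector drops out, and θ_z(t) = t^(-(k+1)) θ_z(1/t), so its Mellin transform is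
entire and symmetric. The Eisenstein series is a combination of the transforms at z and 2z with
denominator 2^(2s) - 1 (`summable_eisCosetTerm_and_eq`). The Fricke involution exchanges these two
lattices, so folding the Ford domain along |z|² = 1/2 shows that the integrals of H against them are
M and ηM for one Mellin transform M (`IsDecayingForm.integral_mul_latticeMellin`). Since (η2^s -
1)(2^s + η) = η(2^(2s) - 1), the factor 2^s + η removes the denominator, and ξ is a constant times
M. Entireness, boundedness on strips and the symmetry are then properties of M; conjugation
invariance of A identifies ξ(s,P̂) with ξ(s,P). -/

theorem norm_quat_sq (a b c d : ℝ) : ‖quat a b c d‖ ^ 2 = a ^ 2 + b ^ 2 + c ^ 2 + d ^ 2 := by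
  rw [sq, ← Quaternion.normSq_eq_norm_mul_self, Quaternion.normSq_def']
  simp

theorem norm_quat_intCast (n : ℤ) : ‖(n : ℍ[ℝ])‖ = |(n : ℝ)| := by
  have : (n : ℍ[ℝ]) = ((n : ℝ) : ℍ[ℝ]) := by ext <;> simp
  rw [this, Quaternion.norm_coe, Real.norm_eq_abs]

theorem norm_quat_natCast (n : ℕ) : ‖(n : ℍ[ℝ])‖ = n := by
  have := norm_quat_intCast n
  simpa using this

theorem quat_mul (a b c d a' b' c' d' : ℝ) :
    quat a b c d * quat a' b' c' d' =
      quat (a * a' - b * b' - c * c' - d * d') (a * b' + b * a' + c * d' - d * c')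
        (a * c' - b * d' + c * a' + d * b') (a * d' + b * c' - c * b' + d * a') := by
  ext <;> simp

theorem quat_add (a b c d a' b' c' d' : ℝ) :
    quat a b c d + quat a' b' c' d' = quat (a + a') (b + b') (c + c') (d + d') := by
  ext <;> simp

theorem zsmul_quat (n : ℤ) (a b c d : ℝ) :
    n • quat a b c d = quat (n * a) (n * b) (n * c) (n * d) := by
  ext <;> simp

theorem star_quat (a b c d : ℝ) : star (quat a b c d) = quat a (-b) (-c) (-d) := by
  ext <;> simp

theorem quat_eta (x : ℍ[ℝ]) : quat x.re x.imI x.imJ x.imK = x := rfl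

theorem mem_latticeS_iff {β : ℍ[ℝ]} :
    β ∈ latticeS ↔ ∃ a b c d : ℤ, Even (a + b + c + d) ∧ β = quat a b c d := by
  constructor
  · intro h
    induction h using Submodule.span_induction with
    | mem x hx =>
      rcases hx with rfl | rfl | rfl | rfl
      · exact ⟨1, 0, 0, -1, by decide, by simp⟩
      · exact ⟨0, -1, 0, -1, by decide, by simp⟩
      · exact ⟨0, 0, -1, -1, by decide, by simp⟩
      · exact ⟨0, 0, 0, 2, by decide, by simp⟩
    | zero => exact ⟨0, 0, 0, 0, by decide, by ext <;> simp⟩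
    | add x y _ _ hx hy =>
      obtain ⟨a, b, c, d, h, rfl⟩ := hx
      obtain ⟨a', b', c', d', h', rfl⟩ := hy
      obtain ⟨k, hk⟩ := h
      obtain ⟨k', hk'⟩ := h'
      exact ⟨a + a', b + b', c + c', d + d', ⟨k + k', by linarith⟩, by
        rw [quat_add]; push_cast; rfl⟩
    | smul n x _ hx =>
      obtain ⟨a, b, c, d, h, rfl⟩ := hx
      refine ⟨n * a, n * b, n * c, n * d, ?_, by rw [zsmul_quat]; push_cast; rfl⟩
      have := h.mul_left n
      convert this using 1
      ring
  · rintro ⟨a, b, c, d, ⟨k, hk⟩, rfl⟩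
    -- The first three coefficients are forced by the coordinates of 1, i, j; the ij-coordinate then
    -- requires (a - b - c + d)/2 = k - b - c.
    have h1 : quat a b c d = a • quat 1 0 0 (-1) + (-b) • quat 0 (-1) 0 (-1) +
        (-c) • quat 0 0 (-1) (-1) + (k - b - c) • quat 0 0 0 2 := by
      have hk' : (a : ℝ) + b + c + d = k + k := by exact_mod_cast hk
      simp only [zsmul_quat, quat_add]
      push_cast
      congr 1 <;> linarith
    rw [h1]
    refine add_mem (add_mem (add_mem ?_ ?_) ?_) ?_ <;>
    exact Submodule.smul_mem _ _ (Submodule.subset_span (by simp))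

theorem mem_hurwitzOrder_iff {β : ℍ[ℝ]} :
    β ∈ hurwitzOrder ↔ ∃ a b c d : ℤ, Even (a + b) ∧ Even (a + c) ∧ Even (a + d) ∧
      β = quat (a / 2) (b / 2) (c / 2) (d / 2) := by
  constructor
  · intro h
    induction h using Submodule.span_induction with
    | mem x hx =>
      rcases hx with rfl | rfl | rfl | rfl
      · exact ⟨2, 0, 0, 0, by decide, by decide, by decide, by simp⟩
      · exact ⟨0, 2, 0, 0, by decide, by decide, by decide, by simp⟩
      · exact ⟨0, 0, 2, 0, by decide, by decide, by decide, by simp⟩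
      · exact ⟨1, 1, 1, 1, by decide, by decide, by decide, by simp⟩
    | zero => exact ⟨0, 0, 0, 0, by decide, by decide, by decide, by ext <;> simp⟩
    | add x y _ _ hx hy =>
      obtain ⟨a, b, c, d, h1, h2, h3, rfl⟩ := hx
      obtain ⟨a', b', c', d', h1', h2', h3', rfl⟩ := hy
      refine ⟨a + a', b + b', c + c', d + d', ?_, ?_, ?_, ?_⟩
      · simpa [add_add_add_comm] using h1.add h1'
      · simpa [add_add_add_comm] using h2.add h2'
      · simpa [add_add_add_comm] using h3.add h3'
      · rw [quat_add]; push_cast; congr 1 <;> ring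
    | smul n x _ hx =>
      obtain ⟨a, b, c, d, h1, h2, h3, rfl⟩ := hx
      refine ⟨n * a, n * b, n * c, n * d, ?_, ?_, ?_, ?_⟩
      · simpa [mul_add] using h1.mul_left n
      · simpa [mul_add] using h2.mul_left n
      · simpa [mul_add] using h3.mul_left n
      · rw [zsmul_quat]; push_cast; congr 1 <;> ring
  · rintro ⟨a, b, c, d, ⟨p, hp⟩, ⟨q, hq⟩, ⟨r, hr⟩, rfl⟩
    -- The bracket multiplied by r - a is ij expressed in the generators.
    have h1 : quat (a / 2) (b / 2) (c / 2) (d / 2) = (0 : ℤ) • quat 1 0 0 0 +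
        (p - a) • quat 0 1 0 0 + (q - a) • quat 0 0 1 0 +
        (0 : ℤ) • quat 0 0 0 0 + a • quat (1 / 2) (1 / 2) (1 / 2) (1 / 2) +
        (r - a) • (quat (1 / 2) (1 / 2) (1 / 2) (1 / 2) + quat (1 / 2) (1 / 2) (1 / 2) (1 / 2) +
          (-1 : ℤ) • quat 1 0 0 0 + (-1 : ℤ) • quat 0 1 0 0 + (-1 : ℤ) • quat 0 0 1 0) := by
      have hp' : (a : ℝ) + b = p + p := by exact_mod_cast hp
      have hq' : (a : ℝ) + c = q + q := by exact_mod_cast hq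
      have hr' : (a : ℝ) + d = r + r := by exact_mod_cast hr
      simp only [zsmul_quat, quat_add]
      push_cast
      congr 1 <;> linarith
    have h0 : quat 0 0 0 0 ∈ hurwitzOrder := by
      have : quat 0 0 0 0 = 0 := by ext <;> simp
      rw [this]; exact zero_mem _
    have e1 : quat 1 0 0 0 ∈ hurwitzOrder := Submodule.subset_span (by simp)
    have e2 : quat 0 1 0 0 ∈ hurwitzOrder := Submodule.subset_span (by simp)
    have e3 : quat 0 0 1 0 ∈ hurwitzOrder := Submodule.subset_span (by simp)
    have e4 : quat (1 / 2) (1 / 2) (1 / 2) (1 / 2) ∈ hurwitzOrder :=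
      Submodule.subset_span (by simp)
    rw [h1]
    have sm : ∀ (n : ℤ) {x : ℍ[ℝ]}, x ∈ hurwitzOrder → n • x ∈ hurwitzOrder :=
      fun n x hx => Submodule.smul_mem _ _ hx
    exact add_mem (add_mem (add_mem (add_mem (add_mem (sm _ e1) (sm _ e2)) (sm _ e3)) (sm _ h0))
      (sm _ e4)) (sm _ (add_mem (add_mem (add_mem (add_mem e4 e4) (sm _ e1)) (sm _ e2)) (sm _ e3)))

theorem varpi_mul_quat (a b c d : ℝ) :
    varpi * quat a b c d = quat (a - b) (a + b) (c - d) (c + d) := by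
  rw [varpi, quat_mul]; congr 1 <;> ring

theorem varpi_ne_zero : varpi ≠ 0 := by
  intro h
  have := congrArg QuaternionAlgebra.re h
  simp [varpi] at this

theorem norm_varpi_sq : ‖varpi‖ ^ 2 = 2 := by
  rw [varpi, norm_quat_sq]; norm_num

theorem norm_varpi_pow_sq (t : ℕ) : ‖varpi ^ t‖ ^ 2 = 2 ^ t := by
  rw [norm_pow, ← pow_mul, mul_comm, pow_mul, norm_varpi_sq]

/-- `S = ϖ₂ 𝒪`. -/
theorem mem_latticeS_iff_varpi {β : ℍ[ℝ]} :
    β ∈ latticeS ↔ ∃ γ ∈ hurwitzOrder, β = varpi * γ := by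
  constructor
  · intro h
    obtain ⟨a, b, c, d, ⟨k, hk⟩, rfl⟩ := mem_latticeS_iff.1 h
    refine ⟨quat ((a + b : ℤ) / 2) ((b - a : ℤ) / 2) ((c + d : ℤ) / 2) ((d - c : ℤ) / 2),
      mem_hurwitzOrder_iff.2 ⟨a + b, b - a, c + d, d - c, ⟨b, by ring⟩, ⟨k, by linarith⟩,
        ⟨k - c, by linarith⟩, rfl⟩, ?_⟩
    rw [varpi_mul_quat]; push_cast; congr 1 <;> ring
  · rintro ⟨γ, h, rfl⟩
    obtain ⟨a, b, c, d, ⟨p, hp⟩, ⟨q, hq⟩, ⟨r, hr⟩, rfl⟩ := mem_hurwitzOrder_iff.1 h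
    rw [varpi_mul_quat]
    refine mem_latticeS_iff.2 ⟨a - p, p, p - a + q - (p - a) - r, q + r - a, ⟨q, by ring⟩, ?_⟩
    have hp' : (a : ℝ) + b = p + p := by exact_mod_cast hp
    have hq' : (a : ℝ) + c = q + q := by exact_mod_cast hq
    have hr' : (a : ℝ) + d = r + r := by exact_mod_cast hr
    push_cast; congr 1 <;> linarith

theorem latticeS_le_hurwitzOrder {β : ℍ[ℝ]} (h : β ∈ latticeS) : β ∈ hurwitzOrder := by
  obtain ⟨a, b, c, d, ⟨k, hk⟩, rfl⟩ := mem_latticeS_iff.1 h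
  exact mem_hurwitzOrder_iff.2 ⟨2 * a, 2 * b, 2 * c, 2 * d, ⟨a + b, by ring⟩, ⟨a + c, by ring⟩,
    ⟨a + d, by ring⟩, by push_cast; congr 1 <;> ring⟩

theorem varpi_mul_mem {β : ℍ[ℝ]} (h : β ∈ latticeS) : varpi * β ∈ latticeS :=
  mem_latticeS_iff_varpi.2 ⟨β, latticeS_le_hurwitzOrder h, rfl⟩

theorem varpi_pow_mul_mem {β : ℍ[ℝ]} (h : β ∈ latticeS) (t : ℕ) : varpi ^ t * β ∈ latticeS := by
  induction t with
  | zero => simpa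
  | succ t ih => rw [pow_succ', mul_assoc]; exact varpi_mul_mem ih

theorem intCast_mul_mem {β : ℍ[ℝ]} (h : β ∈ latticeS) (n : ℤ) : (n : ℍ[ℝ]) * β ∈ latticeS := by
  rw [← zsmul_eq_mul]; exact Submodule.smul_mem _ _ h

theorem star_mem {β : ℍ[ℝ]} (h : β ∈ latticeS) : star β ∈ latticeS := by
  obtain ⟨a, b, c, d, ⟨k, hk⟩, rfl⟩ := mem_latticeS_iff.1 h
  rw [star_quat]
  exact mem_latticeS_iff.2 ⟨a, -b, -c, -d, ⟨k - b - c - d, by linarith⟩, by push_cast; rfl⟩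

theorem quatI_mul_mem {β : ℍ[ℝ]} (h : β ∈ latticeS) : quat 0 1 0 0 * β ∈ latticeS := by
  obtain ⟨a, b, c, d, ⟨k, hk⟩, rfl⟩ := mem_latticeS_iff.1 h
  rw [quat_mul]
  exact mem_latticeS_iff.2 ⟨-b, a, -d, c, ⟨k - b - d, by linarith⟩, by
    push_cast; congr 1 <;> ring⟩

/-- An integer and its square have the same parity, so an even coordinate sum makes the norm even.
This makes Θ invariant under z ↦ z+1 and the arguments of c integral. -/
theorem exists_norm_sq_eq {β : ℍ[ℝ]} (h : β ∈ latticeS) : ∃ m : ℕ, ‖β‖ ^ 2 = 2 * m := by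
  obtain ⟨a, b, c, d, ⟨k, hk⟩, rfl⟩ := mem_latticeS_iff.1 h
  have h2 : ∃ m : ℤ, a ^ 2 + b ^ 2 + c ^ 2 + d ^ 2 = 2 * m := by
    refine ⟨2 * k ^ 2 - (a * b + a * c + a * d + b * c + b * d + c * d), ?_⟩
    have : (a + b + c + d) ^ 2 = 4 * k ^ 2 := by rw [hk]; ring
    linarith
  obtain ⟨m, hm⟩ := h2
  have h0 : 0 ≤ m := by nlinarith [sq_nonneg a, sq_nonneg b, sq_nonneg c, sq_nonneg d]
  lift m to ℕ using h0
  refine ⟨m, ?_⟩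
  rw [norm_quat_sq]
  exact_mod_cast hm

/-- A sum of four squares is 0 mod 4 only if the four entries have equal parity; then the
coordinates (a±b)/2, (c±d)/2 of ϖ₂⁻¹β are integers with even sum. Divisibility by ϖ₂ is thus
detected by the norm alone. -/
theorem exists_eq_varpi_mul {β : ℍ[ℝ]} (h : β ∈ latticeS) {m : ℕ} (hm : ‖β‖ ^ 2 = 4 * m) :
    ∃ γ ∈ latticeS, β = varpi * γ := by
  obtain ⟨a, b, c, d, hk, rfl⟩ := mem_latticeS_iff.1 h
  rw [norm_quat_sq] at hm
  have hm' : a ^ 2 + b ^ 2 + c ^ 2 + d ^ 2 = 4 * m := by exact_mod_cast hm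
  have key : Even (a + b) ∧ Even (c + d) ∧ Even (b + d) := by
    rcases Int.even_or_odd' a with ⟨a', ha | ha⟩ <;> rcases Int.even_or_odd' b with ⟨b', hb | hb⟩ <;>
    rcases Int.even_or_odd' c with ⟨c', hc | hc⟩ <;> rcases Int.even_or_odd' d with ⟨d', hd | hd⟩ <;>
    subst ha hb hc hd <;> ring_nf at hm' <;> simp only [Int.even_iff] at hk ⊢ <;> omega
  obtain ⟨⟨p, hp⟩, ⟨q, hq⟩, ⟨r, hr⟩⟩ := key
  refine ⟨quat p ((p - a : ℤ)) q ((q - c : ℤ)),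
    mem_latticeS_iff.2 ⟨p, p - a, q, q - c, ⟨r, by linarith⟩, rfl⟩, ?_⟩
  have hp' : (a : ℝ) + b = p + p := by exact_mod_cast hp
  have hq' : (c : ℝ) + d = q + q := by exact_mod_cast hq
  rw [varpi_mul_quat]; push_cast; congr 1 <;> linarith

theorem exists_eq_varpi_pow_mul (t : ℕ) {β : ℍ[ℝ]} (h : β ∈ latticeS) {m : ℕ}
    (hm : ‖β‖ ^ 2 = 2 ^ (t + 1) * m) : ∃ γ ∈ latticeS, β = varpi ^ t * γ := by
  induction t generalizing β with
  | zero => exact ⟨β, h, by simp⟩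
  | succ t ih =>
    obtain ⟨γ, hγ, rfl⟩ := exists_eq_varpi_mul h (m := 2 ^ t * m) (by rw [hm]; push_cast; ring)
    have h2 : ‖γ‖ ^ 2 = 2 ^ (t + 1) * m := by
      rw [norm_mul, mul_pow, norm_varpi_sq] at hm
      have : (2 : ℝ) ^ (t + 1 + 1) = 2 * 2 ^ (t + 1) := by ring
      rw [this, mul_assoc] at hm
      linarith
    obtain ⟨δ, hδ, rfl⟩ := ih hγ h2
    exact ⟨δ, hδ, by rw [pow_succ', mul_assoc]⟩

/-! ### Primitive elements, divisor pairs and well-definedness of A(β) -/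

theorem varpiPowDvd_one {β : ℍ[ℝ]} : VarpiPowDvd 1 β ↔ β ∈ latticeS := by
  rw [mem_latticeS_iff_varpi, VarpiPowDvd, pow_one]

theorem varpiPowDvd_two {β : ℍ[ℝ]} : VarpiPowDvd 2 β ↔ ∃ γ ∈ latticeS, β = varpi * γ := by
  constructor
  · rintro ⟨γ, h, rfl⟩
    exact ⟨varpi * γ, mem_latticeS_iff_varpi.2 ⟨γ, h, rfl⟩, by rw [sq, mul_assoc]⟩
  · rintro ⟨γ, h, rfl⟩
    obtain ⟨δ, hδ, rfl⟩ := mem_latticeS_iff_varpi.1 h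
    exact ⟨δ, hδ, by rw [sq, mul_assoc]⟩

theorem exists_odd_of_mem_primS {β : ℍ[ℝ]} (h : β ∈ primS) :
    ∃ m : ℕ, Odd m ∧ ‖β‖ ^ 2 = 2 * m := by
  obtain ⟨hS, -, -, h2, -⟩ := h
  obtain ⟨m, hm⟩ := exists_norm_sq_eq hS
  refine ⟨m, ?_, hm⟩
  by_contra he
  rw [Nat.not_odd_iff_even] at he
  obtain ⟨k, rfl⟩ := he
  exact h2 (varpiPowDvd_two.2 (exists_eq_varpi_mul hS (m := k) (by rw [hm]; push_cast; ring)))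

/-- The pairs `(t, n)`, `n ≥ 1` odd, for which `β ∈ ϖ₂^t n S`. -/
def divisorPairs (β : ℍ[ℝ]) : Set (ℕ × ℕ) :=
  {p | Odd p.2 ∧ (∃ γ ∈ latticeS, β = (p.2 : ℍ[ℝ]) * γ) ∧
    ∃ m : ℕ, ‖β‖ ^ 2 = 2 ^ (p.1 + 1) * m}

/-- As n is odd, the power of 2 in |β|² already divides |β/n|², and the norm criterion extracts
ϖ₂^t. The defining conditions are the ones with visible symmetries; this form is the one that yields
a bijection. -/
theorem mem_divisorPairs_iff {β : ℍ[ℝ]} {t n : ℕ} :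
    (t, n) ∈ divisorPairs β ↔ Odd n ∧ ∃ γ ∈ latticeS, β = varpi ^ t * ((n : ℍ[ℝ]) * γ) := by
  constructor
  · rintro ⟨hn, ⟨γ, hγ, rfl⟩, m, hm⟩
    refine ⟨hn, ?_⟩
    simp only at hm hn ⊢
    obtain ⟨M, hM⟩ := exists_norm_sq_eq hγ
    rw [norm_mul, mul_pow, hM, norm_quat_natCast] at hm
    have h1 : n ^ 2 * M = 2 ^ t * m := by
      have : n ^ 2 * (2 * M) = 2 ^ (t + 1) * m := by exact_mod_cast hm
      rw [pow_succ 2 t] at this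
      linarith
    have h2 : 2 ^ t ∣ M := by
      refine Nat.Coprime.dvd_of_dvd_mul_left ?_ (Dvd.intro _ h1.symm)
      exact Nat.Coprime.pow _ _ (Nat.coprime_two_left.2 hn)
    obtain ⟨j, rfl⟩ := h2
    obtain ⟨δ, hδ, rfl⟩ := exists_eq_varpi_pow_mul t hγ (m := j) (by rw [hM]; push_cast; ring)
    refine ⟨δ, hδ, ?_⟩
    rw [← mul_assoc, ← mul_assoc, (Nat.cast_commute n _).eq]
  · rintro ⟨hn, γ, hγ, rfl⟩
    obtain ⟨M, hM⟩ := exists_norm_sq_eq hγ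
    refine ⟨hn, ⟨varpi ^ t * γ, varpi_pow_mul_mem hγ t, ?_⟩, n ^ 2 * M, ?_⟩
    · rw [← mul_assoc, ← mul_assoc, (Nat.cast_commute n _).eq]
    · rw [norm_mul, norm_mul, mul_pow, mul_pow, norm_varpi_pow_sq, hM, norm_quat_natCast]
      push_cast; ring

/-- The bound t ≤ u is the 2-adic valuation u+1 of |β|². For n ∣ d: cancelling ϖ₂^u gives dβ₀ = nδ
with δ ∈ S; after division by the gcd, Bézout puts β₀ into n'S with n' = n/gcd(n,d) odd, and
primitivity forces n' = ±1. The left side involves β only, so every decomposition yields the same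
sum. -/
theorem divisorPairs_eq {β β₀ : ℍ[ℝ]} {u : ℕ} {d : ℤ} (h : IsPrimDecomp β u d β₀) :
    divisorPairs β = ↑(Finset.range (u + 1) ×ˢ d.natAbs.divisors) := by
  obtain ⟨hd, hβ₀, rfl⟩ := h
  have hd0 : d ≠ 0 := by rintro rfl; simp at hd
  obtain ⟨N, hN, hN2⟩ := exists_odd_of_mem_primS hβ₀
  have hS := hβ₀.1
  have hnorm : ‖varpi ^ u * (d : ℍ[ℝ]) * β₀‖ ^ 2 = 2 ^ (u + 1) * (d.natAbs ^ 2 * N : ℕ) := by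
    rw [norm_mul, norm_mul, mul_pow, mul_pow, norm_varpi_pow_sq, hN2, norm_quat_intCast]
    push_cast
    simp only [sq_abs, Nat.cast_natAbs, Int.cast_abs]
    ring
  ext ⟨t, n⟩
  simp only [Finset.coe_product, Set.mem_prod, Finset.mem_coe, Finset.mem_range,
    Nat.mem_divisors, Order.lt_add_one_iff]
  constructor
  · intro h
    have h2 := h.2.2
    obtain ⟨hn, γ, hγ, hβ⟩ := mem_divisorPairs_iff.1 h
    have htu : t ≤ u := by
      obtain ⟨m, hm⟩ := h2
      rw [hnorm] at hm
      have hm' : 2 ^ (u + 1) * (d.natAbs ^ 2 * N) = 2 ^ (t + 1) * m := by exact_mod_cast hm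
      have hodd : Odd (d.natAbs ^ 2 * N) := ((Int.natAbs_odd.2 hd).pow).mul hN
      by_contra hlt
      push Not at hlt
      have h3 : 2 ^ (u + 1) * 2 ∣ 2 ^ (u + 1) * (d.natAbs ^ 2 * N) := by
        rw [hm', ← pow_succ]
        exact Dvd.dvd.mul_right (pow_dvd_pow _ (by omega)) _
      have h4 := Nat.dvd_of_mul_dvd_mul_left (by positivity) h3
      rw [← Nat.not_even_iff_odd] at hodd
      exact hodd (even_iff_two_dvd.2 h4)
    refine ⟨htu, ?_, by simpa using hd0⟩
    -- The condition on n does not involve t, so t may be raised to u; then ϖ₂^u cancels on both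
    -- sides.
    have h5 : (u, n) ∈ divisorPairs (varpi ^ u * (d : ℍ[ℝ]) * β₀) :=
      ⟨hn, h.2.1, _, hnorm⟩
    obtain ⟨-, δ, hδ, hβ'⟩ := mem_divisorPairs_iff.1 h5
    rw [mul_assoc] at hβ'
    have h6 : (d : ℍ[ℝ]) * β₀ = (n : ℍ[ℝ]) * δ :=
      mul_left_cancel₀ (pow_ne_zero u varpi_ne_zero) hβ'
    obtain ⟨n', d', hcop, hn', hd'⟩ := Int.exists_gcd_one (Int.gcd_pos_of_ne_zero_right (n : ℤ) hd0)
    have hg := Int.gcd_pos_of_ne_zero_right (n : ℤ) hd0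
    set g := Int.gcd n d
    have hg0 : (g : ℍ[ℝ]) ≠ 0 := by
      rw [← norm_ne_zero_iff, norm_quat_natCast]
      exact_mod_cast hg.ne'
    have hnc : (n : ℍ[ℝ]) = g * n' := by
      have := congrArg (Int.cast : ℤ → ℍ[ℝ]) hn'
      push_cast at this
      rw [this, (Nat.cast_commute g _).eq]
    have hdc : (d : ℍ[ℝ]) = g * d' := by
      have := congrArg (Int.cast : ℤ → ℍ[ℝ]) hd'
      push_cast at this
      rw [this, (Nat.cast_commute g _).eq]
    have h7 : (d' : ℍ[ℝ]) * β₀ = (n' : ℍ[ℝ]) * δ := by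
      apply mul_left_cancel₀ hg0
      rw [← mul_assoc, ← mul_assoc, ← hnc, ← hdc, h6]
    have hbez := Int.gcd_eq_gcd_ab n' d'
    rw [hcop] at hbez
    set a := Int.gcdA n' d'
    set b := Int.gcdB n' d'
    have h8 : β₀ = (n' : ℍ[ℝ]) * ((a : ℍ[ℝ]) * β₀ + (b : ℍ[ℝ]) * δ) := by
      have e1 : (1 : ℍ[ℝ]) = n' * a + d' * b := by exact_mod_cast congrArg (Int.cast : ℤ → ℍ[ℝ]) hbez
      calc β₀ = (n' * a + d' * b) * β₀ := by rw [← e1, one_mul]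
        _ = n' * (a * β₀) + b * (d' * β₀) := by
          rw [add_mul, mul_assoc, (Int.cast_commute d' (b : ℍ[ℝ])).eq, mul_assoc]
        _ = _ := by
          rw [h7, mul_add, ← mul_assoc (b : ℍ[ℝ]), ← (Int.cast_commute n' (b : ℍ[ℝ])).eq, mul_assoc]
    have hn'odd : Odd n' := by
      have : Odd (n' * g) := hn' ▸ (by exact_mod_cast hn)
      exact (Int.odd_mul.1 this).1
    have hn'1 : n' = 1 ∨ n' = -1 := by
      by_contra hne
      push Not at hne
      exact hβ₀.2.2.2.2 n' hn'odd hne.1 hne.2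
        ⟨_, add_mem (intCast_mul_mem hS a) (intCast_mul_mem hδ b), h8⟩
    have hnd : (n : ℤ) ∣ d := by
      rcases hn'1 with h1 | h1
      · rw [hn', hd', h1, one_mul]; exact Dvd.intro_left _ rfl
      · rw [hn', hd', h1, neg_one_mul, neg_dvd]; exact Dvd.intro_left _ rfl
    exact Int.natCast_dvd.1 hnd
  · rintro ⟨htu, hnd, -⟩
    obtain ⟨e, he⟩ := Int.natCast_dvd.2 hnd
    obtain ⟨v, rfl⟩ := Nat.exists_eq_add_of_le htu
    have hn : Odd n := by
      rw [he] at hd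
      exact_mod_cast (Int.odd_mul.1 hd).1
    refine mem_divisorPairs_iff.2 ⟨hn, varpi ^ v * ((e : ℍ[ℝ]) * β₀),
      varpi_pow_mul_mem (intCast_mul_mem hS e) v, ?_⟩
    have : (d : ℍ[ℝ]) = n * e := by rw [he]; push_cast; rfl
    rw [this, pow_add]
    simp only [← mul_assoc]
    rw [mul_assoc _ (varpi ^ v), ← (Nat.cast_commute n (varpi ^ v)).eq, ← mul_assoc]

theorem norm_sq_pos_of_mem {β : ℍ[ℝ]} (h : β ∈ latticeS) (h0 : β ≠ 0) :
    ∃ m : ℕ, 0 < m ∧ ‖β‖ ^ 2 = 2 * m := by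
  obtain ⟨m, hm⟩ := exists_norm_sq_eq h
  refine ⟨m, Nat.pos_of_ne_zero ?_, hm⟩
  rintro rfl
  simp at hm
  exact h0 hm

/-- Take u from the power of 2 in |β|²/2 and split off ϖ₂^u; then let d be the largest odd integer
dividing the rest in S, which exists because d² divides the odd number N. Maximality of d and
oddness of N are the two conditions of primitivity. -/
theorem exists_isPrimDecomp {β : ℍ[ℝ]} (h : β ∈ latticeS) (h0 : β ≠ 0) :
    ∃ u d β₀, IsPrimDecomp β u d β₀ := by
  obtain ⟨m, hm0, hm⟩ := norm_sq_pos_of_mem h h0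
  obtain ⟨u, N, hN, rfl⟩ := Nat.exists_eq_two_pow_mul_odd hm0.ne'
  obtain ⟨γ, hγ, rfl⟩ := exists_eq_varpi_pow_mul u h (m := N) (by rw [hm]; push_cast; ring)
  have hγN : ‖γ‖ ^ 2 = 2 * N := by
    rw [norm_mul, mul_pow, norm_varpi_pow_sq] at hm
    push_cast at hm
    have h2 : (0 : ℝ) < 2 ^ u := by positivity
    apply mul_left_cancel₀ h2.ne'
    linarith
  have hγ0 : γ ≠ 0 := right_ne_zero_of_mul h0
  let Q : ℕ → Prop := fun d => Odd d ∧ ∃ δ ∈ latticeS, γ = (d : ℍ[ℝ]) * δ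
  have hQb : ∀ d, Q d → d ≤ N := by
    rintro d ⟨hd, δ, hδ, rfl⟩
    obtain ⟨M, hM⟩ := exists_norm_sq_eq hδ
    rw [norm_mul, mul_pow, norm_quat_natCast, hM] at hγN
    have : d ^ 2 * M = N := by
      have : d ^ 2 * (2 * M) = 2 * N := by exact_mod_cast hγN
      linarith
    have hNpos : 0 < N := hN.pos
    have hM : 0 < M := Nat.pos_of_ne_zero (by rintro rfl; omega)
    nlinarith [hd.pos, Nat.le_mul_of_pos_right d hM]
  have hQ1 : Q 1 := ⟨odd_one, γ, hγ, by simp⟩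
  have hN1 : 1 ≤ N := hQb 1 hQ1
  classical
  have hQd := Nat.findGreatest_spec hN1 hQ1
  set d := Nat.findGreatest Q N with hdd
  obtain ⟨hd, δ, hδ, hγδ⟩ := hQd
  have hδ0 : δ ≠ 0 := by rintro rfl; simp [hγδ] at hγ0
  refine ⟨u, d, δ, by exact_mod_cast hd, ⟨hδ, hδ0, varpiPowDvd_one.2 hδ, ?_, ?_⟩, ?_⟩
  · intro h2
    obtain ⟨ρ, hρ, rfl⟩ := varpiPowDvd_two.1 h2
    obtain ⟨M, hM⟩ := exists_norm_sq_eq hρ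
    rw [hγδ, norm_mul, norm_mul, mul_pow, mul_pow, norm_varpi_sq, hM, norm_quat_natCast] at hγN
    have : d ^ 2 * (2 * (2 * M)) = 2 * N := by exact_mod_cast hγN
    rw [← Nat.not_even_iff_odd] at hN
    exact hN ⟨d ^ 2 * M, by linarith⟩
  · rintro e he he1 he2 ⟨ρ, hρ, rfl⟩
    have hQ2 : Q (d * e.natAbs) := by
      refine ⟨hd.mul (Int.natAbs_odd.2 he), ?_⟩
      rcases Int.natAbs_eq e with h3 | h3
      · refine ⟨ρ, hρ, ?_⟩
        rw [hγδ, h3]; push_cast; simp [mul_assoc]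
      · refine ⟨-ρ, neg_mem hρ, ?_⟩
        rw [hγδ, h3]; push_cast; simp [mul_assoc]
    have h4 := Nat.le_findGreatest (hQb _ hQ2) hQ2
    rw [← hdd] at h4
    have h5 : 2 ≤ e.natAbs := by
      rcases he with ⟨k, hk⟩
      omega
    nlinarith [hd.pos]
  · rw [hγδ, mul_assoc]; push_cast; rfl

/-- The summand of `A(β)` at a pair `(t, n)`. -/
def liftTerm (ε : ℂ) (c : ℤ → ℂ) (β : ℍ[ℝ]) (p : ℕ × ℕ) : ℂ :=
  (-ε) ^ p.1 * c ⌊-(‖β‖ ^ 2 / (2 ^ (p.1 + 1) * (p.2 : ℝ) ^ 2))⌋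

theorem liftSum_eq (ε : ℂ) (c : ℤ → ℂ) {β β₀ : ℍ[ℝ]} {u : ℕ} {d : ℤ}
    (h : IsPrimDecomp β u d β₀) :
    liftSum ε c β u d = ‖β‖ * ∑ᶠ p ∈ divisorPairs β, liftTerm ε c β p := by
  rw [divisorPairs_eq h, finsum_mem_coe_finset, Finset.sum_product, liftSum]
  rfl

theorem liftCoeff_eq (ε : ℂ) (c : ℤ → ℂ) {β β₀ : ℍ[ℝ]} {u : ℕ} {d : ℤ}
    (h : IsPrimDecomp β u d β₀) : liftCoeff ε c β = liftSum ε c β u d := by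
  have hex : ∃ p : ℕ × ℤ × ℍ[ℝ], IsPrimDecomp β p.1 p.2.1 p.2.2 := ⟨(u, d, β₀), h⟩
  rw [liftCoeff, dif_pos hex, liftSum_eq ε c hex.choose_spec, liftSum_eq ε c h]

theorem liftCoeff_eq_finsum (ε : ℂ) (c : ℤ → ℂ) {β : ℍ[ℝ]} (h : β ∈ latticeS) (h0 : β ≠ 0) :
    liftCoeff ε c β = ‖β‖ * ∑ᶠ p ∈ divisorPairs β, liftTerm ε c β p := by
  obtain ⟨u, d, β₀, hd⟩ := exists_isPrimDecomp h h0
  rw [liftCoeff_eq ε c hd, liftSum_eq ε c hd]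

theorem divisorPairs_finite {β : ℍ[ℝ]} (h : β ∈ latticeS) (h0 : β ≠ 0) :
    (divisorPairs β).Finite := by
  obtain ⟨u, d, β₀, hd⟩ := exists_isPrimDecomp h h0
  rw [divisorPairs_eq hd]
  exact Finset.finite_toSet _

/-- Lying in nS and the size of |β|² are both preserved by conjugation. A factorization ϖ₂^t γ is
turned into one with ϖ₂ on the other side, which is why the norm criterion is the better definition.
-/
theorem divisorPairs_star (β : ℍ[ℝ]) : divisorPairs (star β) = divisorPairs β := by
  have key : ∀ γ : ℍ[ℝ], divisorPairs γ ⊆ divisorPairs (star γ) := by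
    rintro γ ⟨t, n⟩ ⟨hn, ⟨δ, hδ, hγ⟩, m, hm⟩
    refine ⟨hn, ⟨star δ, star_mem hδ, ?_⟩, m, by rwa [norm_star]⟩
    rw [hγ, star_mul, star_natCast, (Nat.cast_commute n (star δ)).eq]
  refine Set.Subset.antisymm ?_ (key β)
  have := key (star β)
  rwa [star_star] at this

theorem norm_quatI_mul (β : ℍ[ℝ]) : ‖quat 0 1 0 0 * β‖ = ‖β‖ := by
  have : ‖quat 0 1 0 0‖ = 1 := by
    have h := norm_quat_sq 0 1 0 0
    norm_num at h
    exact h.resolve_right (by linarith [norm_nonneg (quat 0 1 0 0)])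
  rw [norm_mul, this, one_mul]

theorem quatI_mul_self : quat 0 1 0 0 * quat 0 1 0 0 = -1 := by
  ext <;> simp

theorem divisorPairs_quatI_mul (β : ℍ[ℝ]) :
    divisorPairs (quat 0 1 0 0 * β) = divisorPairs β := by
  have key : ∀ γ : ℍ[ℝ], divisorPairs γ ⊆ divisorPairs (quat 0 1 0 0 * γ) := by
    rintro γ ⟨t, n⟩ ⟨hn, ⟨δ, hδ, hγ⟩, m, hm⟩
    refine ⟨hn, ⟨quat 0 1 0 0 * δ, quatI_mul_mem hδ, ?_⟩, m, by rwa [norm_quatI_mul]⟩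
    rw [hγ, ← mul_assoc, ← mul_assoc, (Nat.cast_commute n (quat 0 1 0 0)).eq]
  -- Multiplying by i twice gives -β, so the reverse inclusion also needs invariance under sign.
  have hneg : ∀ γ : ℍ[ℝ], divisorPairs (-γ) ⊆ divisorPairs γ := by
    rintro γ ⟨t, n⟩ ⟨hn, ⟨δ, hδ, hγ⟩, m, hm⟩
    exact ⟨hn, ⟨-δ, neg_mem hδ, by rw [mul_neg, ← hγ, neg_neg]⟩, m, by rwa [norm_neg] at hm⟩
  refine Set.Subset.antisymm ?_ (key β)
  refine ((key _).trans ?_).trans (hneg β)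
  rw [← mul_assoc, quatI_mul_self, neg_one_mul]

theorem liftCoeff_star (ε : ℂ) (c : ℤ → ℂ) {β : ℍ[ℝ]} (h : β ∈ latticeS) (h0 : β ≠ 0) :
    liftCoeff ε c (star β) = liftCoeff ε c β := by
  rw [liftCoeff_eq_finsum ε c h h0, liftCoeff_eq_finsum ε c (star_mem h) (star_ne_zero.2 h0),
    divisorPairs_star]
  simp only [liftTerm, norm_star]

theorem quatI_ne_zero : quat 0 1 0 0 ≠ 0 := by
  intro h
  have := congrArg QuaternionAlgebra.imI h
  simp at this

theorem liftCoeff_quatI_mul (ε : ℂ) (c : ℤ → ℂ) {β : ℍ[ℝ]} (h : β ∈ latticeS) (h0 : β ≠ 0) :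
    liftCoeff ε c (quat 0 1 0 0 * β) = liftCoeff ε c β := by
  rw [liftCoeff_eq_finsum ε c h h0, liftCoeff_eq_finsum ε c (quatI_mul_mem h)
    (mul_ne_zero quatI_ne_zero h0), divisorPairs_quatI_mul]
  simp only [liftTerm, norm_quatI_mul]

/-- The argument of c is -|γ|²/2 for γ = β/(ϖ₂^t n) ∈ S, already an integer. -/
theorem floor_norm_sq_div {β : ℍ[ℝ]} {t n : ℕ} (h : (t, n) ∈ divisorPairs β) :
    ∃ m : ℕ, ‖β‖ ^ 2 = 2 ^ (t + 1) * (n : ℝ) ^ 2 * m ∧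
      ⌊-(‖β‖ ^ 2 / (2 ^ (t + 1) * (n : ℝ) ^ 2))⌋ = -(m : ℤ) := by
  obtain ⟨hn, γ, hγ, rfl⟩ := mem_divisorPairs_iff.1 h
  obtain ⟨m, hm⟩ := exists_norm_sq_eq hγ
  have h1 : ‖varpi ^ t * ((n : ℍ[ℝ]) * γ)‖ ^ 2 = 2 ^ (t + 1) * (n : ℝ) ^ 2 * m := by
    rw [norm_mul, norm_mul, mul_pow, mul_pow, norm_varpi_pow_sq, norm_quat_natCast, hm]
    ring
  refine ⟨m, h1, ?_⟩
  have h2 : (0 : ℝ) < 2 ^ (t + 1) * (n : ℝ) ^ 2 := by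
    have : (0 : ℝ) < n := by exact_mod_cast hn.pos
    positivity
  rw [h1, mul_div_cancel_left₀ _ h2.ne', ← Int.cast_natCast, ← Int.cast_neg, Int.floor_intCast]

/-- Polynomial growth of the `c(-n)` implies polynomial growth of `A(β)`. -/
theorem norm_liftCoeff_le {ε : ℂ} (hε : ε = 1 ∨ ε = -1) {c : ℤ → ℂ} {C : ℝ} {N : ℕ}
    (hc : ∀ m : ℕ, 0 < m → ‖c (-m)‖ ≤ C * (m : ℝ) ^ N) {β : ℍ[ℝ]} (h : β ∈ latticeS) (h0 : β ≠ 0) :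
    ‖liftCoeff ε c β‖ ≤ C * ‖β‖ ^ (2 * N + 5) := by
  obtain ⟨u, d, β₀, hd⟩ := exists_isPrimDecomp h h0
  have hC : 0 ≤ C := by
    have := (norm_nonneg _).trans (hc 1 one_pos)
    simpa using this
  have hB : 0 < ‖β‖ ^ 2 := by have := norm_pos_iff.2 h0; positivity
  have hterm : ∀ p ∈ Finset.range (u + 1) ×ˢ d.natAbs.divisors,
      ‖liftTerm ε c β p‖ ≤ C * (‖β‖ ^ 2) ^ N := by
    rintro ⟨t, n⟩ hp
    have hp' : (t, n) ∈ divisorPairs β := by rw [divisorPairs_eq hd]; exact_mod_cast hp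
    obtain ⟨m, hm, hfl⟩ := floor_norm_sq_div hp'
    have hn : 1 ≤ n := hp'.1.pos
    have hm0 : 0 < m := by
      refine Nat.pos_of_ne_zero ?_
      rintro rfl
      simp at hm
      exact h0 hm
    rw [liftTerm, hfl, norm_mul, norm_pow, norm_neg]
    have : ‖ε‖ = 1 := by rcases hε with rfl | rfl <;> simp
    rw [this, one_pow, one_mul]
    refine (hc m hm0).trans ?_
    have hle : (m : ℝ) ≤ ‖β‖ ^ 2 := by
      rw [hm]
      have h1 : (1 : ℝ) ≤ 2 ^ (t + 1) := one_le_pow₀ (by norm_num)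
      have h2 : (1 : ℝ) ≤ (n : ℝ) ^ 2 := one_le_pow₀ (by exact_mod_cast hn)
      exact le_mul_of_one_le_left (by positivity) (one_le_mul_of_one_le_of_one_le h1 h2)
    gcongr
  obtain ⟨hdo, hβ₀, hβe⟩ := hd
  -- The exponent 2N+5 is 1 from the prefactor |β|, 2N from the coefficients and a generous 4 for
  -- the number of pairs, which is at most 2^(u+1) d² M = |β|².
  have hcard : ((Finset.range (u + 1) ×ˢ d.natAbs.divisors).card : ℝ) ≤ ‖β‖ ^ 4 := by
    obtain ⟨M, hM, hM2⟩ := exists_odd_of_mem_primS hβ₀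
    have hMp : 1 ≤ M := hM.pos
    rw [Finset.card_product, Finset.card_range]
    have e1 : (‖β‖ ^ 2 : ℝ) = ((2 ^ (u + 1) * (d.natAbs ^ 2 * M) : ℕ) : ℝ) := by
      rw [hβe, norm_mul, norm_mul, mul_pow, mul_pow, norm_varpi_pow_sq, hM2, norm_quat_intCast]
      push_cast
      simp only [sq_abs, Nat.cast_natAbs, Int.cast_abs]
      ring
    have hd1 : 1 ≤ d.natAbs := (Int.natAbs_odd.2 hdo).pos
    have e2 : d.natAbs.divisors.card ≤ d.natAbs ^ 2 * M := by
      calc d.natAbs.divisors.card ≤ d.natAbs := Nat.card_divisors_le_self _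
        _ ≤ d.natAbs ^ 2 * M := by
          rw [sq, mul_assoc]
          exact Nat.le_mul_of_pos_right _ (by positivity)
    have e3 : u + 1 ≤ 2 ^ (u + 1) := Nat.lt_two_pow_self.le
    have e4 : (u + 1) * d.natAbs.divisors.card ≤ 2 ^ (u + 1) * (d.natAbs ^ 2 * M) :=
      Nat.mul_le_mul e3 e2
    have e5 : (1 : ℝ) ≤ ‖β‖ ^ 2 := by
      rw [e1]; exact_mod_cast Nat.one_le_iff_ne_zero.2 (by positivity)
    calc (((u + 1) * d.natAbs.divisors.card : ℕ) : ℝ) ≤ ‖β‖ ^ 2 := by rw [e1]; exact_mod_cast e4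
      _ ≤ ‖β‖ ^ 2 * ‖β‖ ^ 2 := le_mul_of_one_le_left (by positivity) e5
      _ = ‖β‖ ^ 4 := by ring
  rw [liftCoeff_eq_finsum ε c h h0, divisorPairs_eq ⟨hdo, hβ₀, hβe⟩, finsum_mem_coe_finset, norm_mul,
    Complex.norm_real, norm_norm]
  calc ‖β‖ * ‖∑ p ∈ Finset.range (u + 1) ×ˢ d.natAbs.divisors, liftTerm ε c β p‖
      ≤ ‖β‖ * (‖β‖ ^ 4 * (C * (‖β‖ ^ 2) ^ N)) := by
        gcongr
        refine (norm_sum_le_of_le _ hterm).trans ?_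
        rw [Finset.sum_const, nsmul_eq_mul]
        gcongr
    _ = C * ‖β‖ ^ (2 * N + 5) := by rw [← pow_mul]; ring

end MaassLift

namespace MaassLift

/-! ## Homogeneous polynomials on the quaternions -/

/-- The coordinate vector of a quaternion. -/
def quatCoord (x : ℍ[ℝ]) : Fin 4 → ℂ := ![(x.re : ℂ), (x.imI : ℂ), (x.imJ : ℂ), (x.imK : ℂ)]

theorem evalQ_eq (P : MvPolynomial (Fin 4) ℂ) (x : ℍ[ℝ]) :
    evalQ P x = ∑ a ∈ P.support, P.coeff a * ∏ i, quatCoord x i ^ a i :=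
  MvPolynomial.eval_eq' _ _

theorem sum_eq_of_mem_support {l : ℕ} {P : MvPolynomial (Fin 4) ℂ} (hP : P.IsHomogeneous l)
    {a : Fin 4 →₀ ℕ} (ha : a ∈ P.support) : ∑ i, a i = l := by
  have := hP (MvPolynomial.mem_support_iff.1 ha)
  rw [← this, Finsupp.weight_apply, Finsupp.sum_fintype _ _ (by simp)]
  simp

theorem eval_smul_of_isHomogeneous {l : ℕ} {P : MvPolynomial (Fin 4) ℂ} (hP : P.IsHomogeneous l)
    (r : ℂ) (v : Fin 4 → ℂ) :
    MvPolynomial.eval (fun i => r * v i) P = r ^ l * MvPolynomial.eval v P := by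
  rw [MvPolynomial.eval_eq', MvPolynomial.eval_eq', Finset.mul_sum]
  refine Finset.sum_congr rfl fun a ha => ?_
  rw [← sum_eq_of_mem_support hP ha, ← Finset.prod_pow_eq_pow_sum]
  simp_rw [mul_pow, Finset.prod_mul_distrib]
  ring

theorem quatCoord_smul (r : ℝ) (x : ℍ[ℝ]) : quatCoord (r • x) = fun i => (r : ℂ) * quatCoord x i := by
  ext i
  fin_cases i <;> simp [quatCoord]

theorem evalQ_smul {l : ℕ} {P : MvPolynomial (Fin 4) ℂ} (hP : P.IsHomogeneous l)
    (r : ℝ) (x : ℍ[ℝ]) : evalQ P (r • x) = (r : ℂ) ^ l * evalQ P x := by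
  have : evalQ P (r • x) = MvPolynomial.eval (quatCoord (r • x)) P := rfl
  rw [this, quatCoord_smul, eval_smul_of_isHomogeneous hP]
  rfl

theorem norm_quatCoord_le (x : ℍ[ℝ]) (i : Fin 4) : ‖quatCoord x i‖ ≤ ‖x‖ := by
  have h := norm_quat_sq x.re x.imI x.imJ x.imK
  rw [quat_eta] at h
  have key : ∀ a : ℝ, a ^ 2 ≤ ‖x‖ ^ 2 → ‖(a : ℂ)‖ ≤ ‖x‖ := fun a ha => by
    rw [Complex.norm_real, Real.norm_eq_abs]
    exact abs_le_of_sq_le_sq ha (norm_nonneg x)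
  fin_cases i <;> refine key _ ?_ <;> nlinarith [sq_nonneg x.re, sq_nonneg x.imI, sq_nonneg x.imJ,
    sq_nonneg x.imK]

theorem exists_norm_evalQ_le {l : ℕ} {P : MvPolynomial (Fin 4) ℂ} (hP : P.IsHomogeneous l) :
    ∃ C : ℝ, 0 ≤ C ∧ ∀ x, ‖evalQ P x‖ ≤ C * ‖x‖ ^ l := by
  refine ⟨∑ a ∈ P.support, ‖P.coeff a‖, by positivity, fun x => ?_⟩
  rw [evalQ_eq, Finset.sum_mul]
  refine norm_sum_le_of_le _ fun a ha => ?_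
  rw [norm_mul, norm_prod, ← sum_eq_of_mem_support hP ha, ← Finset.prod_pow_eq_pow_sum]
  gcongr with i
  rw [norm_pow]
  exact pow_le_pow_left₀ (norm_nonneg _) (norm_quatCoord_le x i) _

theorem varpi_eq_smul : varpi = Real.sqrt 2 • zeta8 := by
  have h : Real.sqrt 2 ≠ 0 := by positivity
  ext <;> simp [varpi, zeta8, h]

/-- ϖ₂ is √2 times (1+i)/√2: homogeneity accounts for √2^l and the eigenvalue for the rest. -/
theorem evalQ_varpi_pow_mul {l : ℕ} {P : MvPolynomial (Fin 4) ℂ} (hP : P.IsHomogeneous l)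
    {εP : ℂ} (he : IsEigenPoly P εP) (t : ℕ) (x : ℍ[ℝ]) :
    evalQ P (varpi ^ t * x) = ((Real.sqrt 2 : ℂ) ^ l * εP) ^ t * evalQ P x := by
  induction t with
  | zero => simp
  | succ t ih =>
    rw [pow_succ', mul_assoc, varpi_eq_smul, smul_mul_assoc, evalQ_smul hP, he, ← varpi_eq_smul, ih]
    ring

theorem evalQ_natCast_mul {l : ℕ} {P : MvPolynomial (Fin 4) ℂ} (hP : P.IsHomogeneous l)
    (n : ℕ) (x : ℍ[ℝ]) : evalQ P ((n : ℍ[ℝ]) * x) = (n : ℂ) ^ l * evalQ P x := by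
  have : (n : ℍ[ℝ]) * x = (n : ℝ) • x := by rw [Nat.cast_smul_eq_nsmul, nsmul_eq_mul]
  rw [this, evalQ_smul hP]
  simp

/-! ## Convergence of lattice sums -/

/-- Nonzero norms squared are even positive integers, so distinct points are at distance at least 1.
-/
instance : DiscreteTopology latticeS := by
  refine DiscreteTopology.of_forall_le_dist one_pos fun x y hxy => ?_
  have h0 : (x - y : ℍ[ℝ]) ≠ 0 := by
    rw [sub_ne_zero]
    exact fun h => hxy (Subtype.ext h)
  obtain ⟨m, hm, h⟩ := norm_sq_pos_of_mem (sub_mem x.2 y.2) h0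
  have : dist x y = ‖(x - y : ℍ[ℝ])‖ := by rw [Subtype.dist_eq, dist_eq_norm]
  show 1 ≤ dist x y
  rw [this]
  have h1 : (1 : ℝ) ≤ m := by exact_mod_cast hm
  nlinarith [norm_nonneg (x - y : ℍ[ℝ])]

theorem finrank_latticeS_le : Module.finrank ℤ latticeS ≤ 4 := by
  classical
  have h : latticeS = Submodule.span ℤ (({quat 1 0 0 (-1), quat 0 (-1) 0 (-1), quat 0 0 (-1) (-1),
    quat 0 0 0 2} : Finset ℍ[ℝ]) : Set ℍ[ℝ]) := by simp [latticeS]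
  rw [h]
  refine (finrank_span_finset_le_card _).trans ?_
  exact Finset.card_le_four

theorem summable_norm_rpow_latticeS {r : ℝ} (hr : r < -4) :
    Summable fun β : latticeS => ‖(β : ℍ[ℝ])‖ ^ r := by
  refine ZLattice.summable_norm_rpow latticeS r (hr.trans_le ?_)
  have : (Module.finrank ℤ latticeS : ℝ) ≤ 4 := by exact_mod_cast finrank_latticeS_le
  linarith

theorem summable_norm_rpow_nonzero {r : ℝ} (hr : r < -4) :
    Summable fun β : LatticeSNonzero => ‖(β : ℍ[ℝ])‖ ^ r :=
  (summable_norm_rpow_latticeS hr).comp_injective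
    (i := fun β : LatticeSNonzero => (⟨β.1, β.2.1⟩ : latticeS)) fun x y h => by
      ext1; simpa using h

/-! ## Factorization of the Dirichlet series -/

/-- The terms of the Dirichlet series `∑ c(-|γ|²/2) P(γ) |γ|^{1-2w}`. -/
def baseTerm (c : ℤ → ℂ) (P : ℍ[ℝ] → ℂ) (w : ℂ) (γ : LatticeSNonzero) : ℂ :=
  c ⌊-(‖(γ : ℍ[ℝ])‖ ^ 2 / 2)⌋ * P γ * (‖(γ : ℍ[ℝ])‖ : ℂ) ^ (1 - 2 * w)

theorem floor_norm_sq_half {γ : ℍ[ℝ]} {m : ℕ} (h : ‖γ‖ ^ 2 = 2 * m) :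
    ⌊-(‖γ‖ ^ 2 / 2)⌋ = -(m : ℤ) := by
  rw [h, mul_div_cancel_left₀ _ two_ne_zero, ← Int.cast_natCast, ← Int.cast_neg, Int.floor_intCast]

/-- The coefficient contributes |γ|^(2N), the polynomial |γ|^l and the power |γ|^(1-2 Re w); a
lattice of rank at most 4 sums any exponent below -4. -/
theorem summable_baseTerm {c : ℤ → ℂ} {C : ℝ} {N : ℕ}
    (hc : ∀ m : ℕ, 0 < m → ‖c (-m)‖ ≤ C * (m : ℝ) ^ N) {l : ℕ} {P : ℍ[ℝ] → ℂ} {C' : ℝ}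
    (hP : ∀ x, ‖P x‖ ≤ C' * ‖x‖ ^ l) {w : ℂ} (hw : 2 * N + l + 5 < 2 * w.re) :
    Summable (baseTerm c P w) := by
  have hs := (summable_norm_rpow_nonzero (r := 2 * N + l + 1 - 2 * w.re) (by linarith)).mul_left
    (C * C')
  refine Summable.of_norm_bounded hs fun γ => ?_
  obtain ⟨m, hm, h⟩ := norm_sq_pos_of_mem γ.2.1 γ.2.2
  have hC : 0 ≤ C := by
    have := (norm_nonneg _).trans (hc 1 one_pos)
    simpa using this
  have hγ : 0 < ‖(γ : ℍ[ℝ])‖ := norm_pos_iff.2 γ.2.2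
  rw [baseTerm, floor_norm_sq_half h, norm_mul, norm_mul,
    Complex.norm_cpow_eq_rpow_re_of_pos hγ]
  have h1 : ‖c (-m)‖ ≤ C * ‖(γ : ℍ[ℝ])‖ ^ (2 * N : ℝ) := by
    refine (hc m hm).trans ?_
    have e : ‖(γ : ℍ[ℝ])‖ ^ (2 * N : ℝ) = (‖(γ : ℍ[ℝ])‖ ^ 2) ^ N := by
      rw [← pow_mul, ← Real.rpow_natCast]; push_cast; rfl
    rw [e]
    have : (m : ℝ) ≤ ‖(γ : ℍ[ℝ])‖ ^ 2 := by rw [h]; linarith [m.cast_nonneg (α := ℝ)]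
    gcongr
  have h2 : ‖P γ‖ ≤ C' * ‖(γ : ℍ[ℝ])‖ ^ (l : ℝ) := by
    rw [Real.rpow_natCast]; exact hP γ
  calc _ ≤ (C * ‖(γ : ℍ[ℝ])‖ ^ (2 * N : ℝ)) * (C' * ‖(γ : ℍ[ℝ])‖ ^ (l : ℝ)) *
        ‖(γ : ℍ[ℝ])‖ ^ (1 - 2 * w).re := by gcongr
    _ = C * C' * (‖(γ : ℍ[ℝ])‖ ^ (2 * N : ℝ) * ‖(γ : ℍ[ℝ])‖ ^ (l : ℝ) *
        ‖(γ : ℍ[ℝ])‖ ^ (1 - 2 * w).re) := by ring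
    _ = _ := by
      rw [← Real.rpow_add hγ, ← Real.rpow_add hγ]
      congr 2
      simp
      ring

/-- `(β, (t, n)) ↔ ((t, n), γ)` with `β = ϖ₂^t n γ`. -/
def pairEquiv : (Σ β : LatticeSNonzero, divisorPairs (β : ℍ[ℝ])) ≃
    (ℕ × {n : ℕ // Odd n}) × LatticeSNonzero where
  toFun x := ((x.2.1.1, ⟨x.2.1.2, x.2.2.1⟩),
    ⟨(mem_divisorPairs_iff.1 x.2.2).2.choose, (mem_divisorPairs_iff.1 x.2.2).2.choose_spec.1, by
      intro h
      have := (mem_divisorPairs_iff.1 x.2.2).2.choose_spec.2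
      rw [h, mul_zero, mul_zero] at this
      exact x.1.2.2 this⟩)
  invFun y := ⟨⟨varpi ^ y.1.1 * (((y.1.2 : ℕ) : ℍ[ℝ]) * y.2),
      varpi_pow_mul_mem (by
        have := intCast_mul_mem y.2.2.1 ((y.1.2 : ℕ) : ℤ)
        push_cast at this; exact this) _,
      mul_ne_zero (pow_ne_zero _ varpi_ne_zero) (mul_ne_zero (by
        rw [← norm_ne_zero_iff, norm_quat_natCast]
        exact_mod_cast y.1.2.2.pos.ne') y.2.2.2)⟩,
    ⟨(y.1.1, y.1.2), mem_divisorPairs_iff.2 ⟨y.1.2.2, y.2, y.2.2.1, rfl⟩⟩⟩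
  left_inv := by
    rintro ⟨⟨β, hβ⟩, ⟨⟨t, n⟩, h⟩⟩
    have := (mem_divisorPairs_iff.1 h).2.choose_spec.2
    simp only at this
    refine Sigma.subtype_ext ?_ rfl
    exact Subtype.ext this.symm
  right_inv := by
    rintro ⟨⟨t, n, hn⟩, γ, hγ⟩
    simp only [Prod.mk.injEq, Subtype.mk.injEq, true_and]
    have h : ∃ γ' ∈ latticeS, varpi ^ t * ((n : ℍ[ℝ]) * γ) = varpi ^ t * ((n : ℍ[ℝ]) * γ') :=
      ⟨γ, hγ.1, rfl⟩
    have h2 := h.choose_spec.2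
    have hn0 : (n : ℍ[ℝ]) ≠ 0 := by
      rw [← norm_ne_zero_iff, norm_quat_natCast]
      exact_mod_cast hn.pos.ne'
    exact (mul_left_cancel₀ hn0 (mul_left_cancel₀ (pow_ne_zero t varpi_ne_zero) h2)).symm

theorem ofReal_pow_cpow {x : ℝ} (hx : 0 ≤ x) (t : ℕ) (a : ℂ) :
    ((x : ℂ) ^ t) ^ a = ((x : ℂ) ^ a) ^ t := by
  induction t with
  | zero => simp
  | succ t ih =>
    rw [pow_succ, ← Complex.ofReal_pow, Complex.mul_cpow_ofReal_nonneg (by positivity) hx,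
      Complex.ofReal_pow, ih, pow_succ]

/-- Splitting of the term at `β = ϖ₂^t n γ`. -/
theorem liftTerm_mul_eq {c : ℤ → ℂ} {l : ℕ} {P : MvPolynomial (Fin 4) ℂ} (hP : P.IsHomogeneous l)
    {εP : ℂ} (he : IsEigenPoly P εP) (ε : ℂ) (w : ℂ) {t n : ℕ} (hn : Odd n) {β : ℍ[ℝ]}
    (γ : LatticeSNonzero) (hβe : β = varpi ^ t * ((n : ℍ[ℝ]) * γ)) :
    ‖β‖ * liftTerm ε c β (t, n) * evalQ P β / (‖β‖ : ℂ) ^ (2 * w) =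
      (-ε * εP * (Real.sqrt 2 : ℂ) ^ ((l : ℂ) + 1 - 2 * w)) ^ t *
        (n : ℂ) ^ ((l : ℂ) + 1 - 2 * w) * baseTerm c (evalQ P) w γ := by
  obtain ⟨γ, hγ, hγ0⟩ := γ
  simp only at hβe
  have htn : (t, n) ∈ divisorPairs β := mem_divisorPairs_iff.2 ⟨hn, γ, hγ, hβe⟩
  have hγp : 0 < ‖γ‖ := norm_pos_iff.2 hγ0
  have hnp : (0 : ℝ) < n := by exact_mod_cast hn.pos
  have hs2 : (0 : ℝ) < Real.sqrt 2 := by positivity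
  have hnv : ‖varpi‖ = Real.sqrt 2 := by
    rw [← norm_varpi_sq, Real.sqrt_sq (norm_nonneg _)]
  have hnorm : ‖β‖ = Real.sqrt 2 ^ t * n * ‖γ‖ := by
    rw [hβe, norm_mul, norm_mul, norm_pow, norm_quat_natCast, hnv]; ring
  have hβp : 0 < ‖β‖ := by rw [hnorm]; positivity
  obtain ⟨m, hm⟩ := exists_norm_sq_eq hγ
  obtain ⟨m', hm', hfl⟩ := floor_norm_sq_div htn
  have hmm : m' = m := by
    have e : ‖β‖ ^ 2 = 2 ^ (t + 1) * (n : ℝ) ^ 2 * m := by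
      rw [hnorm, mul_pow, mul_pow, ← pow_mul, mul_comm t 2, pow_mul, Real.sq_sqrt (by norm_num), hm]
      ring
    rw [hm'] at e
    have := mul_left_cancel₀ (by positivity) e
    exact_mod_cast this
  have hβc : (‖β‖ : ℂ) ^ (1 - 2 * w) = ((Real.sqrt 2 : ℂ) ^ (1 - 2 * w)) ^ t *
      (n : ℂ) ^ (1 - 2 * w) * (‖γ‖ : ℂ) ^ (1 - 2 * w) := by
    rw [hnorm, Complex.ofReal_mul, Complex.mul_cpow_ofReal_nonneg (by positivity) hγp.le,
      Complex.ofReal_mul, Complex.mul_cpow_ofReal_nonneg (by positivity) hnp.le, Complex.ofReal_pow,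
      ofReal_pow_cpow hs2.le, Complex.ofReal_natCast]
  have hβ1 : (‖β‖ : ℂ) / (‖β‖ : ℂ) ^ (2 * w) = (‖β‖ : ℂ) ^ (1 - 2 * w) := by
    rw [Complex.cpow_sub _ _ (by exact_mod_cast hβp.ne'), Complex.cpow_one]
  have hPβ : evalQ P β = ((Real.sqrt 2 : ℂ) ^ l * εP) ^ t * ((n : ℂ) ^ l * evalQ P γ) := by
    rw [hβe, evalQ_varpi_pow_mul hP he, evalQ_natCast_mul hP]
  have hqq : (Real.sqrt 2 : ℂ) ^ ((l : ℂ) + 1 - 2 * w) =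
      (Real.sqrt 2 : ℂ) ^ l * (Real.sqrt 2 : ℂ) ^ (1 - 2 * w) := by
    rw [add_sub_assoc, Complex.cpow_add _ _ (by exact_mod_cast hs2.ne'), Complex.cpow_natCast]
  have hnn : (n : ℂ) ^ ((l : ℂ) + 1 - 2 * w) = (n : ℂ) ^ l * (n : ℂ) ^ (1 - 2 * w) := by
    rw [add_sub_assoc, Complex.cpow_add _ _ (by exact_mod_cast hnp.ne'), Complex.cpow_natCast]
  rw [hnn, hqq, baseTerm, liftTerm, hfl, floor_norm_sq_half hm, hmm, hPβ,
    mul_comm (‖β‖ : ℂ), mul_right_comm, mul_div_assoc, hβ1, hβc]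
  simp only [mul_pow]
  ring

theorem hasSum_mul_prod {ι κ : Type*} {f : ι → ℂ} {g : κ → ℂ} {a b : ℂ}
    (hf : HasSum f a) (hg : HasSum g b) : HasSum (fun x : ι × κ => f x.1 * g x.2) (a * b) := by
  have h1 : Summable (fun x : ι × κ => f x.1 * g x.2) := by
    apply summable_mul_of_summable_norm
    · exact hf.summable.norm
    · exact hg.summable.norm
  exact hf.mul hg h1

/-- The Dirichlet series `∑ A(β) P(β) |β|^{-2w}` as an Euler-type product. -/
theorem hasSum_xiTerm {c : ℤ → ℂ} {l : ℕ} {P : MvPolynomial (Fin 4) ℂ} (hP : P.IsHomogeneous l)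
    {εP : ℂ} (he : IsEigenPoly P εP) (ε : ℂ) (w : ℂ)
    (ha : ‖-ε * εP * (Real.sqrt 2 : ℂ) ^ ((l : ℂ) + 1 - 2 * w)‖ < 1)
    (hb : Summable fun n : {n : ℕ // Odd n} => ((n : ℕ) : ℂ) ^ ((l : ℂ) + 1 - 2 * w))
    (hG : Summable (baseTerm c (evalQ P) w)) :
    HasSum (xiTerm (liftCoeff ε c) (evalQ P) w)
      ((1 - (-ε * εP * (Real.sqrt 2 : ℂ) ^ ((l : ℂ) + 1 - 2 * w)))⁻¹ *
        (∑' n : {n : ℕ // Odd n}, ((n : ℕ) : ℂ) ^ ((l : ℂ) + 1 - 2 * w)) *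
        ∑' γ, baseTerm c (evalQ P) w γ) := by
  set q := -ε * εP * (Real.sqrt 2 : ℂ) ^ ((l : ℂ) + 1 - 2 * w) with hq
  have h123 := hasSum_mul_prod (hasSum_mul_prod (hasSum_geometric_of_norm_lt_one ha) hb.hasSum) hG.hasSum
  have h : HasSum (fun x : Σ β : LatticeSNonzero, divisorPairs (β : ℍ[ℝ]) =>
      q ^ x.2.1.1 * (x.2.1.2 : ℂ) ^ ((l : ℂ) + 1 - 2 * w) *
        baseTerm c (evalQ P) w (pairEquiv x).2) _ := (pairEquiv.hasSum_iff).2 h123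
  -- The product of the three series, reindexed by (β,(t,n)), is summed over each finite fibre above
  -- β; the fibre sum is A(β)P(β)/|β|^(2w).
  refine HasSum.sigma h ?_
  intro β
  have hfin := divisorPairs_finite β.2.1 β.2.2
  have : Fintype (divisorPairs (β : ℍ[ℝ])) := hfin.fintype
  have hval : xiTerm (liftCoeff ε c) (evalQ P) w β =
      ∑ p : divisorPairs (β : ℍ[ℝ]), q ^ p.1.1 * (p.1.2 : ℂ) ^ ((l : ℂ) + 1 - 2 * w) *
        baseTerm c (evalQ P) w (pairEquiv ⟨β, p⟩).2 := by
    rw [xiTerm, liftCoeff_eq_finsum ε c β.2.1 β.2.2, finsum_mem_eq_finite_toFinset_sum _ hfin,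
      Finset.mul_sum, Finset.sum_mul, Finset.sum_div,
      Finset.sum_subtype (p := (· ∈ divisorPairs (β : ℍ[ℝ]))) _ (by simp)]
    refine Finset.sum_congr rfl ?_
    rintro ⟨⟨t, n⟩, htn⟩ -
    have hβ := (mem_divisorPairs_iff.1 htn).2.choose_spec.2
    exact liftTerm_mul_eq hP he ε w (mem_divisorPairs_iff.1 htn).1
      (pairEquiv ⟨β, ⟨(t, n), htn⟩⟩).2 hβ
  rw [hval]
  exact hasSum_fintype _

end MaassLift

namespace MaassLift

open MeasureTheory Set

/-! ## The modified Bessel function -/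

theorem norm_cexp_mul_ccosh_le (μ : ℂ) (t : ℝ) :
    ‖Complex.cosh (μ * t)‖ ≤ Real.cosh (μ.re * t) := by
  rw [Complex.cosh, norm_div, Complex.norm_two, Real.cosh_eq]
  gcongr
  refine (norm_add_le _ _).trans ?_
  rw [Complex.norm_exp, Complex.norm_exp]
  simp

theorem cosh_le_exp_abs (x : ℝ) : Real.cosh x ≤ Real.exp |x| := by
  rw [← Real.cosh_abs, Real.cosh_eq]
  have : Real.exp (-|x|) ≤ Real.exp |x| := Real.exp_le_exp.2 (by linarith [abs_nonneg x])
  linarith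

theorem exp_half_le_one_add_cosh (t : ℝ) : Real.exp t / 2 ≤ 1 + Real.cosh t := by
  rw [Real.cosh_eq]
  linarith [Real.exp_pos (-t)]

theorem one_add_cosh_pos (t : ℝ) : 0 < 1 + Real.cosh t := by linarith [Real.cosh_pos t]

/-- From 1/(1+cosh t) ≤ 2e^(-t). The rate a - |σ| is positive exactly in the range of convergence of
the Mellin transform below. -/
theorem rpow_mul_cosh_le {a σ t : ℝ} (ha : 0 ≤ a) (ht : 0 < t) :
    (1 / (1 + Real.cosh t)) ^ a * Real.cosh (σ * t) ≤ 2 ^ a * Real.exp (-(a - |σ|) * t) := by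
  have h1 : (1 / (1 + Real.cosh t)) ^ a ≤ 2 ^ a * Real.exp (-a * t) := by
    have : Real.exp (-a * t) = Real.exp (-t) ^ a := by rw [← Real.exp_mul]; ring_nf
    rw [this, ← Real.mul_rpow (by norm_num) (Real.exp_pos _).le]
    refine Real.rpow_le_rpow (by have := one_add_cosh_pos t; positivity) ?_ ha
    rw [div_le_iff₀ (one_add_cosh_pos t)]
    have := mul_le_mul_of_nonneg_left (exp_half_le_one_add_cosh t)
      (by positivity : 0 ≤ 2 * Real.exp (-t))
    have e : Real.exp (-t) * Real.exp t = 1 := by rw [← Real.exp_add]; simp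
    linarith
  have h2 : Real.cosh (σ * t) ≤ Real.exp (|σ| * t) := by
    refine (cosh_le_exp_abs _).trans_eq ?_
    rw [abs_mul, abs_of_pos ht]
  calc _ ≤ (2 ^ a * Real.exp (-a * t)) * Real.exp (|σ| * t) := by
        gcongr
    _ = _ := by rw [mul_assoc, ← Real.exp_add]; ring_nf

theorem integrableOn_rpow_mul_cosh {a σ : ℝ} (h : |σ| < a) :
    IntegrableOn (fun t : ℝ => (1 / (1 + Real.cosh t)) ^ a * Real.cosh (σ * t)) (Ioi 0) := by
  have ha : 0 ≤ a := (abs_nonneg σ).trans h.le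
  refine Integrable.mono' ((exp_neg_integrableOn_Ioi 0 (sub_pos.2 h)).const_mul (2 ^ a)) ?_ ?_
  · refine Continuous.aestronglyMeasurable ?_
    refine Continuous.mul (Continuous.rpow_const ?_ fun t => Or.inr ha) (by fun_prop)
    exact continuous_const.div (by fun_prop) fun t => (one_add_cosh_pos t).ne'
  · refine (ae_restrict_iff' measurableSet_Ioi).2 (.of_forall fun t ht => ?_)
    rw [Real.norm_of_nonneg (by have := one_add_cosh_pos t; positivity)]
    exact rpow_mul_cosh_le ha ht

/-- `K_σ(y)` for real `σ` as a real integral. -/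
def besselKReal (σ y : ℝ) : ℝ :=
  ∫ t in Ioi (0 : ℝ), Real.exp (-(y * Real.cosh t)) * Real.cosh (σ * t)

/-- Write exp(-y cosh t) = e^y exp(-y(1+cosh t)) and bound exp(-x) by n!/x^n with n > |σ|; this
reduces to the integrand with powers of 1/(1+cosh t). -/
theorem integrableOn_besselKReal (σ : ℝ) {y : ℝ} (hy : 0 < y) :
    IntegrableOn (fun t : ℝ => Real.exp (-(y * Real.cosh t)) * Real.cosh (σ * t)) (Ioi 0) := by
  obtain ⟨n, hn⟩ := exists_nat_gt |σ|
  refine Integrable.mono' ((integrableOn_rpow_mul_cosh hn).const_mul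
    (Real.exp y * (n.factorial / y ^ n))) (by fun_prop) (.of_forall fun t => ?_)
  rw [Real.norm_of_nonneg (by positivity), ← mul_assoc]
  gcongr
  have hu := one_add_cosh_pos t
  have h1 := Real.pow_div_factorial_le_exp (y * (1 + Real.cosh t)) (by positivity) n
  have h2 : Real.exp (-(y * (1 + Real.cosh t))) ≤ n.factorial / (y * (1 + Real.cosh t)) ^ n := by
    rw [Real.exp_neg, ← inv_div]
    exact inv_anti₀ (by positivity) h1
  have h3 : Real.exp (-(y * Real.cosh t)) = Real.exp y * Real.exp (-(y * (1 + Real.cosh t))) := by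
    rw [← Real.exp_add]; ring_nf
  rw [h3, mul_assoc]
  gcongr
  refine h2.trans_eq ?_
  rw [Real.rpow_natCast, mul_pow, one_div, inv_pow]
  field_simp

theorem norm_besselK_integrand_le (μ : ℂ) (y t : ℝ) :
    ‖Complex.exp (-((y * Real.cosh t : ℝ) : ℂ)) * Complex.cosh (μ * t)‖ ≤
      Real.exp (-(y * Real.cosh t)) * Real.cosh (μ.re * t) := by
  rw [norm_mul, ← Complex.ofReal_neg, ← Complex.ofReal_exp, Complex.norm_real,
    Real.norm_of_nonneg (Real.exp_pos _).le]
  gcongr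
  exact norm_cexp_mul_ccosh_le μ t

theorem norm_besselK_le (μ : ℂ) {y : ℝ} (hy : 0 < y) : ‖besselK μ y‖ ≤ besselKReal μ.re y :=
  norm_integral_le_of_norm_le (integrableOn_besselKReal μ.re hy)
    (.of_forall fun t => norm_besselK_integrand_le μ y t)

theorem besselKReal_nonneg (σ y : ℝ) : 0 ≤ besselKReal σ y :=
  integral_nonneg fun t => by positivity

/-- Since cosh t ≥ 1, the factor exp(-(y-y₀)) comes out of the integrand. -/
theorem besselKReal_le (σ : ℝ) {y₀ y : ℝ} (hy₀ : 0 < y₀) (hy : y₀ ≤ y) :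
    besselKReal σ y ≤ Real.exp (-(y - y₀)) * besselKReal σ y₀ := by
  rw [besselKReal, besselKReal, ← integral_const_mul]
  refine integral_mono (integrableOn_besselKReal σ (hy₀.trans_le hy))
    ((integrableOn_besselKReal σ hy₀).const_mul _) fun t => ?_
  simp only
  rw [← mul_assoc, ← Real.exp_add]
  gcongr
  nlinarith [Real.one_le_cosh t]

/-- The integrand of the double integral for the Mellin transform of `K_σ(x) e^{-x}`. -/
def besselKernel (a σ : ℝ) (p : ℝ × ℝ) : ℝ :=
  p.2 ^ (a - 1) * Real.exp (-((1 + Real.cosh p.1) * p.2)) * Real.cosh (σ * p.1)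

/-- Everything is positive, so integrate in x first: the inner integral is Γ(a) (1+cosh t)^(-a)
cosh(σt). -/
theorem integrable_besselKernel {a σ : ℝ} (h : |σ| < a) :
    Integrable (besselKernel a σ)
      ((volume.restrict (Ioi 0)).prod (volume.restrict (Ioi 0))) := by
  have ha : 0 < a := (abs_nonneg σ).trans_lt h
  have hin : ∀ t : ℝ, IntegrableOn (fun x : ℝ => besselKernel a σ (t, x)) (Ioi 0) := fun t => by
    have := integrableOn_rpow_mul_exp_neg_mul_rpow (s := a - 1) (p := 1) (by linarith) one_pos
      (one_add_cosh_pos t)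
    simp only [Real.rpow_one, neg_mul] at this
    exact Integrable.mul_const this (Real.cosh (σ * t))
  have hmeas : Measurable (besselKernel a σ) := by unfold besselKernel; fun_prop
  rw [integrable_prod_iff hmeas.aestronglyMeasurable]
  refine ⟨.of_forall hin, ?_⟩
  refine ((integrableOn_rpow_mul_cosh h).mul_const (Real.Gamma a)).congr (.of_forall fun t => ?_)
  simp only
  have : ∫ x in Ioi 0, ‖besselKernel a σ (t, x)‖ = ∫ x in Ioi 0, besselKernel a σ (t, x) := by
    refine setIntegral_congr_fun measurableSet_Ioi fun x hx => ?_
    have hx' : 0 < x := hx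
    exact Real.norm_of_nonneg (by unfold besselKernel; positivity)
  rw [this]
  unfold besselKernel
  simp only
  rw [integral_mul_const, Real.integral_rpow_mul_exp_neg_mul_Ioi ha (one_add_cosh_pos t)]
  ring

/-- Substitute x = 1/(1+e^(-t)) in the beta integral B(w+μ, w-μ): one has x(1-x) = 1/(2(1+cosh t))
and x/(1-x) = e^t, so the integrand becomes 2^(-w)(1+cosh t)^(-w)e^(μt) on ℝ. Folding t ↦ -t
replaces e^(μt) by 2cosh(μt). -/
theorem integral_cosh_mul_eq {w μ : ℂ} (h : |μ.re| < w.re) :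
    ∫ t in Ioi (0 : ℝ), (1 / ((1 + Real.cosh t : ℝ) : ℂ)) ^ w * Complex.cosh (μ * t) =
      2 ^ (w - 1) * (Complex.Gamma (w + μ) * Complex.Gamma (w - μ) / Complex.Gamma (2 * w)) := by
  have hu : 0 < (w + μ).re := by rw [Complex.add_re]; linarith [(abs_lt.1 h).1]
  have hv : 0 < (w - μ).re := by rw [Complex.sub_re]; linarith [(abs_lt.1 h).2]
  have hw : 0 < w.re := (abs_nonneg _).trans_lt h
  set G : ℝ → ℂ := fun t => (1 / ((1 + Real.cosh t : ℝ) : ℂ)) ^ w * Complex.exp (μ * t) with hG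
  -- the integrand of the beta integral
  set g : ℝ → ℂ := fun x => (x : ℂ) ^ (w + μ - 1) * (1 - (x : ℂ)) ^ (w - μ - 1) with hg
  have hsub : ∀ t : ℝ, |Real.sigmoid t * (1 - Real.sigmoid t)| • g (Real.sigmoid t) =
      2 ^ (-w) * G t := by
    intro t
    -- With L all bases are exponentials of real numbers, so the complex powers are computed without
    -- branch questions.
    set L := Real.log (1 + Real.exp (-t)) with hL
    have hp : 0 < 1 + Real.exp (-t) := by positivity
    have e1 : (Real.sigmoid t : ℂ) = Complex.exp (-(L : ℂ)) := by
      rw [← Complex.ofReal_neg, ← Complex.ofReal_exp, hL, Real.exp_neg, Real.exp_log hp,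
        Real.sigmoid_def]
    have e2 : (1 - (Real.sigmoid t : ℂ)) = Complex.exp (-(t : ℂ) - L) := by
      rw [← Complex.ofReal_one, ← Complex.ofReal_sub, ← Complex.ofReal_neg, ← Complex.ofReal_sub,
        ← Complex.ofReal_exp, Real.exp_sub, hL, Real.exp_log hp, Real.sigmoid_def]
      congr 1
      field_simp
      ring
    have e3 : ((1 + Real.cosh t : ℝ) : ℂ) = Complex.exp ((t : ℂ) + 2 * L) / 2 := by
      have : (t : ℂ) + 2 * L = ((t + 2 * L : ℝ) : ℂ) := by push_cast; ring
      rw [this, ← Complex.ofReal_exp, Real.exp_add, two_mul, Real.exp_add, hL, Real.exp_log hp,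
        Real.cosh_eq]
      have h1 : Real.exp t * Real.exp (-t) = 1 := by rw [← Real.exp_add]; simp
      rw [← Complex.ofReal_ofNat, ← Complex.ofReal_div]
      congr 1
      linear_combination (-(1 / 2) * Real.exp (-t) - 1) * h1
    have cp : ∀ (x : ℝ) (a : ℂ), Complex.exp (x : ℂ) ^ a = Complex.exp (x * a) := fun x a => by
      rw [Complex.cpow_def_of_ne_zero (Complex.exp_ne_zero _), ← Complex.ofReal_exp,
        ← Complex.ofReal_log (Real.exp_pos _).le, Real.log_exp]
    have e4 : (1 / ((1 + Real.cosh t : ℝ) : ℂ)) ^ w =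
        2 ^ w * Complex.exp (-((t : ℂ) + 2 * L) * w) := by
      have : (1 / ((1 + Real.cosh t : ℝ) : ℂ)) = ((2 : ℝ) : ℂ) * Complex.exp ((-(t + 2 * L) : ℝ) : ℂ) := by
        rw [e3]; push_cast; rw [neg_add, ← neg_add, Complex.exp_neg]; field_simp
      rw [this, ← Complex.ofReal_exp, Complex.mul_cpow_ofReal_nonneg (by norm_num)
        (Real.exp_pos _).le, Complex.ofReal_exp, cp]
      push_cast; rfl
    have hpos : 0 < Real.sigmoid t * (1 - Real.sigmoid t) :=
      mul_pos (Real.sigmoid_pos t) (sub_pos.2 (Real.sigmoid_lt_one t))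
    rw [abs_of_pos hpos, Complex.real_smul]
    simp only [hg, hG]
    rw [e4]
    push_cast
    rw [e2, e1, ← Complex.ofReal_neg, cp, ← Complex.ofReal_neg, ← Complex.ofReal_sub, cp,
      ← mul_assoc ((2 : ℂ) ^ (-w)), ← mul_assoc ((2 : ℂ) ^ (-w)), ← Complex.cpow_add _ _ two_ne_zero]
    simp only [neg_add_cancel, Complex.cpow_zero, one_mul, ← Complex.exp_add]
    congr 1
    push_cast
    ring
  have himg : Real.sigmoid '' univ = Ioo 0 1 := by rw [image_univ, Real.range_sigmoid]
  have hder : ∀ x ∈ (univ : Set ℝ), HasDerivWithinAt Real.sigmoid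
      (Real.sigmoid x * (1 - Real.sigmoid x)) univ x := fun x _ =>
    (Real.hasDerivAt_sigmoid x).hasDerivWithinAt
  have hconv := Complex.betaIntegral_convergent hu hv
  rw [intervalIntegrable_iff_integrableOn_Ioo_of_le zero_le_one, ← himg,
    integrableOn_image_iff_integrableOn_abs_deriv_smul MeasurableSet.univ hder
      Real.sigmoid_injective.injOn] at hconv
  have hGi : Integrable G := by
    rw [integrableOn_univ] at hconv
    have h2 : Integrable fun t => 2 ^ (-w) * G t := hconv.congr (.of_forall hsub)
    have h3 := h2.const_mul (2 ^ w)
    refine h3.congr (.of_forall fun t => ?_)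
    simp only
    rw [← mul_assoc, ← Complex.cpow_add _ _ two_ne_zero]
    simp
  have hbeta : Complex.betaIntegral (w + μ) (w - μ) = 2 ^ (-w) * ∫ t, G t := by
    rw [Complex.betaIntegral, intervalIntegral.integral_of_le zero_le_one,
      integral_Ioc_eq_integral_Ioo, ← himg,
      integral_image_eq_integral_abs_deriv_smul MeasurableSet.univ hder
        Real.sigmoid_injective.injOn, setIntegral_univ, ← integral_const_mul]
    exact integral_congr_ae (.of_forall hsub)
  have hhalf : ∫ t, G t =
      2 * ∫ t in Ioi (0 : ℝ), (1 / ((1 + Real.cosh t : ℝ) : ℂ)) ^ w * Complex.cosh (μ * t) := by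
    rw [← intervalIntegral.integral_Iic_add_Ioi (b := 0) hGi.integrableOn hGi.integrableOn]
    have h1 : ∫ t in Iic 0, G t = ∫ t in Ioi 0, G (-t) := by
      have := integral_comp_neg_Ioi (0 : ℝ) G
      rw [this, neg_zero]
    have hGi' : Integrable fun t => G (-t) := hGi.comp_neg
    rw [h1, ← integral_add hGi'.integrableOn hGi.integrableOn, ← integral_const_mul]
    congr 1
    ext t
    simp only [hG, Real.cosh_neg, Complex.ofReal_neg, mul_neg, Complex.cosh]
    ring
  have hGam := Complex.Gamma_mul_Gamma_eq_betaIntegral hu hv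
  have hsum : w + μ + (w - μ) = 2 * w := by ring
  rw [hsum] at hGam
  have hG2 : Complex.Gamma (2 * w) ≠ 0 := Complex.Gamma_ne_zero_of_re_pos (by simpa using hw)
  rw [hGam, hbeta, hhalf, mul_div_cancel_left₀ _ hG2, ← mul_assoc, ← mul_assoc,
    ← Complex.cpow_add _ _ two_ne_zero]
  have : (2 : ℂ) ^ (w - 1 + -w) = 1 / 2 := by
    rw [show w - 1 + -w = -1 by ring, Complex.cpow_neg_one]; norm_num
  rw [this]; ring

/-- `∫₀^∞ K_μ(x) e^{-x} x^{w-1} dx = √π 2^{-w} Γ(w+μ) Γ(w-μ) / Γ(w+1/2)`. -/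
theorem integral_besselK_mul_exp {w μ : ℂ} (h : |μ.re| < w.re) :
    ∫ x in Ioi (0 : ℝ), besselK μ x * Complex.exp (-(x : ℂ)) * (x : ℂ) ^ (w - 1) =
      Real.sqrt Real.pi * 2 ^ (-w) *
        (Complex.Gamma (w + μ) * Complex.Gamma (w - μ) / Complex.Gamma (w + 1 / 2)) := by
  have hw : 0 < w.re := (abs_nonneg _).trans_lt h
  set F : ℝ → ℝ → ℂ := fun t x => (x : ℂ) ^ (w - 1) *
    Complex.exp (-(((1 + Real.cosh t : ℝ) : ℂ) * x)) * Complex.cosh (μ * t) with hF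
  have hint : Integrable (Function.uncurry F)
      ((volume.restrict (Ioi 0)).prod (volume.restrict (Ioi 0))) := by
    refine Integrable.mono' (integrable_besselKernel h) ?_ ?_
    · have : Measurable (Function.uncurry F) := by
        simp only [hF, Function.uncurry_def]; fun_prop
      exact this.aestronglyMeasurable
    · rw [Measure.prod_restrict]
      refine (ae_restrict_iff' (measurableSet_Ioi.prod measurableSet_Ioi)).2
        (.of_forall fun p hp => ?_)
      have hx : 0 < p.2 := hp.2
      simp only [hF, Function.uncurry_def, besselKernel]
      rw [norm_mul, norm_mul, Complex.norm_cpow_eq_rpow_re_of_pos hx, Complex.norm_exp]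
      refine mul_le_mul (le_of_eq ?_) (norm_cexp_mul_ccosh_le μ p.1) (norm_nonneg _) (by positivity)
      congr 1
      rw [Complex.neg_re, ← Complex.ofReal_mul, Complex.ofReal_re]
  have hswap := integral_integral_swap hint
  have hleft : ∀ t : ℝ, ∫ x in Ioi (0 : ℝ), F t x =
      (1 / ((1 + Real.cosh t : ℝ) : ℂ)) ^ w * Complex.cosh (μ * t) * Complex.Gamma w := by
    intro t
    simp only [hF]
    rw [integral_mul_const, Complex.integral_cpow_mul_exp_neg_mul_Ioi hw (one_add_cosh_pos t)]
    ring
  have hright : ∀ x : ℝ, ∫ t in Ioi (0 : ℝ), F t x =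
      besselK μ x * Complex.exp (-(x : ℂ)) * (x : ℂ) ^ (w - 1) := by
    intro x
    rw [besselK, ← integral_mul_const, ← integral_mul_const]
    congr 1
    ext t
    simp only [hF]
    have : Complex.exp (-(((1 + Real.cosh t : ℝ) : ℂ) * x)) =
        Complex.exp (-((x * Real.cosh t : ℝ) : ℂ)) * Complex.exp (-(x : ℂ)) := by
      rw [← Complex.exp_add]; push_cast; ring_nf
    rw [this]; ring
  simp_rw [hleft, hright] at hswap
  rw [← hswap, integral_mul_const, integral_cosh_mul_eq h]
  -- Legendre duplication trades Γ(w)/Γ(2w) for √π 2^(1-2w)/Γ(w+1/2).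
  have hdup := Complex.Gamma_mul_Gamma_add_half w
  have g1 : Complex.Gamma (2 * w) ≠ 0 := Complex.Gamma_ne_zero_of_re_pos (by simpa using hw)
  have g2 : Complex.Gamma (w + 1 / 2) ≠ 0 :=
    Complex.Gamma_ne_zero_of_re_pos (by simp; linarith)
  have h2 : (2 : ℂ) ^ (w - 1) * 2 ^ (1 - 2 * w) = 2 ^ (-w) := by
    rw [← Complex.cpow_add _ _ two_ne_zero]; ring_nf
  have h3 : Complex.Gamma (w + μ) * Complex.Gamma (w - μ) / Complex.Gamma (2 * w) *
      Complex.Gamma w = 2 ^ (1 - 2 * w) * (Real.sqrt Real.pi) *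
        (Complex.Gamma (w + μ) * Complex.Gamma (w - μ) / Complex.Gamma (w + 1 / 2)) := by
    rw [div_mul_eq_mul_div, mul_div_assoc', div_eq_div_iff g1 g2]
    linear_combination (Complex.Gamma (w + μ) * Complex.Gamma (w - μ)) * hdup
  rw [← h2, mul_assoc, h3]
  ring

/-- If K_μ vanished on (0,∞), so would its Mellin transform at a large integer, which is a quotient
of nonzero Gamma values. A nonzero value is needed to recover c(n) from Fourier integrals of f. -/
theorem exists_besselK_ne_zero (μ : ℂ) : ∃ y : ℝ, 0 < y ∧ besselK μ y ≠ 0 := by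
  by_contra! hne
  obtain ⟨n, hn⟩ := exists_nat_gt |μ.re|
  have h : |μ.re| < ((n : ℂ)).re := by simpa using hn
  have hw : 0 < ((n : ℂ)).re := (abs_nonneg _).trans_lt h
  have h0 := integral_besselK_mul_exp h
  rw [setIntegral_congr_fun (g := fun _ => (0 : ℂ)) measurableSet_Ioi
    (fun x hx => by simp [hne x hx])] at h0
  simp only [integral_zero] at h0
  have g1 : Complex.Gamma (n + μ) ≠ 0 := Complex.Gamma_ne_zero_of_re_pos (by
    rw [Complex.add_re]; linarith [(abs_lt.1 h).1])
  have g2 : Complex.Gamma (n - μ) ≠ 0 := Complex.Gamma_ne_zero_of_re_pos (by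
    rw [Complex.sub_re]; linarith [(abs_lt.1 h).2])
  have g3 : Complex.Gamma (n + 1 / 2) ≠ 0 :=
    Complex.Gamma_ne_zero_of_re_pos (by simp at hw ⊢; linarith)
  have g4 : (Real.sqrt Real.pi : ℂ) ≠ 0 := by
    have := Real.pi_pos
    exact_mod_cast (Real.sqrt_pos.2 this).ne'
  have g5 : (2 : ℂ) ^ (-(n : ℂ)) ≠ 0 := by simp [Complex.cpow_eq_zero_iff]
  exact mul_ne_zero (mul_ne_zero g4 g5) (div_ne_zero (mul_ne_zero g1 g2) g3) h0.symm

end MaassLift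

namespace MaassLift

/-! ## One-dimensional Poisson summation with polynomial weights -/

/-- The polynomials `∂_v^n exp(xv + cv²) |_{v=0}` in `x` and `c`. -/
def gaussPoly (c x : ℂ) : ℕ → ℂ
  | 0 => 1
  | 1 => x
  | n + 2 => x * gaussPoly c x (n + 1) + 2 * c * (n + 1) * gaussPoly c x n

theorem gaussPoly_succ (c x : ℂ) (n : ℕ) :
    gaussPoly c x (n + 1) = x * gaussPoly c x n + 2 * c * n * gaussPoly c x (n - 1) := by
  cases n with
  | zero => simp [gaussPoly]
  | succ n => rw [gaussPoly]; push_cast; rfl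

theorem gaussPoly_zero_left (x : ℂ) (n : ℕ) : gaussPoly 0 x n = x ^ n := by
  induction n with
  | zero => simp [gaussPoly]
  | succ n ih => rw [gaussPoly_succ, ih, pow_succ]; ring

theorem hasDerivAt_gaussPoly (c x : ℂ) (n : ℕ) :
    HasDerivAt (fun x => gaussPoly c x n) (n * gaussPoly c x (n - 1)) x := by
  induction n using Nat.strong_induction_on with
  | _ n ih =>
    match n with
    | 0 => simpa [gaussPoly] using hasDerivAt_const x (1 : ℂ)
    | 1 => simpa [gaussPoly] using hasDerivAt_id' x
    | n + 2 =>
      have h1 := ih (n + 1) (by omega)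
      have h0 := ih n (by omega)
      have h := ((hasDerivAt_id x).mul h1).add (h0.const_mul (2 * c * (n + 1)))
      refine h.congr_deriv ?_
      have e := gaussPoly_succ c x n
      simp only [id, Nat.add_sub_cancel, Nat.add_succ_sub_one]
      push_cast
      linear_combination (-(n + 1 : ℂ)) * e

/-- In the generating function exp(xv+cv²) both ∂_c and ∂_x² multiply by v²: the polynomials satisfy
the heat equation. -/
theorem hasDerivAt_gaussPoly_left (c x : ℂ) (n : ℕ) :
    HasDerivAt (fun c => gaussPoly c x n) (n * (n - 1) * gaussPoly c x (n - 2)) c := by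
  induction n using Nat.strong_induction_on with
  | _ n ih =>
    match n with
    | 0 => simpa [gaussPoly] using hasDerivAt_const c (1 : ℂ)
    | 1 => simpa [gaussPoly] using hasDerivAt_const c x
    | n + 2 =>
      have h1 := ih (n + 1) (by omega)
      have h0 := ih n (by omega)
      have h := (h1.const_mul x).add
        ((((hasDerivAt_id c).const_mul 2).mul_const ((n : ℂ) + 1)).mul h0)
      refine h.congr_deriv ?_
      rcases n with _ | n
      · simp [gaussPoly]
        norm_num
      · have e := gaussPoly_succ c x n
        simp only [id, Nat.add_sub_cancel, mul_one]
        rw [show n + 1 + 1 - 2 = n by omega, show n + 1 - 2 = n - 1 by omega, e]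
        push_cast
        ring

theorem exists_norm_gaussPoly_le (c : ℂ) (n : ℕ) :
    ∃ C : ℝ, 0 ≤ C ∧ ∀ x, ‖gaussPoly c x n‖ ≤ C * (1 + ‖x‖) ^ n := by
  induction n using Nat.strong_induction_on with
  | _ n ih =>
    match n with
    | 0 => exact ⟨1, zero_le_one, fun x => by simp [gaussPoly]⟩
    | 1 => exact ⟨1, zero_le_one, fun x => by simp [gaussPoly]⟩
    | n + 2 =>
      obtain ⟨C1, hC1, h1⟩ := ih (n + 1) (by omega)
      obtain ⟨C0, hC0, h0⟩ := ih n (by omega)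
      refine ⟨C1 + ‖2 * c * (n + 1)‖ * C0, by positivity, fun x => ?_⟩
      have hx : 1 ≤ 1 + ‖x‖ := by linarith [norm_nonneg x]
      calc ‖gaussPoly c x (n + 2)‖
          ≤ ‖x‖ * ‖gaussPoly c x (n + 1)‖ + ‖2 * c * (n + 1)‖ * ‖gaussPoly c x n‖ := by
            rw [gaussPoly, ← norm_mul, ← norm_mul]; exact norm_add_le _ _
        _ ≤ (1 + ‖x‖) * (C1 * (1 + ‖x‖) ^ (n + 1)) +
            ‖2 * c * (n + 1)‖ * (C0 * (1 + ‖x‖) ^ (n + 2)) := by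
            gcongr
            · linarith
            · exact h1 x
            · refine (h0 x).trans ?_
              gcongr
              omega
        _ = _ := by ring

/-- Terms `m^n e^{2πiam - πbm²}`. -/
def polyGaussTerm (b : ℂ) (n : ℕ) (a : ℂ) (m : ℤ) : ℂ :=
  (m : ℂ) ^ n * Complex.exp (2 * Real.pi * Complex.I * a * m - Real.pi * b * m ^ 2)

/-- The Fourier transforms of the `polyGaussTerm`s. -/
def polyGaussDual (b : ℂ) (n : ℕ) (a : ℂ) (m : ℤ) : ℂ :=
  gaussPoly (1 / (4 * Real.pi * b)) (-Complex.I * (m - a) / b) n *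
    Complex.exp (-Real.pi * (m - a) ^ 2 / b)

/-- A majorant uniform for |a| ≤ R is what allows the theta functional equation to be differentiated
term by term in a. -/
theorem exists_summable_polyGaussTerm {b : ℂ} (hb : 0 < b.re) (n : ℕ) (R : ℝ) :
    ∃ u : ℤ → ℝ, Summable u ∧ ∀ m a, ‖a‖ ≤ R → ‖polyGaussTerm b n a m‖ ≤ u m := by
  refine ⟨_, summable_pow_mul_jacobiTheta₂_term_bound R hb n, fun m a ha => ?_⟩
  rw [polyGaussTerm, norm_mul, Complex.norm_exp, norm_pow, Complex.norm_intCast]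
  have hp := Real.pi_pos
  push_cast
  gcongr
  have h1 : (2 * Real.pi * Complex.I * a * m - Real.pi * b * m ^ 2 : ℂ).re =
      2 * Real.pi * (-a.im * m) - Real.pi * (b.re * m ^ 2) := by
    have e : (2 * Real.pi * Complex.I * a * m - Real.pi * b * m ^ 2 : ℂ) =
      ((2 * Real.pi * m : ℝ) : ℂ) * (Complex.I * a) - ((Real.pi * m ^ 2 : ℝ) : ℂ) * b := by
      push_cast; ring
    rw [e, Complex.sub_re, Complex.re_ofReal_mul, Complex.re_ofReal_mul, Complex.I_mul_re]
    ring
  rw [h1]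
  have h2 : -a.im * m ≤ R * |(m : ℝ)| := by
    refine (le_abs_self _).trans ?_
    rw [abs_mul, abs_neg]
    gcongr
    exact (Complex.abs_im_le_norm a).trans ha
  nlinarith

theorem exists_summable_polyGaussDual {b : ℂ} (hb : 0 < b.re) (n : ℕ) (R : ℝ) :
    ∃ u : ℤ → ℝ, Summable u ∧ ∀ m a, ‖a‖ ≤ R → ‖polyGaussDual b n a m‖ ≤ u m := by
  have hp := Real.pi_pos
  obtain ⟨C, hC, hg⟩ := exists_norm_gaussPoly_le (1 / (4 * Real.pi * b)) n
  have hb' : 0 < (b⁻¹).re := by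
    rw [Complex.inv_re]
    refine div_pos hb (Complex.normSq_pos.2 ?_)
    rintro rfl; simp at hb
  set B := ‖b⁻¹‖ with hB
  have hR0 : ∀ a : ℂ, ‖a‖ ≤ R → 0 ≤ R := fun a ha => (norm_nonneg a).trans ha
  -- The linear term in |m| has two sources: 2πBR|m| from expanding (m-a)²/b, and B|m| from bounding
  -- the polynomial factor by an exponential.
  set S := B * R + B / (2 * Real.pi) with hS
  refine ⟨_, (summable_pow_mul_jacobiTheta₂_term_bound S hb' 0).mul_left
    (C * n.factorial * Real.exp (1 + B * R) * Real.exp (Real.pi * B * R ^ 2)), fun m a ha => ?_⟩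
  have hR := hR0 a ha
  have hma : ‖(m - a : ℂ)‖ ≤ |(m : ℝ)| + R := by
    refine (norm_sub_le _ _).trans ?_
    rw [Complex.norm_intCast]
    gcongr
  have h1 : ‖gaussPoly (1 / (4 * Real.pi * b)) (-Complex.I * (m - a) / b) n‖ ≤
      C * (n.factorial * Real.exp (1 + B * (|(m : ℝ)| + R))) := by
    refine (hg _).trans ?_
    gcongr
    have hx : ‖-Complex.I * (m - a) / b‖ ≤ B * (|(m : ℝ)| + R) := by
      rw [div_eq_mul_inv, norm_mul, norm_mul, norm_neg, Complex.norm_I, one_mul, mul_comm]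
      gcongr
    have h2 := Real.pow_div_factorial_le_exp (1 + ‖-Complex.I * (m - a) / b‖) (by positivity) n
    rw [div_le_iff₀ (by positivity)] at h2
    refine h2.trans ?_
    rw [mul_comm]
    gcongr
  have h3 : ‖Complex.exp (-Real.pi * (m - a) ^ 2 / b)‖ ≤
      Real.exp (-Real.pi * ((b⁻¹).re * m ^ 2) + 2 * Real.pi * (B * R * |(m : ℝ)|) +
        Real.pi * B * R ^ 2) := by
    rw [Complex.norm_exp]
    gcongr
    have e : (-Real.pi * (m - a) ^ 2 / b : ℂ) = ((-Real.pi * m ^ 2 : ℝ) : ℂ) * b⁻¹ +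
        ((2 * Real.pi * m : ℝ) : ℂ) * (a * b⁻¹) - ((Real.pi : ℝ) : ℂ) * (a ^ 2 * b⁻¹) := by
      rw [div_eq_mul_inv]; push_cast; ring
    rw [e, Complex.sub_re, Complex.add_re, Complex.re_ofReal_mul, Complex.re_ofReal_mul,
      Complex.re_ofReal_mul]
    have h4 : m * (a * b⁻¹).re ≤ |(m : ℝ)| * (R * B) := by
      refine (le_abs_self _).trans ?_
      rw [abs_mul]
      gcongr
      refine (Complex.abs_re_le_norm _).trans ?_
      rw [norm_mul]
      gcongr
    have h5 : -(a ^ 2 * b⁻¹).re ≤ R ^ 2 * B := by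
      refine (neg_le_abs _).trans ((Complex.abs_re_le_norm _).trans ?_)
      rw [norm_mul, norm_pow]
      gcongr
    nlinarith
  rw [polyGaussDual, norm_mul]
  refine (mul_le_mul h1 h3 (norm_nonneg _) (by positivity)).trans_eq ?_
  rw [pow_zero, one_mul]
  have : ∀ x y : ℝ, C * (n.factorial * Real.exp x) * Real.exp y =
      C * n.factorial * Real.exp (x + y) := fun x y => by rw [Real.exp_add]; ring
  rw [this]
  simp only [mul_assoc, ← Real.exp_add]
  congr 3
  rw [hS]
  push_cast
  field_simp
  ring

theorem summable_polyGaussTerm {b : ℂ} (hb : 0 < b.re) (n : ℕ) (a : ℂ) :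
    Summable (polyGaussTerm b n a) := by
  obtain ⟨u, hu, h⟩ := exists_summable_polyGaussTerm hb n ‖a‖
  exact Summable.of_norm_bounded hu fun m => h m a le_rfl

theorem summable_polyGaussDual {b : ℂ} (hb : 0 < b.re) (n : ℕ) (a : ℂ) :
    Summable (polyGaussDual b n a) := by
  obtain ⟨u, hu, h⟩ := exists_summable_polyGaussDual hb n ‖a‖
  exact Summable.of_norm_bounded hu fun m => h m a le_rfl

theorem hasDerivAt_polyGaussTerm (b : ℂ) (n : ℕ) (m : ℤ) (a : ℂ) :
    HasDerivAt (fun a => polyGaussTerm b n a m)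
      (2 * Real.pi * Complex.I * polyGaussTerm b (n + 1) a m) a := by
  have h : HasDerivAt (fun a : ℂ => 2 * Real.pi * Complex.I * a * m - Real.pi * b * m ^ 2)
      (2 * Real.pi * Complex.I * m) a := by
    have := (((hasDerivAt_id a).const_mul (2 * Real.pi * Complex.I)).mul_const (m : ℂ)).sub_const
      (Real.pi * b * m ^ 2)
    simpa using this
  refine (h.cexp.const_mul ((m : ℂ) ^ n)).congr_deriv ?_
  rw [polyGaussTerm, pow_succ]
  ring

theorem hasDerivAt_polyGaussDual {b : ℂ} (hb : b ≠ 0) (n : ℕ) (m : ℤ) (a : ℂ) :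
    HasDerivAt (fun a => polyGaussDual b n a m)
      (2 * Real.pi * Complex.I * polyGaussDual b (n + 1) a m) a := by
  have h1 : HasDerivAt (fun a : ℂ => -Complex.I * (m - a) / b) (Complex.I / b) a := by
    have := (((hasDerivAt_id a).const_sub (m : ℂ)).const_mul (-Complex.I)).div_const b
    simpa using this
  have h2 : HasDerivAt (fun a : ℂ => -Real.pi * (m - a) ^ 2 / b)
      (2 * Real.pi * (m - a) / b) a := by
    have := ((((hasDerivAt_id a).const_sub (m : ℂ)).pow 2).const_mul (-Real.pi : ℂ)).div_const b
    refine this.congr_deriv ?_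
    simp
    ring
  have h3 := (HasDerivAt.comp a (hasDerivAt_gaussPoly (1 / (4 * Real.pi * b))
    (-Complex.I * (m - a) / b) n) h1).mul h2.cexp
  refine h3.congr_deriv ?_
  simp only [Function.comp, polyGaussDual, gaussPoly_succ _ _ n]
  have hp : (Real.pi : ℂ) ≠ 0 := by exact_mod_cast Real.pi_ne_zero
  field_simp
  linear_combination (8 : ℂ) * Real.pi * (m - a) * gaussPoly (1 / (4 * Real.pi * b)) (-(Complex.I * (m - a) / b)) n * Complex.I_sq

/-- For n = 0 this is the functional equation of the two-variable Jacobi theta function at τ = ib.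
Each derivative in a brings down 2πim on one side, and on the other raises the index of `gaussPoly`
by its recursion. -/
theorem tsum_polyGaussTerm {b : ℂ} (hb : 0 < b.re) (n : ℕ) (a : ℂ) :
    ∑' m, polyGaussTerm b n a m = 1 / b ^ (1 / 2 : ℂ) * ∑' m, polyGaussDual b n a m := by
  have hb0 : b ≠ 0 := by rintro rfl; simp at hb
  have hp : (Real.pi : ℂ) ≠ 0 := by exact_mod_cast Real.pi_ne_zero
  induction n generalizing a with
  | zero =>
    have h := jacobiTheta₂_functional_equation a (Complex.I * b)
    have e1 : ∑' m, polyGaussTerm b 0 a m = jacobiTheta₂ a (Complex.I * b) := by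
      refine tsum_congr fun m => ?_
      rw [polyGaussTerm, jacobiTheta₂_term, pow_zero, one_mul]
      congr 1
      linear_combination (-Real.pi * m ^ 2 * b : ℂ) * Complex.I_sq
    have e2 : -Complex.I * (Complex.I * b) = b := by
      linear_combination (-b) * Complex.I_sq
    rw [e1, h, e2, mul_assoc]
    congr 1
    rw [jacobiTheta₂, ← tsum_mul_left]
    refine tsum_congr fun m => ?_
    rw [polyGaussDual, jacobiTheta₂_term, gaussPoly, one_mul, ← Complex.exp_add]
    congr 1
    have hI := Complex.I_ne_zero
    field_simp
    ring
  | succ n ih =>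
    have key : ∀ {F : ℤ → ℂ → ℂ} {F' : ℤ → ℂ → ℂ}
        (_ : ∀ m z, HasDerivAt (F m) (2 * Real.pi * Complex.I * F' m z) z)
        (_ : ∃ u : ℤ → ℝ, Summable u ∧ ∀ m z, ‖z‖ ≤ ‖a‖ + 1 → ‖F m z‖ ≤ u m),
        2 * Real.pi * Complex.I * ∑' m, F' m a = deriv (fun z => ∑' m, F m z) a := by
      rintro F F' hF ⟨u, hu, hb⟩
      have := Complex.hasSum_deriv_of_summable_norm (F := F) (U := Metric.ball 0 (‖a‖ + 1)) (z := a) hu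
        (fun m z _ => (hF m z).differentiableAt.differentiableWithinAt) Metric.isOpen_ball
        (fun m z hz => hb m z (by simpa using (mem_ball_zero_iff.1 hz).le))
        (by simp)
      rw [← this.tsum_eq, ← tsum_mul_left]
      exact tsum_congr fun m => (hF m a).deriv.symm
    have k1 := key (F := fun m z => polyGaussTerm b n z m)
      (F' := fun m z => polyGaussTerm b (n + 1) z m)
      (fun m z => hasDerivAt_polyGaussTerm b n m z) (exists_summable_polyGaussTerm hb n _)
    have k2 := key (F := fun m z => polyGaussDual b n z m)
      (F' := fun m z => polyGaussDual b (n + 1) z m)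
      (fun m z => hasDerivAt_polyGaussDual hb0 n m z) (exists_summable_polyGaussDual hb n _)
    have k3 : deriv (fun z => ∑' m, polyGaussTerm b n z m) a =
        1 / b ^ (1 / 2 : ℂ) * deriv (fun z => ∑' m, polyGaussDual b n z m) a := by
      rw [← deriv_const_mul_field]
      congr 1
      ext z
      exact ih z
    rw [← k1, ← k2] at k3
    have h2 : (2 * Real.pi * Complex.I : ℂ) ≠ 0 := by
      simp [hp]
    apply mul_left_cancel₀ h2
    rw [k3]
    ring

end MaassLift

namespace MaassLift

/-! ## Gaussian transforms of harmonic polynomials -/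

/-- The linear map sending a monomial `X^a` to `∏ gaussPoly c (x_i) a_i`. -/
def gaussMap (c : ℂ) (x : Fin 4 → ℂ) : MvPolynomial (Fin 4) ℂ →ₗ[ℂ] ℂ :=
  (MvPolynomial.basisMonomials (Fin 4) ℂ).constr ℂ fun a => ∏ i, gaussPoly c (x i) (a i)

theorem gaussMap_monomial (c : ℂ) (x : Fin 4 → ℂ) (a : Fin 4 →₀ ℕ) (r : ℂ) :
    gaussMap c x (MvPolynomial.monomial a r) = r * ∏ i, gaussPoly c (x i) (a i) := by
  have h : MvPolynomial.monomial a r = r • (MvPolynomial.basisMonomials (Fin 4) ℂ) a := by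
    rw [MvPolynomial.coe_basisMonomials, MvPolynomial.smul_monomial, smul_eq_mul, mul_one]
  rw [h, map_smul, gaussMap, Module.Basis.constr_basis, smul_eq_mul]

theorem gaussMap_eq (c : ℂ) (x : Fin 4 → ℂ) (P : MvPolynomial (Fin 4) ℂ) :
    gaussMap c x P = ∑ a ∈ P.support, P.coeff a * ∏ i, gaussPoly c (x i) (a i) := by
  conv_lhs => rw [P.as_sum]
  rw [map_sum]
  exact Finset.sum_congr rfl fun a _ => gaussMap_monomial c x a _

theorem gaussMap_zero_left (x : Fin 4 → ℂ) (P : MvPolynomial (Fin 4) ℂ) :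
    gaussMap 0 x P = MvPolynomial.eval x P := by
  rw [gaussMap_eq, MvPolynomial.eval_eq']
  simp_rw [gaussPoly_zero_left]

/-- The heat equation in each coordinate, summed over the coordinates by the product rule: ∂_c of
the transform is the transform of the Laplacian. -/
theorem hasDerivAt_gaussMap (c : ℂ) (x : Fin 4 → ℂ) (P : MvPolynomial (Fin 4) ℂ) :
    HasDerivAt (fun c => gaussMap c x P)
      (gaussMap c x (∑ i, MvPolynomial.pderiv i (MvPolynomial.pderiv i P))) c := by
  induction P using MvPolynomial.induction_on' with
  | monomial a r =>
    have h := (HasDerivAt.fun_finsetProd (u := Finset.univ) (x := c)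
      (f := fun i c => gaussPoly c (x i) (a i))
      (fun i _ => hasDerivAt_gaussPoly_left c (x i) (a i))).const_mul r
    refine (h.congr_deriv ?_).congr_of_eventuallyEq
      (.of_forall fun c => gaussMap_monomial c x a r)
    rw [map_sum, Finset.mul_sum]
    refine Finset.sum_congr rfl fun i _ => ?_
    rw [MvPolynomial.pderiv_monomial, MvPolynomial.pderiv_monomial, gaussMap_monomial, smul_eq_mul,
      ← Finset.mul_prod_erase Finset.univ (fun j => gaussPoly c (x j) _) (Finset.mem_univ i)]
    have e1 : ∏ j ∈ Finset.univ.erase i, gaussPoly c (x j)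
        ((a - Finsupp.single i 1 - Finsupp.single i 1 : Fin 4 →₀ ℕ) j) =
        ∏ j ∈ Finset.univ.erase i, gaussPoly c (x j) (a j) := by
      refine Finset.prod_congr rfl fun j hj => ?_
      have : i ≠ j := (Finset.ne_of_mem_erase hj).symm
      simp [this]
    rw [e1]
    simp only [Finsupp.coe_tsub, Pi.sub_apply, Finsupp.single_eq_same]
    rcases Nat.eq_zero_or_pos (a i) with h0 | h0
    · simp [h0]
    · rw [Nat.cast_sub h0, Nat.sub_sub]
      push_cast
      ring
  | add P Q hP hQ =>
    simp only [map_add, Finset.sum_add_distrib]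
    exact hP.add hQ

/-- For harmonic P the derivative in c vanishes, so the value can be taken at c = 0, where the
transform is evaluation. This is why theta series with harmonic weights transform without lower
order terms. -/
theorem gaussMap_of_harmonic (c : ℂ) (x : Fin 4 → ℂ) {P : MvPolynomial (Fin 4) ℂ}
    (hP : ∑ i, MvPolynomial.pderiv i (MvPolynomial.pderiv i P) = 0) :
    gaussMap c x P = MvPolynomial.eval x P := by
  have hd : ∀ c, HasDerivAt (fun c => gaussMap c x P) 0 c := fun c => by
    have := hasDerivAt_gaussMap c x P
    rwa [hP, map_zero] at this
  have := is_const_of_deriv_eq_zero (fun c => (hd c).differentiableAt) (fun c => (hd c).deriv) c 0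
  rw [← gaussMap_zero_left, this]

/-! ## Poisson summation on `ℤ⁴` -/

/-- `ℤ⁴`. -/
abbrev Z4 : Type := (ℤ × ℤ) × (ℤ × ℤ)

/-- The quaternion with coordinates `m_i - s`. -/
def shiftQuat (s : ℝ) (m : Z4) : ℍ[ℝ] :=
  quat (m.1.1 - s) (m.1.2 - s) (m.2.1 - s) (m.2.2 - s)

theorem hasSum_of_eq {ι E : Type*} [AddCommMonoid E] [TopologicalSpace E] {f g : ι → E} {a : E}
    (h : HasSum f a) (e : ∀ i, g i = f i) : HasSum g a := by
  rwa [funext e]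

theorem hasSum_prod_four {ι : Type*} {f g h k : ι → ℂ} {a b c d : ℂ} (hf : HasSum f a)
    (hg : HasSum g b) (hh : HasSum h c) (hk : HasSum k d) :
    HasSum (fun m : (ι × ι) × (ι × ι) => f m.1.1 * g m.1.2 * (h m.2.1 * k m.2.2))
      (a * b * (c * d)) := by
  have h1 := hasSum_mul_prod hf hg
  have h2 := hasSum_mul_prod hh hk
  have h3 := hasSum_mul_prod h1 h2
  exact h3

theorem quatCoord_quat (a b c d : ℝ) : quatCoord (quat a b c d) = ![(a : ℂ), b, c, d] := rfl

/-- Poisson summation for a harmonic polynomial times a Gaussian, with the character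
`e^{2πi s (m₁+m₂+m₃+m₄)}`. -/
theorem poisson_harmonic {b : ℂ} (hb : 0 < b.re) {l : ℕ} {P : MvPolynomial (Fin 4) ℂ}
    (hP : IsHarmonicPoly l P) (s : ℝ) :
    ∃ A B : ℂ,
      HasSum (fun m : Z4 => evalQ P (shiftQuat 0 m) *
        Complex.exp (-Real.pi * b * (‖shiftQuat 0 m‖ ^ 2 : ℝ)) *
        Complex.exp (2 * Real.pi * Complex.I * s * (m.1.1 + m.1.2 + m.2.1 + m.2.2))) A ∧
      HasSum (fun m : Z4 => evalQ P (shiftQuat s m) *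
        Complex.exp (-Real.pi / b * (‖shiftQuat s m‖ ^ 2 : ℝ))) B ∧
      A = (1 / b ^ 2) * (-Complex.I / b) ^ l * B := by
  have hb0 : b ≠ 0 := by rintro rfl; simp at hb
  set c := 1 / (4 * Real.pi * b) with hc
  -- the identity for each monomial
  have hL := hasSum_sum (s := P.support) fun (a : Fin 4 →₀ ℕ) _ =>
    (hasSum_prod_four (summable_polyGaussTerm hb (a 0) s).hasSum (summable_polyGaussTerm hb (a 1) s).hasSum
      (summable_polyGaussTerm hb (a 2) s).hasSum (summable_polyGaussTerm hb (a 3) s).hasSum).mul_left (P.coeff a)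
  have hR := hasSum_sum (s := P.support) fun (a : Fin 4 →₀ ℕ) _ =>
    (hasSum_prod_four (summable_polyGaussDual hb (a 0) s).hasSum (summable_polyGaussDual hb (a 1) s).hasSum
      (summable_polyGaussDual hb (a 2) s).hasSum (summable_polyGaussDual hb (a 3) s).hasSum).mul_left (P.coeff a)
  -- Four one-dimensional factors b^(-1/2) combine to b^(-2).
  have hroot : (1 / b ^ (1 / 2 : ℂ)) * (1 / b ^ (1 / 2 : ℂ)) *
      ((1 / b ^ (1 / 2 : ℂ)) * (1 / b ^ (1 / 2 : ℂ))) = 1 / b ^ 2 := by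
    have : b ^ (1 / 2 : ℂ) * b ^ (1 / 2 : ℂ) = b := by
      rw [← Complex.cpow_add _ _ hb0]; norm_num
    rw [div_mul_div_comm, this, div_mul_div_comm, one_mul, one_mul, ← sq]
  simp only [tsum_polyGaussTerm hb] at hL
  have hν : (-Complex.I / b) ^ l ≠ 0 := pow_ne_zero _ (div_ne_zero (by simp) hb0)
  have hsum : ∀ m : Z4, (‖shiftQuat s m‖ ^ 2 : ℝ) =
      ((m.1.1 - s) ^ 2 + (m.1.2 - s) ^ 2 + (m.2.1 - s) ^ 2 + (m.2.2 - s) ^ 2 : ℝ) := fun m => by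
    rw [shiftQuat, norm_quat_sq]
  refine ⟨_, _, hasSum_of_eq hL ?_,
    hasSum_of_eq (hR.mul_left ((-Complex.I / b) ^ l)⁻¹) ?_, ?_⟩
  · intro m
    rw [evalQ_eq, Finset.sum_mul, Finset.sum_mul]
    refine Finset.sum_congr rfl fun a _ => ?_
    simp only [polyGaussTerm, shiftQuat, quatCoord_quat, norm_quat_sq, Fin.prod_univ_four, sub_zero]
    simp only [Matrix.cons_val_zero, Matrix.cons_val_one, Matrix.cons_val, Complex.ofReal_intCast]
    have e : ∀ x y z w x' y' z' w' : ℂ, x * Complex.exp x' * (y * Complex.exp y') *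
        (z * Complex.exp z' * (w * Complex.exp w')) =
        x * y * z * w * Complex.exp (x' + y' + z' + w') := by
      intros; simp only [Complex.exp_add]; ring
    rw [e, mul_assoc (P.coeff a * _), ← Complex.exp_add, mul_assoc (P.coeff a)]
    congr 3
    push_cast
    ring
  · intro m
    -- All arguments are -i/b times the coordinates m_i - s, so homogeneity pulls out (-i/b)^l once
    -- harmonicity has replaced the transform by P.
    have hx : (fun i => -Complex.I / b * quatCoord (shiftQuat s m) i) =
        ![-Complex.I * (m.1.1 - s) / b, -Complex.I * (m.1.2 - s) / b,
          -Complex.I * (m.2.1 - s) / b, -Complex.I * (m.2.2 - s) / b] := by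
      ext i
      fin_cases i <;> simp [shiftQuat, quatCoord] <;> ring
    have h1 : evalQ P (shiftQuat s m) = ((-Complex.I / b) ^ l)⁻¹ * gaussMap c
        ![-Complex.I * (m.1.1 - s) / b, -Complex.I * (m.1.2 - s) / b,
          -Complex.I * (m.2.1 - s) / b, -Complex.I * (m.2.2 - s) / b] P := by
      rw [gaussMap_of_harmonic c _ hP.2, ← hx, eval_smul_of_isHomogeneous hP.1, ← mul_assoc,
        inv_mul_cancel₀ hν, one_mul]
      rfl
    rw [h1, gaussMap_eq, mul_assoc]
    congr 1
    rw [Finset.sum_mul]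
    refine Finset.sum_congr rfl fun a _ => ?_
    rw [hsum]
    simp only [polyGaussDual, Fin.prod_univ_four]
    simp only [Matrix.cons_val_zero, Matrix.cons_val_one, Matrix.cons_val, ← hc]
    have e : ∀ x y z w x' y' z' w' : ℂ, x * Complex.exp x' * (y * Complex.exp y') *
        (z * Complex.exp z' * (w * Complex.exp w')) =
        x * y * z * w * Complex.exp (x' + y' + z' + w') := by
      intros; simp only [Complex.exp_add]; ring
    rw [e, mul_assoc (P.coeff a)]
    congr 3
    push_cast
    ring
  · rw [← hroot, mul_assoc, ← mul_assoc ((-Complex.I / b) ^ l), mul_inv_cancel₀ hν, one_mul,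
      Finset.mul_sum]
    refine Finset.sum_congr rfl fun a _ => ?_
    ring

/-! ## The theta inversion formula on `S` -/

theorem shiftQuat_zero (m : Z4) : shiftQuat 0 m = quat m.1.1 m.1.2 m.2.1 m.2.2 := by
  simp [shiftQuat]

/-- The vectors of `ℤ⁴` with even coordinate sum form the lattice `S`. -/
def evenEquiv : {m : Z4 // Even (m.1.1 + m.1.2 + m.2.1 + m.2.2)} ≃ latticeS :=
  Equiv.ofBijective (fun m => ⟨shiftQuat 0 m.1, by
      rw [shiftQuat_zero]; exact mem_latticeS_iff.2 ⟨_, _, _, _, m.2, rfl⟩⟩) (by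
    constructor
    · rintro ⟨⟨⟨a, b⟩, c, d⟩, h⟩ ⟨⟨⟨a', b'⟩, c', d'⟩, h'⟩ he
      have he' := congrArg Subtype.val he
      simp only [shiftQuat_zero] at he'
      have h1 := congrArg QuaternionAlgebra.re he'
      have h2 := congrArg QuaternionAlgebra.imI he'
      have h3 := congrArg QuaternionAlgebra.imJ he'
      have h4 := congrArg QuaternionAlgebra.imK he'
      simp at h1 h2 h3 h4
      simp [h1, h2, h3, h4]
    · rintro ⟨β, hβ⟩
      obtain ⟨a, b, c, d, h, rfl⟩ := mem_latticeS_iff.1 hβ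
      exact ⟨⟨((a, b), (c, d)), h⟩, Subtype.ext (shiftQuat_zero _)⟩)

/-- `ϖ₂ (ℤ⁴ ∪ (ℤ + 1/2)⁴) = S`. -/
def varpiEquiv : Z4 ⊕ Z4 ≃ latticeS :=
  Equiv.ofBijective (Sum.elim
    (fun m => ⟨varpi * shiftQuat 0 m, mem_latticeS_iff_varpi.2 ⟨_, by
      rw [shiftQuat_zero]
      exact mem_hurwitzOrder_iff.2 ⟨2 * m.1.1, 2 * m.1.2, 2 * m.2.1, 2 * m.2.2,
        ⟨m.1.1 + m.1.2, by ring⟩, ⟨m.1.1 + m.2.1, by ring⟩, ⟨m.1.1 + m.2.2, by ring⟩,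
        by push_cast; congr 1 <;> ring⟩, rfl⟩⟩)
    (fun m => ⟨varpi * shiftQuat (1 / 2) m, mem_latticeS_iff_varpi.2 ⟨_,
      mem_hurwitzOrder_iff.2 ⟨2 * m.1.1 - 1, 2 * m.1.2 - 1, 2 * m.2.1 - 1, 2 * m.2.2 - 1,
        ⟨m.1.1 + m.1.2 - 1, by ring⟩, ⟨m.1.1 + m.2.1 - 1, by ring⟩, ⟨m.1.1 + m.2.2 - 1, by ring⟩,
        by rw [shiftQuat]; push_cast; congr 1 <;> ring⟩, rfl⟩⟩)) (by
    have key : ∀ (s t : ℝ) (m n : Z4), varpi * shiftQuat s m = varpi * shiftQuat t n →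
        (m.1.1 - s = n.1.1 - t ∧ m.1.2 - s = n.1.2 - t) ∧
          (m.2.1 - s = n.2.1 - t ∧ m.2.2 - s = n.2.2 - t) := by
      intro s t m n h
      have h := mul_left_cancel₀ varpi_ne_zero h
      exact ⟨⟨congrArg QuaternionAlgebra.re h, congrArg QuaternionAlgebra.imI h⟩,
        ⟨congrArg QuaternionAlgebra.imJ h, congrArg QuaternionAlgebra.imK h⟩⟩
    have hhalf : ∀ a b : ℤ, (a : ℝ) - 0 ≠ b - 1 / 2 := by
      intro a b h
      have h2 : (2 : ℝ) * a = 2 * b - 1 := by linarith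
      have h3 : 2 * a = 2 * b - 1 := by exact_mod_cast h2
      omega
    constructor
    · rintro (m | m) (n | n) h <;> have h' := key _ _ _ _ (congrArg Subtype.val h)
      · simp only [sub_zero, Int.cast_inj] at h'
        exact congrArg _ (Prod.ext (Prod.ext h'.1.1 h'.1.2) (Prod.ext h'.2.1 h'.2.2))
      · exact (hhalf _ _ h'.1.1).elim
      · exact (hhalf _ _ h'.1.1.symm).elim
      · simp only [sub_left_inj, Int.cast_inj] at h'
        exact congrArg _ (Prod.ext (Prod.ext h'.1.1 h'.1.2) (Prod.ext h'.2.1 h'.2.2))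
    · rintro ⟨β, hβ⟩
      obtain ⟨γ, hγ, rfl⟩ := mem_latticeS_iff_varpi.1 hβ
      obtain ⟨a, b, c, d, hab, hac, had, rfl⟩ := mem_hurwitzOrder_iff.1 hγ
      rcases Int.even_or_odd' a with ⟨a', rfl | rfl⟩
      · obtain ⟨b', rfl⟩ : Even b := by simpa [Int.even_add] using hab
        obtain ⟨c', rfl⟩ : Even c := by simpa [Int.even_add] using hac
        obtain ⟨d', rfl⟩ : Even d := by simpa [Int.even_add] using had
        refine ⟨Sum.inl ((a', b'), (c', d')), Subtype.ext ?_⟩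
        simp only [Sum.elim_inl, shiftQuat_zero]
        push_cast
        congr 2 <;> ring
      · have ho : ∀ x : ℤ, Even (2 * a' + 1 + x) → ∃ y, x = 2 * y - 1 := by
          rintro x ⟨k, hk⟩
          exact ⟨k - a', by omega⟩
        obtain ⟨b', rfl⟩ := ho b hab
        obtain ⟨c', rfl⟩ := ho c hac
        obtain ⟨d', rfl⟩ := ho d had
        refine ⟨Sum.inr ((a' + 1, b'), (c', d')), Subtype.ext ?_⟩
        simp only [Sum.elim_inr, shiftQuat]
        push_cast
        congr 2 <;> ring)

theorem varpiEquiv_inl (m : Z4) : (varpiEquiv (Sum.inl m) : ℍ[ℝ]) = varpi * shiftQuat 0 m := rfl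

theorem varpiEquiv_inr (m : Z4) :
    (varpiEquiv (Sum.inr m) : ℍ[ℝ]) = varpi * shiftQuat (1 / 2) m := rfl

/-- The theta inversion formula for `S`, whose dual lattice is `ϖ₂⁻¹ S`. -/
theorem theta_inversion {b : ℂ} (hb : 0 < b.re) {l : ℕ} {P : MvPolynomial (Fin 4) ℂ}
    (hP : IsHarmonicPoly l P) :
    (Summable fun β : latticeS => evalQ P β * Complex.exp (-Real.pi * b * (‖(β : ℍ[ℝ])‖ ^ 2 : ℝ))) ∧
    ∑' β : latticeS, evalQ P β * Complex.exp (-Real.pi * b * (‖(β : ℍ[ℝ])‖ ^ 2 : ℝ)) =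
      1 / 2 * (1 / b ^ 2) * (-Complex.I / b) ^ l * ∑' β : latticeS, evalQ P (varpi⁻¹ * β) *
        Complex.exp (-Real.pi / b * (‖varpi⁻¹ * (β : ℍ[ℝ])‖ ^ 2 : ℝ)) := by
  -- Averaging the characters for s = 0 and s = 1/2, that is 1 and (-1)^(m₁+m₂+m₃+m₄), selects the
  -- vectors of S. The dual sums run over ℤ⁴ and (ℤ+1/2)⁴, whose union is the Hurwitz order ϖ₂⁻¹S.
  obtain ⟨A0, B0, hA0, hB0, h0⟩ := poisson_harmonic hb hP 0
  obtain ⟨A1, B1, hA1, hB1, h1⟩ := poisson_harmonic hb hP (1 / 2)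
  have hR : HasSum (fun β : latticeS => evalQ P (varpi⁻¹ * β) *
      Complex.exp (-Real.pi / b * (‖varpi⁻¹ * (β : ℍ[ℝ])‖ ^ 2 : ℝ))) (B0 + B1) := by
    rw [← varpiEquiv.hasSum_iff]
    have hv : ∀ x, varpi⁻¹ * (varpi * x) = x := fun x => by
      rw [← mul_assoc, inv_mul_cancel₀ varpi_ne_zero, one_mul]
    refine HasSum.sum ?_ ?_
    · refine hasSum_of_eq hB0 fun m => ?_
      simp only [Function.comp, varpiEquiv_inl, hv]
    · refine hasSum_of_eq hB1 fun m => ?_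
      simp only [Function.comp, varpiEquiv_inr, hv]
  have hL : HasSum (fun β : latticeS => evalQ P β *
      Complex.exp (-Real.pi * b * (‖(β : ℍ[ℝ])‖ ^ 2 : ℝ))) (1 / 2 * (A0 + A1)) := by
    rw [← evenEquiv.hasSum_iff]
    have h := (hA0.add hA1).mul_left (1 / 2)
    have h2 : HasSum ({m : Z4 | Even (m.1.1 + m.1.2 + m.2.1 + m.2.2)}.indicator
        fun m => evalQ P (shiftQuat 0 m) *
          Complex.exp (-Real.pi * b * (‖shiftQuat 0 m‖ ^ 2 : ℝ))) (1 / 2 * (A0 + A1)) := by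
      refine hasSum_of_eq h fun m => ?_
      have hchar : Complex.exp (2 * Real.pi * Complex.I * ((1 / 2 : ℝ) : ℂ) *
          (m.1.1 + m.1.2 + m.2.1 + m.2.2)) =
          (-1 : ℂ) ^ (m.1.1 + m.1.2 + m.2.1 + m.2.2 : ℤ) := by
        rw [← Complex.exp_pi_mul_I, ← Complex.exp_int_mul]
        congr 1
        push_cast
        ring
      rw [hchar]
      by_cases hm : Even (m.1.1 + m.1.2 + m.2.1 + m.2.2)
      · rw [Set.indicator_of_mem (show m ∈ {m : Z4 | Even (m.1.1 + m.1.2 + m.2.1 + m.2.2)} from hm),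
          hm.neg_one_zpow]
        simp
        ring
      · rw [Set.indicator_of_notMem
          (show m ∉ {m : Z4 | Even (m.1.1 + m.1.2 + m.2.1 + m.2.2)} from hm),
          (Int.not_even_iff_odd.1 hm).neg_one_zpow]
        simp
    exact hasSum_subtype_iff_indicator.2 h2
  refine ⟨hL.summable, ?_⟩
  rw [hL.tsum_eq, hR.tsum_eq, h0, h1]
  ring

end MaassLift

namespace MaassLift

/-! ## The theta series of the lattices `ℤz + ℤ` -/

/-- The linear form `m z + n`. -/
def linForm (z : UpperHalfPlane) (n : ℤ × ℤ) : ℂ := n.1 * (z : ℂ) + n.2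

/-- The linear form `m z + n`, scaled to a lattice of covolume `1`. -/
def unitForm (z : UpperHalfPlane) (n : ℤ × ℤ) : ℂ := linForm z n / (Real.sqrt z.im : ℂ)

/-- The terms `v^j exp(a v - π t |v|²)` for `v` in a lattice of covolume `1`. -/
def latticeGaussTerm (z : UpperHalfPlane) (t : ℝ) (j : ℕ) (a : ℂ) (n : ℤ × ℤ) : ℂ :=
  unitForm z n ^ j * Complex.exp (a * unitForm z n - (Real.pi * t * ‖unitForm z n‖ ^ 2 : ℝ))

theorem normSq_linForm (z : UpperHalfPlane) (n : ℤ × ℤ) :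
    ‖linForm z n‖ ^ 2 = (n.1 * z.re + n.2) ^ 2 + (n.1 * z.im) ^ 2 := by
  rw [← Complex.normSq_eq_norm_sq, Complex.normSq_apply, linForm]
  simp
  ring

theorem normSq_unitForm (z : UpperHalfPlane) (n : ℤ × ℤ) :
    ‖unitForm z n‖ ^ 2 = ‖linForm z n‖ ^ 2 / z.im := by
  rw [unitForm, norm_div, div_pow, Complex.norm_real, Real.norm_eq_abs, sq_abs,
    Real.sq_sqrt z.im_pos.le]

theorem linForm_ne_zero (z : UpperHalfPlane) {n : ℤ × ℤ} (hn : n ≠ 0) : linForm z n ≠ 0 := by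
  intro h
  have h2 := normSq_linForm z n
  rw [h, norm_zero, zero_pow two_ne_zero] at h2
  have h3 : (n.1 : ℝ) * z.im = 0 := by nlinarith [sq_nonneg (n.1 * z.re + n.2 : ℝ), sq_nonneg (n.1 * z.im : ℝ)]
  have h4 : n.1 = 0 := by
    rcases mul_eq_zero.1 h3 with h | h
    · exact_mod_cast h
    · exact absurd h z.im_pos.ne'
  rw [h4] at h2
  have h5 : n.2 ^ 2 = 0 := by
    simp at h2
    exact_mod_cast h2.symm
  exact hn (Prod.ext h4 (pow_eq_zero_iff two_ne_zero |>.1 h5))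

theorem norm_pair (n : ℤ × ℤ) : ‖![n.1, n.2]‖ = ‖n‖ := by
  rw [EisensteinSeries.norm_eq_max_natAbs, Prod.norm_def]
  simp [Int.norm_eq_abs]

/-- On a vertical strip, `|m z + n|` is uniformly bounded below by a multiple of `max(|m|,|n|)`. -/
theorem exists_le_norm_linForm (A : ℝ) {B : ℝ} (hB : 0 < B) :
    ∃ ρ : ℝ, 0 < ρ ∧ ∀ z : UpperHalfPlane, |z.re| ≤ A → B ≤ z.im →
      ∀ n : ℤ × ℤ, ρ * ‖n‖ ≤ ‖linForm z n‖ := by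
  refine ⟨_, EisensteinSeries.r_pos ⟨⟨A, B⟩, hB⟩, fun z hA hB' n => ?_⟩
  rcases eq_or_ne n 0 with rfl | hn
  · simp
  · have h := EisensteinSeries.r_mul_max_le z (x := ![n.1, n.2]) (by
      intro h
      exact hn (Prod.ext (congrFun h 0) (congrFun h 1)))
    rw [norm_pair] at h
    refine (mul_le_mul_of_nonneg_right ?_ (norm_nonneg _)).trans h
    exact EisensteinSeries.r_lower_bound_on_verticalStrip z hB ⟨hA, hB'⟩

theorem summable_norm_pair_rpow {a : ℝ} (ha : 2 < a) :
    Summable fun n : ℤ × ℤ => ‖n‖ ^ (-a) := by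
  refine ((finTwoArrowEquiv ℤ).symm.summable_iff.2
    (EisensteinSeries.summable_one_div_norm_rpow ha)).congr fun n => ?_
  simp only [Function.comp]
  rw [← norm_pair]
  rfl

theorem summable_exp_neg_sq {T : ℝ} (hT : 0 < T) (S : ℝ) :
    Summable fun n : ℤ => Real.exp (-Real.pi * (T * n ^ 2 - 2 * S * |(n : ℝ)|)) := by
  simpa using summable_pow_mul_jacobiTheta₂_term_bound S hT 0

/-- Half of the Gaussian absorbs v^j and the linear term by completing the square; the other half
dominates a product of one-variable Gaussians. Uniformity in |a| ≤ R permits differentiation in a.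
-/
theorem exists_summable_latticeGaussTerm (z : UpperHalfPlane) {t : ℝ} (ht : 0 < t) (j : ℕ) (R : ℝ) :
    ∃ u : ℤ × ℤ → ℝ, Summable u ∧ ∀ n a, ‖a‖ ≤ R → ‖latticeGaussTerm z t j a n‖ ≤ u n := by
  obtain ⟨ρ, hρ, h⟩ := exists_le_norm_linForm |z.re| z.im_pos
  -- One factor 1/2 is the half of the Gaussian that is kept, the other comes from max(|m|,|n|)² ≥
  -- (m²+n²)/2.
  set T := t * (ρ ^ 2 / z.im) / 4 with hT
  have hT0 : 0 < T := by have := z.im_pos; positivity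
  have hS := (summable_exp_neg_sq hT0 0).mul_of_nonneg (summable_exp_neg_sq hT0 0)
    (fun _ => (Real.exp_pos _).le) (fun _ => (Real.exp_pos _).le)
  refine ⟨_, hS.mul_left (j.factorial * Real.exp ((R + 1) ^ 2 / (2 * Real.pi * t))), ?_⟩
  intro n a ha
  set x := ‖unitForm z n‖ with hx
  have hx0 : 0 ≤ x := norm_nonneg _
  have h1 : x ^ j ≤ j.factorial * Real.exp x := by
    have := Real.pow_div_factorial_le_exp x hx0 j
    rw [div_le_iff₀ (by positivity)] at this
    linarith
  have h2 : x ^ 2 ≥ ρ ^ 2 / z.im * ((n.1 ^ 2 + n.2 ^ 2) / 2) := by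
    rw [hx, normSq_unitForm, div_mul_eq_mul_div]
    have := z.im_pos
    gcongr
    have h3 := h z le_rfl le_rfl n
    have h4 : (n.1 ^ 2 + n.2 ^ 2 : ℝ) / 2 ≤ ‖n‖ ^ 2 := by
      have e1 : |(n.1 : ℝ)| ≤ ‖n‖ := by
        rw [Prod.norm_def]; exact (le_of_eq (Int.norm_eq_abs _).symm).trans (le_max_left _ _)
      have e2 : |(n.2 : ℝ)| ≤ ‖n‖ := by
        rw [Prod.norm_def]; exact (le_of_eq (Int.norm_eq_abs _).symm).trans (le_max_right _ _)
      have e3 := pow_le_pow_left₀ (abs_nonneg _) e1 2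
      have e4 := pow_le_pow_left₀ (abs_nonneg _) e2 2
      rw [sq_abs] at e3 e4
      linarith
    calc ρ ^ 2 * ((n.1 ^ 2 + n.2 ^ 2) / 2) ≤ ρ ^ 2 * ‖n‖ ^ 2 := by gcongr
      _ = (ρ * ‖n‖) ^ 2 := by ring
      _ ≤ _ := by gcongr
  rw [latticeGaussTerm, norm_mul, norm_pow, Complex.norm_exp, Complex.sub_re, Complex.ofReal_re, ← hx]
  have h3 : (a * unitForm z n).re ≤ R * x := by
    refine (Complex.re_le_norm _).trans ?_
    rw [norm_mul]
    gcongr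
  have h5 : (R + 1) * x ≤ (R + 1) ^ 2 / (2 * Real.pi * t) + Real.pi * t / 2 * x ^ 2 := by
    have : 0 ≤ (R + 1 - Real.pi * t * x) ^ 2 / (2 * Real.pi * t) := by positivity
    have e : (R + 1 - Real.pi * t * x) ^ 2 / (2 * Real.pi * t) =
        (R + 1) ^ 2 / (2 * Real.pi * t) + Real.pi * t / 2 * x ^ 2 - (R + 1) * x := by
      field_simp
      ring
    linarith
  calc x ^ j * Real.exp ((a * unitForm z n).re - Real.pi * t * x ^ 2)
      ≤ j.factorial * Real.exp x * Real.exp (R * x - Real.pi * t * x ^ 2) := by gcongr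
    _ = j.factorial * Real.exp ((R + 1) * x - Real.pi * t * x ^ 2) := by
        rw [mul_assoc, ← Real.exp_add]; ring_nf
    _ ≤ j.factorial * Real.exp ((R + 1) ^ 2 / (2 * Real.pi * t) +
          (-Real.pi * (T * n.1 ^ 2 - 2 * 0 * |(n.1 : ℝ)|) +
            -Real.pi * (T * n.2 ^ 2 - 2 * 0 * |(n.2 : ℝ)|))) := by
        gcongr
        have h6 : Real.pi * t / 2 * (ρ ^ 2 / z.im * ((n.1 ^ 2 + n.2 ^ 2) / 2)) ≤
            Real.pi * t / 2 * x ^ 2 := by gcongr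
        have h7 : Real.pi * t / 2 * (ρ ^ 2 / z.im * ((n.1 ^ 2 + n.2 ^ 2) / 2)) =
          Real.pi * (T * n.1 ^ 2) + Real.pi * (T * n.2 ^ 2) := by rw [hT]; ring
        linarith
    _ = _ := by rw [Real.exp_add, Real.exp_add]; ring

theorem summable_latticeGaussTerm (z : UpperHalfPlane) {t : ℝ} (ht : 0 < t) (j : ℕ) (a : ℂ) :
    Summable (latticeGaussTerm z t j a) := by
  obtain ⟨u, hu, h⟩ := exists_summable_latticeGaussTerm z ht j ‖a‖
  exact Summable.of_norm_bounded hu fun m => h m a le_rfl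

theorem hasDerivAt_latticeGaussTerm (z : UpperHalfPlane) (t : ℝ) (j : ℕ) (n : ℤ × ℤ) (a : ℂ) :
    HasDerivAt (fun a => latticeGaussTerm z t j a n) (latticeGaussTerm z t (j + 1) a n) a := by
  have h : HasDerivAt (fun a : ℂ => a * unitForm z n - (Real.pi * t * ‖unitForm z n‖ ^ 2 : ℝ))
      (unitForm z n) a := by
    simpa using ((hasDerivAt_id a).mul_const (unitForm z n)).sub_const
      ((Real.pi * t * ‖unitForm z n‖ ^ 2 : ℝ) : ℂ)
  refine (h.cexp.const_mul (unitForm z n ^ j)).congr_deriv ?_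
  rw [latticeGaussTerm, pow_succ]
  ring

theorem hasDerivAt_tsum_latticeGaussTerm (z : UpperHalfPlane) {t : ℝ} (ht : 0 < t) (j : ℕ) (a : ℂ) :
    HasDerivAt (fun a => ∑' n, latticeGaussTerm z t j a n)
      (∑' n, latticeGaussTerm z t (j + 1) a n) a := by
  obtain ⟨u, hu, hb⟩ := exists_summable_latticeGaussTerm z ht j (‖a‖ + 1)
  have hd : ∀ m, DifferentiableOn ℂ (fun a => latticeGaussTerm z t j a m)
      (Metric.ball 0 (‖a‖ + 1)) := fun m a _ =>
    (hasDerivAt_latticeGaussTerm z t j m a).differentiableAt.differentiableWithinAt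
  have hbd : ∀ m, ∀ w ∈ Metric.ball (0 : ℂ) (‖a‖ + 1), ‖latticeGaussTerm z t j w m‖ ≤ u m :=
    fun m w hw => hb m w (mem_ball_zero_iff.1 hw).le
  have ha : a ∈ Metric.ball (0 : ℂ) (‖a‖ + 1) := by simp
  have h1 := Complex.hasSum_deriv_of_summable_norm hu hd Metric.isOpen_ball hbd ha
  have h2 := (Complex.differentiableOn_tsum_of_summable_norm hu hd Metric.isOpen_ball hbd).differentiableAt
    (Metric.isOpen_ball.mem_nhds ha)
  refine h2.hasDerivAt.congr_deriv ?_
  rw [← h1.tsum_eq]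
  exact tsum_congr fun m => (hasDerivAt_latticeGaussTerm z t j m a).deriv

/-- The common intermediate step of the two one-variable Poisson summations. -/
def latticeGaussMid (z : UpperHalfPlane) (t : ℝ) (a : ℂ) (n : ℤ × ℤ) : ℂ :=
  Complex.exp (-Real.pi * (t * z.im) * n.1 ^ 2 +
    2 * Real.pi * (Complex.I * a * (Real.sqrt z.im) / (2 * Real.pi) + Complex.I * n.2 * z.re) * n.1 +
    (-Real.pi * (z.im / t) * n.2 ^ 2 - Complex.I * n.2 * a * (Real.sqrt z.im) / t +
      a ^ 2 / (4 * Real.pi * t)))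

/-- Absolute convergence in both variables justifies changing the order of summation between the two
one-variable Poisson summations. -/
theorem summable_latticeGaussMid (z : UpperHalfPlane) {t : ℝ} (ht : 0 < t) (a : ℂ) :
    Summable (latticeGaussMid z t a) := by
  have hy := z.im_pos
  have hp := Real.pi_pos
  set S := ‖a‖ * Real.sqrt z.im / (2 * Real.pi) with hS
  have h1 := (summable_exp_neg_sq (T := t * z.im) (by positivity) S).mul_of_nonneg
    (summable_exp_neg_sq (T := z.im / t) (by positivity) (S / t))
    (fun _ => (Real.exp_pos _).le) (fun _ => (Real.exp_pos _).le)
  refine Summable.of_norm_bounded (h1.mul_left (Real.exp (a ^ 2 / (4 * Real.pi * t)).re)) fun n => ?_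
  rw [latticeGaussMid, Complex.norm_exp, ← Real.exp_add, ← Real.exp_add]
  apply Real.exp_le_exp.2
  have e : (-Real.pi * (t * z.im) * n.1 ^ 2 +
    2 * Real.pi * (Complex.I * a * (Real.sqrt z.im) / (2 * Real.pi) + Complex.I * n.2 * z.re) * n.1 +
    (-Real.pi * (z.im / t) * n.2 ^ 2 - Complex.I * n.2 * a * (Real.sqrt z.im) / t +
      a ^ 2 / (4 * Real.pi * t)) : ℂ) =
      ((-Real.pi * (t * z.im) * n.1 ^ 2 - Real.pi * (z.im / t) * n.2 ^ 2 : ℝ) : ℂ) +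
      ((Real.sqrt z.im * n.1 : ℝ) : ℂ) * (Complex.I * a) +
      ((2 * Real.pi * n.2 * z.re * n.1 : ℝ) : ℂ) * Complex.I -
      ((Real.sqrt z.im / t * n.2 : ℝ) : ℂ) * (Complex.I * a) + a ^ 2 / (4 * Real.pi * t) := by
    have : (Real.pi : ℂ) ≠ 0 := by exact_mod_cast Real.pi_ne_zero
    have ht' : (t : ℂ) ≠ 0 := by exact_mod_cast ht.ne'
    push_cast
    field_simp
    ring
  rw [e, Complex.add_re, Complex.sub_re, Complex.add_re, Complex.add_re, Complex.ofReal_re,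
    Complex.re_ofReal_mul, Complex.re_ofReal_mul, Complex.re_ofReal_mul, Complex.I_re, mul_zero]
  have h2 : ∀ x : ℝ, x * (Complex.I * a).re ≤ |x| * ‖a‖ := fun x => by
    refine (le_abs_self _).trans ?_
    rw [abs_mul]
    gcongr
    refine (Complex.abs_re_le_norm _).trans ?_
    simp
  have h3 := h2 (Real.sqrt z.im * n.1)
  have h4 := h2 (-(Real.sqrt z.im / t * n.2))
  rw [abs_mul, abs_of_nonneg (Real.sqrt_nonneg _)] at h3
  rw [abs_neg, abs_mul, abs_of_nonneg (by positivity)] at h4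
  have e3 : -Real.pi * (t * z.im * n.1 ^ 2 - 2 * S * |(n.1 : ℝ)|) =
      -Real.pi * (t * z.im) * n.1 ^ 2 + Real.sqrt z.im * |(n.1 : ℝ)| * ‖a‖ := by
    rw [hS]; field_simp; ring
  have e4 : -Real.pi * (z.im / t * n.2 ^ 2 - 2 * (S / t) * |(n.2 : ℝ)|) =
      -Real.pi * (z.im / t) * n.2 ^ 2 + Real.sqrt z.im / t * |(n.2 : ℝ)| * ‖a‖ := by
    rw [hS]; field_simp; ring
  rw [e3, e4]
  linarith

theorem tsum_latticeGaussTerm_inner (z : UpperHalfPlane) {t : ℝ} (ht : 0 < t) (a : ℂ) (m : ℤ) :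
    ∑' n : ℤ, latticeGaussTerm z t 0 a (m, n) =
      1 / ((t / z.im : ℝ) : ℂ) ^ (1 / 2 : ℂ) * ∑' n : ℤ, latticeGaussMid z t a (m, n) := by
  have hy := z.im_pos
  have hy' : (z.im : ℂ) ≠ 0 := by exact_mod_cast hy.ne'
  have hs : (Real.sqrt z.im : ℂ) ^ 2 = z.im := by exact_mod_cast Real.sq_sqrt hy.le
  have hs0 : (Real.sqrt z.im : ℂ) ≠ 0 := by
    intro h; rw [h] at hs; exact hy' (by simpa using hs.symm)
  have ht' : (t : ℂ) ≠ 0 := by exact_mod_cast ht.ne'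
  have hp : (Real.pi : ℂ) ≠ 0 := by exact_mod_cast Real.pi_ne_zero
  have hz : (z : ℂ) = z.re + z.im * Complex.I := (Complex.re_add_im _).symm
  have hb : 0 < (((t / z.im : ℝ) : ℂ)).re := by rw [Complex.ofReal_re]; positivity
  have h := Complex.tsum_exp_neg_quadratic hb
    (a / (2 * Real.pi * Real.sqrt z.im) - t * m * z.re / z.im)
  set A : ℂ := a * m * z / Real.sqrt z.im - Real.pi * t * m ^ 2 * (z.re ^ 2 + z.im ^ 2) / z.im with hA
  have e1 : ∑' n : ℤ, latticeGaussTerm z t 0 a (m, n) = Complex.exp A *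
      ∑' n : ℤ, Complex.exp (-Real.pi * ((t / z.im : ℝ) : ℂ) * n ^ 2 + 2 * Real.pi *
        (a / (2 * Real.pi * Real.sqrt z.im) - t * m * z.re / z.im) * n) := by
    rw [← tsum_mul_left]
    refine tsum_congr fun n => ?_
    rw [latticeGaussTerm, pow_zero, one_mul, ← Complex.exp_add, normSq_unitForm, normSq_linForm,
      unitForm, linForm, hA]
    congr 1
    push_cast
    field_simp
    ring
  rw [e1, h, ← mul_assoc, mul_comm (Complex.exp A), mul_assoc, ← tsum_mul_left]
  congr 1
  refine tsum_congr fun n => ?_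
  rw [latticeGaussMid, ← Complex.exp_add, hA, hz]
  congr 1
  push_cast
  have hI := Complex.I_sq
  rw [← hs]
  field_simp
  ring_nf
  simp only [hI]
  ring_nf

/-- Together with Poisson summation in the second coordinate this returns to a sum over the same
lattice: a planar lattice of covolume 1 is its own dual up to a quarter turn, visible in the index
(-n,m). -/
theorem tsum_latticeGaussMid_inner (z : UpperHalfPlane) {t : ℝ} (ht : 0 < t) (a : ℂ) (n : ℤ) :
    ∑' m : ℤ, latticeGaussMid z t a (m, n) =
      1 / ((t * z.im : ℝ) : ℂ) ^ (1 / 2 : ℂ) *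
        ∑' m : ℤ, latticeGaussTerm z (1 / t) 0 (a / t) (-n, m) := by
  have hy := z.im_pos
  have hy' : (z.im : ℂ) ≠ 0 := by exact_mod_cast hy.ne'
  have hs : (Real.sqrt z.im : ℂ) ^ 2 = z.im := by exact_mod_cast Real.sq_sqrt hy.le
  have hs0 : (Real.sqrt z.im : ℂ) ≠ 0 := by
    intro h; rw [h] at hs; exact hy' (by simpa using hs.symm)
  have ht' : (t : ℂ) ≠ 0 := by exact_mod_cast ht.ne'
  have hp : (Real.pi : ℂ) ≠ 0 := by exact_mod_cast Real.pi_ne_zero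
  have hz : (z : ℂ) = z.re + z.im * Complex.I := (Complex.re_add_im _).symm
  have hb : 0 < (((t * z.im : ℝ) : ℂ)).re := by rw [Complex.ofReal_re]; positivity
  have h := Complex.tsum_exp_neg_quadratic hb
    (Complex.I * a * (Real.sqrt z.im) / (2 * Real.pi) + Complex.I * n * z.re)
  set A : ℂ := -Real.pi * (z.im / t) * n ^ 2 - Complex.I * n * a * (Real.sqrt z.im) / t +
      a ^ 2 / (4 * Real.pi * t) with hA
  have e1 : ∑' m : ℤ, latticeGaussMid z t a (m, n) = Complex.exp A *
      ∑' m : ℤ, Complex.exp (-Real.pi * ((t * z.im : ℝ) : ℂ) * m ^ 2 + 2 * Real.pi *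
        (Complex.I * a * (Real.sqrt z.im) / (2 * Real.pi) + Complex.I * n * z.re) * m) := by
    rw [← tsum_mul_left]
    refine tsum_congr fun m => ?_
    rw [latticeGaussMid, ← Complex.exp_add, hA]
    congr 1
    push_cast
    ring
  rw [e1, h, ← mul_assoc, mul_comm (Complex.exp A), mul_assoc, ← tsum_mul_left]
  congr 1
  refine tsum_congr fun m => ?_
  rw [latticeGaussTerm, pow_zero, one_mul, ← Complex.exp_add, normSq_unitForm, normSq_linForm,
      unitForm, linForm, hA, hz]
  congr 1
  push_cast
  have hI := Complex.I_sq
  have hI4 : Complex.I ^ 4 = 1 := Complex.I_pow_four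
  rw [← hs]
  field_simp
  ring_nf
  simp only [hI, hI4]
  ring_nf

theorem tsum_latticeGaussTerm_zero (z : UpperHalfPlane) {t : ℝ} (ht : 0 < t) (a : ℂ) :
    ∑' n, latticeGaussTerm z t 0 a n = 1 / t * ∑' n, latticeGaussTerm z (1 / t) 0 (a / t) n := by
  have hy := z.im_pos
  have hS := summable_latticeGaussTerm z ht 0 a
  have hM := summable_latticeGaussMid z ht a
  have hS' := summable_latticeGaussTerm z (one_div_pos.2 ht) 0 (a / t)
  rw [hS.tsum_prod]
  simp_rw [tsum_latticeGaussTerm_inner z ht a]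
  rw [tsum_mul_left, ← (show Summable (Function.uncurry fun m n => latticeGaussMid z t a (m, n)) from hM).tsum_comm]
  simp_rw [tsum_latticeGaussMid_inner z ht a]
  rw [tsum_mul_left, hS'.tsum_prod, ← (Equiv.neg ℤ).tsum_eq
    (fun n => ∑' m, latticeGaussTerm z (1 / t) 0 (a / t) (n, m)), ← mul_assoc]
  congr 1
  -- The two square roots (t/y)^(1/2) and (ty)^(1/2) multiply to t.
  rw [div_mul_div_comm, one_mul, ← Complex.mul_cpow_ofReal_nonneg (by positivity) (by positivity),
    ← Complex.ofReal_mul, show t / z.im * (t * z.im) = t ^ 2 by field_simp, Complex.ofReal_pow]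
  congr 1
  rw [← Complex.cpow_nat_mul' (n := 2) (by simp [Complex.arg_ofReal_of_nonneg ht.le, Real.pi_pos])
    (by simp [Complex.arg_ofReal_of_nonneg ht.le, Real.pi_pos.le])]
  norm_num

/-- Differentiate the case j = 0 in a: each derivative inserts a factor v on the left, and on the
right a factor v/t because the parameter there is a/t. Since only powers of the holomorphic
coordinate v occur, no correction terms appear. -/
theorem tsum_latticeGaussTerm (z : UpperHalfPlane) {t : ℝ} (ht : 0 < t) (j : ℕ) (a : ℂ) :
    ∑' n, latticeGaussTerm z t j a n =
      1 / (t : ℂ) ^ (j + 1) * ∑' n, latticeGaussTerm z (1 / t) j (a / t) n := by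
  induction j generalizing a with
  | zero => simpa using tsum_latticeGaussTerm_zero z ht a
  | succ j ih =>
    have h1 := hasDerivAt_tsum_latticeGaussTerm z ht j a
    have h2 : HasDerivAt (fun a : ℂ => a / (t : ℂ)) (1 / t) a := by
      simpa using (hasDerivAt_id a).div_const (t : ℂ)
    have h3 := (HasDerivAt.comp a (hasDerivAt_tsum_latticeGaussTerm z (one_div_pos.2 ht) j (a / t))
      h2).const_mul (1 / (t : ℂ) ^ (j + 1))
    rw [show (fun a => ∑' n, latticeGaussTerm z t j a n) = _ from funext ih] at h1
    rw [h1.unique h3]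
    rw [pow_succ (t : ℂ) (j + 1)]
    ring

end MaassLift

namespace MaassLift
open MeasureTheory Set Filter Asymptotics

/-! ## Mellin transforms of self-dual rapidly decaying functions -/

/-- `F` decays rapidly at infinity and satisfies `F(t) = t^{-(k+1)} F(1/t)`. -/
structure IsSelfDualDecaying (k : ℕ) (F : ℝ → ℂ) : Prop where
  meas : AEStronglyMeasurable F (volume.restrict (Ioi 0))
  feq : ∀ t : ℝ, 0 < t → F t = 1 / (t : ℂ) ^ (k + 1) * F (1 / t)
  bound : ∀ M : ℕ, k + 3 ≤ 2 * M → ∃ C : ℝ, ∀ t : ℝ, 0 < t → ‖F t‖ ≤ C * (t ^ M)⁻¹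

namespace IsSelfDualDecaying

variable {k : ℕ} {F : ℝ → ℂ}

theorem locallyIntegrableOn (h : IsSelfDualDecaying k F) : LocallyIntegrableOn F (Ioi 0) := by
  obtain ⟨C, hC⟩ := h.bound (k + 3) (by omega)
  have h2 : LocallyIntegrableOn (fun t : ℝ => C * (t ^ (k + 3))⁻¹) (Ioi 0) := by
    refine ContinuousOn.locallyIntegrableOn ?_ measurableSet_Ioi
    exact continuousOn_const.mul ((continuousOn_pow _).inv₀ fun t ht => pow_ne_zero _ (ne_of_gt ht))
  rw [locallyIntegrableOn_iff isOpen_Ioi.isLocallyClosed] at h2 ⊢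
  intro K hK hKc
  refine (h2 K hK hKc).mono' (h.meas.mono_measure (Measure.restrict_mono hK le_rfl)) ?_
  refine (ae_restrict_iff' hKc.measurableSet).2 (Eventually.of_forall fun t ht => hC t (hK ht))

theorem isBigO_rpow (h : IsSelfDualDecaying k F) (r : ℝ) : F =O[atTop] (· ^ r) := by
  obtain ⟨N, hN⟩ := exists_nat_gt (max (-r) (k + 3 : ℝ))
  obtain ⟨C, hC⟩ := h.bound N (by
    have := (le_max_right _ _).trans_lt hN
    have : k + 3 < N := by exact_mod_cast this
    omega)
  refine IsBigO.of_bound |C| ?_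
  filter_upwards [eventually_ge_atTop 1] with t ht
  have ht0 : 0 < t := by linarith
  rw [Real.norm_of_nonneg (Real.rpow_nonneg ht0.le _)]
  refine (hC t ht0).trans ?_
  rw [← Real.rpow_natCast, ← Real.rpow_neg ht0.le]
  have h3 : t ^ (-(N : ℝ)) ≤ t ^ r := by
    apply Real.rpow_le_rpow_of_exponent_le ht
    have := (le_max_left _ _).trans_lt hN
    linarith
  calc C * t ^ (-(N : ℝ)) ≤ |C| * t ^ (-(N : ℝ)) := by
        gcongr; exact le_abs_self C
    _ ≤ |C| * t ^ r := by gcongr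

/-- The self-dual pair `(F, F)`. -/
def pair (h : IsSelfDualDecaying k F) : WeakFEPair ℂ where
  f := F
  g := F
  k := k + 1
  ε := 1
  f₀ := 0
  g₀ := 0
  hf_int := h.locallyIntegrableOn
  hg_int := h.locallyIntegrableOn
  hk := by positivity
  hε := one_ne_zero
  h_feq := fun x hx => by
    have hx' : (x : ℂ) ≠ 0 := by exact_mod_cast (ne_of_gt hx)
    rw [h.feq x hx, one_mul, smul_eq_mul, ← mul_assoc, Complex.ofReal_cpow (le_of_lt hx)]
    have : (x : ℂ) ^ (((k : ℝ) + 1 : ℝ) : ℂ) = (x : ℂ) ^ (k + 1) := by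
      rw [← Complex.cpow_natCast]; push_cast; rfl
    rw [this, mul_one_div_cancel (pow_ne_zero _ hx'), one_mul]
  hf_top := fun r => by simpa using h.isBigO_rpow r
  hg_top := fun r => by simpa using h.isBigO_rpow r

theorem isStrongFEPair (h : IsSelfDualDecaying k F) : IsStrongFEPair h.pair := ⟨rfl, rfl⟩

theorem mellinConvergent (h : IsSelfDualDecaying k F) (s : ℂ) : MellinConvergent F s :=
  (h.isStrongFEPair.hasMellin s).1

theorem differentiable_mellin (h : IsSelfDualDecaying k F) : Differentiable ℂ (mellin F) := by
  have := h.isStrongFEPair.differentiable_Λ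
  rwa [h.isStrongFEPair.Λ_eq] at this

theorem mellin_symm (h : IsSelfDualDecaying k F) (s : ℂ) :
    mellin F (k + 1 - s) = mellin F s := by
  have := h.pair.functional_equation s
  rw [h.isStrongFEPair.Λ_eq, h.isStrongFEPair.symm_Λ_eq] at this
  simpa [pair] using this

/-- On the strip |t^(s-1)| ≤ t^(a-1) + t^(b-1), so the absolute integrals on the two edges give a
bound for the whole strip. -/
theorem exists_norm_mellin_le (h : IsSelfDualDecaying k F) (a b : ℝ) :
    ∃ M : ℝ, ∀ s : ℂ, a ≤ s.re → s.re ≤ b → ‖mellin F s‖ ≤ M := by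
  have key : ∀ s : ℂ, IntegrableOn (fun t : ℝ => t ^ (s.re - 1) * ‖F t‖) (Ioi 0) := fun s => by
    refine (h.mellinConvergent s).norm.congr ?_
    refine (ae_restrict_iff' measurableSet_Ioi).2 (Eventually.of_forall fun t (ht : 0 < t) => ?_)
    simp [Complex.norm_cpow_eq_rpow_re_of_pos ht]
  have ka := key a
  have kb := key b
  rw [Complex.ofReal_re] at ka kb
  refine ⟨_, fun s ha hb => norm_integral_le_of_norm_le (ka.add kb) ?_⟩
  refine (ae_restrict_iff' measurableSet_Ioi).2 (Eventually.of_forall fun t (ht : 0 < t) => ?_)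
  rw [norm_smul, Complex.norm_cpow_eq_rpow_re_of_pos ht]
  simp only [Complex.sub_re, Complex.one_re, Pi.add_apply]
  rw [← add_mul]
  gcongr
  rcases le_total 1 t with h1 | h1
  · refine (Real.rpow_le_rpow_of_exponent_le h1 (by linarith : s.re - 1 ≤ b - 1)).trans ?_
    have := Real.rpow_nonneg ht.le (a - 1)
    linarith
  · refine (Real.rpow_le_rpow_of_exponent_ge ht h1 (by linarith : a - 1 ≤ s.re - 1)).trans ?_
    have := Real.rpow_nonneg ht.le (b - 1)
    linarith

end IsSelfDualDecaying

/-! ## The theta series with polynomial weight `v^k` and its Mellin transform -/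

/-- `∑ v^k exp(-π t |v|²)`, the sum over the scaled lattice `(ℤz + ℤ)/√y`. -/
def unitTheta (k : ℕ) (z : UpperHalfPlane) (t : ℝ) : ℂ := ∑' n, latticeGaussTerm z t k 0 n

theorem latticeGaussTerm_zero (k : ℕ) (z : UpperHalfPlane) (t : ℝ) (n : ℤ × ℤ) :
    latticeGaussTerm z t k 0 n =
      unitForm z n ^ k * (Real.exp (-Real.pi * ‖unitForm z n‖ ^ 2 * t) : ℂ) := by
  rw [latticeGaussTerm, zero_mul, zero_sub, Complex.ofReal_exp]
  congr 2
  push_cast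
  ring

theorem hasSum_unitTheta (k : ℕ) (z : UpperHalfPlane) {t : ℝ} (ht : 0 < t) :
    HasSum (latticeGaussTerm z t k 0) (unitTheta k z t) :=
  (summable_latticeGaussTerm z ht k 0).hasSum

theorem unitTheta_inv (k : ℕ) (z : UpperHalfPlane) {t : ℝ} (ht : 0 < t) :
    unitTheta k z t = 1 / (t : ℂ) ^ (k + 1) * unitTheta k z (1 / t) := by
  simpa [unitTheta] using tsum_latticeGaussTerm z ht k 0

theorem norm_unitForm (z : UpperHalfPlane) (n : ℤ × ℤ) :
    ‖unitForm z n‖ = ‖linForm z n‖ / Real.sqrt z.im := by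
  rw [unitForm, norm_div, Complex.norm_real, Real.norm_of_nonneg (Real.sqrt_nonneg _)]

theorem unitForm_zero (z : UpperHalfPlane) : unitForm z 0 = 0 := by simp [unitForm, linForm]

/-- Since k > 0 the zero vector contributes nothing, and on the others exp(-x) ≤ M!/x^M. The cost of
uniformity in z is the growth y^M, which a rapidly decaying form absorbs. -/
theorem exists_norm_unitTheta_le {k M : ℕ} (hk : 0 < k) (hM : k + 3 ≤ 2 * M) (A : ℝ) {B : ℝ}
    (hB : 0 < B) :
    ∃ C : ℝ, 0 ≤ C ∧ ∀ z : UpperHalfPlane, |z.re| ≤ A → B ≤ z.im → ∀ t : ℝ, 0 < t →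
      ‖unitTheta k z t‖ ≤ C * z.im ^ M * (t ^ M)⁻¹ := by
  obtain ⟨ρ, hρ, hlow⟩ := exists_le_norm_linForm A hB
  -- After v^k is used up, the power 2M - k = q + 3 > 2 of 1/|v| remains, which makes the double
  -- series converge.
  obtain ⟨q, hq⟩ := Nat.exists_eq_add_of_le hM
  have hsum : Summable fun n : ℤ × ℤ => (‖n‖ ^ (q + 3))⁻¹ := by
    refine (summable_norm_pair_rpow (a := ((q + 3 : ℕ) : ℝ)) (by push_cast; linarith [(Nat.cast_nonneg q : (0:ℝ) ≤ q)])).congr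
      fun n => ?_
    rw [Real.rpow_neg (norm_nonneg _), Real.rpow_natCast]
  set D : ℝ := M.factorial * (Real.pi ^ M)⁻¹ * (Real.sqrt B ^ k)⁻¹ * (ρ ^ (q + 3))⁻¹ with hD
  have hD0 : 0 ≤ D := by positivity
  refine ⟨D * ∑' n : ℤ × ℤ, (‖n‖ ^ (q + 3))⁻¹, mul_nonneg hD0 (tsum_nonneg fun n => by positivity),
    fun z hA hBz t ht => ?_⟩
  have hy := z.im_pos
  have hterm : ∀ n, ‖latticeGaussTerm z t k 0 n‖ ≤
      D * z.im ^ M * (t ^ M)⁻¹ * (‖n‖ ^ (q + 3))⁻¹ := fun n => by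
    rcases eq_or_ne n 0 with rfl | hn
    · rw [latticeGaussTerm_zero, unitForm_zero, zero_pow hk.ne', zero_mul, norm_zero]
      positivity
    have hx : 0 < ‖unitForm z n‖ := by
      rw [norm_unitForm]
      exact div_pos (norm_pos_iff.2 (linForm_ne_zero z hn)) (Real.sqrt_pos.2 hy)
    have hn0 : 0 < ‖n‖ := norm_pos_iff.2 hn
    have hxl : ρ * ‖n‖ / Real.sqrt z.im ≤ ‖unitForm z n‖ := by
      rw [norm_unitForm]
      gcongr
      exact hlow z hA hBz n
    rw [latticeGaussTerm_zero, norm_mul, norm_pow, Complex.norm_real, Real.norm_of_nonneg (Real.exp_pos _).le]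
    set x := ‖unitForm z n‖ with hxdef
    have hs : 0 < Real.sqrt z.im := Real.sqrt_pos.2 hy
    have e1 : Real.exp (-Real.pi * x ^ 2 * t) ≤ M.factorial * ((Real.pi * x ^ 2 * t) ^ M)⁻¹ := by
      have h1 := Real.pow_div_factorial_le_exp (Real.pi * x ^ 2 * t) (by positivity) M
      rw [show -Real.pi * x ^ 2 * t = -(Real.pi * x ^ 2 * t) by ring, Real.exp_neg]
      rw [div_le_iff₀ (by positivity)] at h1
      rw [inv_le_iff_one_le_mul₀ (Real.exp_pos _), ← div_eq_mul_inv, div_mul_eq_mul_div,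
        one_le_div (by positivity)]
      linarith
    calc x ^ k * Real.exp (-Real.pi * x ^ 2 * t)
        ≤ x ^ k * (M.factorial * ((Real.pi * x ^ 2 * t) ^ M)⁻¹) := by gcongr
      _ = M.factorial * (Real.pi ^ M)⁻¹ * (t ^ M)⁻¹ * (x ^ (q + 3))⁻¹ := by
        rw [mul_pow, mul_pow, ← pow_mul, hq, show k + 3 + q = k + (q + 3) by ring, pow_add x]
        field_simp
      _ ≤ M.factorial * (Real.pi ^ M)⁻¹ * (t ^ M)⁻¹ * ((ρ * ‖n‖ / Real.sqrt z.im) ^ (q + 3))⁻¹ := by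
        gcongr
      _ = M.factorial * (Real.pi ^ M)⁻¹ * (t ^ M)⁻¹ * (ρ ^ (q + 3))⁻¹ * (‖n‖ ^ (q + 3))⁻¹ *
          (Real.sqrt z.im ^ (2 * M) * (Real.sqrt z.im ^ k)⁻¹) := by
        rw [hq, show k + 3 + q = k + (q + 3) by ring, pow_add (Real.sqrt z.im), div_pow, mul_pow]
        field_simp
      _ ≤ M.factorial * (Real.pi ^ M)⁻¹ * (t ^ M)⁻¹ * (ρ ^ (q + 3))⁻¹ * (‖n‖ ^ (q + 3))⁻¹ *
          (Real.sqrt z.im ^ (2 * M) * (Real.sqrt B ^ k)⁻¹) := by gcongr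
      _ = _ := by
        rw [pow_mul, Real.sq_sqrt hy.le, hD]
        ring
  refine (tsum_of_norm_bounded (hsum.hasSum.mul_left _) hterm).trans_eq ?_
  ring

theorem continuous_unitForm (n : ℤ × ℤ) : Continuous fun z => unitForm z n := by
  unfold unitForm linForm
  refine Continuous.div ?_ ?_ fun z => ?_
  · exact (continuous_const.mul UpperHalfPlane.continuous_coe).add continuous_const
  · exact Complex.continuous_ofReal.comp (Real.continuous_sqrt.comp UpperHalfPlane.continuous_im)
  · exact_mod_cast (Real.sqrt_pos.2 z.im_pos).ne'

theorem continuous_latticeGaussTerm (k : ℕ) (n : ℤ × ℤ) :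
    Continuous fun p : UpperHalfPlane × ℝ => latticeGaussTerm p.1 p.2 k 0 n := by
  have h := (continuous_unitForm n).comp (continuous_fst : Continuous (Prod.fst : UpperHalfPlane × ℝ → _))
  simp only [latticeGaussTerm_zero]
  simp only [Function.comp_def] at h
  refine (h.pow k).mul (Complex.continuous_ofReal.comp (Real.continuous_exp.comp ?_))
  exact (continuous_const.mul (h.norm.pow 2)).mul continuous_snd

theorem measurable_indicator_unitTheta (k : ℕ) :
    Measurable fun p : UpperHalfPlane × ℝ => (Ioi (0 : ℝ)).indicator (unitTheta k p.1) p.2 := by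
  refine measurable_of_tendsto_metrizable' (u := atTop)
    (f := fun s : Finset (ℤ × ℤ) => fun p : UpperHalfPlane × ℝ =>
      (univ ×ˢ Ioi (0 : ℝ)).indicator (fun p => ∑ n ∈ s, latticeGaussTerm p.1 p.2 k 0 n) p) ?_ ?_
  · intro s
    refine Measurable.indicator ?_ (MeasurableSet.univ.prod measurableSet_Ioi)
    exact (continuous_finsetSum s fun n _ => continuous_latticeGaussTerm k n).measurable
  · refine tendsto_pi_nhds.2 fun p => ?_
    by_cases hp : p.2 ∈ Ioi (0 : ℝ)
    · rw [indicator_of_mem hp]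
      have hp' : p ∈ (univ : Set UpperHalfPlane) ×ˢ Ioi (0 : ℝ) := ⟨mem_univ _, hp⟩
      simp only [indicator_of_mem hp']
      exact hasSum_unitTheta k p.1 hp
    · rw [indicator_of_notMem hp]
      have hp' : p ∉ (univ : Set UpperHalfPlane) ×ˢ Ioi (0 : ℝ) := fun h => hp h.2
      simp only [indicator_of_notMem hp']
      exact tendsto_const_nhds

theorem isSelfDualDecaying_unitTheta {k : ℕ} (hk : 0 < k) (z : UpperHalfPlane) :
    IsSelfDualDecaying k (unitTheta k z) where
  meas := by
    have h := (measurable_indicator_unitTheta k).comp (measurable_prodMk_left (x := z))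
    exact ((aemeasurable_indicator_iff measurableSet_Ioi).1 h.aemeasurable).aestronglyMeasurable
  feq := fun t ht => unitTheta_inv k z ht
  bound := fun M hM => by
    obtain ⟨C, -, hC⟩ := exists_norm_unitTheta_le hk hM |z.re| z.im_pos
    exact ⟨C * z.im ^ M, fun t ht => hC z le_rfl le_rfl t ht⟩

/-- The completed Eisenstein series of the full lattice `ℤz + ℤ`. -/
def latticeMellin (k : ℕ) (z : UpperHalfPlane) (s : ℂ) : ℂ := mellin (unitTheta k z) (s + k / 2)

theorem differentiable_latticeMellin {k : ℕ} (hk : 0 < k) (z : UpperHalfPlane) :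
    Differentiable ℂ (latticeMellin k z) :=
  (isSelfDualDecaying_unitTheta hk z).differentiable_mellin.comp
    (differentiable_id.add_const _)

theorem summable_norm_unitForm_rpow (z : UpperHalfPlane) {a : ℝ} (ha : 2 < a) :
    Summable fun n : ℤ × ℤ => ‖unitForm z n‖ ^ (-a) := by
  obtain ⟨ρ, hρ, h⟩ := exists_le_norm_linForm |z.re| z.im_pos
  have hs : 0 < Real.sqrt z.im := Real.sqrt_pos.2 z.im_pos
  refine Summable.of_nonneg_of_le (fun n => Real.rpow_nonneg (norm_nonneg _) _) (fun n => ?_)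
    ((summable_norm_pair_rpow ha).mul_left ((ρ / Real.sqrt z.im) ^ (-a)))
  rcases eq_or_ne n 0 with rfl | hn
  · rw [unitForm_zero, norm_zero, norm_zero, Real.zero_rpow (by linarith), mul_zero]
  · rw [← Real.mul_rpow (by positivity) (norm_nonneg _)]
    refine Real.rpow_le_rpow_of_nonpos (mul_pos (by positivity) (norm_pos_iff.2 hn)) ?_ (by linarith)
    rw [norm_unitForm, div_mul_eq_mul_div]
    gcongr
    exact h z le_rfl le_rfl n

/-- Term by term each Gaussian contributes π^(-σ) Γ(σ) v^k |v|^(-2σ) with σ = s + k/2; absolute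
convergence is that of ∑ |v|^(-2 Re s). -/
theorem hasSum_latticeMellin {k : ℕ} (hk : 0 < k) (z : UpperHalfPlane) {s : ℂ} (hs : 1 < s.re) :
    HasSum (fun n : ℤ × ℤ => (Real.pi : ℂ) ^ (-(s + k / 2)) * Complex.Gamma (s + k / 2) *
      unitForm z n ^ k / ((‖unitForm z n‖ ^ 2 : ℝ) : ℂ) ^ (s + k / 2)) (latticeMellin k z s) := by
  have hre : (s + k / 2).re = s.re + k / 2 := by simp
  refine hasSum_mellin_pi_mul (fun n => ?_) ?_ (fun t ht => ?_) ?_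
  · rcases eq_or_ne n 0 with rfl | hn
    · left; rw [unitForm_zero, zero_pow hk.ne']
    · right
      rw [norm_unitForm]
      have := norm_pos_iff.2 (linForm_ne_zero z hn)
      have := Real.sqrt_pos.2 z.im_pos
      positivity
  · rw [hre]; positivity
  · exact hasSum_of_eq (hasSum_unitTheta k z ht) fun n => (latticeGaussTerm_zero k z t n).symm
  · refine (summable_norm_unitForm_rpow z (a := 2 * s.re) (by linarith)).congr fun n => ?_
    rcases eq_or_ne n 0 with rfl | hn
    · rw [unitForm_zero, norm_zero, Real.zero_rpow (by linarith)]
      simp [hk.ne']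
    · have hx : 0 < ‖unitForm z n‖ := by
        rw [norm_unitForm]
        exact div_pos (norm_pos_iff.2 (linForm_ne_zero z hn)) (Real.sqrt_pos.2 z.im_pos)
      rw [hre, norm_pow, ← Real.rpow_natCast, ← Real.rpow_natCast, ← Real.rpow_mul hx.le,
        ← Real.rpow_sub hx]
      congr 1
      push_cast
      ring

/-- The behaviour under `z ↦ -1/z`. -/
theorem unitTheta_neg_inv (k : ℕ) {z z' : UpperHalfPlane} (h : (z' : ℂ) = -1 / z) (t : ℝ) :
    unitTheta k z' t = ((‖(z : ℂ)‖ : ℂ) / z) ^ k * unitTheta k z t := by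
  have hz : (z : ℂ) ≠ 0 := UpperHalfPlane.ne_zero z
  have hn : ‖(z : ℂ)‖ ≠ 0 := norm_ne_zero_iff.2 hz
  have him : z'.im = z.im / ‖(z : ℂ)‖ ^ 2 := by
    rw [← UpperHalfPlane.coe_im, h, ← Complex.normSq_eq_norm_sq]
    rw [Complex.div_im]
    simp
    ring
  have hsq : Real.sqrt z'.im = Real.sqrt z.im / ‖(z : ℂ)‖ := by
    rw [him, Real.sqrt_div z.im_pos.le, Real.sqrt_sq (norm_nonneg _)]
  have hs : (Real.sqrt z.im : ℂ) ≠ 0 := by exact_mod_cast (Real.sqrt_pos.2 z.im_pos).ne'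
  have hf : ∀ m n : ℤ, unitForm z' (m, n) = ((‖(z : ℂ)‖ : ℂ) / z) * unitForm z (n, -m) := fun m n => by
    rw [unitForm, unitForm, linForm, linForm, h, hsq]
    push_cast
    have : (‖(z : ℂ)‖ : ℂ) ≠ 0 := by exact_mod_cast hn
    field_simp
    ring
  rw [unitTheta, unitTheta, ← tsum_mul_left, ← ((Equiv.prodComm ℤ ℤ).trans
    ((Equiv.refl ℤ).prodCongr (Equiv.neg ℤ))).tsum_eq (fun n => ((‖(z : ℂ)‖ : ℂ) / z) ^ k * latticeGaussTerm z t k 0 n)]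
  refine tsum_congr fun ⟨m, n⟩ => ?_
  simp only [Equiv.trans_apply, Equiv.prodComm_apply, Prod.swap_prod_mk, Equiv.prodCongr_apply,
    Prod.map_apply, Equiv.coe_refl, id, Equiv.neg_apply]
  have hnf : ‖unitForm z' (m, n)‖ = ‖unitForm z (n, -m)‖ := by
    rw [hf, norm_mul, norm_div, Complex.norm_real, norm_norm, div_self hn, one_mul]
  rw [latticeGaussTerm_zero, latticeGaussTerm_zero, hnf, hf, mul_pow, mul_assoc]

theorem latticeMellin_neg_inv (k : ℕ) {z z' : UpperHalfPlane} (h : (z' : ℂ) = -1 / z) (s : ℂ) :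
    latticeMellin k z' s = ((‖(z : ℂ)‖ : ℂ) / z) ^ k * latticeMellin k z s := by
  rw [latticeMellin, latticeMellin, ← smul_eq_mul, ← mellin_const_smul]
  congr 1
  ext t
  exact unitTheta_neg_inv k h t

end MaassLift

namespace MaassLift
open MeasureTheory Set Filter

/-! ## Cosets of `Γ_∞` in `Γ₀(2)` and coprime pairs -/

theorem mem_closure_neg_one_T_iff {γ : SL(2, ℤ)} :
    γ ∈ Subgroup.closure {-1, ModularGroup.T} ↔ γ 1 0 = 0 := by
  constructor
  · intro h
    refine Subgroup.closure_induction (p := fun γ _ => γ 1 0 = 0) ?_ ?_ ?_ ?_ h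
    · rintro γ (rfl | rfl)
      · simp
      · simp [ModularGroup.T]
    · simp
    · intro x y _ _ hx hy
      rw [Matrix.SpecialLinearGroup.coe_mul, Matrix.mul_apply, Fin.sum_univ_two, hx, hy]
      ring
    · intro x _ hx
      rw [Matrix.SpecialLinearGroup.SL2_inv_expl]
      simpa using hx
  · intro h
    have hT : ModularGroup.T ∈ Subgroup.closure ({-1, ModularGroup.T} : Set SL(2, ℤ)) :=
      Subgroup.subset_closure (by simp)
    have hn : (-1 : SL(2, ℤ)) ∈ Subgroup.closure ({-1, ModularGroup.T} : Set SL(2, ℤ)) :=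
      Subgroup.subset_closure (by simp)
    have hdet := Matrix.det_fin_two γ.1
    rw [γ.2, h, mul_zero, sub_zero] at hdet
    rcases Int.mul_eq_one_iff_eq_one_or_neg_one.1 hdet.symm with ⟨ha, hd⟩ | ⟨ha, hd⟩
    · have : γ = ModularGroup.T ^ (γ 0 1) := by
        ext i j
        rw [ModularGroup.coe_T_zpow]
        fin_cases i <;> fin_cases j <;> simp [ha, hd, h]
      rw [this]
      exact Subgroup.zpow_mem _ hT _
    · have : γ = -1 * ModularGroup.T ^ (-γ 0 1) := by
        ext i j
        rw [Matrix.SpecialLinearGroup.coe_mul, ModularGroup.coe_T_zpow]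
        fin_cases i <;> fin_cases j <;> simp [ha, hd, h]
      rw [this]
      exact Subgroup.mul_mem _ hn (Subgroup.zpow_mem _ hT _)

theorem mem_Gamma0_two_iff {γ : SL(2, ℤ)} : γ ∈ CongruenceSubgroup.Gamma0 2 ↔ Even (γ 1 0) := by
  rw [CongruenceSubgroup.Gamma0_mem, ZMod.intCast_zmod_eq_zero_iff_dvd, even_iff_two_dvd]
  rfl

/-- The pairs of coprime integers with even first entry. -/
def EvenCoprime : Type := {n : ℤ × ℤ // IsCoprime n.1 n.2 ∧ Even n.1}

/-- The bottom row of a matrix. -/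
def bottomRow (γ : SL(2, ℤ)) : ℤ × ℤ := (γ 1 0, γ 1 1)

theorem isCoprime_bottomRow (γ : SL(2, ℤ)) : IsCoprime (bottomRow γ).1 (bottomRow γ).2 := by
  refine ⟨-γ 0 1, γ 0 0, ?_⟩
  have := Matrix.det_fin_two γ.1
  rw [γ.2] at this
  simp only [bottomRow]
  linear_combination -this

theorem mul_inv_one_zero (γ δ : SL(2, ℤ)) :
    (γ * δ⁻¹) 1 0 = γ 1 0 * δ 1 1 - γ 1 1 * δ 1 0 := by
  rw [Matrix.SpecialLinearGroup.coe_mul, Matrix.SpecialLinearGroup.SL2_inv_expl,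
    Matrix.mul_apply, Fin.sum_univ_two]
  simp
  ring

/-- The lower left entry of γδ⁻¹ is cd' - dc'; its vanishing makes the bottom rows proportional, and
coprimality of both rows forces the factor to be ±1. -/
theorem rightRel_GammaInf_iff {γ δ : CongruenceSubgroup.Gamma0 2} :
    QuotientGroup.rightRel GammaInf γ δ ↔
      bottomRow (δ : SL(2, ℤ)) = bottomRow (γ : SL(2, ℤ)) ∨
        bottomRow (δ : SL(2, ℤ)) = -bottomRow (γ : SL(2, ℤ)) := by
  rw [QuotientGroup.rightRel_apply, GammaInf, Subgroup.mem_subgroupOf, mem_closure_neg_one_T_iff]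
  rw [Subgroup.coe_mul, Subgroup.coe_inv, mul_inv_one_zero, sub_eq_zero]
  obtain ⟨a, b, h1⟩ := isCoprime_bottomRow (γ : SL(2, ℤ))
  obtain ⟨a', b', h2⟩ := isCoprime_bottomRow (δ : SL(2, ℤ))
  simp only [bottomRow, Prod.mk.injEq, Prod.neg_mk] at *
  set c := (γ : SL(2, ℤ)) 1 0
  set d := (γ : SL(2, ℤ)) 1 1
  set c' := (δ : SL(2, ℤ)) 1 0
  set d' := (δ : SL(2, ℤ)) 1 1
  constructor
  · intro h
    have e1 : c' = (a * c' + b * d') * c := by linear_combination (-c') * h1 + b * h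
    have e2 : d' = (a * c' + b * d') * d := by linear_combination (-d') * h1 - a * h
    have e3 : (a * c' + b * d') * (a' * c + b' * d) = 1 := by
      linear_combination h2 - a' * e1 - b' * e2
    rcases Int.isUnit_iff.1 (IsUnit.of_mul_eq_one _ e3) with h | h
    · left; rw [h] at e1 e2; exact ⟨by linarith, by linarith⟩
    · right; rw [h] at e1 e2; exact ⟨by linarith, by linarith⟩
  · rintro (⟨h, h'⟩ | ⟨h, h'⟩) <;> rw [h, h'] <;> ring

theorem bottomRow_ne_neg (γ : SL(2, ℤ)) : bottomRow γ ≠ -bottomRow γ := by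
  intro h
  obtain ⟨a, b, h1⟩ := isCoprime_bottomRow γ
  have h2 : (bottomRow γ).1 = 0 := by have := congrArg Prod.fst h; simp at this; omega
  have h3 : (bottomRow γ).2 = 0 := by have := congrArg Prod.snd h; simp at this; omega
  rw [h2, h3] at h1
  simp at h1

/-- The bottom row of the representative of a coset. -/
def cosetRow (q : Quotient (QuotientGroup.rightRel GammaInf)) : ℤ × ℤ :=
  bottomRow (q.out : CongruenceSubgroup.Gamma0 2)

/-- A coset of `Γ_∞` and a sign give a coprime pair with even first entry. -/
def cosetPair (x : Quotient (QuotientGroup.rightRel GammaInf) × Bool) : EvenCoprime :=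
  ⟨if x.2 then cosetRow x.1 else -cosetRow x.1, by
    have h := isCoprime_bottomRow (x.1.out : CongruenceSubgroup.Gamma0 2)
    have h2 := mem_Gamma0_two_iff.1 (x.1.out : CongruenceSubgroup.Gamma0 2).2
    split_ifs
    · exact ⟨h, h2⟩
    · exact ⟨h.neg_neg, h2.neg⟩⟩

theorem cosetPair_bijective : Function.Bijective cosetPair := by
  constructor
  · rintro ⟨q, u⟩ ⟨q', u'⟩ h
    have h := congrArg Subtype.val h
    simp only [cosetPair] at h
    have hq : q = q' := by
      rw [← Quotient.out_equiv_out]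
      refine rightRel_GammaInf_iff.2 ?_
      change cosetRow q' = cosetRow q ∨ cosetRow q' = -cosetRow q
      cases u <;> cases u' <;> simp only [Bool.false_eq_true, if_false, if_true] at h
      · left; exact (neg_injective h).symm
      · right; exact h.symm
      · right; rw [h, neg_neg]
      · left; exact h.symm
    subst hq
    have hne : cosetRow q ≠ -cosetRow q := bottomRow_ne_neg _
    cases u <;> cases u' <;> simp only [Bool.false_eq_true, if_false, if_true] at h
    · rfl
    · exact absurd h.symm hne
    · exact absurd h hne
    · rfl
  · rintro ⟨n, hn, he⟩
    obtain ⟨g, h0, h1⟩ := hn.exists_SL2_row 1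
    have hrow : bottomRow g = n := Prod.ext h0 h1
    have hg : g ∈ CongruenceSubgroup.Gamma0 2 := mem_Gamma0_two_iff.2 (by rw [h0]; exact he)
    set q : Quotient (QuotientGroup.rightRel GammaInf) := Quotient.mk _ ⟨g, hg⟩
    have h := rightRel_GammaInf_iff.1 (Quotient.exact (Quotient.out_eq q))
    simp only [hrow] at h
    rcases h with h | h
    · exact ⟨(q, true), Subtype.ext h.symm⟩
    · exact ⟨(q, false), Subtype.ext h.symm⟩

/-! ## Eisenstein series as lattice sums -/

/-- The terms `(w/|w|)^k (y/|w|²)^s` with `w = m z + n`. -/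
def eisLatticeTerm (k : ℕ) (z : UpperHalfPlane) (s : ℂ) (n : ℤ × ℤ) : ℂ :=
  (linForm z n / (‖linForm z n‖ : ℂ)) ^ k * ((z.im / ‖linForm z n‖ ^ 2 : ℝ) : ℂ) ^ s

theorem eisTerm_eq (l : ℕ) (z : UpperHalfPlane) (s : ℂ) (γ : SL(2, ℤ)) :
    eisTerm l z s γ = eisLatticeTerm (l + 2) z s (bottomRow γ) := rfl

theorem linForm_neg (z : UpperHalfPlane) (n : ℤ × ℤ) : linForm z (-n) = -linForm z n := by
  simp [linForm]; ring

theorem eisLatticeTerm_neg {k : ℕ} (hk : Even k) (z : UpperHalfPlane) (s : ℂ) (n : ℤ × ℤ) :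
    eisLatticeTerm k z s (-n) = eisLatticeTerm k z s n := by
  rw [eisLatticeTerm, linForm_neg, norm_neg, neg_div, hk.neg_pow]
  rfl

theorem eisLatticeTerm_eq {k : ℕ} (hk : 0 < k) (z : UpperHalfPlane) (s : ℂ) (n : ℤ × ℤ) :
    eisLatticeTerm k z s n =
      unitForm z n ^ k / ((‖unitForm z n‖ ^ 2 : ℝ) : ℂ) ^ (s + k / 2) := by
  rcases eq_or_ne n 0 with rfl | hn
  · rw [unitForm_zero, eisLatticeTerm]
    simp [linForm, hk.ne']
  have hw := norm_pos_iff.2 (linForm_ne_zero z hn)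
  have hy := z.im_pos
  set x := ‖unitForm z n‖ with hx
  have hx0 : 0 < x := by rw [hx, norm_unitForm]; exact div_pos hw (Real.sqrt_pos.2 hy)
  have h1 : linForm z n / (‖linForm z n‖ : ℂ) = unitForm z n / x := by
    rw [hx, norm_unitForm, unitForm]
    have : (Real.sqrt z.im : ℂ) ≠ 0 := by exact_mod_cast (Real.sqrt_pos.2 hy).ne'
    have : (‖linForm z n‖ : ℂ) ≠ 0 := by exact_mod_cast hw.ne'
    push_cast
    field_simp
  have h2 : z.im / ‖linForm z n‖ ^ 2 = (x ^ 2)⁻¹ := by rw [hx, normSq_unitForm, inv_div]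
  have hx2 : ((x ^ 2 : ℝ) : ℂ) ≠ 0 := by exact_mod_cast (pow_pos hx0 2).ne'
  have h3 : ((x ^ 2 : ℝ) : ℂ) ^ ((k : ℂ) / 2) = (x : ℂ) ^ k := by
    rw [Complex.ofReal_pow, ← Complex.cpow_nat_mul' (n := 2)
      (by simp [Complex.arg_ofReal_of_nonneg hx0.le, Real.pi_pos])
      (by simp [Complex.arg_ofReal_of_nonneg hx0.le, Real.pi_pos.le]), ← Complex.cpow_natCast]
    congr 1
    push_cast
    ring
  rw [eisLatticeTerm, h1, h2, Complex.cpow_add _ _ hx2, h3, Complex.ofReal_inv,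
    Complex.inv_cpow _ _ (by rw [Complex.arg_ofReal_of_nonneg (by positivity)]; exact Real.pi_pos.ne),
    div_pow]
  rw [div_eq_mul_inv, div_eq_mul_inv, mul_inv]
  ring

theorem summable_eisLatticeTerm {k : ℕ} (hk : 0 < k) (z : UpperHalfPlane) {s : ℂ} (hs : 1 < s.re) :
    Summable (eisLatticeTerm k z s) := by
  have h : (Real.pi : ℂ) ^ (-(s + k / 2)) * Complex.Gamma (s + k / 2) ≠ 0 := by
    refine mul_ne_zero ?_ (Complex.Gamma_ne_zero_of_re_pos ?_)
    · rw [Complex.cpow_ne_zero_iff]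
      left; exact_mod_cast Real.pi_ne_zero
    · have : (s + k / 2).re = s.re + k / 2 := by simp
      rw [this]; positivity
  refine ((hasSum_latticeMellin hk z hs).summable.mul_left
    ((Real.pi : ℂ) ^ (-(s + k / 2)) * Complex.Gamma (s + k / 2))⁻¹).congr fun n => ?_
  rw [eisLatticeTerm_eq hk, mul_div_assoc, inv_mul_cancel_left₀ h]

theorem latticeMellin_eq {k : ℕ} (hk : 0 < k) (z : UpperHalfPlane) {s : ℂ} (hs : 1 < s.re) :
    latticeMellin k z s = (Real.pi : ℂ) ^ (-(s + k / 2)) * Complex.Gamma (s + k / 2) *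
      ∑' n, eisLatticeTerm k z s n := by
  rw [← (hasSum_latticeMellin hk z hs).tsum_eq, ← tsum_mul_left]
  refine tsum_congr fun n => ?_
  rw [eisLatticeTerm_eq hk]
  ring

/-- The point `2z`. -/
def twoMul (z : UpperHalfPlane) : UpperHalfPlane := ⟨2 * z, by
  have := z.im_pos
  simpa using this⟩

theorem coe_twoMul (z : UpperHalfPlane) : (twoMul z : ℂ) = 2 * z := rfl

theorem twoMul_im (z : UpperHalfPlane) : (twoMul z).im = 2 * z.im := by
  rw [← UpperHalfPlane.coe_im, coe_twoMul]; simp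

theorem twoMul_re (z : UpperHalfPlane) : (twoMul z).re = 2 * z.re := by
  rw [← UpperHalfPlane.coe_re, coe_twoMul]; simp

theorem eisLatticeTerm_natCast_mul (k : ℕ) (z : UpperHalfPlane) (s : ℂ) {m : ℕ} (hm : 0 < m)
    (n : ℤ × ℤ) :
    eisLatticeTerm k z s (m * n.1, m * n.2) = (m : ℂ) ^ (-(2 * s)) * eisLatticeTerm k z s n := by
  have hm' : (m : ℂ) ≠ 0 := by exact_mod_cast hm.ne'
  have h : linForm z (m * n.1, m * n.2) = m * linForm z n := by
    simp [linForm]; ring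
  have hr : z.im / (m * ‖linForm z n‖) ^ 2 = ((m : ℝ) ^ 2)⁻¹ * (z.im / ‖linForm z n‖ ^ 2) := by
    rw [mul_pow]; field_simp
  rw [eisLatticeTerm, h, norm_mul, Complex.norm_natCast, Complex.ofReal_mul, Complex.ofReal_natCast,
    mul_div_mul_left _ _ hm', hr, Complex.ofReal_mul, Complex.mul_cpow_ofReal_nonneg (by positivity)
    (by have := z.im_pos; positivity)]
  have e : ((((m : ℝ) ^ 2)⁻¹ : ℝ) : ℂ) ^ s = (m : ℂ) ^ (-(2 * s)) := by
    rw [Complex.ofReal_inv, Complex.inv_cpow _ _ (by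
      rw [Complex.arg_ofReal_of_nonneg (by positivity)]; exact Real.pi_pos.ne), Complex.ofReal_pow,
      Complex.ofReal_natCast, Complex.cpow_neg]
    congr 1
    rw [← Complex.cpow_nat_mul' (n := 2)
      (by rw [Complex.natCast_arg]; simp [Real.pi_pos])
      (by rw [Complex.natCast_arg]; simp [Real.pi_pos.le])]
    norm_num
  rw [e, eisLatticeTerm]
  ring

/-- The vectors with even first coordinate form the lattice of 2z; its height is 2y rather than y,
whence 2^(-s). -/
theorem eisLatticeTerm_twoMul (k : ℕ) (z : UpperHalfPlane) (s : ℂ) (n : ℤ × ℤ) :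
    eisLatticeTerm k z s (2 * n.1, n.2) = 2 ^ (-s) * eisLatticeTerm k (twoMul z) s n := by
  have h : linForm z (2 * n.1, n.2) = linForm (twoMul z) n := by
    simp [linForm, coe_twoMul]; ring
  rw [eisLatticeTerm, h, eisLatticeTerm, twoMul_im]
  have e : z.im / ‖linForm (twoMul z) n‖ ^ 2 =
      (2 : ℝ)⁻¹ * (2 * z.im / ‖linForm (twoMul z) n‖ ^ 2) := by ring
  rw [e, Complex.ofReal_mul, Complex.mul_cpow_ofReal_nonneg (by positivity)
    (by have := z.im_pos; positivity), Complex.ofReal_inv, Complex.inv_cpow _ _ (by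
      rw [Complex.arg_ofReal_of_nonneg (by positivity)]; exact Real.pi_pos.ne), ← Complex.cpow_neg]
  push_cast
  ring

/-- Removing the even integers removes the Euler factor at 2. -/
theorem hasSum_odd_cpow {s : ℂ} (hs : 1 < s.re) :
    HasSum (fun n : {n : ℕ // Odd n} => (n : ℂ) ^ (-s)) ((1 - 2 ^ (-s)) * riemannZeta s) := by
  have hsum : Summable fun n : ℕ => (n : ℂ) ^ (-s) := by
    refine (Complex.summable_one_div_nat_cpow.2 hs).congr fun n => ?_
    rw [Complex.cpow_neg, one_div]
  have hz : HasSum (fun n : ℕ => (n : ℂ) ^ (-s)) (riemannZeta s) := by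
    have h : ∑' n : ℕ, 1 / (n : ℂ) ^ s = ∑' n : ℕ, (n : ℂ) ^ (-s) :=
      tsum_congr fun n => by rw [Complex.cpow_neg, one_div]
    rw [zeta_eq_tsum_one_div_nat_cpow hs, h]
    exact hsum.hasSum
  have he : HasSum (fun n : ℕ => ((2 * n : ℕ) : ℂ) ^ (-s)) (2 ^ (-s) * riemannZeta s) := by
    refine hasSum_of_eq (hz.mul_left _) fun n => ?_
    push_cast
    rw [← Complex.ofReal_natCast, ← Complex.ofReal_ofNat,
      Complex.mul_cpow_ofReal_nonneg (by norm_num) (Nat.cast_nonneg _)]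
  obtain ⟨B, hB⟩ : ∃ B, HasSum (fun n : ℕ => ((2 * n + 1 : ℕ) : ℂ) ^ (-s)) B :=
    ⟨_, (hsum.comp_injective (i := fun n : ℕ => 2 * n + 1) fun a b h => by simpa using h).hasSum⟩
  have h3 : B = (1 - 2 ^ (-s)) * riemannZeta s := by
    have h := HasSum.even_add_odd (f := fun n : ℕ => (n : ℂ) ^ (-s)) he hB
    linear_combination h.unique hz
  let e : ℕ ≃ {n : ℕ // Odd n} :=
    Equiv.ofBijective (fun n => ⟨2 * n + 1, n, rfl⟩)
      ⟨fun a b h => by simpa using congrArg Subtype.val h, fun ⟨n, k, hk⟩ => ⟨k, Subtype.ext hk.symm⟩⟩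
  rw [← e.hasSum_iff, ← h3]
  exact hasSum_of_eq hB fun n => rfl

/-- A pair of integers with even first and odd second entry is, in a unique way, an odd positive
multiple of a coprime pair. -/
def oddMulPair (x : {m : ℕ // Odd m} × EvenCoprime) : {n : ℤ × ℤ // Even n.1 ∧ Odd n.2} :=
  ⟨(x.1 * x.2.1.1, x.1 * x.2.1.2), x.2.2.2.mul_left _, by
    have h1 : Odd ((x.1 : ℕ) : ℤ) := by exact_mod_cast x.1.2
    refine h1.mul ?_
    by_contra h
    have h2 := Int.not_odd_iff_even.1 h
    have h3 := x.2.2.1.isUnit_of_dvd' (even_iff_two_dvd.1 x.2.2.2) (even_iff_two_dvd.1 h2)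
    rw [Int.isUnit_iff] at h3
    omega⟩

theorem oddMulPair_bijective : Function.Bijective oddMulPair := by
  -- The odd multiplier is recovered as the gcd of the pair, which gives uniqueness.
  have hgcd : ∀ x, ((oddMulPair x).1.1).gcd (oddMulPair x).1.2 = x.1 := by
    rintro ⟨m, n⟩
    simp only [oddMulPair, Int.gcd_mul_left, Int.natAbs_natCast]
    rw [Int.isCoprime_iff_gcd_eq_one.1 n.2.1, mul_one]
  constructor
  · rintro ⟨⟨m, hm⟩, n⟩ ⟨⟨m', hm'⟩, n'⟩ h
    have h1 : m = m' := by
      have h1 := hgcd (⟨m, hm⟩, n)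
      rw [h, hgcd (⟨m', hm'⟩, n')] at h1
      exact h1.symm
    subst h1
    have hm0 : (m : ℤ) ≠ 0 := by exact_mod_cast hm.pos.ne'
    have h2 := congrArg Subtype.val h
    simp only [oddMulPair, Prod.mk.injEq] at h2
    have : n = n' := Subtype.ext (Prod.ext (mul_left_cancel₀ hm0 h2.1) (mul_left_cancel₀ hm0 h2.2))
    rw [this]
  · rintro ⟨⟨a, b⟩, ha, hb⟩
    simp only at ha hb
    have hb0 : b ≠ 0 := by rintro rfl; simp at hb
    have hg : 0 < a.gcd b := Int.gcd_pos_of_ne_zero_right _ hb0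
    obtain ⟨a', ha'⟩ := Int.gcd_dvd_left a b
    obtain ⟨b', hb'⟩ := Int.gcd_dvd_right a b
    have hodd : Odd ((a.gcd b : ℕ) : ℤ) := by
      rw [hb'] at hb
      exact (Int.odd_mul.1 hb).1
    have hco : IsCoprime a' b' := by
      rw [Int.isCoprime_iff_gcd_eq_one]
      have h1 : a.gcd b = a.gcd b * a'.gcd b' := by
        have h2 := Int.gcd_mul_left (m := (a.gcd b : ℕ)) (n := a') (k := b')
        rwa [← ha', ← hb', Int.natAbs_natCast] at h2
      exact (Nat.eq_of_mul_eq_mul_left hg (by rw [mul_one]; exact h1)).symm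
    have hev : Even a' := by
      rw [ha', Int.even_mul] at ha
      exact ha.resolve_left (Int.not_even_iff_odd.2 hodd)
    exact ⟨(⟨a.gcd b, by exact_mod_cast hodd⟩, ⟨(a', b'), hco, hev⟩), Subtype.ext
      (Prod.ext ha'.symm hb'.symm)⟩

theorem hasSum_indicator_range {ι κ : Type*} {g : ι → κ} (hg : Function.Injective g) {f : κ → ℂ}
    {f' : ι → ℂ} (h : ∀ i, f (g i) = f' i) (hf' : Summable f') {s : Set κ} (hs : s = range g) :
    HasSum (s.indicator f) (∑' i, f' i) := by
  subst hs
  rw [← hg.hasSum_iff fun x hx => indicator_of_notMem hx _]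
  refine hasSum_of_eq hf'.hasSum fun n => ?_
  rw [Function.comp_apply, indicator_of_mem (mem_range_self n), h]

theorem hasSum_eisLatticeTerm_even {k : ℕ} (hk : 0 < k) (z : UpperHalfPlane) {s : ℂ}
    (hs : 1 < s.re) :
    HasSum (({n : ℤ × ℤ | Even n.1}).indicator (eisLatticeTerm k z s))
      (2 ^ (-s) * ∑' n, eisLatticeTerm k (twoMul z) s n) := by
  rw [← tsum_mul_left]
  refine hasSum_indicator_range (g := fun n : ℤ × ℤ => (2 * n.1, n.2)) (fun a b h => ?_)
    (fun n => eisLatticeTerm_twoMul k z s n) ((summable_eisLatticeTerm hk _ hs).mul_left _) ?_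
  · simp only [Prod.mk.injEq, mul_eq_mul_left_iff, OfNat.ofNat_ne_zero, or_false] at h
    exact Prod.ext h.1 h.2
  · ext ⟨a, b⟩
    constructor
    · rintro ⟨c, hc⟩
      exact ⟨(c, b), Prod.ext (by simp only at hc ⊢; omega) rfl⟩
    · rintro ⟨c, hc⟩
      rw [← hc]
      exact even_two_mul _

theorem hasSum_eisLatticeTerm_even_even {k : ℕ} (hk : 0 < k) (z : UpperHalfPlane) {s : ℂ}
    (hs : 1 < s.re) :
    HasSum (({n : ℤ × ℤ | Even n.1 ∧ Even n.2}).indicator (eisLatticeTerm k z s))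
      (2 ^ (-(2 * s)) * ∑' n, eisLatticeTerm k z s n) := by
  rw [← tsum_mul_left]
  refine hasSum_indicator_range (g := fun n : ℤ × ℤ => (2 * n.1, 2 * n.2)) (fun a b h => ?_)
    (fun n => ?_) ((summable_eisLatticeTerm hk _ hs).mul_left _) ?_
  · simp only [Prod.mk.injEq, mul_eq_mul_left_iff, OfNat.ofNat_ne_zero, or_false] at h
    exact Prod.ext h.1 h.2
  · have := eisLatticeTerm_natCast_mul k z s (m := 2) two_pos n
    simpa only [Nat.cast_ofNat] using this
  · ext ⟨a, b⟩
    constructor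
    · rintro ⟨⟨c, hc⟩, d, hd⟩
      exact ⟨(c, d), Prod.ext (by simp only at hc ⊢; omega) (by simp only at hd ⊢; omega)⟩
    · rintro ⟨c, hc⟩
      rw [← hc]
      exact ⟨even_two_mul _, even_two_mul _⟩

theorem hasSum_eisLatticeTerm_even_odd {k : ℕ} (hk : 0 < k) (z : UpperHalfPlane) {s : ℂ}
    (hs : 1 < s.re) :
    HasSum (({n : ℤ × ℤ | Even n.1 ∧ Odd n.2}).indicator (eisLatticeTerm k z s))
      (2 ^ (-s) * ∑' n, eisLatticeTerm k (twoMul z) s n -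
        2 ^ (-(2 * s)) * ∑' n, eisLatticeTerm k z s n) := by
  have h := (hasSum_eisLatticeTerm_even hk z hs).sub (hasSum_eisLatticeTerm_even_even hk z hs)
  refine hasSum_of_eq h fun n => ?_
  simp only [indicator, mem_ofPred_eq]
  by_cases ha : Even n.1 <;> by_cases hb : Even n.2 <;> simp [ha, hb]

/-- The sum over pairs (even, odd) is evaluated in two ways. Such a pair is an odd multiple of a
coprime one, and each coset gives two coprime pairs ±(c,d): this is the left side. Subtracting the
pairs (even, even) from all pairs with even first entry gives lattice sums for 2z and z. -/
theorem summable_eisCosetTerm_and_eq {l : ℕ} (hl : Even l) (z : UpperHalfPlane) {s : ℂ}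
    (hs : 1 < s.re) :
    Summable (eisCosetTerm l z s) ∧
      (1 - 2 ^ (-(2 * s))) * riemannZeta (2 * s) * (2 * ∑' q, eisCosetTerm l z s q) =
        2 ^ (-s) * ∑' n, eisLatticeTerm (l + 2) (twoMul z) s n -
          2 ^ (-(2 * s)) * ∑' n, eisLatticeTerm (l + 2) z s n := by
  have hk : Even (l + 2) := hl.add even_two
  have hsum : Summable fun n : EvenCoprime => eisLatticeTerm (l + 2) z s n.1 :=
    (summable_eisLatticeTerm (by omega) z hs).comp_injective Subtype.val_injective
  have h1 := hsum.hasSum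
  rw [← (Equiv.ofBijective _ cosetPair_bijective).hasSum_iff] at h1
  have hterm : ∀ q b, eisLatticeTerm (l + 2) z s (cosetPair (q, b)).1 = eisCosetTerm l z s q := by
    intro q b
    rw [eisCosetTerm, eisTerm_eq]
    cases b
    · exact eisLatticeTerm_neg hk z s _
    · rfl
  have h2 : HasSum (fun x : Quotient (QuotientGroup.rightRel GammaInf) × Bool =>
      eisCosetTerm l z s x.1) (∑' n : EvenCoprime, eisLatticeTerm (l + 2) z s n.1) :=
    hasSum_of_eq h1 fun x => (hterm x.1 x.2).symm
  have h3 := h2.prod_fiberwise (g := fun q => 2 * eisCosetTerm l z s q) fun q => by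
    have := hasSum_fintype fun _ : Bool => eisCosetTerm l z s q
    simpa [two_mul] using this
  have hS : Summable (eisCosetTerm l z s) := by
    refine (h3.summable.mul_left (1 / 2)).congr fun q => ?_
    ring
  refine ⟨hS, ?_⟩
  have h4 : ∑' n : EvenCoprime, eisLatticeTerm (l + 2) z s n.1 = 2 * ∑' q, eisCosetTerm l z s q := by
    rw [← h3.tsum_eq, tsum_mul_left]
  have h5 := hasSum_mul_prod (hasSum_odd_cpow (s := 2 * s) (by simp; linarith)) hsum.hasSum
  have h6 := hasSum_indicator_range (g := fun x => (oddMulPair x).1)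
    (f := eisLatticeTerm (l + 2) z s) (Subtype.val_injective.comp oddMulPair_bijective.1)
    (fun x => eisLatticeTerm_natCast_mul (l + 2) z s x.1.2.pos x.2.1) h5.summable
    (s := {n : ℤ × ℤ | Even n.1 ∧ Odd n.2}) ?_
  · rw [← h4, ← h5.tsum_eq, ← (hasSum_eisLatticeTerm_even_odd (k := l + 2) (by omega) z hs).unique h6]
  · ext n
    constructor
    · intro hn
      obtain ⟨x, hx⟩ := oddMulPair_bijective.2 ⟨n, hn⟩
      exact ⟨x, congrArg Subtype.val hx⟩
    · rintro ⟨x, rfl⟩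
      exact (oddMulPair x).2

/-! ## The continuation of the Eisenstein series -/

/-- The continuation of the Eisenstein series at the cusp `∞`. -/
def eisContinuation (l : ℕ) (z : UpperHalfPlane) (s : ℂ) : ℂ :=
  ((4 * Real.pi : ℝ) : ℂ) ^ ((l : ℂ) / 2) / 4 * (Real.pi : ℂ) ^ ((l : ℂ) / 2 + 1) *
    ((2 ^ s * latticeMellin (l + 2) (twoMul z) s - latticeMellin (l + 2) z s) / (2 ^ (2 * s) - 1))

theorem eisContinuation_eq {l : ℕ} (hl : Even l) (z : UpperHalfPlane) {s : ℂ} (hs : 1 < s.re) :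
    eisContinuation l z s = eisSeries l z s := by
  have hk : 0 < l + 2 := by omega
  have h := (summable_eisCosetTerm_and_eq hl z hs).2
  have hpi : (Real.pi : ℂ) ≠ 0 := by exact_mod_cast Real.pi_ne_zero
  have h2 : (2 : ℂ) ^ (2 * s) ≠ 0 := by rw [Complex.cpow_ne_zero_iff]; left; norm_num
  have h2s : (2 : ℂ) ^ s ≠ 0 := by rw [Complex.cpow_ne_zero_iff]; left; norm_num
  have hne : (2 : ℂ) ^ (2 * s) - 1 ≠ 0 := by
    intro h0
    have := congrArg norm (sub_eq_zero.1 h0)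
    rw [← Complex.ofReal_ofNat, Complex.norm_cpow_eq_rpow_re_of_pos two_pos, norm_one] at this
    have h3 : (1 : ℝ) < 2 ^ (2 * s).re := Real.one_lt_rpow one_lt_two (by simp; linarith)
    exact h3.ne' this
  have e2 : (2 : ℂ) ^ (-(2 * s)) = ((2 : ℂ) ^ (2 * s))⁻¹ := Complex.cpow_neg _ _
  have e3 : (2 : ℂ) ^ (-s) = 2 ^ s * ((2 : ℂ) ^ (2 * s))⁻¹ := by
    rw [← Complex.cpow_neg, ← Complex.cpow_add _ _ two_ne_zero]; ring_nf
  rw [e2, e3] at h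
  have h' : riemannZeta (2 * s) * (2 * ∑' q, eisCosetTerm l z s q) =
      (2 ^ s * ∑' n, eisLatticeTerm (l + 2) (twoMul z) s n - ∑' n, eisLatticeTerm (l + 2) z s n) /
        (2 ^ (2 * s) - 1) := by
    rw [eq_div_iff hne]
    field_simp at h
    linear_combination h
  have ep : (Real.pi : ℂ) ^ ((l : ℂ) / 2 + 1) * (Real.pi : ℂ) ^ (-(s + ((l + 2 : ℕ) : ℂ) / 2)) =
      (Real.pi : ℂ) ^ (-s) := by
    rw [← Complex.cpow_add _ _ hpi]; congr 1; push_cast; ring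
  have eg : s + ((l + 2 : ℕ) : ℂ) / 2 = s + (l : ℂ) / 2 + 1 := by push_cast; ring
  -- The constant 1/4 is the 1/2 in the definition of the series times 1/2 for the double counting
  -- of cosets; π^(l/2+1) converts π^(-(s+l/2+1)) into π^(-s).
  rw [eisContinuation, latticeMellin_eq hk _ hs, latticeMellin_eq hk _ hs, eisSeries, ← ep]
  simp only [eg]
  linear_combination (-(((4 * Real.pi : ℝ) : ℂ) ^ ((l : ℂ) / 2) / 4 * ((Real.pi : ℂ) ^ ((l : ℂ) / 2 + 1) *
    (Real.pi : ℂ) ^ (-(s + (l : ℂ) / 2 + 1))) * Complex.Gamma (s + (l : ℂ) / 2 + 1))) * h'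

theorem differentiable_two_cpow : Differentiable ℂ fun s : ℂ => (2 : ℂ) ^ s := fun _ =>
  (differentiableAt_id).const_cpow (Or.inl two_ne_zero)

theorem isEisContinuation_eisContinuation {l : ℕ} (hl : Even l) :
    IsEisContinuation l (eisContinuation l) := by
  intro z
  have hk : 0 < l + 2 := by omega
  have h2 : Differentiable ℂ fun s : ℂ => (2 : ℂ) ^ (2 * s) - 1 :=
    (differentiable_two_cpow.comp (differentiable_id.const_mul 2)).sub_const 1
  have h1 : Differentiable ℂ fun s : ℂ =>
      2 ^ s * latticeMellin (l + 2) (twoMul z) s - latticeMellin (l + 2) z s :=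
    (differentiable_two_cpow.mul (differentiable_latticeMellin hk _)).sub
      (differentiable_latticeMellin hk _)
  refine ⟨fun _ _ => ?_, fun s hs => ?_, fun s hs => ?_⟩
  · exact (MeromorphicAt.const _ _).mul ((h1.analyticAt _).meromorphicAt.div (h2.analyticAt _).meromorphicAt)
  · exact (((h1 s).div (h2 s) (sub_ne_zero.2 hs)).const_mul _).differentiableWithinAt
  · exact ⟨(summable_eisCosetTerm_and_eq hl z hs).1, eisContinuation_eq hl z hs⟩

theorem countable_two_cpow_eq_one : {s : ℂ | (2 : ℂ) ^ (2 * s) = 1}.Countable := by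
  have hlog : Complex.log 2 ≠ 0 := by
    rw [← Complex.ofReal_ofNat, ← Complex.ofReal_log (by norm_num)]
    exact_mod_cast (Real.log_pos one_lt_two).ne'
  refine (countable_range fun n : ℤ => (n * (2 * Real.pi * Complex.I)) / (2 * Complex.log 2)).mono ?_
  intro s hs
  rw [mem_ofPred_eq, Complex.cpow_def_of_ne_zero two_ne_zero, Complex.exp_eq_one_iff] at hs
  obtain ⟨n, hn⟩ := hs
  refine ⟨n, ?_⟩
  simp only
  rw [← hn]
  field_simp

/-- The points with 2^(2s) = 1 are countable, so their complement is connected and the identity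
theorem applies from Re s > 1. Any admissible continuation may thus be replaced by the explicit one.
-/
theorem IsEisContinuation.eq_eisContinuation {l : ℕ} (hl : Even l) {E : UpperHalfPlane → ℂ → ℂ}
    (hE : IsEisContinuation l E) (z : UpperHalfPlane) {s : ℂ} (hs : (2 : ℂ) ^ (2 * s) ≠ 1) :
    E z s = eisContinuation l z s := by
  have h0 := isEisContinuation_eisContinuation hl
  set U : Set ℂ := {s : ℂ | (2 : ℂ) ^ (2 * s) ≠ 1} with hU
  have hUo : IsOpen U := by
    have hc : Continuous fun s : ℂ => (2 : ℂ) ^ (2 * s) :=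
      (differentiable_two_cpow.comp (differentiable_id.const_mul 2)).continuous
    exact isOpen_ne_fun hc continuous_const
  have hUc : IsPreconnected U :=
    (Set.Countable.isConnected_compl_of_one_lt_rank (by simp) countable_two_cpow_eq_one).isPreconnected
  have hne : ∀ s : ℂ, 1 < s.re → s ∈ U := fun s hs h => by
    have := congrArg norm h
    rw [← Complex.ofReal_ofNat, Complex.norm_cpow_eq_rpow_re_of_pos two_pos, norm_one] at this
    have h3 : (1 : ℝ) < 2 ^ (2 * s).re := Real.one_lt_rpow one_lt_two (by simp; linarith)
    exact h3.ne' this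
  refine ((hE z).2.1.analyticOnNhd hUo).eqOn_of_preconnected_of_eventuallyEq
    ((h0 z).2.1.analyticOnNhd hUo) hUc (hne 2 (by simp)) ?_ hs
  have ho : IsOpen {s : ℂ | 1 < s.re} := isOpen_lt continuous_const Complex.continuous_re
  filter_upwards [ho.mem_nhds (show (2 : ℂ) ∈ {s : ℂ | 1 < s.re} by simp)] with s hs
  rw [((hE z).2.2 s hs).2, ((h0 z).2.2 s hs).2]

end MaassLift

namespace MaassLift
open MeasureTheory Set Filter
open scoped Pointwise

/-! ## The Ford domain -/

instance : ContinuousConstSMul SL(2, ℤ) UpperHalfPlane :=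
  ⟨fun γ => continuous_const_smul (γ : GL (Fin 2) ℝ)⟩

instance : SMulInvariantMeasure SL(2, ℤ) UpperHalfPlane volume :=
  ⟨fun γ _ hs => measure_preimage_smul_of_nullMeasurableSet (G := GL (Fin 2) ℝ) hs.nullMeasurableSet γ⟩

theorem normSq_coe (z : UpperHalfPlane) : ‖(z : ℂ)‖ ^ 2 = z.re ^ 2 + z.im ^ 2 := by
  rw [← Complex.normSq_eq_norm_sq, Complex.normSq_apply]
  simp
  ring

theorem mem_fordDomain_iff {z : UpperHalfPlane} :
    z ∈ fordDomain ↔ |z.re| ≤ 1 / 2 ∧ |z.re| ≤ ‖(z : ℂ)‖ ^ 2 := by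
  have h1 : ‖2 * (z : ℂ) - 1‖ ^ 2 = 1 + 4 * (‖(z : ℂ)‖ ^ 2 - z.re) := by
    rw [normSq_coe, ← Complex.normSq_eq_norm_sq, Complex.normSq_apply]
    simp
    ring
  have h2 : ‖2 * (z : ℂ) + 1‖ ^ 2 = 1 + 4 * (‖(z : ℂ)‖ ^ 2 + z.re) := by
    rw [normSq_coe, ← Complex.normSq_eq_norm_sq, Complex.normSq_apply]
    simp
    ring
  rw [fordDomain, mem_ofPred_eq, ← one_le_sq_iff₀ (norm_nonneg _), ← one_le_sq_iff₀ (norm_nonneg _), h1, h2]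
  refine and_congr_right fun _ => ?_
  rw [abs_le]
  constructor
  · rintro ⟨h, h'⟩; constructor <;> linarith
  · rintro ⟨h, h'⟩; constructor <;> linarith

/-- The interior of the Ford domain. -/
def fordInterior : Set UpperHalfPlane := {z | |z.re| < 1 / 2 ∧ |z.re| < ‖(z : ℂ)‖ ^ 2}

theorem smul_im (γ : SL(2, ℤ)) (z : UpperHalfPlane) :
    (γ • z).im = z.im / ‖linForm z (bottomRow γ)‖ ^ 2 := by
  rw [ModularGroup.im_smul_eq_div_normSq, Complex.normSq_eq_norm_sq, ModularGroup.denom_apply]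
  rfl

theorem coe_smul_eq (γ : SL(2, ℤ)) (z : UpperHalfPlane) :
    ((γ • z : UpperHalfPlane) : ℂ) =
      ((γ 0 0 : ℤ) * (z : ℂ) + (γ 0 1 : ℤ)) / linForm z (bottomRow γ) := by
  rw [UpperHalfPlane.coe_specialLinearGroup_apply]
  simp [linForm, bottomRow]

/-- In the interior |z|² > |x|, so |mz+n|² exceeds m²|x| - 2|mn||x| + n², affine in |x| on [0,1/2].
At 0 it is n² ≥ 1, at 1/2 it is ((|m|-|n|)² + n²)/2 ≥ 1, because |m| ≠ |n| by parity. -/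
theorem one_lt_normSq_linForm {z : UpperHalfPlane} (hz : z ∈ fordInterior) {n : ℤ × ℤ}
    (h1 : Even n.1) (h0 : n.1 ≠ 0) (h2 : Odd n.2) : 1 < ‖linForm z n‖ ^ 2 := by
  obtain ⟨hx, hN⟩ := hz
  rw [normSq_coe] at hN
  rw [normSq_linForm]
  have hc : (0 : ℝ) < (n.1 : ℝ) ^ 2 := by positivity
  have hd1 : (1 : ℝ) ≤ (n.2 : ℝ) ^ 2 := by
    have : n.2 ≠ 0 := by rintro h; rw [h] at h2; simp at h2
    have : 1 ≤ n.2 ^ 2 := by have h4 := pow_ne_zero 2 this; have := sq_nonneg n.2; omega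
    exact_mod_cast this
  have hcd : (1 : ℝ) ≤ (|(n.1 : ℝ)| - |(n.2 : ℝ)|) ^ 2 := by
    have hne : |n.1| - |n.2| ≠ 0 := by
      intro h
      have h3 : |n.1| = |n.2| := by linarith
      have h4 : Even |n.1| := even_abs.2 h1
      rw [h3, even_abs] at h4
      exact Int.not_even_iff_odd.2 h2 h4
    have : 1 ≤ (|n.1| - |n.2|) ^ 2 := by
      have := sq_nonneg (|n.1| - |n.2|); have := pow_ne_zero 2 hne; omega
    exact_mod_cast this
  have e1 : (n.1 : ℝ) ^ 2 = |(n.1 : ℝ)| ^ 2 := (sq_abs _).symm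
  have e2 : (n.2 : ℝ) ^ 2 = |(n.2 : ℝ)| ^ 2 := (sq_abs _).symm
  have h3 : -(|(n.1 : ℝ)| * |(n.2 : ℝ)| * |z.re|) ≤ n.1 * n.2 * z.re := by
    rw [← abs_mul, ← abs_mul]
    exact neg_abs_le _
  have h4 : (n.1 : ℝ) ^ 2 * |z.re| < (n.1 : ℝ) ^ 2 * (z.re ^ 2 + z.im ^ 2) :=
    mul_lt_mul_of_pos_left hN hc
  have h5 : 1 ≤ (n.1 : ℝ) ^ 2 * |z.re| - 2 * (|(n.1 : ℝ)| * |(n.2 : ℝ)| * |z.re|) + (n.2 : ℝ) ^ 2 := by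
    rw [e2] at hd1
    rw [e1, e2]
    set a := |(n.1 : ℝ)|
    set b := |(n.2 : ℝ)|
    rcases le_total 0 (a ^ 2 - 2 * (a * b)) with h | h
    · have := mul_nonneg h (abs_nonneg z.re)
      linarith
    · have : (a ^ 2 - 2 * (a * b)) * (1 / 2) ≤ (a ^ 2 - 2 * (a * b)) * |z.re| :=
        mul_le_mul_of_nonpos_left hx.le h
      nlinarith
  nlinarith

/-- If c ≠ 0, both γ at z and γ⁻¹ at γz would strictly lower the imaginary part. If c = 0, γ is a
translation up to sign, trivial because the domain has width 1. -/
theorem eq_one_or_neg_one_of_mem_fordInterior {γ : SL(2, ℤ)} (hγ : γ ∈ CongruenceSubgroup.Gamma0 2)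
    {z : UpperHalfPlane} (hz : z ∈ fordInterior) (hz' : γ • z ∈ fordInterior) :
    γ = 1 ∨ γ = -1 := by
  have hev := mem_Gamma0_two_iff.1 hγ
  have hdet := Matrix.det_fin_two γ.1
  rw [γ.2] at hdet
  have hodd : Odd (γ 0 0 * γ 1 1) := by
    have : γ 0 0 * γ 1 1 = 1 + γ 0 1 * γ 1 0 := by linear_combination -hdet
    rw [this]
    exact odd_one.add_even (hev.mul_left _)
  rw [Int.odd_mul] at hodd
  by_cases h0 : γ 1 0 = 0
  · have hmem := mem_closure_neg_one_T_iff.2 h0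
    obtain ⟨n, hn⟩ := ModularGroup.exists_eq_T_zpow_of_c_eq_zero h0
    have h1 := hz.1
    have h2 := hz'.1
    rw [hn, ModularGroup.re_T_zpow_smul] at h2
    rw [abs_lt] at h1 h2
    have hn0 : n = 0 := by
      have h3 : (n : ℝ) < 1 := by linarith
      have h4 : (-1 : ℝ) < n := by linarith
      have h3' : n < 1 := by exact_mod_cast h3
      have h4' : -1 < n := by exact_mod_cast h4
      omega
    rw [h0, mul_zero, sub_zero] at hdet
    have hb : γ 0 1 = 0 := by
      have h5 := congrArg (UpperHalfPlane.coe) (hn UpperHalfPlane.I)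
      rw [hn0, zpow_zero, one_smul, coe_smul_eq] at h5
      simp only [linForm, bottomRow, h0, Int.cast_zero, zero_mul, zero_add] at h5
      have hd : ((γ 1 1 : ℤ) : ℂ) ≠ 0 := by
        intro h
        have : γ 1 1 = 0 := by exact_mod_cast h
        rw [this, mul_zero] at hdet
        exact one_ne_zero hdet
      rw [div_eq_iff hd] at h5
      have h6 := congrArg Complex.re h5
      simp [UpperHalfPlane.I] at h6
      exact h6
    rcases Int.mul_eq_one_iff_eq_one_or_neg_one.1 hdet.symm with ⟨ha, hd⟩ | ⟨ha, hd⟩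
    · left; ext i j; fin_cases i <;> fin_cases j <;> simp [ha, hd, hb, h0]
    · right; ext i j; fin_cases i <;> fin_cases j <;> simp [ha, hd, hb, h0]
  · exfalso
    have h1 := one_lt_normSq_linForm hz (n := bottomRow γ) hev h0 hodd.2
    have hinv : bottomRow γ⁻¹ = (-γ 1 0, γ 0 0) := by
      rw [bottomRow, Matrix.SpecialLinearGroup.SL2_inv_expl]; rfl
    have h2 := one_lt_normSq_linForm hz' (n := bottomRow γ⁻¹) (by rw [hinv]; exact hev.neg)
      (by rw [hinv]; exact neg_ne_zero.2 h0) (by rw [hinv]; exact hodd.1)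
    have e1 := smul_im γ z
    have e2 := smul_im γ⁻¹ (γ • z)
    rw [inv_smul_smul] at e2
    have l1 : (γ • z).im < z.im := by rw [e1]; exact div_lt_self z.im_pos h1
    have l2 : z.im < (γ • z).im := by
      conv_lhs => rw [e2]
      exact div_lt_self (γ • z).im_pos h2
    exact lt_asymm l1 l2

/-- Every point is equivalent under `Γ₀(2)` to a point of the Ford domain. -/
theorem exists_smul_mem_fordDomain (z : UpperHalfPlane) :
    ∃ γ ∈ CongruenceSubgroup.Gamma0 2, γ • z ∈ fordDomain := by
  obtain ⟨g, hg⟩ := ModularGroup.exists_smul_mem_fd z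
  set w := g • z with hw
  obtain ⟨hN, hx⟩ := hg
  rw [Complex.normSq_eq_norm_sq] at hN
  have hwim := w.im_pos
  -- The point w lies in the standard domain of SL₂(ℤ). If g is not in Γ₀(2), then S Tⁿ g is, as
  -- soon as g₀₀ + n g₁₀ is even: n = 0, or n = ±1 with the sign opposite to Re w.
  by_cases hc : Even (g 1 0)
  · refine ⟨g, mem_Gamma0_two_iff.2 hc, mem_fordDomain_iff.2 ⟨hx, ?_⟩⟩
    linarith
  have hSg : ∀ n : ℤ, ((ModularGroup.S * ModularGroup.T ^ n * g : SL(2, ℤ))) 1 0 = g 0 0 + n * g 1 0 := by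
    intro n
    rw [Matrix.SpecialLinearGroup.coe_mul, Matrix.SpecialLinearGroup.coe_mul, ModularGroup.coe_S,
      ModularGroup.coe_T_zpow]
    simp [Matrix.mul_apply, Fin.sum_univ_two]
  have hmem : ∀ n : ℤ, |w.re + n| ≤ 1 → 2 * |w.re + n| ≤ ‖(w : ℂ) + n‖ ^ 2 →
      (ModularGroup.S * ModularGroup.T ^ n * g) • z ∈ fordDomain := by
    intro n h1 h2
    rw [mul_smul, mul_smul, ← hw]
    set v := ModularGroup.T ^ n • w with hv
    have hvc : (v : ℂ) = w + n := by rw [hv, ModularGroup.coe_T_zpow_smul_eq]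
    have hvre : v.re = w.re + n := ModularGroup.re_T_zpow_smul w n
    rw [← hvc, ← hvre] at h2
    rw [← hvre] at h1
    have hc : ((ModularGroup.S • v : UpperHalfPlane) : ℂ) = (-(v : ℂ))⁻¹ := by
      rw [UpperHalfPlane.modular_S_smul]
    have hv0 : (v : ℂ) ≠ 0 := UpperHalfPlane.ne_zero v
    have hvn : 0 < ‖(v : ℂ)‖ ^ 2 := by positivity
    have hre : (ModularGroup.S • v).re = -v.re / ‖(v : ℂ)‖ ^ 2 := by
      rw [← UpperHalfPlane.coe_re, hc, Complex.inv_re, Complex.normSq_neg, Complex.normSq_eq_norm_sq]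
      simp
    rw [mem_fordDomain_iff, hre, hc, norm_inv, norm_neg, abs_div, abs_neg, abs_of_pos hvn, inv_pow,
      div_le_iff₀ hvn, div_le_iff₀ hvn, inv_mul_cancel₀ hvn.ne']
    exact ⟨by linarith, h1⟩
  have hNw := normSq_coe w
  have hnn : ∀ n : ℤ, ‖(w : ℂ) + n‖ ^ 2 = ‖(w : ℂ)‖ ^ 2 + 2 * n * w.re + n ^ 2 := by
    intro n
    rw [hNw, ← Complex.normSq_eq_norm_sq, Complex.normSq_apply]
    simp
    ring
  have hodd := Int.not_even_iff_odd.1 hc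
  rw [abs_le] at hx
  by_cases ha : Even (g 0 0)
  · refine ⟨ModularGroup.S * ModularGroup.T ^ (0 : ℤ) * g, mem_Gamma0_two_iff.2 ?_, hmem 0 ?_ ?_⟩
    · rw [hSg, zero_mul, add_zero]; exact ha
    · rw [abs_le]; push_cast; constructor <;> linarith
    · rw [hnn]
      have : |w.re + ((0 : ℤ) : ℝ)| ≤ 1 / 2 := by rw [abs_le]; push_cast; constructor <;> linarith
      push_cast
      push_cast at this
      linarith
  · have ha' := Int.not_even_iff_odd.1 ha
    rcases le_total 0 w.re with h | h
    · refine ⟨ModularGroup.S * ModularGroup.T ^ (-1 : ℤ) * g, mem_Gamma0_two_iff.2 ?_, hmem (-1) ?_ ?_⟩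
      · rw [hSg]; exact ha'.add_odd (by rw [neg_one_mul]; exact hodd.neg)
      · rw [abs_le]; push_cast; constructor <;> linarith
      · rw [hnn, abs_of_nonpos (by push_cast; linarith)]
        push_cast
        linarith
    · refine ⟨ModularGroup.S * ModularGroup.T ^ (1 : ℤ) * g, mem_Gamma0_two_iff.2 ?_, hmem 1 ?_ ?_⟩
      · rw [hSg]; exact ha'.add_odd (by rw [one_mul]; exact hodd)
      · rw [abs_le]; push_cast; constructor <;> linarith
      · rw [hnn, abs_of_nonneg (by push_cast; linarith)]
        push_cast
        linarith

/-! ### Null boundary, tilings of the strip, and unfolding -/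

theorem measurableSet_fordDomain : MeasurableSet fordDomain := by
  refine IsClosed.measurableSet ?_
  have hc := UpperHalfPlane.continuous_coe
  have h : fordDomain = {z : UpperHalfPlane | |z.re| ≤ 1 / 2} ∩ ({z : UpperHalfPlane | 1 ≤ ‖2 * (z : ℂ) - 1‖} ∩
    {z : UpperHalfPlane | 1 ≤ ‖2 * (z : ℂ) + 1‖}) := rfl
  rw [h]
  refine (isClosed_le UpperHalfPlane.continuous_re.abs continuous_const).inter
    ((isClosed_le continuous_const ?_).inter (isClosed_le continuous_const ?_))
  · exact ((continuous_const.mul hc).sub continuous_const).norm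
  · exact ((continuous_const.mul hc).add continuous_const).norm

theorem volume_preimage_coe_eq_zero {s : Set ℂ} (hs : volume s = 0) :
    volume (UpperHalfPlane.coe ⁻¹' s) = 0 := by
  rw [UpperHalfPlane.volume_eq_lintegral]
  exact setLIntegral_measure_zero _ _ (measure_mono_null (image_preimage_subset _ _) hs)

theorem volume_re_eq (a : ℝ) : volume {z : ℂ | z.re = a} = 0 := by
  have h : {z : ℂ | z.re = a} = Complex.measurableEquivRealProd ⁻¹' ({a} ×ˢ univ) := by
    ext z; simp [Complex.measurableEquivRealProd]
  rw [h, Complex.volume_preserving_equiv_real_prod.measure_preimage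
    ((measurableSet_singleton a).prod MeasurableSet.univ).nullMeasurableSet, Measure.volume_eq_prod,
    Measure.prod_prod]
  simp

theorem volume_circle (c : ℂ) (R : ℝ) : volume {z : ℂ | ‖z - c‖ = R} = 0 := by
  have : {z : ℂ | ‖z - c‖ = R} = Metric.sphere c R := by
    ext z; simp
  rw [this]
  exact Measure.addHaar_sphere volume c R

theorem volume_fordDomain_diff_interior : volume (fordDomain \ fordInterior) = 0 := by
  have h1 := volume_preimage_coe_eq_zero (volume_re_eq (1 / 2))
  have h2 := volume_preimage_coe_eq_zero (volume_re_eq (-1 / 2))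
  have h3 := volume_preimage_coe_eq_zero (volume_circle (1 / 2) (1 / 2))
  have h4 := volume_preimage_coe_eq_zero (volume_circle (-1 / 2) (1 / 2))
  refine measure_mono_null ?_ (measure_union_null (measure_union_null h1 h2) (measure_union_null h3 h4))
  rintro z ⟨hz, hz'⟩
  rw [mem_fordDomain_iff] at hz
  have hcirc : ∀ δ : ℝ, ‖(z : ℂ)‖ ^ 2 = 2 * δ * z.re → δ ^ 2 = (1 / 2) ^ 2 → ‖(z : ℂ) - δ‖ = 1 / 2 := by
    intro δ h hδ
    rw [← sq_eq_sq₀ (norm_nonneg _) (by norm_num), ← hδ]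
    have : ‖(z : ℂ) - δ‖ ^ 2 = ‖(z : ℂ)‖ ^ 2 - 2 * δ * z.re + δ ^ 2 := by
      rw [normSq_coe, ← Complex.normSq_eq_norm_sq, Complex.normSq_apply]
      simp
      ring
    rw [this, h]
    ring
  by_cases hx : |z.re| < 1 / 2
  · have hN : |z.re| = ‖(z : ℂ)‖ ^ 2 := le_antisymm hz.2 (not_lt.1 fun h => hz' ⟨hx, h⟩)
    right
    rcases abs_choice z.re with h | h
    · left
      have := hcirc (1 / 2) (by rw [← hN, h]; ring) rfl
      push_cast at this
      exact this
    · right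
      have := hcirc (-1 / 2) (by rw [← hN, h]; ring) (by norm_num)
      push_cast at this
      exact this
  · have hx' : |z.re| = 1 / 2 := le_antisymm hz.1 (not_lt.1 hx)
    left
    rcases abs_choice z.re with h | h
    · left
      change z.re = 1 / 2
      rw [← h, hx']
    · right
      change z.re = -1 / 2
      linarith

/-- An overlap point interior to one translate cannot be interior to the other, so the overlap lies
in two translates of the null boundary. -/
theorem aedisjoint_smul_fordDomain {γ δ : SL(2, ℤ)} (h : γ⁻¹ * δ ∈ CongruenceSubgroup.Gamma0 2)
    (h1 : γ⁻¹ * δ ≠ 1) (h2 : γ⁻¹ * δ ≠ -1) :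
    AEDisjoint volume (γ • fordDomain) (δ • fordDomain) := by
  have hn : ∀ γ : SL(2, ℤ), volume (γ • (fordDomain \ fordInterior)) = 0 := fun γ => by
    rw [measure_smul, volume_fordDomain_diff_interior]
  refine measure_mono_null ?_ (measure_union_null (hn γ) (hn δ))
  rintro z ⟨⟨a, ha, rfl⟩, b, hb, hab⟩
  simp only at hab
  by_cases ha' : a ∈ fordInterior
  · right
    refine ⟨b, ⟨hb, fun hb' => ?_⟩, hab⟩
    have e : (γ⁻¹ * δ) • b = a := by rw [mul_smul, hab, inv_smul_smul]
    rcases eq_one_or_neg_one_of_mem_fordInterior h hb' (by rw [e]; exact ha') with h | h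
    · exact h1 h
    · exact h2 h
  · left
    exact ⟨a, ⟨ha, ha'⟩, rfl⟩

/-- The vertical strip, a fundamental domain for the translations by integers. -/
def unitStrip : Set UpperHalfPlane := {z | -1 / 2 < z.re ∧ z.re ≤ 1 / 2}

theorem measurableSet_unitStrip : MeasurableSet unitStrip := by
  have h1 : MeasurableSet {z : UpperHalfPlane | -1 / 2 < z.re} :=
    (isOpen_lt continuous_const UpperHalfPlane.continuous_re).measurableSet
  have h2 : MeasurableSet {z : UpperHalfPlane | z.re ≤ 1 / 2} :=
    (isClosed_le UpperHalfPlane.continuous_re continuous_const).measurableSet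
  exact h1.inter h2

/-- The group of translations. -/
abbrev translations : Subgroup SL(2, ℤ) := Subgroup.zpowers ModularGroup.T

theorem isFundamentalDomain_unitStrip :
    IsFundamentalDomain translations unitStrip (volume : Measure UpperHalfPlane) := by
  refine IsFundamentalDomain.mk' measurableSet_unitStrip.nullMeasurableSet fun z => ?_
  obtain ⟨n, hn, huniq⟩ := existsUnique_add_zsmul_mem_Ioc (zero_lt_one' ℝ) z.re (-1 / 2)
  have hmem : ∀ m : ℤ, ModularGroup.T ^ m • z ∈ unitStrip ↔
      z.re + m • (1 : ℝ) ∈ Ioc (-1 / 2 : ℝ) (-1 / 2 + 1) := fun m => by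
    rw [unitStrip, mem_ofPred_eq, ModularGroup.re_T_zpow_smul, mem_Ioc]
    norm_num
  refine ⟨⟨ModularGroup.T ^ n, n, rfl⟩, (hmem n).2 hn, ?_⟩
  rintro ⟨_, m, rfl⟩ hm
  have := huniq m ((hmem m).1 hm)
  simp only [this]

theorem mem_GammaInf_iff {γ : CongruenceSubgroup.Gamma0 2} :
    γ ∈ GammaInf ↔ (γ : SL(2, ℤ)) 1 0 = 0 := by
  rw [GammaInf, Subgroup.mem_subgroupOf, mem_closure_neg_one_T_iff]

theorem coset_out_mul_mem (γ : CongruenceSubgroup.Gamma0 2) :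
    (((Quotient.mk (QuotientGroup.rightRel GammaInf) γ).out * γ⁻¹ : CongruenceSubgroup.Gamma0 2) :
      SL(2, ℤ)) 1 0 = 0 := by
  have h := Quotient.exact (Quotient.out_eq (Quotient.mk (QuotientGroup.rightRel GammaInf) γ))
  exact mem_GammaInf_iff.1 (QuotientGroup.rightRel_apply.1
    ((QuotientGroup.rightRel GammaInf).symm h))

theorem eq_of_out_eq_mul {q q' : Quotient (QuotientGroup.rightRel GammaInf)} {δ : SL(2, ℤ)}
    (hδ : δ 1 0 = 0) (h : (q'.out : SL(2, ℤ)) = δ * q.out) : q = q' := by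
  rw [← Quotient.out_equiv_out]
  refine QuotientGroup.rightRel_apply.2 (mem_GammaInf_iff.2 ?_)
  simpa [h] using hδ

theorem T_zpow_one_zero (n : ℤ) : (ModularGroup.T ^ n : SL(2, ℤ)) 1 0 = 0 := by
  rw [ModularGroup.coe_T_zpow]; rfl

theorem eq_zero_of_T_zpow {n : ℤ} (h : ModularGroup.T ^ n = 1 ∨ ModularGroup.T ^ n = -1) : n = 0 := by
  have h1 := ModularGroup.coe_T_zpow n
  rcases h with h | h
  · have := congrFun (congrFun h1 0) 1
    rw [h] at this
    simpa using this.symm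
  · have := congrFun (congrFun h1 0) 1
    rw [h] at this
    simpa using this.symm

/-- The union of the translates of the Ford domain by the coset representatives. -/
def fordUnion : Set UpperHalfPlane :=
  ⋃ q : Quotient (QuotientGroup.rightRel GammaInf), (q.out : SL(2, ℤ)) • fordDomain

theorem nullMeasurableSet_smul_fordDomain (γ : SL(2, ℤ)) :
    NullMeasurableSet (γ • fordDomain) (volume : Measure UpperHalfPlane) :=
  (measurableSet_fordDomain.const_smul γ).nullMeasurableSet

instance : Countable SL(2, ℤ) :=
  have : Countable (Matrix (Fin 2) (Fin 2) ℤ) := inferInstanceAs (Countable (Fin 2 → Fin 2 → ℤ))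
  Subtype.countable

instance : Countable (Quotient (QuotientGroup.rightRel GammaInf)) :=
  Quotient.countable

theorem pairwise_aedisjoint_fordDomain :
    Pairwise (Function.onFun (AEDisjoint (volume : Measure UpperHalfPlane))
      fun q : Quotient (QuotientGroup.rightRel GammaInf) => (q.out : SL(2, ℤ)) • fordDomain) := by
  intro q q' hqq
  refine aedisjoint_smul_fordDomain ?_ ?_ ?_
  · exact (q.out⁻¹ * q'.out).2
  · intro h
    refine hqq (eq_of_out_eq_mul (δ := 1) (by simp) ?_)
    rw [one_mul, ← mul_inv_cancel_left (q.out : SL(2, ℤ)) q'.out, h, mul_one]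
  · intro h
    refine hqq (eq_of_out_eq_mul (δ := -1) (by simp) ?_)
    rw [← mul_inv_cancel_left (q.out : SL(2, ℤ)) q'.out, h]
    simp

/-- If Tⁿ times one representative equals ± another, both represent the same coset and n = 0;
otherwise the translates meet in a null set. As -1 acts trivially, translations replace Γ_∞, and
unfolding becomes the comparison of two fundamental domains of one group. -/
theorem isFundamentalDomain_fordUnion :
    IsFundamentalDomain translations fordUnion (volume : Measure UpperHalfPlane) := by
  refine IsFundamentalDomain.mk'' ?_ (Eventually.of_forall fun z => ?_) ?_ ?_
  · exact NullMeasurableSet.iUnion fun q => nullMeasurableSet_smul_fordDomain _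
  · obtain ⟨γ, hγ, hz⟩ := exists_smul_mem_fordDomain z
    set g : CongruenceSubgroup.Gamma0 2 := ⟨γ, hγ⟩
    have h := coset_out_mul_mem g⁻¹
    rw [inv_inv] at h
    obtain ⟨n, hn⟩ := ModularGroup.exists_eq_T_zpow_of_c_eq_zero h
    refine ⟨⟨ModularGroup.T ^ n, n, rfl⟩, mem_iUnion.2 ⟨Quotient.mk _ g⁻¹, ⟨γ • z, hz, ?_⟩⟩⟩
    change _ = ModularGroup.T ^ n • z
    rw [← hn z, Subgroup.coe_mul, mul_smul]
  · rintro ⟨_, n, rfl⟩ hn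
    have hn0 : n ≠ 0 := by
      rintro rfl
      exact hn (Subtype.ext (zpow_zero _))
    change volume ((ModularGroup.T ^ n • fordUnion) ∩ fordUnion) = 0
    rw [fordUnion, smul_set_iUnion, iUnion_inter]
    refine measure_iUnion_null fun q => ?_
    rw [inter_iUnion]
    refine measure_iUnion_null fun q' => ?_
    rw [smul_smul]
    have hT : ModularGroup.T ^ n ∈ CongruenceSubgroup.Gamma0 2 := by
      rw [mem_Gamma0_two_iff, T_zpow_one_zero]; simp
    have key : ∀ δ : SL(2, ℤ), δ 1 0 = 0 → (q'.out : SL(2, ℤ)) = δ * (ModularGroup.T ^ n * q.out) →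
        δ * ModularGroup.T ^ n = 1 := by
      intro δ hδ h
      rw [← mul_assoc] at h
      have h3 : (δ * ModularGroup.T ^ n) 1 0 = 0 := by
        rw [← mem_closure_neg_one_T_iff] at hδ ⊢
        exact mul_mem hδ (mem_closure_neg_one_T_iff.2 (T_zpow_one_zero n))
      have h2 := eq_of_out_eq_mul h3 h
      rw [← h2] at h
      exact (mul_eq_right.1 h.symm)
    refine aedisjoint_smul_fordDomain ?_ ?_ ?_
    · exact mul_mem (inv_mem (mul_mem hT q.out.2)) q'.out.2
    · intro h
      have := key 1 (by simp) (by
        rw [one_mul, ← mul_inv_cancel_left (ModularGroup.T ^ n * (q.out : SL(2, ℤ))) q'.out, h, mul_one])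
      rw [one_mul] at this
      exact hn0 (eq_zero_of_T_zpow (Or.inl this))
    · intro h
      have := key (-1) (by simp) (by
        rw [← mul_inv_cancel_left (ModularGroup.T ^ n * (q.out : SL(2, ℤ))) q'.out, h]
        simp)
      rw [neg_one_mul, neg_eq_iff_eq_neg] at this
      exact hn0 (eq_zero_of_T_zpow (Or.inr this))
  · exact fun g => (measurePreserving_smul g volume).quasiMeasurePreserving

/-- Unfolding: the integral over the Ford domain of a sum over `Γ_∞ \ Γ₀(2)` is an integral over
the strip. -/
theorem integral_fordDomain_tsum {G : UpperHalfPlane → ℂ} (hT : ∀ z, G (ModularGroup.T • z) = G z)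
    (hG : IntegrableOn G unitStrip) :
    ∫ z in fordDomain, ∑' q : Quotient (QuotientGroup.rightRel GammaInf),
      G ((q.out : SL(2, ℤ)) • z) = ∫ z in unitStrip, G z := by
  have hinv : ∀ (g : translations) (z : UpperHalfPlane), G (g • z) = G z := by
    rintro ⟨_, n, rfl⟩ z
    change G (ModularGroup.T ^ n • z) = G z
    induction n generalizing z with
    | zero => simp
    | succ n ih => rw [zpow_add_one, mul_smul, ih, hT]
    | pred n ih =>
      rw [zpow_sub_one, mul_smul, ih, ← hT (ModularGroup.T⁻¹ • z), smul_inv_smul]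
  have hU : IntegrableOn G fordUnion :=
    (isFundamentalDomain_fordUnion.integrableOn_iff isFundamentalDomain_unitStrip hinv).2 hG
  have hcv : ∀ (γ : SL(2, ℤ)) (F : UpperHalfPlane → ℂ),
      ∫ z in γ • fordDomain, F z = ∫ z in fordDomain, F (γ • z) := fun γ F => by
    rw [← image_smul]
    exact (measurePreserving_smul γ volume).setIntegral_image_emb (measurableEmbedding_const_smul γ) _ _
  have hcvn : ∀ (γ : SL(2, ℤ)) (F : UpperHalfPlane → ℝ),
      ∫ z in γ • fordDomain, F z = ∫ z in fordDomain, F (γ • z) := fun γ F => by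
    rw [← image_smul]
    exact (measurePreserving_smul γ volume).setIntegral_image_emb (measurableEmbedding_const_smul γ) _ _
  have h1 := hasSum_integral_iUnion_ae (fun q => nullMeasurableSet_smul_fordDomain _)
    pairwise_aedisjoint_fordDomain hU
  -- The same decomposition for |G| gives the summability that permits exchanging sum and integral.
  have h2 := hasSum_integral_iUnion_ae (fun q => nullMeasurableSet_smul_fordDomain _)
    pairwise_aedisjoint_fordDomain hU.norm
  simp only [hcv] at h1
  simp only [hcvn] at h2
  have hint : ∀ q : Quotient (QuotientGroup.rightRel GammaInf),
      IntegrableOn (fun z => G ((q.out : SL(2, ℤ)) • z)) fordDomain := fun q => by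
    have : IntegrableOn G ((q.out : SL(2, ℤ)) • fordDomain) := hU.mono_set (subset_iUnion_of_subset q le_rfl)
    rw [← image_smul] at this
    exact ((measurePreserving_smul (q.out : SL(2, ℤ)) volume).integrableOn_image
      (measurableEmbedding_const_smul _)).1 this
  rw [← (hasSum_integral_of_summable_integral_norm hint h2.summable).tsum_eq, h1.tsum_eq]
  exact isFundamentalDomain_fordUnion.setIntegral_eq isFundamentalDomain_unitStrip hinv

end MaassLift

namespace MaassLift
open MeasureTheory Set Filter

/-! ## The Fricke involution -/

/-- The matrix of `z ↦ -1/(2z)`. -/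
def frickeMatrix : GL (Fin 2) ℝ :=
  Matrix.GeneralLinearGroup.mkOfDetNeZero !![0, -1; 2, 0] (by simp)

/-- The Fricke involution `z ↦ -1/(2z)`. -/
def fricke (z : UpperHalfPlane) : UpperHalfPlane := frickeMatrix • z

theorem coe_fricke (z : UpperHalfPlane) : (fricke z : ℂ) = -1 / (2 * z) := by
  rw [fricke, UpperHalfPlane.coe_smul_of_det_pos]
  · simp [UpperHalfPlane.num, UpperHalfPlane.denom, frickeMatrix]
  · simp [frickeMatrix]

theorem ofComplex_neg_inv (z : UpperHalfPlane) :
    UpperHalfPlane.ofComplex (-1 / (2 * (z : ℂ))) = fricke z := by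
  rw [← coe_fricke, UpperHalfPlane.ofComplex_apply]

theorem fricke_fricke (z : UpperHalfPlane) : fricke (fricke z) = z := by
  apply UpperHalfPlane.ext
  rw [coe_fricke, coe_fricke]
  have := UpperHalfPlane.ne_zero z
  field_simp

theorem norm_fricke (z : UpperHalfPlane) : ‖(fricke z : ℂ)‖ = 1 / (2 * ‖(z : ℂ)‖) := by
  rw [coe_fricke]; simp

theorem fricke_im (z : UpperHalfPlane) : (fricke z).im = z.im / (2 * ‖(z : ℂ)‖ ^ 2) := by
  rw [← UpperHalfPlane.coe_im, coe_fricke, ← Complex.normSq_eq_norm_sq, Complex.div_im]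
  have := Complex.normSq_pos.2 (UpperHalfPlane.ne_zero z)
  simp
  field_simp

theorem fricke_re (z : UpperHalfPlane) : (fricke z).re = -z.re / (2 * ‖(z : ℂ)‖ ^ 2) := by
  rw [← UpperHalfPlane.coe_re, coe_fricke, ← Complex.normSq_eq_norm_sq, Complex.div_re]
  have := Complex.normSq_pos.2 (UpperHalfPlane.ne_zero z)
  simp
  field_simp

theorem measurePreserving_fricke :
    MeasurePreserving fricke (volume : Measure UpperHalfPlane) volume :=
  measurePreserving_smul frickeMatrix volume

theorem measurableEmbedding_fricke : MeasurableEmbedding fricke :=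
  measurableEmbedding_const_smul frickeMatrix

/-- The part of the Ford domain above the circle fixed by the Fricke involution. -/
def fordUpper : Set UpperHalfPlane := {z | |z.re| ≤ 1 / 2 ∧ 1 / 2 ≤ ‖(z : ℂ)‖ ^ 2}

theorem isClosed_fordUpper : IsClosed fordUpper :=
  (isClosed_le UpperHalfPlane.continuous_re.abs continuous_const).inter
    (isClosed_le continuous_const (UpperHalfPlane.continuous_coe.norm.pow 2))

/-- The lowest points are the corners with |x| = 1/2 and |z|² = 1/2; hence the threshold 1/2 in all
estimates near the cusp. -/
theorem half_le_im_of_mem_fordUpper {z : UpperHalfPlane} (hz : z ∈ fordUpper) : 1 / 2 ≤ z.im := by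
  obtain ⟨h1, h2⟩ := hz
  rw [normSq_coe, ← sq_abs z.re] at h2
  have := z.im_pos
  nlinarith [abs_nonneg z.re]

/-- The involution z ↦ -1/(2z) exchanges the conditions |x| ≤ 1/2 and |x| ≤ |z|², and reverses |z|²
≥ 1/2. The cusp 0 is thereby moved to ∞ and needs no analysis of its own. -/
theorem fordDomain_eq : fordDomain = fordUpper ∪ fricke '' fordUpper := by
  ext z
  have hz : 0 < ‖(z : ℂ)‖ := norm_pos_iff.2 (UpperHalfPlane.ne_zero z)
  have hf : z ∈ fricke '' fordUpper ↔ |z.re| ≤ ‖(z : ℂ)‖ ^ 2 ∧ ‖(z : ℂ)‖ ^ 2 ≤ 1 / 2 := by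
    have e1 : z ∈ fricke '' fordUpper ↔ fricke z ∈ fordUpper := by
      constructor
      · rintro ⟨w, hw, rfl⟩; rwa [fricke_fricke]
      · exact fun h => ⟨_, h, fricke_fricke z⟩
    rw [e1, fordUpper, mem_ofPred_eq, fricke_re, norm_fricke, abs_div, abs_neg,
      abs_of_pos (by positivity : 0 < 2 * ‖(z : ℂ)‖ ^ 2), div_le_iff₀ (by positivity), div_pow,
      le_div_iff₀ (by positivity)]
    constructor
    · rintro ⟨h, h'⟩; constructor <;> nlinarith
    · rintro ⟨h, h'⟩; constructor <;> nlinarith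
  rw [mem_union, hf, mem_fordDomain_iff, fordUpper, mem_ofPred_eq]
  constructor
  · rintro ⟨h1, h2⟩
    rcases le_total (1 / 2) (‖(z : ℂ)‖ ^ 2) with h | h
    · exact Or.inl ⟨h1, h⟩
    · exact Or.inr ⟨h2, h⟩
  · rintro (⟨h1, h2⟩ | ⟨h1, h2⟩) <;> constructor <;> linarith

theorem aedisjoint_fordUpper :
    AEDisjoint (volume : Measure UpperHalfPlane) fordUpper (fricke '' fordUpper) := by
  refine measure_mono_null ?_ (volume_preimage_coe_eq_zero (volume_circle 0 (Real.sqrt (1 / 2))))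
  rintro z ⟨hz, w, hw, rfl⟩
  have hn : 0 < ‖(w : ℂ)‖ := norm_pos_iff.2 (UpperHalfPlane.ne_zero w)
  have h1 := hz.2
  have h2 := hw.2
  rw [mem_preimage, mem_ofPred_eq, sub_zero]
  rw [norm_fricke] at h1 ⊢
  rw [eq_comm, Real.sqrt_eq_iff_eq_sq (by norm_num) (by positivity)]
  rw [div_pow, le_div_iff₀ (by positivity)] at h1
  have h3 : ‖(w : ℂ)‖ ^ 2 = 1 / 2 := by nlinarith
  rw [div_pow, mul_pow, h3]
  norm_num

/-- Integrals over the Ford domain as integrals over its upper half. -/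
theorem integrableOn_fordDomain {g : UpperHalfPlane → ℂ} (h1 : IntegrableOn g fordUpper)
    (h2 : IntegrableOn (fun z => g (fricke z)) fordUpper) :
    IntegrableOn g fordDomain ∧
      ∫ z in fordDomain, g z = (∫ z in fordUpper, g z) + ∫ z in fordUpper, g (fricke z) := by
  have h3 : IntegrableOn g (fricke '' fordUpper) :=
    (measurePreserving_fricke.integrableOn_image measurableEmbedding_fricke).2 h2
  rw [fordDomain_eq]
  refine ⟨h1.union h3, ?_⟩
  rw [setIntegral_union₀ aedisjoint_fordUpper
    (measurableEmbedding_fricke.measurableSet_image.2 isClosed_fordUpper.measurableSet).nullMeasurableSet h1 h3,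
    measurePreserving_fricke.setIntegral_image_emb measurableEmbedding_fricke]

/-! ## The invariant measure in coordinates -/

/-- The point `x + iy`. -/
def mkPoint (p : ℝ × ℝ) : UpperHalfPlane := UpperHalfPlane.ofComplex (p.1 + p.2 * Complex.I)

theorem coe_mkPoint {p : ℝ × ℝ} (hp : 0 < p.2) : (mkPoint p : ℂ) = p.1 + p.2 * Complex.I := by
  rw [mkPoint, UpperHalfPlane.ofComplex_apply_of_im_pos (by simpa using hp)]

theorem mkPoint_re {p : ℝ × ℝ} (hp : 0 < p.2) : (mkPoint p).re = p.1 := by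
  rw [← UpperHalfPlane.coe_re, coe_mkPoint hp]; simp

theorem mkPoint_im {p : ℝ × ℝ} (hp : 0 < p.2) : (mkPoint p).im = p.2 := by
  rw [← UpperHalfPlane.coe_im, coe_mkPoint hp]; simp

/-- The coordinates of a point. -/
def coords (z : UpperHalfPlane) : ℝ × ℝ := (z.re, z.im)

theorem mkPoint_coords (z : UpperHalfPlane) : mkPoint (coords z) = z := by
  apply UpperHalfPlane.ext
  rw [coe_mkPoint (show 0 < (coords z).2 from z.im_pos)]
  exact Complex.re_add_im _

theorem measurableEmbedding_coords : MeasurableEmbedding coords :=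
  Complex.measurableEquivRealProd.measurableEmbedding.comp UpperHalfPlane.measurableEmbedding_coe

theorem map_coords :
    Measure.map coords volume = ((volume : Measure (ℝ × ℝ)).restrict {p | 0 < p.2}).withDensity
      fun p => (((1 / ‖p.2‖₊) ^ 2 : NNReal) : ENNReal) := by
  ext s hs
  have hpos : MeasurableSet {p : ℝ × ℝ | 0 < p.2} := measurableSet_lt measurable_const measurable_snd
  rw [measurableEmbedding_coords.map_apply, UpperHalfPlane.volume_eq_lintegral, withDensity_apply _ hs,
    Measure.restrict_restrict hs]
  have h : UpperHalfPlane.coe '' (coords ⁻¹' s) =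
      Complex.measurableEquivRealProd ⁻¹' (s ∩ {p | 0 < p.2}) := by
    ext z
    constructor
    · rintro ⟨w, hw, rfl⟩
      exact ⟨hw, w.im_pos⟩
    · rintro ⟨h1, h2⟩
      exact ⟨⟨z, h2⟩, h1, rfl⟩
  rw [h, ← Complex.volume_preserving_equiv_real_prod.setLIntegral_comp_preimage (hs.inter hpos)
    (f := fun p => (((1 / ‖p.2‖₊) ^ 2 : NNReal) : ENNReal))]
  · rfl
  · fun_prop

theorem measurable_density : Measurable fun p : ℝ × ℝ => (1 / ‖p.2‖₊) ^ 2 := by fun_prop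

theorem coords_preimage (A B : Set ℝ) :
    coords ⁻¹' (A ×ˢ B) = {z : UpperHalfPlane | z.re ∈ A ∧ z.im ∈ B} := rfl

theorem integrableOn_coords {A B : Set ℝ} (hA : MeasurableSet A) (hB : MeasurableSet B)
    (hB0 : B ⊆ Ioi 0) {G : UpperHalfPlane → ℂ} :
    IntegrableOn G {z | z.re ∈ A ∧ z.im ∈ B} ↔
      IntegrableOn (fun p : ℝ × ℝ => ((1 / p.2 ^ 2 : ℝ) : ℂ) * G (mkPoint p)) (A ×ˢ B) := by
  have hs : A ×ˢ B ⊆ {p : ℝ × ℝ | 0 < p.2} := fun p hp => hB0 hp.2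
  have e : (fun p : ℝ × ℝ => ((1 / p.2 ^ 2 : ℝ) : ℂ) * G (mkPoint p)) =
      fun p : ℝ × ℝ => (((1 / ‖p.2‖₊) ^ 2 : NNReal)) • G (mkPoint p) := by
    ext p
    rw [NNReal.smul_def]
    simp
  rw [e, IntegrableOn, IntegrableOn, ← Measure.restrict_restrict_of_subset hs,
    ← integrable_withDensity_iff_integrable_smul measurable_density,
    ← restrict_withDensity (hA.prod hB), ← map_coords]
  rw [← IntegrableOn, ← IntegrableOn, measurableEmbedding_coords.integrableOn_map_iff, coords_preimage]
  refine integrableOn_congr_fun (fun z _ => ?_) ?_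
  · simp [mkPoint_coords]
  · exact measurableEmbedding_coords.measurable (hA.prod hB)

theorem setIntegral_coords {A B : Set ℝ} (hA : MeasurableSet A) (hB : MeasurableSet B)
    (hB0 : B ⊆ Ioi 0) (G : UpperHalfPlane → ℂ) :
    ∫ z in {z | z.re ∈ A ∧ z.im ∈ B}, G z =
      ∫ p in A ×ˢ B, ((1 / p.2 ^ 2 : ℝ) : ℂ) * G (mkPoint p) := by
  have hs : A ×ˢ B ⊆ {p : ℝ × ℝ | 0 < p.2} := fun p hp => hB0 hp.2
  have e : (fun p : ℝ × ℝ => ((1 / p.2 ^ 2 : ℝ) : ℂ) * G (mkPoint p)) =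
      fun p : ℝ × ℝ => (((1 / ‖p.2‖₊) ^ 2 : NNReal)) • G (mkPoint p) := by
    ext p
    rw [NNReal.smul_def]
    simp
  rw [e, ← Measure.restrict_restrict_of_subset hs,
    ← integral_withDensity_eq_integral_smul measurable_density,
    ← restrict_withDensity (hA.prod hB), ← map_coords, measurableEmbedding_coords.setIntegral_map,
    coords_preimage]
  simp [mkPoint_coords]

theorem volume_fordUpper_lt_top : volume fordUpper < ⊤ := by
  have h : IntegrableOn (fun _ : UpperHalfPlane => (1 : ℂ))
      {z | z.re ∈ Icc (-1 / 2 : ℝ) (1 / 2) ∧ z.im ∈ Ioi (1 / 4 : ℝ)} := by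
    rw [integrableOn_coords measurableSet_Icc measurableSet_Ioi
      (fun x (hx : 1 / 4 < x) => show 0 < x by linarith)]
    have h1 : IntegrableOn (fun _ : ℝ => (1 : ℂ)) (Icc (-1 / 2) (1 / 2)) := by simp
    have h2 : IntegrableOn (fun y : ℝ => ((1 / y ^ 2 : ℝ) : ℂ)) (Ioi (1 / 4)) := by
      have : IntegrableOn (fun y : ℝ => ((y ^ (-2 : ℝ) : ℝ) : ℂ)) (Ioi (1 / 4)) :=
        (integrableOn_Ioi_rpow_of_lt (by norm_num) (by norm_num)).ofReal
      refine this.congr_fun (fun y (hy : 1 / 4 < y) => ?_) measurableSet_Ioi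
      simp only
      have hy0 : 0 < y := by linarith
      rw [Real.rpow_neg hy0.le]
      norm_num
    have := Integrable.mul_prod h1 h2
    rw [Measure.prod_restrict] at this
    refine this.congr (Eventually.of_forall fun p => ?_)
    simp
  have h2 := (integrableOn_const_iff (C := (1 : ℂ)) (by simp)).1 h
  rcases h2 with h2 | h2
  · simp at h2
  · refine (measure_mono fun z hz => ?_).trans_lt h2
    have := half_le_im_of_mem_fordUpper hz
    have h3 := abs_le.1 hz.1
    exact ⟨⟨by linarith, h3.2⟩, show 1 / 4 < z.im by linarith⟩

end MaassLift

namespace MaassLift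
open MeasureTheory Set Filter

/-! ## Reduction to the upper half of the Ford domain -/

/-- Reduce by Γ₀(2) to the Ford domain and, if needed, by the Fricke involution to its upper half.
The new height is y/|cz+d|² or y/(2|az+b|²); a nonzero first coefficient bounds it by 1/y, and c = 0
by y. In the second case a ≠ 0 because ad is odd. -/
theorem exists_reduction (z : UpperHalfPlane) :
    ∃ w ∈ fordUpper, w.im ≤ max z.im z.im⁻¹ ∧
      ∀ g : UpperHalfPlane → ℝ, (∀ γ ∈ CongruenceSubgroup.Gamma0 2, ∀ z, g (γ • z) = g z) →
        (∀ z, g (fricke z) = g z) → g w = g z := by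
  obtain ⟨γ, hγ, hz⟩ := exists_smul_mem_fordDomain z
  have hy := z.im_pos
  have hdet := Matrix.det_fin_two γ.1
  rw [γ.2] at hdet
  have hlow : ∀ n : ℤ × ℤ, n.1 ≠ 0 → z.im ^ 2 ≤ ‖linForm z n‖ ^ 2 := fun n hn => by
    rw [normSq_linForm]
    have h1 : (1 : ℝ) ≤ (n.1 : ℝ) ^ 2 := by
      have : 1 ≤ n.1 ^ 2 := by have h4 := pow_ne_zero 2 hn; have := sq_nonneg n.1; omega
      exact_mod_cast this
    nlinarith [sq_nonneg (n.1 * z.re + n.2 : ℝ), sq_nonneg z.im]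
  rw [fordDomain_eq] at hz
  rcases hz with hz | ⟨w, hw, hwz⟩
  · refine ⟨γ • z, hz, ?_, fun g h1 _ => h1 γ hγ z⟩
    rw [smul_im]
    by_cases hc : γ 1 0 = 0
    · rw [hc, mul_zero, sub_zero] at hdet
      refine le_max_of_le_left (div_le_self hy.le ?_)
      rw [normSq_linForm]
      have hd : (1 : ℝ) ≤ ((γ 1 1 : ℤ) : ℝ) ^ 2 := by
        rcases Int.mul_eq_one_iff_eq_one_or_neg_one.1 hdet.symm with ⟨-, hd⟩ | ⟨-, hd⟩ <;> rw [hd] <;> simp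
      simpa [bottomRow, hc] using hd
    · refine le_max_of_le_right ?_
      have h := hlow (bottomRow γ) hc
      rw [div_le_iff₀ (lt_of_lt_of_le (by positivity) h), inv_mul_eq_div, le_div_iff₀ hy]
      nlinarith
  · have hev := mem_Gamma0_two_iff.1 hγ
    have ha : γ 0 0 ≠ 0 := by
      intro h
      rw [h, zero_mul, zero_sub] at hdet
      have : Even (1 : ℤ) := by rw [hdet]; exact (hev.mul_left _).neg
      exact absurd this (by decide)
    have hwf : w = fricke (γ • z) := by rw [← hwz, fricke_fricke]
    refine ⟨w, hw, le_max_of_le_right ?_, fun g h1 h2 => by rw [hwf, h2, h1 γ hγ]⟩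
    have h := hlow (γ 0 0, γ 0 1) ha
    have hl0 : 0 < ‖linForm z (bottomRow γ)‖ ^ 2 := by
      have := (γ • z).im_pos
      rw [smul_im] at this
      exact (div_pos_iff_of_pos_left hy).1 this
    have hpos : 0 < ‖linForm z (γ 0 0, γ 0 1)‖ ^ 2 := lt_of_lt_of_le (by positivity) h
    have e : ((γ • z : UpperHalfPlane) : ℂ) = linForm z (γ 0 0, γ 0 1) / linForm z (bottomRow γ) :=
      coe_smul_eq γ z
    rw [hwf, fricke_im, e, smul_im, norm_div, div_pow]
    have : z.im / ‖linForm z (bottomRow γ)‖ ^ 2 /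
        (2 * (‖linForm z (γ 0 0, γ 0 1)‖ ^ 2 / ‖linForm z (bottomRow γ)‖ ^ 2)) =
        z.im / (2 * ‖linForm z (γ 0 0, γ 0 1)‖ ^ 2) := by
      have hl1 : ‖linForm z (bottomRow γ)‖ ≠ 0 := fun h => by simp [h] at hl0
      field_simp
    rw [this, div_le_iff₀ (by positivity), inv_mul_eq_div, le_div_iff₀ hy]
    nlinarith

/-! ## Fourier series -/

theorem integral_exp_two_pi_int (k : ℤ) :
    ∫ x in Ioc (-1 / 2 : ℝ) (1 / 2), Complex.exp (2 * Real.pi * Complex.I * k * x) =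
      if k = 0 then 1 else 0 := by
  rw [← intervalIntegral.integral_of_le (by norm_num)]
  split_ifs with hk
  · subst hk; norm_num
  · have hc : (2 * Real.pi * Complex.I * k : ℂ) ≠ 0 := by
      simp [hk, Real.pi_ne_zero]
    rw [integral_exp_mul_complex hc]
    have : Complex.exp (2 * Real.pi * Complex.I * k * (1 / 2 : ℝ)) =
        Complex.exp (2 * Real.pi * Complex.I * k * (-1 / 2 : ℝ)) := by
      rw [Complex.exp_eq_exp_iff_exists_int]
      exact ⟨k, by push_cast; ring⟩
    rw [this, sub_self, zero_div]

theorem norm_exp_two_pi_int (k : ℤ) (x : ℝ) :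
    ‖Complex.exp (2 * Real.pi * Complex.I * k * x)‖ = 1 := by
  have : (2 * Real.pi * Complex.I * k * x : ℂ) = ((2 * Real.pi * k * x : ℝ) : ℂ) * Complex.I := by
    push_cast; ring
  rw [this, Complex.norm_exp_ofReal_mul_I]

/-- The integral over a period of an absolutely convergent Fourier series. -/
theorem hasSum_integral_fourier {ι : Type*} [Countable ι] {a : ι → ℂ} (ha : Summable fun i => ‖a i‖)
    (k : ι → ℤ) {F : ℝ → ℂ}
    (hF : ∀ x : ℝ, HasSum (fun i => a i * Complex.exp (2 * Real.pi * Complex.I * k i * x)) (F x)) :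
    HasSum (fun i => if k i = 0 then a i else 0) (∫ x in Ioc (-1 / 2 : ℝ) (1 / 2), F x) := by
  have hcont : ∀ i, Continuous fun x : ℝ => a i * Complex.exp (2 * Real.pi * Complex.I * k i * x) :=
    fun i => by fun_prop
  have h := hasSum_integral_of_summable_integral_norm (μ := volume.restrict (Ioc (-1 / 2 : ℝ) (1 / 2)))
    (F := fun i (x : ℝ) => a i * Complex.exp (2 * Real.pi * Complex.I * k i * x))
    (fun i => ((hcont i).integrableOn_Icc.mono_set Ioc_subset_Icc_self)) ?_
  · have e : ∀ x : ℝ, ∑' i, a i * Complex.exp (2 * Real.pi * Complex.I * k i * x) = F x :=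
      fun x => (hF x).tsum_eq
    simp only [e] at h
    refine hasSum_of_eq h fun i => ?_
    rw [integral_const_mul, integral_exp_two_pi_int]
    simp
  · refine ha.congr fun i => ?_
    simp only [norm_mul, norm_exp_two_pi_int, mul_one]
    simp
    norm_num

/-! ## Bounds for Maass forms -/

section MaassBounds

variable {r : ℂ} {f : UpperHalfPlane → ℂ} {c : ℤ → ℂ} {ε : ℂ}

theorem IsMaassCuspForm.continuous (hf : IsMaassCuspForm r f) : Continuous f := by
  have h := hf.smooth.continuousOn.comp_continuous UpperHalfPlane.continuous_coe fun z => z.im_pos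
  simpa [Function.comp_def] using h

theorem IsMaassCuspForm.T_zpow_smul (hf : IsMaassCuspForm r f) (n : ℤ) (z : UpperHalfPlane) :
    f (ModularGroup.T ^ n • z) = f z :=
  hf.invariant _ (mem_Gamma0_two_iff.2 (by rw [T_zpow_one_zero]; simp)) z

theorem HasAtkinLehnerEigenvalue.fricke (h : HasAtkinLehnerEigenvalue f ε) (z : UpperHalfPlane) :
    f (MaassLift.fricke z) = ε * f z := by
  rw [← ofComplex_neg_inv]; exact h z

theorem exists_T_zpow_re (z : UpperHalfPlane) : ∃ n : ℤ, |(ModularGroup.T ^ n • z).re| ≤ 1 / 2 := by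
  obtain ⟨n, hn, -⟩ := existsUnique_add_zsmul_mem_Ioc (zero_lt_one' ℝ) z.re (-1 / 2)
  refine ⟨n, ?_⟩
  rw [ModularGroup.re_T_zpow_smul, abs_le]
  simp only [zsmul_eq_mul, mul_one, mem_Ioc] at hn
  constructor <;> linarith [hn.1, hn.2]

/-- Moderate growth covers y ≥ 1; for 1/2 ≤ y ≤ 1 translate into a compact rectangle. The base 2y is
at least 1, so one exponent serves both ranges. -/
theorem IsMaassCuspForm.exists_norm_le_pow (hf : IsMaassCuspForm r f) :
    ∃ (C : ℝ) (N : ℕ), 0 ≤ C ∧ ∀ z : UpperHalfPlane, 1 / 2 ≤ z.im → ‖f z‖ ≤ C * (2 * z.im) ^ N := by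
  obtain ⟨C, N, h⟩ := hf.moderate 1
  simp only [one_smul] at h
  have hK : IsCompact ((fun p : ℝ × ℝ => (p.1 + p.2 * Complex.I : ℂ)) ''
      (Icc (-1 / 2) (1 / 2) ×ˢ Icc (1 / 2) 1)) :=
    (isCompact_Icc.prod isCompact_Icc).image (by fun_prop)
  obtain ⟨D, hD⟩ := hK.exists_bound_of_continuousOn (hf.smooth.continuousOn.mono (by
    rintro _ ⟨p, hp, rfl⟩
    have := hp.2.1
    simp
    linarith))
  refine ⟨max |C| |D|, ⌈|N|⌉₊, by positivity, fun z hz => ?_⟩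
  have h1 : (1 : ℝ) ≤ 2 * z.im := by linarith
  rcases le_total 1 z.im with hy | hy
  · refine (h z hy).trans ?_
    have e1 : z.im ^ N ≤ (2 * z.im) ^ ⌈|N|⌉₊ := by
      rw [← Real.rpow_natCast]
      calc z.im ^ N ≤ z.im ^ ((⌈|N|⌉₊ : ℕ) : ℝ) :=
            Real.rpow_le_rpow_of_exponent_le hy ((le_abs_self N).trans (Nat.le_ceil _))
        _ ≤ _ := Real.rpow_le_rpow z.im_pos.le (by linarith) (by positivity)
    calc C * z.im ^ N ≤ |C| * z.im ^ N := by
          have := Real.rpow_nonneg z.im_pos.le N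
          gcongr; exact le_abs_self C
      _ ≤ max |C| |D| * (2 * z.im) ^ ⌈|N|⌉₊ := by
          have := Real.rpow_nonneg z.im_pos.le N
          gcongr; exact le_max_left _ _
  · obtain ⟨n, hn⟩ := exists_T_zpow_re z
    rw [← hf.T_zpow_smul n z]
    have hmem : ((ModularGroup.T ^ n • z : UpperHalfPlane) : ℂ) ∈
        (fun p : ℝ × ℝ => (p.1 + p.2 * Complex.I : ℂ)) '' (Icc (-1 / 2) (1 / 2) ×ˢ Icc (1 / 2) 1) := by
      refine ⟨coords (ModularGroup.T ^ n • z), ⟨?_, ?_⟩, Complex.re_add_im _⟩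
      · have := abs_le.1 hn
        exact ⟨by change -1 / 2 ≤ (ModularGroup.T ^ n • z).re; linarith, this.2⟩
      · change (ModularGroup.T ^ n • z).im ∈ _
        rw [ModularGroup.im_T_zpow_smul]
        exact ⟨hz, hy⟩
    have hDz := hD _ hmem
    rw [UpperHalfPlane.ofComplex_apply] at hDz
    refine hDz.trans ((le_abs_self D).trans ((le_max_right |C| |D|).trans ?_))
    exact le_mul_of_one_le_right (by positivity) (one_le_pow₀ h1)

theorem norm_fricke_eq (hε : ε = 1 ∨ ε = -1) (hAL : HasAtkinLehnerEigenvalue f ε)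
    (z : UpperHalfPlane) : ‖f (fricke z)‖ = ‖f z‖ := by
  rw [hAL.fricke, norm_mul]
  rcases hε with rfl | rfl <;> simp

theorem IsMaassCuspForm.exists_norm_le (hf : IsMaassCuspForm r f) (hε : ε = 1 ∨ ε = -1)
    (hAL : HasAtkinLehnerEigenvalue f ε) :
    ∃ (C : ℝ) (N : ℕ), 0 ≤ C ∧ ∀ z : UpperHalfPlane, ‖f z‖ ≤ C * (max z.im z.im⁻¹) ^ N := by
  obtain ⟨C, N, hC, h⟩ := hf.exists_norm_le_pow
  refine ⟨C * 2 ^ N, N, by positivity, fun z => ?_⟩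
  obtain ⟨w, hw, hle, hg⟩ := exists_reduction z
  rw [← hg (fun z => ‖f z‖) (fun γ hγ z => by rw [hf.invariant γ hγ]) (norm_fricke_eq hε hAL)]
  refine (h w (half_le_im_of_mem_fordUpper hw)).trans ?_
  rw [mul_pow, mul_assoc]
  have := w.im_pos
  gcongr

/-- The coefficient of the Fourier expansion along a horizontal line. -/
def whitCoeff (r : ℂ) (c : ℤ → ℂ) (y : ℝ) (n : ℤ) : ℂ :=
  c n * whittakerW0 (Complex.I * r / 2) (4 * Real.pi * |(n : ℝ)| * y)

theorem HasFourierCoeffs.hasSum_mkPoint (hc : HasFourierCoeffs r f c) {y : ℝ} (hy : 0 < y) (x : ℝ) :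
    HasSum (fun n : {n : ℤ // n ≠ 0} => whitCoeff r c y n *
      Complex.exp (2 * Real.pi * Complex.I * (n : ℤ) * x)) (f (mkPoint (x, y))) := by
  have h := hc (mkPoint (x, y))
  rw [mkPoint_im (p := (x, y)) hy, mkPoint_re (p := (x, y)) hy] at h
  exact h

theorem HasFourierCoeffs.summable_norm (hc : HasFourierCoeffs r f c) {y : ℝ} (hy : 0 < y) :
    Summable fun n : {n : ℤ // n ≠ 0} => ‖whitCoeff r c y n‖ := by
  refine (hc.hasSum_mkPoint hy 0).summable.norm.congr fun n => ?_
  rw [norm_mul, norm_exp_two_pi_int, mul_one]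

theorem HasFourierCoeffs.whitCoeff_eq (hc : HasFourierCoeffs r f c) {y : ℝ} (hy : 0 < y)
    {n : ℤ} (hn : n ≠ 0) :
    whitCoeff r c y n = ∫ x in Ioc (-1 / 2 : ℝ) (1 / 2), f (mkPoint (x, y)) *
      Complex.exp (2 * Real.pi * Complex.I * (-n : ℤ) * x) := by
  have h := hasSum_integral_fourier (hc.summable_norm hy) (fun m => (m : ℤ) - n)
    (F := fun x => f (mkPoint (x, y)) * Complex.exp (2 * Real.pi * Complex.I * (-n : ℤ) * x))
    fun x => by
      refine hasSum_of_eq ((hc.hasSum_mkPoint hy x).mul_right _) fun m => ?_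
      rw [mul_assoc (whitCoeff r c y m), ← Complex.exp_add]
      congr 2
      push_cast
      ring
  refine (hasSum_of_eq (hasSum_ite_eq (⟨n, hn⟩ : {n : ℤ // n ≠ 0}) (whitCoeff r c y n)) fun m => ?_).unique h
  by_cases hm : m = ⟨n, hn⟩
  · subst hm; simp
  · have : (m : ℤ) - n ≠ 0 := fun h => hm (Subtype.ext (by simpa [sub_eq_zero] using h))
    simp [hm, this]

/-- Evaluate the Fourier integral at height y = y₀/(2π|n|): the Whittaker value is then a constant
independent of n, nonzero by the choice of y₀, while f grows at most polynomially in 1/y. -/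
theorem IsMaassCuspForm.exists_norm_coeff_le (hf : IsMaassCuspForm r f) (hε : ε = 1 ∨ ε = -1)
    (hAL : HasAtkinLehnerEigenvalue f ε) (hc : HasFourierCoeffs r f c) :
    ∃ (C : ℝ) (N : ℕ), 0 ≤ C ∧ ∀ n : ℤ, n ≠ 0 → ‖c n‖ ≤ C * |(n : ℝ)| ^ N := by
  obtain ⟨C, N, hC, h⟩ := hf.exists_norm_le hε hAL
  obtain ⟨y₀, hy₀, hK⟩ := exists_besselK_ne_zero (Complex.I * r / 2)
  have hpi := Real.pi_pos
  set W := whittakerW0 (Complex.I * r / 2) (2 * y₀) with hW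
  have hW0 : W ≠ 0 := by
    rw [hW, whittakerW0, mul_div_cancel_left₀ y₀ two_ne_zero]
    refine mul_ne_zero ?_ hK
    exact_mod_cast (Real.sqrt_pos.2 (by positivity)).ne'
  set D := max (y₀ / (2 * Real.pi)) (y₀ / (2 * Real.pi))⁻¹ with hD
  have hD0 : 0 < D := lt_max_of_lt_left (by positivity)
  refine ⟨C * D ^ N / ‖W‖, N, by positivity, fun n hn => ?_⟩
  have hn1 : (1 : ℝ) ≤ |(n : ℝ)| := by exact_mod_cast Int.one_le_abs hn
  have hn0 : 0 < |(n : ℝ)| := by linarith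
  set y := y₀ / (2 * Real.pi) / |(n : ℝ)| with hy
  have hy0 : 0 < y := by positivity
  have hmax : max y y⁻¹ ≤ D * |(n : ℝ)| := by
    refine max_le ?_ ?_
    · calc y ≤ y₀ / (2 * Real.pi) := div_le_self (by positivity) hn1
        _ ≤ D := le_max_left _ _
        _ ≤ _ := le_mul_of_one_le_right hD0.le hn1
    · rw [hy, inv_div, div_eq_mul_inv, mul_comm]
      gcongr
      exact le_max_right _ _
  have harg : 4 * Real.pi * |(n : ℝ)| * y = 2 * y₀ := by
    rw [hy]; field_simp; ring
  have key : ‖c n‖ * ‖W‖ ≤ C * (D * |(n : ℝ)|) ^ N := by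
    have e := hc.whitCoeff_eq hy0 hn
    rw [whitCoeff, harg, ← hW] at e
    rw [← norm_mul, e]
    have hb := norm_setIntegral_le_of_norm_le_const (μ := (volume : Measure ℝ))
      (s := Ioc (-1 / 2 : ℝ) (1 / 2)) (C := C * (D * |(n : ℝ)|) ^ N)
      (f := fun x => f (mkPoint (x, y)) * Complex.exp (2 * Real.pi * Complex.I * (-n : ℤ) * x))
      (by simp) (fun x _ => by
        rw [norm_mul, norm_exp_two_pi_int, mul_one]
        refine (h _).trans ?_
        rw [mkPoint_im (p := (x, y)) hy0]
        have : 0 ≤ max y y⁻¹ := le_max_of_le_left hy0.le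
        gcongr)
    refine hb.trans_eq ?_
    simp
    norm_num
  rw [mul_pow, ← mul_assoc] at key
  rw [div_mul_eq_mul_div, le_div_iff₀ (norm_pos_iff.2 hW0)]
  exact key

theorem exists_norm_whittakerW0_le (μ : ℂ) :
    ∃ C : ℝ, 0 ≤ C ∧ ∀ y : ℝ, 1 ≤ y → ‖whittakerW0 μ y‖ ≤ C * y * Real.exp (-y / 2) := by
  refine ⟨besselKReal μ.re (1 / 2) * Real.exp (1 / 2),
    mul_nonneg (besselKReal_nonneg _ _) (Real.exp_pos _).le, fun y hy => ?_⟩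
  rw [whittakerW0, norm_mul, Complex.norm_real, Real.norm_of_nonneg (Real.sqrt_nonneg _)]
  have h1 : Real.sqrt (y / Real.pi) ≤ y := by
    rw [Real.sqrt_le_left (by linarith)]
    have : y / Real.pi ≤ y := div_le_self (by linarith) (by linarith [Real.pi_gt_three])
    nlinarith
  have h2 := (norm_besselK_le μ (y := y / 2) (by linarith)).trans
    (besselKReal_le μ.re (y₀ := 1 / 2) (y := y / 2) (by norm_num) (by linarith))
  calc Real.sqrt (y / Real.pi) * ‖besselK μ (y / 2)‖
      ≤ y * (Real.exp (-(y / 2 - 1 / 2)) * besselKReal μ.re (1 / 2)) := by gcongr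
    _ = _ := by
      rw [show -(y / 2 - 1 / 2) = 1 / 2 + -y / 2 by ring, Real.exp_add]
      ring

/-- The Whittaker function at 4π|n|y decays like exp(-2π|n|y) up to a linear factor; for y ≥ 1/2 and
|n| ≥ 1 this pays for e^(-y), for e^(-|n|) to sum over n, and for the linear factor y. -/
theorem IsMaassCuspForm.exists_norm_le_exp (hf : IsMaassCuspForm r f) (hε : ε = 1 ∨ ε = -1)
    (hAL : HasAtkinLehnerEigenvalue f ε) (hc : HasFourierCoeffs r f c) :
    ∃ C : ℝ, 0 ≤ C ∧ ∀ z : UpperHalfPlane, 1 / 2 ≤ z.im → ‖f z‖ ≤ C * Real.exp (-z.im) := by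
  obtain ⟨C, N, hC, h⟩ := hf.exists_norm_coeff_le hε hAL hc
  obtain ⟨D, hD, hW⟩ := exists_norm_whittakerW0_le (Complex.I * r / 2)
  have hpi := Real.pi_gt_three
  have hs : Summable fun n : {n : ℤ // n ≠ 0} =>
      |((n : ℤ) : ℝ)| ^ (N + 1) * Real.exp (-(|((n : ℤ) : ℝ)|)) := by
    have : Summable fun n : ℤ => |(n : ℝ)| ^ (N + 1) * Real.exp (-(|(n : ℝ)|)) := by
      apply Summable.of_nat_of_neg <;>
      · have := Real.summable_pow_mul_exp_neg_nat_mul (N + 1) zero_lt_one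
        simpa using this
    exact this.comp_injective Subtype.val_injective
  set S := ∑' n : {n : ℤ // n ≠ 0}, |((n : ℤ) : ℝ)| ^ (N + 1) * Real.exp (-(|((n : ℤ) : ℝ)|))
  refine ⟨C * D * (4 * Real.pi) * S, by
    have : 0 ≤ S := tsum_nonneg fun n => by positivity
    positivity, fun z hz => ?_⟩
  have hy := z.im_pos
  have hterm : ∀ n : {n : ℤ // n ≠ 0},
      ‖c n * whittakerW0 (Complex.I * r / 2) (4 * Real.pi * |((n : ℤ) : ℝ)| * z.im) *
        Complex.exp (2 * Real.pi * Complex.I * ((n : ℤ) : ℂ) * (z.re : ℂ))‖ ≤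
      C * D * (4 * Real.pi) * Real.exp (-z.im) *
        (|((n : ℤ) : ℝ)| ^ (N + 1) * Real.exp (-(|((n : ℤ) : ℝ)|))) := by
    intro n
    have hn1 : (1 : ℝ) ≤ |((n : ℤ) : ℝ)| := by exact_mod_cast Int.one_le_abs n.2
    set m := |((n : ℤ) : ℝ)|
    have hmy : 1 / 2 ≤ m * z.im := by nlinarith
    rw [norm_mul, norm_exp_two_pi_int, mul_one, norm_mul]
    have e1 := hW (4 * Real.pi * m * z.im) (by nlinarith)
    have e2 : z.im * Real.exp (-(4 * Real.pi * m * z.im) / 2) ≤ Real.exp (-z.im) * Real.exp (-m) := by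
      have h3 : z.im ≤ Real.exp z.im := by linarith [Real.add_one_le_exp z.im]
      rw [← Real.exp_add]
      refine (mul_le_mul_of_nonneg_right h3 (Real.exp_pos _).le).trans ?_
      rw [← Real.exp_add]
      apply Real.exp_le_exp.2
      have h4 : 2 * 3 * (m * z.im) ≤ 2 * Real.pi * (m * z.im) := by gcongr
      have h5 : z.im ≤ m * z.im := le_mul_of_one_le_left hy.le hn1
      have h6 : m ≤ 2 * (m * z.im) := by nlinarith
      linarith
    calc ‖c n‖ * ‖whittakerW0 (Complex.I * r / 2) (4 * Real.pi * m * z.im)‖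
        ≤ (C * m ^ N) * (D * (4 * Real.pi * m * z.im) * Real.exp (-(4 * Real.pi * m * z.im) / 2)) := by
          gcongr
          exact h n n.2
      _ = C * D * (4 * Real.pi) * m ^ (N + 1) * (z.im * Real.exp (-(4 * Real.pi * m * z.im) / 2)) := by ring
      _ ≤ C * D * (4 * Real.pi) * m ^ (N + 1) * (Real.exp (-z.im) * Real.exp (-m)) := by gcongr
      _ = _ := by ring
  rw [← (hc z).tsum_eq]
  refine (tsum_of_norm_bounded (hs.hasSum.mul_left _) hterm).trans_eq ?_
  ring

end MaassBounds

end MaassLift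

namespace MaassLift
open MeasureTheory Set Filter

/-! ## Generators of `Γ₀(2)` -/

/-- The matrix `(1 0; 2 1)`. -/
def lowerTwo : SL(2, ℤ) := ⟨!![1, 0; 2, 1], by simp⟩

theorem mul_apply_one (γ δ : SL(2, ℤ)) (j : Fin 2) :
    (γ * δ) 1 j = γ 1 0 * δ 0 j + γ 1 1 * δ 1 j := by
  rw [Matrix.SpecialLinearGroup.coe_mul, Matrix.mul_apply, Fin.sum_univ_two]

/-- Descent on |c| + |d|: right multiplication by T^±1 changes d by ±c, and by `lowerTwo`^±1 changes
c by ±2d. As c is even and d odd, |c| ≠ |d|, so some step decreases the sum until c = 0. -/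
theorem Gamma0_two_le_closure :
    CongruenceSubgroup.Gamma0 2 ≤ Subgroup.closure {-1, ModularGroup.T, lowerTwo} := by
  set K := Subgroup.closure ({-1, ModularGroup.T, lowerTwo} : Set SL(2, ℤ)) with hK
  have hT : ModularGroup.T ∈ K := Subgroup.subset_closure (by simp)
  have hV : lowerTwo ∈ K := Subgroup.subset_closure (by simp)
  have key : ∀ (n : ℕ) (γ : SL(2, ℤ)), (γ 1 0).natAbs + (γ 1 1).natAbs ≤ n →
      Even (γ 1 0) → γ ∈ K := by
    intro n
    induction n with
    | zero =>
      intro γ h _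
      exfalso
      have hdet := Matrix.det_fin_two γ.1
      rw [γ.2] at hdet
      have h1 : γ 1 0 = 0 := by omega
      have h2 : γ 1 1 = 0 := by omega
      have h1' : γ.1 1 0 = 0 := h1
      have h2' : γ.1 1 1 = 0 := h2
      rw [h1', h2'] at hdet
      simp at hdet
    | succ n ih =>
      intro γ h hev
      have hdet := Matrix.det_fin_two γ.1
      rw [γ.2] at hdet
      by_cases h0 : γ 1 0 = 0
      · refine Subgroup.closure_mono ?_ (mem_closure_neg_one_T_iff.2 h0)
        intro x hx
        simp only [mem_insert_iff, mem_singleton_iff] at hx ⊢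
        tauto
      have hodd : Odd (γ 1 1) := by
        by_contra hc
        rw [Int.not_odd_iff_even] at hc
        obtain ⟨a, ha⟩ := hev
        obtain ⟨b, hb⟩ := hc
        have ha' : γ.1 1 0 = a + a := ha
        have hb' : γ.1 1 1 = b + b := hb
        rw [ha', hb'] at hdet
        have : (1 : ℤ) = 2 * (γ.1 0 0 * b - γ.1 0 1 * a) := by linear_combination hdet
        omega
      have e1 : (γ * ModularGroup.T) 1 0 = γ 1 0 ∧ (γ * ModularGroup.T) 1 1 = γ 1 0 + γ 1 1 := by
        rw [mul_apply_one, mul_apply_one, ModularGroup.coe_T]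
        simp
      have e2 : (γ * ModularGroup.T⁻¹) 1 0 = γ 1 0 ∧
          (γ * ModularGroup.T⁻¹) 1 1 = γ 1 1 - γ 1 0 := by
        rw [mul_apply_one, mul_apply_one, ModularGroup.coe_T_inv]
        simp
        ring
      have e3 : (γ * lowerTwo) 1 0 = γ 1 0 + 2 * γ 1 1 ∧ (γ * lowerTwo) 1 1 = γ 1 1 := by
        rw [mul_apply_one, mul_apply_one, show (lowerTwo : Matrix (Fin 2) (Fin 2) ℤ) = !![1, 0; 2, 1]
          from rfl]
        simp
        ring
      have e4 : (γ * lowerTwo⁻¹) 1 0 = γ 1 0 - 2 * γ 1 1 ∧ (γ * lowerTwo⁻¹) 1 1 = γ 1 1 := by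
        rw [mul_apply_one, mul_apply_one, Matrix.SpecialLinearGroup.coe_inv,
          show (lowerTwo : Matrix (Fin 2) (Fin 2) ℤ) = !![1, 0; 2, 1] from rfl,
          Matrix.adjugate_fin_two_of]
        simp
        ring
      have hmul : ∀ δ ∈ K, γ * δ ∈ K → γ ∈ K := fun δ hδ h => by
        simpa using K.mul_mem h (K.inv_mem hδ)
      by_cases hlt : (γ 1 1).natAbs < (γ 1 0).natAbs
      · by_cases hs : (γ 1 0 + 2 * γ 1 1).natAbs < (γ 1 0).natAbs
        · refine hmul _ hV (ih _ ?_ ?_)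
          · rw [e3.1, e3.2]; omega
          · rw [e3.1]; exact hev.add (even_two_mul _)
        · refine hmul _ (K.inv_mem hV) (ih _ ?_ ?_)
          · rw [e4.1, e4.2]
            obtain ⟨b, hb⟩ := hodd
            omega
          · rw [e4.1]; exact hev.sub (even_two_mul _)
      · have hne : (γ 1 1).natAbs ≠ (γ 1 0).natAbs := by
          obtain ⟨a, ha⟩ := hev
          obtain ⟨b, hb⟩ := hodd
          omega
        by_cases hs : (γ 1 0 + γ 1 1).natAbs < (γ 1 1).natAbs
        · refine hmul _ hT (ih _ ?_ ?_)
          · rw [e1.1, e1.2]; omega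
          · rw [e1.1]; exact hev
        · refine hmul _ (K.inv_mem hT) (ih _ ?_ ?_)
          · rw [e2.1, e2.2]; omega
          · rw [e2.1]; exact hev
  intro γ hγ
  exact key _ γ le_rfl (mem_Gamma0_two_iff.1 hγ)

/-! ## The theta series -/

variable {l : ℕ} {P : MvPolynomial (Fin 4) ℂ} {εP : ℂ}

/-- The terms of the theta series. -/
def thetaTerm (P : MvPolynomial (Fin 4) ℂ) (z : UpperHalfPlane) (β : latticeS) : ℂ :=
  evalQ P β *
    Complex.exp (2 * Real.pi * Complex.I * ((‖(β : ℍ[ℝ])‖ ^ 2 / 2 : ℝ) : ℂ) * (z : ℂ))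

theorem thetaTerm_eq (P : MvPolynomial (Fin 4) ℂ) (z : UpperHalfPlane) (β : latticeS) :
    thetaTerm P z β = evalQ P β *
      Complex.exp (-Real.pi * (-Complex.I * z) * (‖(β : ℍ[ℝ])‖ ^ 2 : ℝ)) := by
  rw [thetaTerm]
  congr 2
  push_cast
  ring

theorem re_neg_I_mul (z : UpperHalfPlane) : (-Complex.I * (z : ℂ)).re = z.im := by simp

theorem hasSum_theta (hP : IsHarmonicPoly l P) (z : UpperHalfPlane) :
    HasSum (thetaTerm P z) (theta (evalQ P) z) := by
  have h := (theta_inversion (b := -Complex.I * z) (by rw [re_neg_I_mul]; exact z.im_pos) hP).1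
  simp only [← thetaTerm_eq] at h
  exact h.hasSum

theorem norm_thetaTerm (P : MvPolynomial (Fin 4) ℂ) (z : UpperHalfPlane) (β : latticeS) :
    ‖thetaTerm P z β‖ = ‖evalQ P β‖ * Real.exp (-Real.pi * ‖(β : ℍ[ℝ])‖ ^ 2 * z.im) := by
  rw [thetaTerm_eq, norm_mul, Complex.norm_exp]
  congr 2
  rw [Complex.re_mul_ofReal, ← Complex.ofReal_neg, Complex.re_ofReal_mul, re_neg_I_mul]
  ring

theorem exists_norm_theta_le (hP : IsHarmonicPoly l P) :
    ∃ C : ℝ, 0 ≤ C ∧ ∀ z : UpperHalfPlane, 1 / 2 ≤ z.im → ‖theta (evalQ P) z‖ ≤ C := by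
  set w : UpperHalfPlane := mkPoint (0, 1 / 2) with hw
  have him : w.im = 1 / 2 := mkPoint_im (p := (0, 1 / 2)) (by norm_num)
  have hs := (hasSum_theta hP w).summable.norm
  refine ⟨∑' β, ‖thetaTerm P w β‖, tsum_nonneg fun _ => norm_nonneg _, fun z hz => ?_⟩
  have hz' := (hasSum_theta hP z).summable.norm
  rw [← (hasSum_theta hP z).tsum_eq]
  refine (norm_tsum_le_tsum_norm hz').trans (hz'.tsum_le_tsum (fun β => ?_) hs)
  rw [norm_thetaTerm, norm_thetaTerm, him]
  gcongr ?_ * Real.exp ?_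
  have : 0 ≤ Real.pi * ‖(β : ℍ[ℝ])‖ ^ 2 := by positivity
  nlinarith

theorem theta_T_smul (hP : IsHarmonicPoly l P) (z : UpperHalfPlane) :
    theta (evalQ P) (ModularGroup.T • z) = theta (evalQ P) z := by
  rw [← (hasSum_theta hP z).tsum_eq, ← (hasSum_theta hP _).tsum_eq]
  congr 1
  ext β
  obtain ⟨m, hm⟩ := exists_norm_sq_eq β.2
  rw [thetaTerm, thetaTerm, UpperHalfPlane.modular_T_smul, UpperHalfPlane.coe_vadd, hm, mul_add, Complex.exp_add]
  have : Complex.exp (2 * Real.pi * Complex.I * ((2 * m / 2 : ℝ) : ℂ) * ((1 : ℝ) : ℂ)) = 1 := by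
    rw [Complex.exp_eq_one_iff]
    refine ⟨m, ?_⟩
    push_cast
    ring
  rw [this, one_mul]

/-- Apply the inversion formula with b = -iz. The eigenproperty gives P(ϖ₂⁻¹β) = 2^(-l/2) ε_P P(β),
and |ϖ₂⁻¹β|² = |β|²/2 turns the dual Gaussian into the one at -1/(2z). The minus sign is 1/b² =
-1/z². -/
theorem theta_fricke (hP : IsHarmonicPoly l P) (hE : IsEigenPoly P εP) (hε : εP = 1 ∨ εP = -1)
    (z : UpperHalfPlane) :
    theta (evalQ P) (fricke z) = -εP * ((Real.sqrt 2 : ℝ) * z : ℂ) ^ (l + 2) * theta (evalQ P) z := by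
  have hz : (z : ℂ) ≠ 0 := UpperHalfPlane.ne_zero z
  have h2 : ((Real.sqrt 2 : ℝ) : ℂ) ≠ 0 := by exact_mod_cast (Real.sqrt_pos.2 two_pos).ne'
  have h22 : ((Real.sqrt 2 : ℝ) : ℂ) ^ 2 = 2 := by
    rw [← Complex.ofReal_pow, Real.sq_sqrt two_pos.le]; norm_num
  have hεP : εP ^ 2 = 1 := by rcases hε with rfl | rfl <;> norm_num
  have h := (theta_inversion (b := -Complex.I * z) (by rw [re_neg_I_mul]; exact z.im_pos) hP).2
  simp only [← thetaTerm_eq] at h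
  rw [(hasSum_theta hP z).tsum_eq] at h
  have hterm : ∀ β : latticeS, evalQ P (varpi⁻¹ * β) *
      Complex.exp (-Real.pi / (-Complex.I * z) * (‖varpi⁻¹ * (β : ℍ[ℝ])‖ ^ 2 : ℝ)) =
      (((Real.sqrt 2 : ℝ) : ℂ) ^ l)⁻¹ * εP * thetaTerm P (fricke z) β := by
    intro β
    have h3 : evalQ P β = εP * ((Real.sqrt 2 : ℝ) : ℂ) ^ l * evalQ P (varpi⁻¹ * β) := by
      have := evalQ_varpi_pow_mul hP.1 hE 1 (varpi⁻¹ * (β : ℍ[ℝ]))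
      rw [pow_one, mul_inv_cancel_left₀ varpi_ne_zero] at this
      rw [this]; ring
    have h4 : ‖varpi⁻¹ * (β : ℍ[ℝ])‖ ^ 2 = ‖(β : ℍ[ℝ])‖ ^ 2 / 2 := by
      rw [norm_mul, norm_inv, mul_pow, inv_pow, norm_varpi_sq]; ring
    rw [thetaTerm, h3, h4, coe_fricke]
    have h5 : -(Real.pi : ℂ) / (-Complex.I * z) * ((‖(β : ℍ[ℝ])‖ ^ 2 / 2 : ℝ) : ℂ) =
        2 * Real.pi * Complex.I * ((‖(β : ℍ[ℝ])‖ ^ 2 / 2 : ℝ) : ℂ) * (-1 / (2 * z)) := by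
      have := Complex.I_ne_zero
      have hI := Complex.I_sq
      field_simp
      rw [hI]; ring
    rw [h5]
    have : (((Real.sqrt 2 : ℝ) : ℂ) ^ l)⁻¹ * ((Real.sqrt 2 : ℝ) : ℂ) ^ l = 1 :=
      inv_mul_cancel₀ (pow_ne_zero _ h2)
    linear_combination (-(evalQ P (varpi⁻¹ * β)) * Complex.exp (2 * Real.pi * Complex.I *
      ((‖(β : ℍ[ℝ])‖ ^ 2 / 2 : ℝ) : ℂ) * (-1 / (2 * z)))) * (εP ^ 2 * this + hεP)
  simp only [hterm] at h
  rw [tsum_mul_left, (hasSum_theta hP _).tsum_eq] at h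
  have h6 : -Complex.I / (-Complex.I * (z : ℂ)) = 1 / z := by
    have := Complex.I_ne_zero
    field_simp
  rw [h6] at h
  rw [h, mul_pow, pow_add, pow_add, h22]
  have hI := Complex.I_sq
  have h7 : (1 : ℂ) / (-Complex.I * z) ^ 2 = -1 / z ^ 2 := by
    rw [mul_pow, neg_sq, hI]; field_simp
  rw [h7, div_pow, one_pow]
  field_simp
  linear_combination (-theta (evalQ P) (fricke z)) * hεP

theorem linForm_mul (γ δ : SL(2, ℤ)) (z : UpperHalfPlane) :
    linForm z (bottomRow (γ * δ)) = linForm (δ • z) (bottomRow γ) * linForm z (bottomRow δ) := by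
  have h : linForm z (bottomRow δ) ≠ 0 := by
    refine linForm_ne_zero z fun h => bottomRow_ne_neg δ (by rw [h, neg_zero])
  rw [linForm, linForm, coe_smul_eq]
  have e1 : bottomRow (γ * δ) = (γ 1 0 * δ 0 0 + γ 1 1 * δ 1 0, γ 1 0 * δ 0 1 + γ 1 1 * δ 1 1) := by
    rw [bottomRow, mul_apply_one, mul_apply_one]
  rw [e1, add_mul, mul_assoc, div_mul_cancel₀ _ h, linForm]
  simp only [bottomRow]
  push_cast
  ring

theorem linForm_bottomRow_ne_zero (γ : SL(2, ℤ)) (z : UpperHalfPlane) :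
    linForm z (bottomRow γ) ≠ 0 :=
  linForm_ne_zero z fun h => bottomRow_ne_neg γ (by rw [h, neg_zero])

/-- Conjugation by the Fricke involution turns T⁻¹ into this generator, so its action on Θ follows
from periodicity and `theta_fricke`. -/
theorem lowerTwo_smul (z : UpperHalfPlane) :
    lowerTwo • z = fricke (ModularGroup.T⁻¹ • fricke z) := by
  apply UpperHalfPlane.ext
  have hz : (z : ℂ) ≠ 0 := UpperHalfPlane.ne_zero z
  have h1 : 2 * (z : ℂ) + 1 ≠ 0 := by
    have := linForm_bottomRow_ne_zero lowerTwo z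
    simpa [linForm, bottomRow, lowerTwo] using this
  have h3 : ((ModularGroup.T⁻¹ • fricke z : UpperHalfPlane) : ℂ) = fricke z - 1 := by
    rw [show (ModularGroup.T⁻¹ : SL(2, ℤ)) = ModularGroup.T ^ (-1 : ℤ) by simp,
      UpperHalfPlane.modular_T_zpow_smul, UpperHalfPlane.coe_vadd]
    push_cast; ring
  rw [coe_fricke, h3, coe_fricke, coe_smul_eq]
  have h2 : 2 * (-1 / (2 * (z : ℂ)) - 1) = -(2 * z + 1) / z := by
    field_simp
    ring
  have h4 : -1 / (-(2 * (z : ℂ) + 1) / z) = z / (2 * z + 1) := by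
    field_simp
  rw [h2, h4]
  simp [linForm, bottomRow, lowerTwo]

/-- By the cocycle relation generators suffice: -1 uses that l is even, T is periodicity, and for
`lowerTwo` the two Fricke factors -ε_P cancel. -/
theorem theta_smul (hP : IsHarmonicPoly l P) (hE : IsEigenPoly P εP) (hε : εP = 1 ∨ εP = -1)
    (hl : Even l) {γ : SL(2, ℤ)} (hγ : γ ∈ CongruenceSubgroup.Gamma0 2) (z : UpperHalfPlane) :
    theta (evalQ P) (γ • z) = linForm z (bottomRow γ) ^ (l + 2) * theta (evalQ P) z := by
  have hk : Even (l + 2) := hl.add even_two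
  have hεP : εP ^ 2 = 1 := by rcases hε with rfl | rfl <;> norm_num
  have h22 : ((Real.sqrt 2 : ℝ) : ℂ) ^ 2 = 2 := by
    rw [← Complex.ofReal_pow, Real.sq_sqrt two_pos.le]; norm_num
  revert z
  refine Subgroup.closure_induction (p := fun γ _ => ∀ z : UpperHalfPlane,
    theta (evalQ P) (γ • z) = linForm z (bottomRow γ) ^ (l + 2) * theta (evalQ P) z)
    ?_ ?_ ?_ ?_ (Gamma0_two_le_closure hγ)
  · rintro x (rfl | rfl | rfl) z
    · rw [show (-1 : SL(2, ℤ)) • z = z by simp]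
      simp [linForm, bottomRow, hk.neg_pow]
    · rw [theta_T_smul hP]
      simp [linForm, bottomRow, ModularGroup.T]
    · have hz : (z : ℂ) ≠ 0 := UpperHalfPlane.ne_zero z
      have h3 : ((ModularGroup.T⁻¹ • fricke z : UpperHalfPlane) : ℂ) = fricke z - 1 := by
        rw [show (ModularGroup.T⁻¹ : SL(2, ℤ)) = ModularGroup.T ^ (-1 : ℤ) by simp,
          UpperHalfPlane.modular_T_zpow_smul, UpperHalfPlane.coe_vadd]
        push_cast; ring
      have h4 : theta (evalQ P) (ModularGroup.T⁻¹ • fricke z) = theta (evalQ P) (fricke z) := by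
        rw [← theta_T_smul hP, smul_inv_smul]
      rw [lowerTwo_smul, theta_fricke hP hE hε, h4, theta_fricke hP hE hε, h3, coe_fricke]
      have h5 : linForm z (bottomRow lowerTwo) = 2 * z + 1 := by
        simp [linForm, bottomRow, lowerTwo]
      have h6 : (((Real.sqrt 2 : ℝ) : ℂ) * (-1 / (2 * z) - 1)) ^ (l + 2) *
          (((Real.sqrt 2 : ℝ) : ℂ) * z) ^ (l + 2) = (2 * z + 1) ^ (l + 2) := by
        rw [← mul_pow, ← hk.neg_pow (2 * (z : ℂ) + 1)]
        congr 1
        field_simp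
        rw [h22]; ring
      rw [h5, ← h6]
      linear_combination ((((Real.sqrt 2 : ℝ) : ℂ) * (-1 / (2 * z) - 1)) ^ (l + 2) *
          (((Real.sqrt 2 : ℝ) : ℂ) * z) ^ (l + 2) * theta (evalQ P) z) * hεP
  · intro z
    rw [one_smul]
    simp [linForm, bottomRow]
  · intro γ δ _ _ h1 h2 z
    rw [mul_smul, h1, h2, linForm_mul, mul_pow]
    ring
  · intro γ _ h z
    have h1 := h (γ⁻¹ • z)
    have h2 := linForm_mul γ γ⁻¹ z
    rw [mul_inv_cancel, show linForm z (bottomRow 1) = 1 by simp [linForm, bottomRow]] at h2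
    rw [smul_inv_smul] at h1
    rw [h1, ← mul_assoc, ← mul_pow, mul_comm (linForm z _), ← h2, one_pow, one_mul]

instance : Countable latticeS := by
  have h : (latticeS : Set ℍ[ℝ]) ⊆ range fun p : ℤ × ℤ × ℤ × ℤ =>
      quat p.1 p.2.1 p.2.2.1 p.2.2.2 := by
    intro β hβ
    obtain ⟨a, b, c, d, -, rfl⟩ := mem_latticeS_iff.1 hβ
    exact ⟨(a, b, c, d), rfl⟩
  exact ((countable_range _).mono h).to_subtype

theorem measurable_theta (hP : IsHarmonicPoly l P) : Measurable (theta (evalQ P)) := by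
  refine measurable_of_tendsto_metrizable' (u := atTop)
    (f := fun s : Finset latticeS => fun z => ∑ β ∈ s, thetaTerm P z β) ?_ ?_
  · intro s
    refine (continuous_finsetSum s fun β _ => ?_).measurable
    exact continuous_const.mul (Complex.continuous_exp.comp
      (continuous_const.mul UpperHalfPlane.continuous_coe))
  · exact tendsto_pi_nhds.2 fun z => hasSum_theta hP z

end MaassLift

namespace MaassLift
open MeasureTheory Set Filter

/-! ## Integrals of families of self-dual functions -/

section Family

variable {X : Type*} [MeasurableSpace X] {μ : Measure X} {k : ℕ}
  {Ψ : X → ℝ → ℂ}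

/-- A measurable family of self-dual functions that decay rapidly, uniformly in the family. -/
structure IsSelfDualFamily (μ : Measure X) (k : ℕ) (Ψ : X → ℝ → ℂ) : Prop where
  meas : Measurable fun p : X × ℝ => (Ioi (0 : ℝ)).indicator (Ψ p.1) p.2
  feq : ∀ᵐ x ∂μ, ∀ t : ℝ, 0 < t → Ψ x t = 1 / (t : ℂ) ^ (k + 1) * Ψ x (1 / t)
  bound : ∀ M : ℕ, k + 3 ≤ 2 * M → ∃ C : ℝ, 0 ≤ C ∧
    ∀ᵐ x ∂μ, ∀ t : ℝ, 0 < t → ‖Ψ x t‖ ≤ C * (t ^ M)⁻¹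

namespace IsSelfDualFamily

/-- For t > 1 use the bound with a large M; for t ≤ 1 carry it over by self-duality. The majorant
does not depend on the family parameter, as Fubini on a finite measure space requires. -/
theorem exists_integrable_bound (h : IsSelfDualFamily μ k Ψ) (σ : ℝ) :
    ∃ D : ℝ → ℝ, IntegrableOn D (Ioi 0) ∧
      ∀ᵐ x ∂μ, ∀ t : ℝ, 0 < t → t ^ (σ - 1) * ‖Ψ x t‖ ≤ D t := by
  obtain ⟨M, hM⟩ := exists_nat_gt (max (max σ (k + 1 - σ)) (k + 3))
  have hM1 : σ < M := ((le_max_left _ _).trans (le_max_left _ _)).trans_lt hM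
  have hM2 : k + 1 - σ < M := ((le_max_right _ _).trans (le_max_left _ _)).trans_lt hM
  have hM3 : (k : ℝ) + 3 < M := (le_max_right _ _).trans_lt hM
  have hM3' : k + 3 < M := by exact_mod_cast hM3
  obtain ⟨C, hC0, hC⟩ := h.bound M (by omega)
  have i1 : IntegrableOn (fun t : ℝ => C * t ^ (σ - 1 - M)) (Ioi 1) :=
    (integrableOn_Ioi_rpow_of_lt (by linarith) one_pos).const_mul C
  have i2 : IntegrableOn (fun t : ℝ => C * t ^ (σ - 1 + (M - (k + 1)))) (Ioc 0 1) := by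
    have := (intervalIntegral.intervalIntegrable_rpow' (a := 0) (b := 1)
      (r := σ - 1 + (M - (k + 1))) (by linarith)).const_mul C
    rwa [intervalIntegrable_iff_integrableOn_Ioc_of_le zero_le_one] at this
  classical
  refine ⟨(Ioi 1).piecewise (fun t => C * t ^ (σ - 1 - M))
    (fun t => C * t ^ (σ - 1 + (M - (k + 1)))), ?_, ?_⟩
  · rw [← Ioc_union_Ioi_eq_Ioi (zero_le_one' ℝ)]
    refine IntegrableOn.union ?_ ?_
    · refine i2.congr_fun (fun t ht => ?_) measurableSet_Ioc
      rw [piecewise_eq_of_notMem _ _ _ (show t ∉ Ioi (1 : ℝ) from not_lt.2 ht.2)]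
    · refine i1.congr_fun (fun t ht => ?_) measurableSet_Ioi
      rw [piecewise_eq_of_mem _ _ _ ht]
  · filter_upwards [hC, h.feq] with x hx hfe t ht
    by_cases h1 : t ∈ Ioi 1
    · rw [piecewise_eq_of_mem _ _ _ h1]
      calc t ^ (σ - 1) * ‖Ψ x t‖ ≤ t ^ (σ - 1) * (C * (t ^ M)⁻¹) := by
            gcongr; exact hx t ht
        _ = C * t ^ (σ - 1 - M) := by
            rw [Real.rpow_sub ht _ (M : ℝ), Real.rpow_natCast]; ring
    · rw [piecewise_eq_of_notMem _ _ _ h1]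
      have h2 : ‖Ψ x t‖ ≤ C * t ^ ((M : ℝ) - (k + 1)) := by
        rw [hfe t ht, norm_mul]
        have h3 := hx (1 / t) (by positivity)
        have h4 : ‖1 / (t : ℂ) ^ (k + 1)‖ = 1 / t ^ (k + 1) := by
          simp [abs_of_pos ht]
        rw [h4, Real.rpow_sub ht, Real.rpow_natCast,
          show ((k : ℝ) + 1) = ((k + 1 : ℕ) : ℝ) by push_cast; rfl, Real.rpow_natCast]
        calc 1 / t ^ (k + 1) * ‖Ψ x (1 / t)‖ ≤ 1 / t ^ (k + 1) * (C * ((1 / t) ^ M)⁻¹) := by gcongr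
          _ = C * (t ^ M / t ^ (k + 1)) := by
            rw [one_div, one_div, inv_pow, inv_inv]; ring
      calc t ^ (σ - 1) * ‖Ψ x t‖ ≤ t ^ (σ - 1) * (C * t ^ ((M : ℝ) - (k + 1))) := by gcongr
        _ = C * t ^ (σ - 1 + (M - (k + 1))) := by
            rw [Real.rpow_add ht]; ring

variable [IsFiniteMeasure μ]

theorem isSelfDualDecaying_integral (h : IsSelfDualFamily μ k Ψ) :
    IsSelfDualDecaying k fun t => ∫ x, Ψ x t ∂μ where
  meas := by
    have h0 : Measurable (Function.uncurry fun (t : ℝ) (x : X) => (Ioi (0 : ℝ)).indicator (Ψ x) t) :=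
      h.meas.comp measurable_swap
    have h1 : StronglyMeasurable fun t : ℝ => ∫ x, (Ioi (0 : ℝ)).indicator (Ψ x) t ∂μ :=
      h0.stronglyMeasurable.integral_prod_right
    refine h1.aestronglyMeasurable.congr ?_
    refine (ae_restrict_iff' measurableSet_Ioi).2 (.of_forall fun t ht => ?_)
    simp only [indicator_of_mem ht]
  feq := fun t ht => by
    rw [← integral_const_mul]
    exact integral_congr_ae (h.feq.mono fun x hx => hx t ht)
  bound := fun M hM => by
    obtain ⟨C, -, hC⟩ := h.bound M hM
    refine ⟨C * μ.real univ, fun t ht => ?_⟩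
    refine (norm_integral_le_of_norm_le_const (hC.mono fun x hx => hx t ht)).trans_eq ?_
    ring

theorem integrable_prod (h : IsSelfDualFamily μ k Ψ) (s : ℂ) :
    Integrable (fun p : X × ℝ => (p.2 : ℂ) ^ (s - 1) • Ψ p.1 p.2)
      (μ.prod (volume.restrict (Ioi 0))) := by
  obtain ⟨D, hD, hle⟩ := h.exists_integrable_bound s.re
  have hD' : Integrable (fun p : X × ℝ => (1 : ℝ) * D p.2) (μ.prod (volume.restrict (Ioi 0))) :=
    (integrable_const (1 : ℝ)).mul_prod hD
  have hpos : ∀ᵐ p ∂(μ.prod (volume.restrict (Ioi (0 : ℝ)))), p.2 ∈ Ioi (0 : ℝ) :=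
    Measure.quasiMeasurePreserving_snd.ae (ae_restrict_mem measurableSet_Ioi)
  refine hD'.mono' ?_ ?_
  · have hm : Measurable fun p : X × ℝ => (p.2 : ℂ) ^ (s - 1) •
        (Ioi (0 : ℝ)).indicator (Ψ p.1) p.2 := by
      simp only [smul_eq_mul]
      refine Measurable.mul ?_ h.meas
      exact (Complex.measurable_ofReal.comp measurable_snd).pow_const _
    refine hm.aestronglyMeasurable.congr ?_
    filter_upwards [hpos] with p hp
    rw [indicator_of_mem hp]
  · filter_upwards [hpos, Measure.quasiMeasurePreserving_fst.ae hle] with p (hp : 0 < p.2) hx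
    rw [norm_smul, Complex.norm_cpow_eq_rpow_re_of_pos hp, one_mul]
    exact hx p.2 hp

theorem integrable_mellin (h : IsSelfDualFamily μ k Ψ) (s : ℂ) :
    Integrable (fun x => mellin (Ψ x) s) μ :=
  (h.integrable_prod s).integral_prod_left

theorem integral_mellin (h : IsSelfDualFamily μ k Ψ) (s : ℂ) :
    ∫ x, mellin (Ψ x) s ∂μ = mellin (fun t => ∫ x, Ψ x t ∂μ) s := by
  have h1 := integral_integral_swap (f := fun x (t : ℝ) => (t : ℂ) ^ (s - 1) • Ψ x t)
    (h.integrable_prod s)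
  rw [mellin]
  simp only [mellin]
  rw [h1]
  congr 1
  ext t
  rw [integral_smul]

end IsSelfDualFamily

end Family

/-! ## Integrals of rapidly decaying forms of weight `-k` against the Eisenstein series -/

/-- `H` transforms under `Γ₀(2)` by `((cz+d)/|cz+d|)^k`, under the Fricke involution by
`η (z/|z|)^k` with a sign `η`, and decays rapidly at the cusps. -/
structure IsDecayingForm (k : ℕ) (η : ℂ) (H : UpperHalfPlane → ℂ) : Prop where
  meas : Measurable H
  smul : ∀ γ ∈ CongruenceSubgroup.Gamma0 2, ∀ z,
    H (γ • z) = (linForm z (bottomRow γ) / ‖linForm z (bottomRow γ)‖) ^ k * H z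
  sq_eq_one : η ^ 2 = 1
  fricke : ∀ z, H (fricke z) = η * ((z : ℂ) / ‖(z : ℂ)‖) ^ k * H z
  decay : ∀ M : ℕ, ∃ C : ℝ, 0 ≤ C ∧ ∀ z : UpperHalfPlane, 1 / 2 ≤ z.im → ‖H z‖ * z.im ^ M ≤ C

/-- The integrand of the folded theta integral. -/
def foldedTerm (k : ℕ) (η : ℂ) (H : UpperHalfPlane → ℂ) (z : UpperHalfPlane) (t : ℝ) : ℂ :=
  H z * (unitTheta k z t + η * unitTheta k (twoMul z) t)

/-- `∫ H(z) (θ_z(t) + η θ_{2z}(t))` over the upper half of the Ford domain, with `θ_z` the theta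
series of the lattice `(ℤz + ℤ)/√y` with the weight `v^k`. -/
def foldedTheta (k : ℕ) (η : ℂ) (H : UpperHalfPlane → ℂ) (t : ℝ) : ℂ :=
  ∫ z in fordUpper, foldedTerm k η H z t

theorem measurable_twoMul : Measurable twoMul := by
  refine (Continuous.measurable ?_)
  rw [UpperHalfPlane.isEmbedding_coe.continuous_iff]
  exact continuous_const.mul UpperHalfPlane.continuous_coe

instance : IsFiniteMeasure (volume.restrict fordUpper) := ⟨by
  rw [Measure.restrict_apply_univ]; exact volume_fordUpper_lt_top⟩

namespace IsDecayingForm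

variable {k : ℕ} {η : ℂ} {H : UpperHalfPlane → ℂ}

theorem norm_eta (h : IsDecayingForm k η H) : ‖η‖ = 1 := by
  have := congrArg norm h.sq_eq_one
  rw [norm_pow, norm_one] at this
  exact (pow_eq_one_iff_of_nonneg (norm_nonneg _) two_ne_zero).1 this

/-- The growth y^M of the theta bound is cancelled by the decay of H, leaving a bound uniform over
the whole noncompact region. -/
theorem mul_unitTheta_family (h : IsDecayingForm k η H) (hk : 0 < k) :
    IsSelfDualFamily (volume.restrict fordUpper) k fun z t => H z * unitTheta k z t where
  meas := by
    have := (h.meas.comp (measurable_fst (β := ℝ))).mul (measurable_indicator_unitTheta k)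
    convert this using 1
    ext p
    simp only [Pi.mul_apply, indicator, Function.comp_apply]
    split_ifs <;> simp
  feq := .of_forall fun z t ht => by rw [unitTheta_inv k z ht]; ring
  bound := fun M hM => by
    obtain ⟨C, hC0, hC⟩ := exists_norm_unitTheta_le hk hM 1 (B := 1 / 2) (by norm_num)
    obtain ⟨D, hD0, hD⟩ := h.decay M
    refine ⟨D * C, by positivity, ?_⟩
    filter_upwards [ae_restrict_mem isClosed_fordUpper.measurableSet] with z hz t ht
    have him := half_le_im_of_mem_fordUpper hz
    rw [norm_mul]
    calc ‖H z‖ * ‖unitTheta k z t‖ ≤ ‖H z‖ * (C * z.im ^ M * (t ^ M)⁻¹) := by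
          gcongr; exact hC z (hz.1.trans (by norm_num)) him t ht
      _ = (‖H z‖ * z.im ^ M) * C * (t ^ M)⁻¹ := by ring
      _ ≤ D * C * (t ^ M)⁻¹ := by gcongr; exact hD z him

theorem mul_unitTheta_twoMul_family (h : IsDecayingForm k η H) (hk : 0 < k) :
    IsSelfDualFamily (volume.restrict fordUpper) k fun z t => H z * unitTheta k (twoMul z) t where
  meas := by
    have h2 : Measurable fun p : UpperHalfPlane × ℝ => (twoMul p.1, p.2) :=
      (measurable_twoMul.comp measurable_fst).prodMk measurable_snd
    have := (h.meas.comp (measurable_fst (β := ℝ))).mul ((measurable_indicator_unitTheta k).comp h2)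
    convert this using 1
    ext p
    simp only [Pi.mul_apply, indicator, Function.comp_apply]
    split_ifs <;> simp
  feq := .of_forall fun z t ht => by rw [unitTheta_inv k (twoMul z) ht]; ring
  bound := fun M hM => by
    obtain ⟨C, hC0, hC⟩ := exists_norm_unitTheta_le hk hM 1 (B := 1 / 2) (by norm_num)
    obtain ⟨D, hD0, hD⟩ := h.decay M
    refine ⟨D * (C * 2 ^ M), by positivity, ?_⟩
    filter_upwards [ae_restrict_mem isClosed_fordUpper.measurableSet] with z hz t ht
    have him := half_le_im_of_mem_fordUpper hz
    rw [norm_mul]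
    have hb := hC (twoMul z) (by rw [twoMul_re, abs_mul, abs_two]; linarith [hz.1])
      (by rw [twoMul_im]; linarith) t ht
    rw [twoMul_im, mul_pow] at hb
    calc ‖H z‖ * ‖unitTheta k (twoMul z) t‖ ≤ ‖H z‖ * (C * (2 ^ M * z.im ^ M) * (t ^ M)⁻¹) := by
          gcongr
      _ = (‖H z‖ * z.im ^ M) * (C * 2 ^ M) * (t ^ M)⁻¹ := by ring
      _ ≤ D * (C * 2 ^ M) * (t ^ M)⁻¹ := by gcongr; exact hD z him

theorem mellin_const_mul (a : ℂ) (F : ℝ → ℂ) (s : ℂ) :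
    mellin (fun t => a * F t) s = a * mellin F s := by
  simpa using mellin_const_smul F s a

theorem foldedTerm_family (h : IsDecayingForm k η H) (hk : 0 < k) :
    IsSelfDualFamily (volume.restrict fordUpper) k (foldedTerm k η H) where
  meas := by
    have := (h.mul_unitTheta_family hk).meas.add
      ((h.mul_unitTheta_twoMul_family hk).meas.const_mul η)
    convert this using 1
    ext p
    simp only [Pi.add_apply, indicator, foldedTerm]
    split_ifs <;> ring
  feq := by
    filter_upwards [(h.mul_unitTheta_family hk).feq, (h.mul_unitTheta_twoMul_family hk).feq]
      with z h1 h2 t ht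
    rw [foldedTerm, foldedTerm]
    linear_combination h1 t ht + η * h2 t ht
  bound := fun M hM => by
    obtain ⟨C, hC0, hC⟩ := (h.mul_unitTheta_family hk).bound M hM
    obtain ⟨D, hD0, hD⟩ := (h.mul_unitTheta_twoMul_family hk).bound M hM
    refine ⟨C + D, by positivity, ?_⟩
    filter_upwards [hC, hD] with z h1 h2 t ht
    rw [foldedTerm, show H z * (unitTheta k z t + η * unitTheta k (twoMul z) t) =
      H z * unitTheta k z t + η * (H z * unitTheta k (twoMul z) t) by ring, add_mul]
    refine (norm_add_le _ _).trans (add_le_add (h1 t ht) ?_)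
    rw [norm_mul, h.norm_eta, one_mul]
    exact h2 t ht

theorem isSelfDualDecaying_foldedTheta (h : IsDecayingForm k η H) (hk : 0 < k) :
    IsSelfDualDecaying k (foldedTheta k η H) :=
  (h.foldedTerm_family hk).isSelfDualDecaying_integral

/-- As -1/(2z) is the inversion of 2z, the Fricke involution exchanges the lattices of z and 2z up
to homothety. The automorphy factors of H and of the theta transform are inverse to each other, so
only η remains. -/
theorem fricke_mul_latticeMellin (h : IsDecayingForm k η H) (s : ℂ) (z : UpperHalfPlane) :
    H (MaassLift.fricke z) * latticeMellin k (MaassLift.fricke z) s =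
      η * (H z * latticeMellin k (twoMul z) s) := by
  have hz : (z : ℂ) ≠ 0 := UpperHalfPlane.ne_zero z
  have hn : ((‖(z : ℂ)‖ : ℝ) : ℂ) ≠ 0 := by exact_mod_cast norm_ne_zero_iff.2 hz
  rw [h.fricke, latticeMellin_neg_inv k (z := twoMul z) (by rw [coe_fricke, coe_twoMul])]
  have h1 : (((‖(twoMul z : ℂ)‖ : ℝ) : ℂ) / (twoMul z : ℂ)) = ((‖(z : ℂ)‖ : ℝ) : ℂ) / z := by
    rw [coe_twoMul, norm_mul]
    simp
    field_simp
  have h2 : ((z : ℂ) / (‖(z : ℂ)‖ : ℝ)) ^ k * (((‖(z : ℂ)‖ : ℝ) : ℂ) / z) ^ k = 1 := by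
    rw [← mul_pow, div_mul_div_cancel₀ hn, div_self hz, one_pow]
  rw [h1]
  linear_combination η * H z * latticeMellin k (twoMul z) s * h2

theorem fricke_mul_latticeMellin_twoMul (h : IsDecayingForm k η H) (s : ℂ) (z : UpperHalfPlane) :
    H (MaassLift.fricke z) * latticeMellin k (twoMul (MaassLift.fricke z)) s =
      η * (H z * latticeMellin k z s) := by
  have h1 := h.fricke_mul_latticeMellin s (MaassLift.fricke z)
  rw [fricke_fricke] at h1
  linear_combination (-η) * h1 - H (MaassLift.fricke z) *
    latticeMellin k (twoMul (MaassLift.fricke z)) s * h.sq_eq_one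

/-- Over the Fricke image of the upper half, the integrand for z becomes η times that for 2z and
conversely. Both integrals over the full domain are therefore combinations of the same two integrals
over the half, and differ by η since η² = 1. -/
theorem integral_mul_latticeMellin (h : IsDecayingForm k η H) (hk : 0 < k) (s : ℂ) :
    IntegrableOn (fun z => H z * latticeMellin k z s) fordDomain ∧
    IntegrableOn (fun z => H z * latticeMellin k (twoMul z) s) fordDomain ∧
    ∫ z in fordDomain, H z * latticeMellin k z s = mellin (foldedTheta k η H) (s + k / 2) ∧
    ∫ z in fordDomain, H z * latticeMellin k (twoMul z) s =
      η * mellin (foldedTheta k η H) (s + k / 2) := by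
  have i0 : IntegrableOn (fun z => H z * latticeMellin k z s) fordUpper := by
    have := (h.mul_unitTheta_family hk).integrable_mellin (s + k / 2)
    simp only [mellin_const_mul] at this
    exact this
  have i1 : IntegrableOn (fun z => H z * latticeMellin k (twoMul z) s) fordUpper := by
    have := (h.mul_unitTheta_twoMul_family hk).integrable_mellin (s + k / 2)
    simp only [mellin_const_mul] at this
    exact this
  have a0 := integrableOn_fordDomain i0 (by
    simp only [h.fricke_mul_latticeMellin]; exact i1.const_mul η)
  have a1 := integrableOn_fordDomain i1 (by
    simp only [h.fricke_mul_latticeMellin_twoMul]; exact i0.const_mul η)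
  have e : mellin (foldedTheta k η H) (s + k / 2) =
      (∫ z in fordUpper, H z * latticeMellin k z s) +
        η * ∫ z in fordUpper, H z * latticeMellin k (twoMul z) s := by
    rw [← integral_const_mul, ← integral_add i0 (i1.const_mul η)]
    rw [show mellin (foldedTheta k η H) (s + k / 2) =
      ∫ z in fordUpper, mellin (foldedTerm k η H z) (s + k / 2) from
      ((h.foldedTerm_family hk).integral_mellin _).symm]
    congr 1
    ext z
    have h1 := ((isSelfDualDecaying_unitTheta hk z).mellinConvergent (s + k / 2))
    have h2 := ((isSelfDualDecaying_unitTheta hk (twoMul z)).mellinConvergent (s + k / 2))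
    have h3 := (hasMellin_add h1 (h2.const_smul η)).2
    rw [show foldedTerm k η H z = fun t => H z * (unitTheta k z t + η • unitTheta k (twoMul z) t)
      from rfl, mellin_const_mul, h3, mellin_const_smul, latticeMellin, latticeMellin, smul_eq_mul]
    ring
  refine ⟨a0.1, a1.1, ?_, ?_⟩
  · rw [a0.2, e]
    simp only [h.fricke_mul_latticeMellin, integral_const_mul]
  · rw [a1.2, e]
    simp only [h.fricke_mul_latticeMellin_twoMul, integral_const_mul]
    linear_combination (-∫ z in fordUpper, H z * latticeMellin k (twoMul z) s) * h.sq_eq_one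

/-- The integral is K(η2^s - 1)/(2^(2s) - 1) times the Mellin transform, and (η2^s - 1)(2^s + η) =
η(2^(2s) - 1) as η² = 1. The factor 2^s + η thus cancels the whole denominator. -/
theorem integral_mul_eisContinuation {l : ℕ} (h : IsDecayingForm (l + 2) η H) {s : ℂ}
    (hs : (2 : ℂ) ^ (2 * s) ≠ 1) :
    IntegrableOn (fun z => H z * eisContinuation l z s) fordDomain ∧
    ((2 : ℂ) ^ s + η) * ∫ z in fordDomain, H z * eisContinuation l z s =
      η * (((4 * Real.pi : ℝ) : ℂ) ^ ((l : ℂ) / 2) / 4 * (Real.pi : ℂ) ^ ((l : ℂ) / 2 + 1)) *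
        mellin (foldedTheta (l + 2) η H) (s + (l + 2 : ℕ) / 2) := by
  obtain ⟨i0, i1, e0, e1⟩ := h.integral_mul_latticeMellin (by omega) s
  set K : ℂ := ((4 * Real.pi : ℝ) : ℂ) ^ ((l : ℂ) / 2) / 4 * (Real.pi : ℂ) ^ ((l : ℂ) / 2 + 1)
    with hK
  have hne : (2 : ℂ) ^ (2 * s) - 1 ≠ 0 := sub_ne_zero.2 hs
  have heq : (fun z => H z * eisContinuation l z s) = fun z =>
      (K * 2 ^ s / (2 ^ (2 * s) - 1)) * (H z * latticeMellin (l + 2) (twoMul z) s) -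
        (K / (2 ^ (2 * s) - 1)) * (H z * latticeMellin (l + 2) z s) := by
    ext z
    rw [eisContinuation, ← hK]
    ring
  refine ⟨heq ▸ (i1.const_mul _).sub (i0.const_mul _), ?_⟩
  rw [heq, integral_sub (i1.const_mul _) (i0.const_mul _), integral_const_mul, integral_const_mul,
    e0, e1]
  have h2 : (2 : ℂ) ^ (2 * s) = (2 ^ s) ^ 2 := by
    rw [← Complex.cpow_nat_mul]; norm_num
  rw [div_mul_eq_mul_div, div_mul_eq_mul_div, ← sub_div, ← mul_div_assoc, div_eq_iff hne, h2]
  linear_combination (K * 2 ^ s * mellin (foldedTheta (l + 2) η H) (s + (l + 2 : ℕ) / 2)) *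
    h.sq_eq_one

end IsDecayingForm

end MaassLift

namespace MaassLift
open MeasureTheory Set Filter

/-! ## The product of a cusp form and a theta series -/

variable {r : ℂ} {f : UpperHalfPlane → ℂ} {ε : ℂ} {c : ℤ → ℂ} {l : ℕ}
  {P : MvPolynomial (Fin 4) ℂ} {εP : ℂ}

/-- `f(z) Θ(z) y^{(l+2)/2}`. -/
def formProduct (l : ℕ) (f : UpperHalfPlane → ℂ) (P : MvPolynomial (Fin 4) ℂ)
    (z : UpperHalfPlane) : ℂ :=
  f z * theta (evalQ P) z * ((z.im ^ (((l : ℝ) + 2) / 2) : ℝ) : ℂ)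

theorem zetaIntegrand_eq (l : ℕ) (f : UpperHalfPlane → ℂ) (P : MvPolynomial (Fin 4) ℂ)
    (E : UpperHalfPlane → ℂ → ℂ) (s : ℂ) (z : UpperHalfPlane) :
    zetaIntegrand l f (evalQ P) E s z = formProduct l f P z * E z s := by
  rw [zetaIntegrand, formProduct]; ring

theorem rpow_half_sq {a : ℝ} (ha : 0 ≤ a) (l : ℕ) :
    (a ^ 2) ^ (((l : ℝ) + 2) / 2) = a ^ (l + 2) := by
  rw [← Real.rpow_natCast a 2, ← Real.rpow_mul ha, ← Real.rpow_natCast]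
  congr 1
  push_cast
  ring

/-- Θ contributes (cz+d)^(l+2) and the power of y contributes |cz+d|^(-(l+2)). The sign is ε from f
times -ε_P from Θ, and the exponential decay of f beats the power of y while Θ stays bounded. -/
theorem isDecayingForm_formProduct (hf : IsMaassCuspForm r f) (hε : ε = 1 ∨ ε = -1)
    (hAL : HasAtkinLehnerEigenvalue f ε) (hc : HasFourierCoeffs r f c) (hP : IsHarmonicPoly l P)
    (hE : IsEigenPoly P εP) (hεP : εP = 1 ∨ εP = -1) (hl : Even l) :
    IsDecayingForm (l + 2) (-(ε * εP)) (formProduct l f P) where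
  meas := by
    refine (hf.continuous.measurable.mul (measurable_theta hP)).mul ?_
    exact Complex.measurable_ofReal.comp (UpperHalfPlane.continuous_im.measurable.pow_const _)
  smul := fun γ hγ z => by
    have hn := norm_pos_iff.2 (linForm_bottomRow_ne_zero γ z)
    rw [formProduct, formProduct, hf.invariant γ hγ, theta_smul hP hE hεP hl hγ, smul_im,
      Real.div_rpow z.im_pos.le (by positivity), rpow_half_sq hn.le, div_pow]
    push_cast
    ring
  sq_eq_one := by rcases hε with rfl | rfl <;> rcases hεP with rfl | rfl <;> norm_num
  fricke := fun z => by
    have hz := norm_pos_iff.2 (UpperHalfPlane.ne_zero z)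
    have h2 : 2 * ‖(z : ℂ)‖ ^ 2 = (Real.sqrt 2 * ‖(z : ℂ)‖) ^ 2 := by
      rw [mul_pow, Real.sq_sqrt two_pos.le]
    have hs : ((Real.sqrt 2 : ℝ) : ℂ) ≠ 0 := by exact_mod_cast (Real.sqrt_pos.2 two_pos).ne'
    have hn : ((‖(z : ℂ)‖ : ℝ) : ℂ) ≠ 0 := by exact_mod_cast hz.ne'
    rw [formProduct, formProduct, hAL.fricke, theta_fricke hP hE hεP, fricke_im, h2,
      Real.div_rpow z.im_pos.le (by positivity), rpow_half_sq (by positivity), div_pow, mul_pow,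
      mul_pow]
    push_cast
    field_simp
  decay := fun M => by
    obtain ⟨C, hC0, hC⟩ := hf.exists_norm_le_exp hε hAL hc
    obtain ⟨D, hD0, hD⟩ := exists_norm_theta_le hP
    set n := l + 2 + M with hn
    refine ⟨C * D * (2 ^ n * n.factorial), by positivity, fun z hz => ?_⟩
    have hy := z.im_pos
    have h1 : z.im ^ (((l : ℝ) + 2) / 2) ≤ (2 * z.im) ^ (l + 2) := by
      calc z.im ^ (((l : ℝ) + 2) / 2) ≤ (2 * z.im) ^ (((l : ℝ) + 2) / 2) := by
            gcongr; linarith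
        _ ≤ (2 * z.im) ^ (((l + 2 : ℕ) : ℝ)) := by
            refine Real.rpow_le_rpow_of_exponent_le (by linarith) ?_
            push_cast
            linarith [(Nat.cast_nonneg l : (0 : ℝ) ≤ l)]
        _ = _ := Real.rpow_natCast _ _
    have h2 : z.im ^ M ≤ (2 * z.im) ^ M := by gcongr; linarith
    have h3 : z.im ^ n * Real.exp (-z.im) ≤ n.factorial := by
      have := Real.pow_div_factorial_le_exp z.im hy.le n
      rw [div_le_iff₀ (by positivity)] at this
      calc z.im ^ n * Real.exp (-z.im) ≤ (Real.exp z.im * n.factorial) * Real.exp (-z.im) := by gcongr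
        _ = n.factorial := by
          rw [mul_right_comm, ← Real.exp_add, add_neg_cancel, Real.exp_zero, one_mul]
    rw [formProduct, norm_mul, norm_mul, Complex.norm_real,
      Real.norm_of_nonneg (Real.rpow_nonneg hy.le _)]
    calc ‖f z‖ * ‖theta (evalQ P) z‖ * z.im ^ (((l : ℝ) + 2) / 2) * z.im ^ M
        ≤ (C * Real.exp (-z.im)) * D * (2 * z.im) ^ (l + 2) * (2 * z.im) ^ M := by
          gcongr
          · exact hC z hz
          · exact hD z hz
      _ = C * D * (2 ^ n * (z.im ^ n * Real.exp (-z.im))) := by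
          rw [hn, pow_add, pow_add]; ring
      _ ≤ C * D * (2 ^ n * n.factorial) := by gcongr

/-- A rapidly decaying form is bounded. -/
theorem IsDecayingForm.exists_norm_le {k : ℕ} {η : ℂ} {H : UpperHalfPlane → ℂ}
    (h : IsDecayingForm k η H) : ∃ C : ℝ, 0 ≤ C ∧ ∀ z, ‖H z‖ ≤ C := by
  obtain ⟨C, hC0, hC⟩ := h.decay 0
  refine ⟨C, hC0, fun z => ?_⟩
  obtain ⟨w, hw, -, hg⟩ := exists_reduction z
  have := hg (fun z => ‖H z‖) (fun γ hγ z => by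
      rw [h.smul γ hγ, norm_mul, norm_pow, norm_div, Complex.norm_real, norm_norm,
        div_self (norm_ne_zero_iff.2 (linForm_bottomRow_ne_zero γ z)), one_pow, one_mul])
    (fun z => by
      rw [h.fricke, norm_mul, norm_mul, h.norm_eta, norm_pow, norm_div, Complex.norm_real, norm_norm,
        div_self (norm_ne_zero_iff.2 (UpperHalfPlane.ne_zero z)), one_pow, one_mul, one_mul])
  rw [← this]
  simpa using hC w (half_le_im_of_mem_fordUpper hw)

/-! ## Unfolding -/

section Unfolding

variable {η : ℂ} {H : UpperHalfPlane → ℂ}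

theorem continuousOn_mkPoint : ContinuousOn mkPoint {p : ℝ × ℝ | 0 < p.2} := by
  rw [UpperHalfPlane.isEmbedding_coe.continuousOn_iff]
  refine ContinuousOn.congr (f := fun p : ℝ × ℝ => (p.1 + p.2 * Complex.I : ℂ)) ?_
    fun p hp => coe_mkPoint hp
  fun_prop

theorem aemeasurable_mkPoint : AEMeasurable mkPoint (volume.restrict {p : ℝ × ℝ | 0 < p.2}) :=
  continuousOn_mkPoint.aemeasurable (measurableSet_lt measurable_const measurable_snd)

theorem measurable_im_cpow (s : ℂ) : Measurable fun z : UpperHalfPlane => (z.im : ℂ) ^ s :=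
  (Complex.measurable_ofReal.comp UpperHalfPlane.continuous_im.measurable).pow_const s

/-- Near y = 0 the form is bounded, and y^(Re s - 2) is integrable because Re s > 1; near ∞ rapid
decay beats any power. -/
theorem IsDecayingForm.integrableOn_unitStrip {k : ℕ} (h : IsDecayingForm k η H) {s : ℂ}
    (hs : 1 < s.re) : IntegrableOn (fun z => H z * (z.im : ℂ) ^ s) unitStrip := by
  have hst : unitStrip = {z : UpperHalfPlane | z.re ∈ Ioc (-1 / 2 : ℝ) (1 / 2) ∧ z.im ∈ Ioi (0 : ℝ)} := by
    ext z
    exact ⟨fun h => ⟨h, z.im_pos⟩, fun h => h.1⟩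
  obtain ⟨C, hC0, hC⟩ := h.exists_norm_le
  obtain ⟨M, hM⟩ := exists_nat_gt s.re
  obtain ⟨D, hD0, hD⟩ := h.decay M
  have i1 : IntegrableOn (fun y : ℝ => D * y ^ (s.re - 2 - M)) (Ioi 1) :=
    (integrableOn_Ioi_rpow_of_lt (by linarith) one_pos).const_mul D
  have i2 : IntegrableOn (fun y : ℝ => C * y ^ (s.re - 2)) (Ioc 0 1) := by
    have := (intervalIntegral.intervalIntegrable_rpow' (a := 0) (b := 1)
      (r := s.re - 2) (by linarith)).const_mul C
    rwa [intervalIntegrable_iff_integrableOn_Ioc_of_le zero_le_one] at this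
  classical
  set B : ℝ → ℝ := (Ioi 1).piecewise (fun y => D * y ^ (s.re - 2 - M))
    (fun y => C * y ^ (s.re - 2)) with hB
  have iB : IntegrableOn B (Ioi 0) := by
    rw [← Ioc_union_Ioi_eq_Ioi (zero_le_one' ℝ)]
    refine IntegrableOn.union ?_ ?_
    · refine i2.congr_fun (fun t ht => ?_) measurableSet_Ioc
      rw [hB, piecewise_eq_of_notMem _ _ _ (show t ∉ Ioi (1 : ℝ) from not_lt.2 ht.2)]
    · refine i1.congr_fun (fun t ht => ?_) measurableSet_Ioi
      rw [hB, piecewise_eq_of_mem _ _ _ ht]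
  have hm : Measurable fun z => H z * (z.im : ℂ) ^ s := h.meas.mul (measurable_im_cpow s)
  rw [hst, integrableOn_coords measurableSet_Ioc measurableSet_Ioi Subset.rfl]
  have iP : Integrable (fun p : ℝ × ℝ => (1 : ℝ) * B p.2)
      ((volume.restrict (Ioc (-1 / 2 : ℝ) (1 / 2))).prod (volume.restrict (Ioi 0))) :=
    (integrable_const (1 : ℝ)).mul_prod iB
  rw [Measure.prod_restrict] at iP
  refine Integrable.mono' iP ?_ ?_
  · refine AEMeasurable.aestronglyMeasurable (AEMeasurable.mul ?_ (hm.comp_aemeasurable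
      (aemeasurable_mkPoint.mono_set fun p hp => hp.2)))
    exact (Complex.measurable_ofReal.comp ((measurable_snd.pow_const 2).const_div 1)).aemeasurable
  · refine (ae_restrict_iff' (measurableSet_Ioc.prod measurableSet_Ioi)).2 (.of_forall fun p hp => ?_)
    have hp2 : 0 < p.2 := hp.2
    rw [mkPoint_im hp2, norm_mul, norm_mul, Complex.norm_real, Complex.norm_cpow_eq_rpow_re_of_pos hp2,
      Real.norm_of_nonneg (by positivity), one_mul]
    have e : p.2 ^ (s.re - 2) = 1 / p.2 ^ 2 * p.2 ^ s.re := by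
      rw [Real.rpow_sub hp2, show (2 : ℝ) = ((2 : ℕ) : ℝ) by norm_num, Real.rpow_natCast]; ring
    by_cases h1 : p.2 ∈ Ioi 1
    · rw [hB, piecewise_eq_of_mem _ _ _ h1]
      have := hD (mkPoint p) (by rw [mkPoint_im hp2]; linarith [mem_Ioi.1 h1])
      rw [mkPoint_im hp2] at this
      rw [Real.rpow_sub hp2 _ (M : ℝ), Real.rpow_natCast, e]
      calc 1 / p.2 ^ 2 * (‖H (mkPoint p)‖ * p.2 ^ s.re) =
          (‖H (mkPoint p)‖ * p.2 ^ M) * (1 / p.2 ^ 2 * p.2 ^ s.re / p.2 ^ M) := by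
            field_simp
        _ ≤ D * (1 / p.2 ^ 2 * p.2 ^ s.re / p.2 ^ M) := by gcongr
    · rw [hB, piecewise_eq_of_notMem _ _ _ h1, e]
      calc 1 / p.2 ^ 2 * (‖H (mkPoint p)‖ * p.2 ^ s.re) =
          ‖H (mkPoint p)‖ * (1 / p.2 ^ 2 * p.2 ^ s.re) := by ring
        _ ≤ C * (1 / p.2 ^ 2 * p.2 ^ s.re) := by gcongr; exact hC _

/-- The automorphy factor of H is the one in the Eisenstein series, so H(γz) Im(γz)^s is H(z) times
its γ-term, and the sum unfolds to the strip. -/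
theorem IsDecayingForm.integral_eisSeries (h : IsDecayingForm (l + 2) η H) {s : ℂ}
    (hs : 1 < s.re) :
    ∫ z in fordDomain, H z * eisSeries l z s =
      ((4 * Real.pi : ℝ) : ℂ) ^ ((l : ℂ) / 2) * (Real.pi : ℂ) ^ (-s) *
        Complex.Gamma (s + (l : ℂ) / 2 + 1) * riemannZeta (2 * s) *
        (1 / 2 * ∫ z in unitStrip, H z * (z.im : ℂ) ^ s) := by
  have hT : ∀ z, H (ModularGroup.T • z) * ((ModularGroup.T • z : UpperHalfPlane).im : ℂ) ^ s =
      H z * (z.im : ℂ) ^ s := fun z => by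
    have hTm : ModularGroup.T ∈ CongruenceSubgroup.Gamma0 2 :=
      mem_Gamma0_two_iff.2 (by simp [ModularGroup.T])
    rw [h.smul _ hTm, show linForm z (bottomRow ModularGroup.T) = 1 by
      simp [linForm, bottomRow, ModularGroup.T], UpperHalfPlane.modular_T_smul, UpperHalfPlane.vadd_im]
    simp
  rw [← integral_fordDomain_tsum hT (h.integrableOn_unitStrip hs), ← integral_const_mul,
    ← integral_const_mul]
  congr 1
  ext z
  have e : ∀ q : Quotient (QuotientGroup.rightRel GammaInf),
      H ((q.out : SL(2, ℤ)) • z) * ((((q.out : SL(2, ℤ)) • z : UpperHalfPlane).im : ℝ) : ℂ) ^ s =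
        H z * eisCosetTerm l z s q := fun q => by
    rw [h.smul _ q.out.2, smul_im, eisCosetTerm, eisTerm_eq, eisLatticeTerm]
    ring
  simp only [e, tsum_mul_left]
  rw [eisSeries]
  ring

end Unfolding

end MaassLift

namespace MaassLift
open MeasureTheory Set Filter

/-! ## Rankin–Selberg integral over the strip -/

instance : Countable LatticeSNonzero :=
  Function.Injective.countable (f := fun β : LatticeSNonzero => (⟨β.1, β.2.1⟩ : latticeS))
    fun _ _ h => Subtype.ext (Subtype.mk.inj h)

/-- The function `K_μ(x) e^{-x} x^{w-1}`. -/
def besselExpKernel (μ w : ℂ) (x : ℝ) : ℂ :=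
  besselK μ x * Complex.exp (-(x : ℂ)) * (x : ℂ) ^ (w - 1)

/-- A non-integrable function would have integral 0 by convention, whereas the evaluated integral is
a quotient of nonzero Gamma values. -/
theorem integrableOn_besselExpKernel {μ w : ℂ} (h : |μ.re| < w.re) :
    IntegrableOn (besselExpKernel μ w) (Ioi 0) := by
  by_contra hc
  have h1 := integral_besselK_mul_exp h
  have h2 := abs_lt.1 h
  have hw : 0 < w.re := (abs_nonneg _).trans_lt h
  rw [show ∫ x in Ioi (0 : ℝ), besselK μ x * Complex.exp (-(x : ℂ)) * (x : ℂ) ^ (w - 1) = 0 from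
    integral_undef hc] at h1
  refine absurd h1.symm (mul_ne_zero (mul_ne_zero ?_ ?_) (div_ne_zero (mul_ne_zero ?_ ?_) ?_))
  · exact_mod_cast (Real.sqrt_pos.2 Real.pi_pos).ne'
  · rw [Complex.cpow_ne_zero_iff]; left; norm_num
  · exact Complex.Gamma_ne_zero_of_re_pos (by rw [Complex.add_re]; linarith [h2.1])
  · exact Complex.Gamma_ne_zero_of_re_pos (by rw [Complex.sub_re]; linarith [h2.2])
  · exact Complex.Gamma_ne_zero_of_re_pos (by simp; linarith)

theorem besselExpKernel_mul {μ w : ℂ} {a y : ℝ} (ha : 0 < a) (hy : 0 < y) :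
    besselK μ (a * y) * Complex.exp (-((a * y : ℝ) : ℂ)) * (y : ℂ) ^ (w - 1) =
      (a : ℂ) ^ (1 - w) * besselExpKernel μ w (a * y) := by
  have ha' : (a : ℂ) ≠ 0 := by exact_mod_cast ha.ne'
  rw [besselExpKernel, Complex.ofReal_mul a y, Complex.mul_cpow_ofReal_nonneg ha.le hy.le,
    show (1 - w) = -(w - 1) by ring, Complex.cpow_neg]
  have : (a : ℂ) ^ (w - 1) ≠ 0 := by rw [Complex.cpow_ne_zero_iff]; exact Or.inl ha'
  field_simp

variable {r : ℂ} {f : UpperHalfPlane → ℂ} {ε : ℂ} {c : ℤ → ℂ} {l : ℕ}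
  {P : MvPolynomial (Fin 4) ℂ} {εP : ℂ}

/-- The contribution of `γ` to the constant Fourier coefficient of `f Θ` at height `y`. -/
def stripTerm (r : ℂ) (c : ℤ → ℂ) (P : MvPolynomial (Fin 4) ℂ) (y : ℝ) (γ : LatticeSNonzero) : ℂ :=
  c ⌊-(‖(γ : ℍ[ℝ])‖ ^ 2 / 2)⌋ * whittakerW0 (Complex.I * r / 2) (2 * Real.pi * ‖(γ : ℍ[ℝ])‖ ^ 2 * y) *
    (evalQ P γ * Complex.exp (-((Real.pi * ‖(γ : ℍ[ℝ])‖ ^ 2 * y : ℝ) : ℂ)))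

theorem cast_floor_norm_sq {β : ℍ[ℝ]} (h : β ∈ latticeS) :
    ((⌊-(‖β‖ ^ 2 / 2)⌋ : ℤ) : ℝ) = -(‖β‖ ^ 2 / 2) := by
  obtain ⟨m, hm⟩ := exists_norm_sq_eq h
  rw [floor_norm_sq_half hm, hm]
  push_cast
  ring

/-- The nonzero element `γ` as an index of the product of `f` and `Θ`. -/
def stripIndex (γ : LatticeSNonzero) : {n : ℤ // n ≠ 0} × latticeS :=
  (⟨⌊-(‖(γ : ℍ[ℝ])‖ ^ 2 / 2)⌋, by
    obtain ⟨m, hm0, hm⟩ := norm_sq_pos_of_mem γ.2.1 γ.2.2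
    rw [floor_norm_sq_half hm]
    omega⟩, ⟨γ, γ.2.1⟩)

theorem stripIndex_injective : Function.Injective stripIndex := fun x y h => by
  have := congrArg (fun p => ((p.2 : latticeS) : ℍ[ℝ])) h
  exact Subtype.ext this

/-- The frequency of a product of Fourier modes of `f` and `Θ`. -/
def stripFreq (x : {n : ℤ // n ≠ 0} × latticeS) : ℤ :=
  x.1 - ⌊-(‖(x.2 : ℍ[ℝ])‖ ^ 2 / 2)⌋

/-- In the absolutely convergent double Fourier series of fΘ the mode of (n,β) has frequency n +
|β|²/2; integration over a period keeps n = -|β|²/2. As f has no constant term, β = 0 does not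
occur. -/
theorem hasSum_integral_horocycle (hc : HasFourierCoeffs r f c) (hP : IsHarmonicPoly l P) {y : ℝ}
    (hy : 0 < y) :
    HasSum (stripTerm r c P y)
      (∫ x in Ioc (-1 / 2 : ℝ) (1 / 2), f (mkPoint (x, y)) * theta (evalQ P) (mkPoint (x, y))) := by
  set b : latticeS → ℂ := fun β =>
    evalQ P β * Complex.exp (-((Real.pi * ‖(β : ℍ[ℝ])‖ ^ 2 * y : ℝ) : ℂ)) with hb
  set a : {n : ℤ // n ≠ 0} × latticeS → ℂ := fun x => whitCoeff r c y x.1 * b x.2 with ha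
  have hθ : ∀ (x : ℝ) (β : latticeS), thetaTerm P (mkPoint (x, y)) β =
      b β * Complex.exp (2 * Real.pi * Complex.I * (-⌊-(‖(β : ℍ[ℝ])‖ ^ 2 / 2)⌋ : ℤ) * x) := by
    intro x β
    rw [hb, thetaTerm, coe_mkPoint (p := (x, y)) hy, mul_assoc (evalQ P β), ← Complex.exp_add]
    congr 2
    have h1 : (((-⌊-(‖(β : ℍ[ℝ])‖ ^ 2 / 2)⌋ : ℤ) : ℝ) : ℂ) = ((‖(β : ℍ[ℝ])‖ ^ 2 / 2 : ℝ) : ℂ) := by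
      congr 1
      rw [Int.cast_neg, cast_floor_norm_sq β.2, neg_neg]
    rw [Complex.ofReal_intCast] at h1
    rw [h1]
    push_cast
    linear_combination (Real.pi * (‖(β : ℍ[ℝ])‖ : ℂ) ^ 2 * y) * Complex.I_sq
  have hbs : Summable fun β => ‖b β‖ := by
    refine (hasSum_theta hP (mkPoint (0, y))).summable.norm.congr fun β => ?_
    rw [hθ, norm_mul, norm_exp_two_pi_int, mul_one]
  have hF : ∀ x : ℝ, HasSum (fun i => a i * Complex.exp (2 * Real.pi * Complex.I * stripFreq i * x))
      (f (mkPoint (x, y)) * theta (evalQ P) (mkPoint (x, y))) := by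
    intro x
    refine hasSum_of_eq (hasSum_mul_prod (hc.hasSum_mkPoint hy x)
      (hasSum_theta hP (mkPoint (x, y)))) fun i => ?_
    rw [hθ, ha, stripFreq]
    have : Complex.exp (2 * Real.pi * Complex.I *
        (((i.1 : ℤ) - ⌊-(‖(i.2 : ℍ[ℝ])‖ ^ 2 / 2)⌋ : ℤ) : ℂ) * x) =
        Complex.exp (2 * Real.pi * Complex.I * (i.1 : ℤ) * x) *
        Complex.exp (2 * Real.pi * Complex.I * (-⌊-(‖(i.2 : ℍ[ℝ])‖ ^ 2 / 2)⌋ : ℤ) * x) := by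
      rw [← Complex.exp_add]
      congr 1
      push_cast
      ring
    rw [this]
    ring
  have has : Summable fun i => ‖a i‖ := by
    refine (summable_mul_of_summable_norm (f := fun n : {n : ℤ // n ≠ 0} => ‖whitCoeff r c y n‖)
      (g := fun β => ‖b β‖) ?_ ?_).congr fun i => (norm_mul _ _).symm
    · simpa using hc.summable_norm hy
    · simpa using hbs
  have key := hasSum_integral_fourier has stripFreq hF
  rw [← stripIndex_injective.hasSum_iff] at key
  · refine hasSum_of_eq key fun γ => ?_
    rw [Function.comp_apply, if_pos (by simp [stripFreq, stripIndex])]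
    have h1 : |((⌊-(‖(γ : ℍ[ℝ])‖ ^ 2 / 2)⌋ : ℤ) : ℝ)| = ‖(γ : ℍ[ℝ])‖ ^ 2 / 2 := by
      rw [cast_floor_norm_sq γ.2.1, abs_neg, abs_of_nonneg (by positivity)]
    simp only [ha, hb, stripIndex, whitCoeff, stripTerm]
    rw [h1, show 4 * Real.pi * (‖(γ : ℍ[ℝ])‖ ^ 2 / 2) * y = 2 * Real.pi * ‖(γ : ℍ[ℝ])‖ ^ 2 * y by ring]
  · intro x hx
    rw [if_neg]
    intro h0
    refine hx ⟨⟨x.2, x.2.2, fun h => ?_⟩, ?_⟩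
    · rw [stripFreq, h] at h0
      exact x.1.2 (by simpa using h0)
    · rw [stripFreq, sub_eq_zero] at h0
      exact Prod.ext (Subtype.ext h0.symm) rfl

/-- The Bessel function of f and the exponential of Θ have the same argument x = π|γ|²y, so the
y-integral is a rescaled Mellin transform of K_μ(x)e^(-x); the shift by 1/2 in w comes from the √y
in the Whittaker function. -/
theorem stripTerm_mul_cpow {s : ℂ} {y : ℝ} (hy : 0 < y) (γ : LatticeSNonzero) :
    stripTerm r c P y γ * (y : ℂ) ^ (s + (l : ℂ) / 2 - 1) =
      (c ⌊-(‖(γ : ℍ[ℝ])‖ ^ 2 / 2)⌋ * evalQ P γ * ((Real.sqrt 2 * ‖(γ : ℍ[ℝ])‖ : ℝ) : ℂ) *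
        ((Real.pi * ‖(γ : ℍ[ℝ])‖ ^ 2 : ℝ) : ℂ) ^ (1 - (s + (l : ℂ) / 2 + 1 / 2))) *
      besselExpKernel (Complex.I * r / 2) (s + (l : ℂ) / 2 + 1 / 2)
        (Real.pi * ‖(γ : ℍ[ℝ])‖ ^ 2 * y) := by
  have hg : 0 < ‖(γ : ℍ[ℝ])‖ := norm_pos_iff.2 γ.2.2
  have hpi := Real.pi_pos
  have h1 := besselExpKernel_mul (μ := Complex.I * r / 2) (w := s + (l : ℂ) / 2 + 1 / 2)
    (a := Real.pi * ‖(γ : ℍ[ℝ])‖ ^ 2) (by positivity) hy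
  have h2 : Real.sqrt (2 * Real.pi * ‖(γ : ℍ[ℝ])‖ ^ 2 * y / Real.pi) =
      Real.sqrt 2 * ‖(γ : ℍ[ℝ])‖ * Real.sqrt y := by
    rw [show 2 * Real.pi * ‖(γ : ℍ[ℝ])‖ ^ 2 * y / Real.pi = 2 * ‖(γ : ℍ[ℝ])‖ ^ 2 * y by
      field_simp, Real.sqrt_mul (by positivity), Real.sqrt_mul (by positivity), Real.sqrt_sq hg.le]
  have h3 : ((Real.sqrt y : ℝ) : ℂ) * (y : ℂ) ^ (s + (l : ℂ) / 2 - 1) =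
      (y : ℂ) ^ (s + (l : ℂ) / 2 + 1 / 2 - 1) := by
    have hy' : (y : ℂ) ≠ 0 := by exact_mod_cast hy.ne'
    rw [Real.sqrt_eq_rpow, Complex.ofReal_cpow hy.le, ← Complex.cpow_add _ _ hy']
    congr 1
    push_cast
    ring
  rw [mul_assoc _ _ (besselExpKernel _ _ _), ← h1, stripTerm, whittakerW0, h2,
    show 2 * Real.pi * ‖(γ : ℍ[ℝ])‖ ^ 2 * y / 2 = Real.pi * ‖(γ : ℍ[ℝ])‖ ^ 2 * y by ring, ← h3,
    Complex.ofReal_mul (Real.sqrt 2 * _)]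
  ring

theorem const_mul_pi_cpow (w : ℂ) (γ : LatticeSNonzero) :
    c ⌊-(‖(γ : ℍ[ℝ])‖ ^ 2 / 2)⌋ * evalQ P γ * ((Real.sqrt 2 * ‖(γ : ℍ[ℝ])‖ : ℝ) : ℂ) *
        ((Real.pi * ‖(γ : ℍ[ℝ])‖ ^ 2 : ℝ) : ℂ) ^ (1 - w) *
        ((Real.pi * ‖(γ : ℍ[ℝ])‖ ^ 2 : ℝ) : ℂ)⁻¹ =
      ((Real.sqrt 2 : ℝ) : ℂ) * (Real.pi : ℂ) ^ (-w) * baseTerm c (evalQ P) w γ := by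
  have hg : 0 < ‖(γ : ℍ[ℝ])‖ := norm_pos_iff.2 γ.2.2
  have hg' : (‖(γ : ℍ[ℝ])‖ : ℂ) ≠ 0 := by exact_mod_cast hg.ne'
  have hpi := Real.pi_pos
  have h0 : ((Real.pi * ‖(γ : ℍ[ℝ])‖ ^ 2 : ℝ) : ℂ) ≠ 0 := by
    exact_mod_cast (by positivity : Real.pi * ‖(γ : ℍ[ℝ])‖ ^ 2 ≠ 0)
  have h1 : ((Real.pi * ‖(γ : ℍ[ℝ])‖ ^ 2 : ℝ) : ℂ) ^ (1 - w) *
      ((Real.pi * ‖(γ : ℍ[ℝ])‖ ^ 2 : ℝ) : ℂ)⁻¹ =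
      (Real.pi : ℂ) ^ (-w) * (‖(γ : ℍ[ℝ])‖ : ℂ) ^ (-(2 * w)) := by
    rw [← Complex.cpow_neg_one, ← Complex.cpow_add _ _ h0, show 1 - w + -1 = -w by ring,
      Complex.ofReal_mul, Complex.mul_cpow_ofReal_nonneg hpi.le (by positivity)]
    congr 1
    rw [Complex.ofReal_pow, ← Complex.cpow_nat_mul' (n := 2)]
    · congr 1; push_cast; ring
    · rw [Complex.arg_ofReal_of_nonneg hg.le]; simp [hpi]
    · rw [Complex.arg_ofReal_of_nonneg hg.le]; simp [hpi.le]
  have h2 : (‖(γ : ℍ[ℝ])‖ : ℂ) ^ (1 - 2 * w) =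
      ‖(γ : ℍ[ℝ])‖ * (‖(γ : ℍ[ℝ])‖ : ℂ) ^ (-(2 * w)) := by
    rw [sub_eq_add_neg, Complex.cpow_add _ _ hg', Complex.cpow_one]
  rw [mul_assoc _ (_ ^ _) _⁻¹, h1, baseTerm, h2, Complex.ofReal_mul (Real.sqrt 2)]
  ring

/-- The integral of `f Θ y^{(l+2)/2} y^s` over the strip, in terms of a Dirichlet series. -/
theorem integral_unitStrip_formProduct (hc : HasFourierCoeffs r f c) (hP : IsHarmonicPoly l P)
    {η : ℂ} (hH : IsDecayingForm (l + 2) η (formProduct l f P)) {s w : ℂ}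
    (hw : w = s + (l : ℂ) / 2 + 1 / 2) (hs : 1 < s.re) (hμ : |(Complex.I * r / 2).re| < w.re)
    (hsum : Summable (baseTerm c (evalQ P) w)) :
    ∫ z in unitStrip, formProduct l f P z * (z.im : ℂ) ^ s =
      ((Real.sqrt 2 : ℝ) : ℂ) * (Real.pi : ℂ) ^ (-w) * (Real.sqrt Real.pi * 2 ^ (-w) *
        (Complex.Gamma (w + Complex.I * r / 2) * Complex.Gamma (w - Complex.I * r / 2) /
          Complex.Gamma (w + 1 / 2))) * ∑' γ, baseTerm c (evalQ P) w γ := by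
  have hst : unitStrip = {z : UpperHalfPlane | z.re ∈ Ioc (-1 / 2 : ℝ) (1 / 2) ∧ z.im ∈ Ioi (0 : ℝ)} := by
    ext z
    exact ⟨fun h => ⟨h, z.im_pos⟩, fun h => h.1⟩
  have hi := hH.integrableOn_unitStrip hs
  rw [hst, integrableOn_coords measurableSet_Ioc measurableSet_Ioi Subset.rfl] at hi
  rw [hst, setIntegral_coords measurableSet_Ioc measurableSet_Ioi Subset.rfl]
  rw [IntegrableOn, Measure.volume_eq_prod, ← Measure.prod_restrict] at hi
  rw [Measure.volume_eq_prod, ← Measure.prod_restrict, integral_prod_symm _ hi]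
  have hinner : ∀ y ∈ Ioi (0 : ℝ), ∫ x in Ioc (-1 / 2 : ℝ) (1 / 2), ((1 / y ^ 2 : ℝ) : ℂ) *
      (formProduct l f P (mkPoint (x, y)) * ((mkPoint (x, y)).im : ℂ) ^ s) =
      ∑' γ, stripTerm r c P y γ * (y : ℂ) ^ (s + (l : ℂ) / 2 - 1) := by
    intro y (hy : 0 < y)
    have hy' : (y : ℂ) ≠ 0 := by exact_mod_cast hy.ne'
    rw [tsum_mul_right, (hasSum_integral_horocycle hc hP hy).tsum_eq, ← integral_mul_const]
    congr 1
    ext x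
    rw [formProduct, mkPoint_im (p := (x, y)) hy]
    -- The exponents are -2 from the measure, l/2+1 from the weight factor and s from the strip
    -- integrand.
    have h1 : ((1 / y ^ 2 : ℝ) : ℂ) * (((y ^ (((l : ℝ) + 2) / 2) : ℝ) : ℂ) * (y : ℂ) ^ s) =
        (y : ℂ) ^ (s + (l : ℂ) / 2 - 1) := by
      have h2 : ((1 / y ^ 2 : ℝ) : ℂ) = (y : ℂ) ^ (-2 : ℂ) := by
        rw [Complex.cpow_neg, show (2 : ℂ) = ((2 : ℕ) : ℂ) by norm_num, Complex.cpow_natCast]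
        push_cast
        rw [one_div]
      rw [h2, Complex.ofReal_cpow hy.le, ← Complex.cpow_add _ _ hy', ← Complex.cpow_add _ _ hy']
      congr 1
      push_cast
      ring
    rw [← h1]
    ring
  rw [setIntegral_congr_fun measurableSet_Ioi hinner]
  set g := besselExpKernel (Complex.I * r / 2) w with hg
  have ig : IntegrableOn g (Ioi 0) := integrableOn_besselExpKernel hμ
  set C : LatticeSNonzero → ℂ := fun γ =>
    c ⌊-(‖(γ : ℍ[ℝ])‖ ^ 2 / 2)⌋ * evalQ P γ * ((Real.sqrt 2 * ‖(γ : ℍ[ℝ])‖ : ℝ) : ℂ) *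
      ((Real.pi * ‖(γ : ℍ[ℝ])‖ ^ 2 : ℝ) : ℂ) ^ (1 - w) with hC
  have ha : ∀ γ : LatticeSNonzero, 0 < Real.pi * ‖(γ : ℍ[ℝ])‖ ^ 2 := fun γ =>
    mul_pos Real.pi_pos (pow_pos (norm_pos_iff.2 γ.2.2) 2)
  have hterm : ∀ (γ : LatticeSNonzero), ∀ y ∈ Ioi (0 : ℝ),
      stripTerm r c P y γ * (y : ℂ) ^ (s + (l : ℂ) / 2 - 1) =
        C γ * g (Real.pi * ‖(γ : ℍ[ℝ])‖ ^ 2 * y) := fun γ y hy => by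
    rw [stripTerm_mul_cpow hy, ← hw]
  have hint : ∀ γ : LatticeSNonzero,
      IntegrableOn (fun y : ℝ => C γ * g (Real.pi * ‖(γ : ℍ[ℝ])‖ ^ 2 * y)) (Ioi 0) := fun γ => by
    refine Integrable.const_mul ?_ _
    have := (integrableOn_Ioi_comp_mul_left_iff g 0 (ha γ)).2 (by rwa [mul_zero])
    exact this
  -- By scaling, each integral of norms is a fixed integral times the norm of a term of the base
  -- series, so summability is that of the base series.
  have hnorm : Summable fun γ : LatticeSNonzero =>
      ∫ y in Ioi (0 : ℝ), ‖C γ * g (Real.pi * ‖(γ : ℍ[ℝ])‖ ^ 2 * y)‖ := by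
    have h1 := (hsum.norm.mul_left (‖((Real.sqrt 2 : ℝ) : ℂ) * (Real.pi : ℂ) ^ (-w)‖)).mul_right
      (∫ y in Ioi (0 : ℝ), ‖g y‖)
    refine h1.congr fun γ => ?_
    simp only [norm_mul (C γ)]
    rw [integral_const_mul, integral_comp_mul_left_Ioi (fun y => ‖g y‖) 0 (ha γ), mul_zero,
      smul_eq_mul, ← mul_assoc, ← norm_mul, ← const_mul_pi_cpow, norm_mul, norm_inv,
      Complex.norm_real, Real.norm_of_nonneg (ha γ).le]
  rw [setIntegral_congr_fun measurableSet_Ioi (g := fun y => ∑' γ, C γ *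
    g (Real.pi * ‖(γ : ℍ[ℝ])‖ ^ 2 * y)) fun y hy => tsum_congr fun γ => hterm γ y hy]
  have hsumI := hasSum_integral_of_summable_integral_norm hint hnorm
  rw [← hsumI.tsum_eq, ← tsum_mul_left]
  refine tsum_congr fun γ => ?_
  rw [integral_const_mul, integral_comp_mul_left_Ioi g 0 (ha γ), mul_zero, Complex.real_smul,
    ← mul_assoc, Complex.ofReal_inv, const_mul_pi_cpow,
    show ∫ x in Ioi (0 : ℝ), g x = _ from integral_besselK_mul_exp hμ]
  ring

end MaassLift

namespace MaassLift
open MeasureTheory Set Filter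

/-! ## Convergence and symmetries of the Dirichlet series -/

variable {r : ℂ} {f : UpperHalfPlane → ℂ} {ε : ℂ} {c : ℤ → ℂ} {l : ℕ}
  {P : MvPolynomial (Fin 4) ℂ} {εP : ℂ}

theorem summable_xiTerm {A : ℍ[ℝ] → ℂ} {Q : ℍ[ℝ] → ℂ} {C D κ : ℝ}
    (hA : ∀ β ∈ latticeS, β ≠ 0 → ‖A β‖ ≤ C * ‖β‖ ^ κ) (hQ : ∀ x, ‖Q x‖ ≤ D * ‖x‖ ^ l) {w : ℂ}
    (hw : ((l : ℝ) + 4 + κ) / 2 < w.re) : Summable (xiTerm A Q w) := by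
  have hs := (summable_norm_rpow_nonzero (r := κ + l - 2 * w.re) (by linarith)).mul_left (C * D)
  refine Summable.of_norm_bounded hs fun β => ?_
  have hb : 0 < ‖(β : ℍ[ℝ])‖ := norm_pos_iff.2 β.2.2
  rw [xiTerm, norm_div, norm_mul, Complex.norm_cpow_eq_rpow_re_of_pos hb]
  have h1 := hA β β.2.1 β.2.2
  have h2 := hQ β
  have hre : (2 * w).re = 2 * w.re := by simp
  rw [hre]
  calc ‖A β‖ * ‖Q β‖ / ‖(β : ℍ[ℝ])‖ ^ (2 * w.re)
      ≤ (C * ‖(β : ℍ[ℝ])‖ ^ κ) * (D * ‖(β : ℍ[ℝ])‖ ^ l) / ‖(β : ℍ[ℝ])‖ ^ (2 * w.re) := by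
        have := (norm_nonneg _).trans h1
        gcongr
    _ = C * D * ‖(β : ℍ[ℝ])‖ ^ (κ + l - 2 * w.re) := by
        rw [Real.rpow_sub hb, Real.rpow_add hb, Real.rpow_natCast]; ring

/-- Quaternion conjugation on the nonzero elements of the lattice. -/
def starEquiv : LatticeSNonzero ≃ LatticeSNonzero where
  toFun β := ⟨star β.1, star_mem β.2.1, star_ne_zero.2 β.2.2⟩
  invFun β := ⟨star β.1, star_mem β.2.1, star_ne_zero.2 β.2.2⟩
  left_inv _ := Subtype.ext (star_star _)
  right_inv _ := Subtype.ext (star_star _)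

theorem xiTerm_star (ε : ℂ) (c : ℤ → ℂ) (Q : ℍ[ℝ] → ℂ) (s : ℂ) (β : LatticeSNonzero) :
    xiTerm (liftCoeff ε c) (fun x => Q (star x)) s β =
      xiTerm (liftCoeff ε c) Q s (starEquiv β) := by
  simp only [xiTerm, starEquiv, Equiv.coe_fn_mk, liftCoeff_star ε c β.2.1 β.2.2, norm_star]

theorem summable_xiTerm_star_iff (ε : ℂ) (c : ℤ → ℂ) (Q : ℍ[ℝ] → ℂ) (s : ℂ) :
    Summable (xiTerm (liftCoeff ε c) (fun x => Q (star x)) s) ↔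
      Summable (xiTerm (liftCoeff ε c) Q s) := by
  rw [← starEquiv.summable_iff (f := xiTerm (liftCoeff ε c) Q s)]
  exact summable_congr fun β => xiTerm_star ε c Q s β

theorem xiSeries_star (r ε : ℂ) (c : ℤ → ℂ) (Q : ℍ[ℝ] → ℂ) (s : ℂ) :
    xiSeries r (liftCoeff ε c) (fun x => Q (star x)) s = xiSeries r (liftCoeff ε c) Q s := by
  rw [xiSeries, xiSeries, ← starEquiv.tsum_eq (xiTerm (liftCoeff ε c) Q s)]
  congr 1
  exact tsum_congr fun β => xiTerm_star ε c Q s β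

theorem zeta8_mul_self : zeta8 * zeta8 = quat 0 1 0 0 := by
  have h : Real.sqrt 2 * Real.sqrt 2 = 2 := Real.mul_self_sqrt two_pos.le
  have h0 : Real.sqrt 2 ≠ 0 := (Real.sqrt_pos.2 two_pos).ne'
  rw [zeta8, quat_mul]
  congr 1 <;> field_simp <;> linarith

theorem IsEigenPoly.quatI_mul (hE : IsEigenPoly P εP) (x : ℍ[ℝ]) :
    evalQ P (quat 0 1 0 0 * x) = εP ^ 2 * evalQ P x := by
  rw [← zeta8_mul_self, mul_assoc, hE, hE]; ring

/-- Left multiplication by `i` on the nonzero elements of the lattice. -/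
def quatIEquiv : LatticeSNonzero ≃ LatticeSNonzero where
  toFun β := ⟨quat 0 1 0 0 * β.1, quatI_mul_mem β.2.1, mul_ne_zero quatI_ne_zero β.2.2⟩
  invFun β := ⟨-(quat 0 1 0 0 * β.1), latticeS.neg_mem (quatI_mul_mem β.2.1),
    neg_ne_zero.2 (mul_ne_zero quatI_ne_zero β.2.2)⟩
  left_inv β := Subtype.ext (by
    change -(quat 0 1 0 0 * (quat 0 1 0 0 * β.1)) = β.1
    rw [← mul_assoc, quatI_mul_self, neg_one_mul, neg_neg])
  right_inv β := Subtype.ext (by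
    change quat 0 1 0 0 * -(quat 0 1 0 0 * β.1) = β.1
    rw [mul_neg, ← mul_assoc, quatI_mul_self, neg_one_mul, neg_neg])

/-- Left multiplication by i = ((1+i)/√2)² permutes S∖{0}, fixes A and norms, and multiplies P by
ε_P²; the sum equals ε_P² times itself. -/
theorem xiSeries_eq_zero (r ε : ℂ) (c : ℤ → ℂ) (hE : IsEigenPoly P εP) (h : εP ^ 2 ≠ 1) (s : ℂ) :
    xiSeries r (liftCoeff ε c) (evalQ P) s = 0 := by
  have h1 : ∑' β, xiTerm (liftCoeff ε c) (evalQ P) s β =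
      εP ^ 2 * ∑' β, xiTerm (liftCoeff ε c) (evalQ P) s β := by
    rw [← tsum_mul_left]
    conv_lhs => rw [← quatIEquiv.tsum_eq]
    refine tsum_congr fun β => ?_
    simp only [xiTerm, quatIEquiv, Equiv.coe_fn_mk, liftCoeff_quatI_mul ε c β.2.1 β.2.2,
      norm_quatI_mul, hE.quatI_mul]
    ring
  have h2 : (εP ^ 2 - 1) * ∑' β, xiTerm (liftCoeff ε c) (evalQ P) s β = 0 := by
    linear_combination -h1
  rw [xiSeries, (mul_eq_zero.1 h2).resolve_left (sub_ne_zero.2 h), mul_zero]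

/-- Quaternions supply only real coordinates, but ℝ is infinite, so a complex polynomial vanishing
at all of them is zero. -/
theorem exists_evalQ_ne_zero (hP : P ≠ 0) : ∃ x : ℍ[ℝ], evalQ P x ≠ 0 := by
  by_contra! h
  refine hP (MvPolynomial.funext_set (fun _ : Fin 4 => range ((↑) : ℝ → ℂ))
    (fun _ => infinite_range_of_injective Complex.ofReal_injective) fun x hx => ?_)
  choose y hy using fun i => hx i (mem_univ i)
  have := h (quat (y 0) (y 1) (y 2) (y 3))
  have hv : ![((y 0 : ℝ) : ℂ), ((y 1 : ℝ) : ℂ), ((y 2 : ℝ) : ℂ), ((y 3 : ℝ) : ℂ)] = x := by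
    funext i
    fin_cases i <;> simp [hy]
  rw [map_zero, ← this, ← hv]
  rfl

/-- The fourth power of (1+i)/√2 is -1, so P(-x) = ε_P⁴ P(x) = P(x), while homogeneity gives (-1)^l
P(x). -/
theorem IsEigenPoly.even (hP : P.IsHomogeneous l) (h0 : P ≠ 0) (hE : IsEigenPoly P εP)
    (hεP : εP = 1 ∨ εP = -1) : Even l := by
  obtain ⟨x, hx⟩ := exists_evalQ_ne_zero h0
  have h1 : evalQ P (-x) = evalQ P x := by
    have h2 := hE.quatI_mul (quat 0 1 0 0 * x)
    rw [← mul_assoc, quatI_mul_self, neg_one_mul, hE.quatI_mul] at h2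
    rw [h2]
    rcases hεP with rfl | rfl <;> norm_num
  have h3 := evalQ_smul hP (-1) x
  rw [neg_one_smul, h1] at h3
  by_contra hl
  rw [Nat.not_even_iff_odd] at hl
  push_cast at h3
  rw [hl.neg_one_pow] at h3
  exact hx (by linear_combination h3 / 2)

theorem rpow_le_rpow_norm_latticeS {β : ℍ[ℝ]} (h : β ∈ latticeS) (h0 : β ≠ 0) {a b : ℝ}
    (hab : a ≤ b) : ‖β‖ ^ a ≤ ‖β‖ ^ b := by
  obtain ⟨m, hm0, hm⟩ := norm_sq_pos_of_mem h h0
  refine Real.rpow_le_rpow_of_exponent_le ?_ hab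
  have : (1 : ℝ) ≤ m := by exact_mod_cast hm0
  nlinarith [norm_nonneg β]

/-! ## The continuation -/

/-- The Dirichlet series in terms of the integral against the Eisenstein series. -/
theorem xiSeries_eq_integral (hf : IsMaassCuspForm r f) (hε : ε = 1 ∨ ε = -1)
    (hAL : HasAtkinLehnerEigenvalue f ε) (hc : HasFourierCoeffs r f c) (hP : IsHarmonicPoly l P)
    (hE : IsEigenPoly P εP) (hεP : εP = 1 ∨ εP = -1) (hl : Even l) {s w : ℂ}
    (hw : w = s + (l : ℂ) / 2 + 1 / 2) (hs : 1 < s.re) (hμ : |(Complex.I * r / 2).re| < w.re)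
    (hsum : Summable (baseTerm c (evalQ P) w)) :
    xiSeries r (liftCoeff ε c) (evalQ P) w =
      (2 : ℂ) ^ (1 - (l : ℂ) / 2) * (Real.pi : ℂ) ^ (-((l : ℂ) + 1)) * ((2 : ℂ) ^ s + -(ε * εP)) *
        ∫ z in fordDomain, formProduct l f P z * eisContinuation l z s := by
  have hH := isDecayingForm_formProduct hf hε hAL hc hP hE hεP hl
  set η := -(ε * εP) with hη
  have hpi : (Real.pi : ℂ) ≠ 0 := by exact_mod_cast Real.pi_ne_zero
  have h2 : (2 : ℂ) ≠ 0 := two_ne_zero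
  have hη2 := hH.sq_eq_one
  have hexp : (l : ℂ) + 1 - 2 * w = -(2 * s) := by rw [hw]; ring
  have h2s : (2 : ℂ) ^ s ≠ 0 := by rw [Complex.cpow_ne_zero_iff]; exact Or.inl h2
  have hx2 : (2 : ℂ) ^ (-(2 * s)) = ((2 : ℂ) ^ s)⁻¹ ^ 2 := by
    rw [← Complex.cpow_neg, ← Complex.cpow_nat_mul]
    congr 1
    push_cast
    ring
  have hq : -ε * εP * (Real.sqrt 2 : ℂ) ^ ((l : ℂ) + 1 - 2 * w) = η * ((2 : ℂ) ^ s)⁻¹ := by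
    have h3 : (Real.sqrt 2 : ℂ) ^ (-(2 * s)) = ((2 : ℂ) ^ s)⁻¹ := by
      rw [Complex.cpow_neg]
      congr 1
      have h0 : ((Real.sqrt 2 : ℝ) : ℂ) ≠ 0 := by exact_mod_cast (Real.sqrt_pos.2 two_pos).ne'
      rw [two_mul, Complex.cpow_add _ _ h0,
        ← Complex.mul_cpow_ofReal_nonneg (Real.sqrt_nonneg _) (Real.sqrt_nonneg _),
        ← Complex.ofReal_mul, Real.mul_self_sqrt two_pos.le, Complex.ofReal_ofNat]
    rw [hexp, h3, hη]
    ring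
  have hqn : ‖η * ((2 : ℂ) ^ s)⁻¹‖ < 1 := by
    rw [norm_mul, hH.norm_eta, one_mul, norm_inv, ← Complex.ofReal_ofNat,
      Complex.norm_cpow_eq_rpow_re_of_pos two_pos]
    exact inv_lt_one_of_one_lt₀ (Real.one_lt_rpow one_lt_two (by linarith))
  have hodd := hasSum_odd_cpow (s := 2 * s) (by simp; linarith)
  have hxi := hasSum_xiTerm hP.1 hE ε w (by rw [hq]; exact hqn) (by rw [hexp]; exact hodd.summable) hsum
  rw [hq, hexp, hodd.tsum_eq] at hxi
  have hstrip := integral_unitStrip_formProduct hc hP hH hw hs hμ hsum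
  have hI : ∫ z in fordDomain, formProduct l f P z * eisContinuation l z s =
      ∫ z in fordDomain, formProduct l f P z * eisSeries l z s := by
    congr 1
    ext z
    rw [eisContinuation_eq hl z hs]
  rw [hI, hH.integral_eisSeries hs, hstrip, xiSeries, hxi.tsum_eq]
  have hwre : 0 < w.re := (abs_nonneg _).trans_lt hμ
  have hΓ : Complex.Gamma (w + 1 / 2) ≠ 0 :=
    Complex.Gamma_ne_zero_of_re_pos (by simp; linarith)
  rw [show s + (l : ℂ) / 2 + 1 = w + 1 / 2 by rw [hw]; ring, hx2]
  have h1q : 1 - η * ((2 : ℂ) ^ s)⁻¹ ≠ 0 := fun h => by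
    rw [sub_eq_zero] at h
    rw [← h, norm_one] at hqn
    exact lt_irrefl _ hqn
  -- The geometric series divides the factor 1 - 2^(-2s) of the odd zeta sum: (1 - 2^(-2s))/(1 -
  -- η2^(-s)) = 1 + η2^(-s), because η² = 1.
  have hcancel : (1 - η * ((2 : ℂ) ^ s)⁻¹)⁻¹ * (1 - ((2 : ℂ) ^ s)⁻¹ ^ 2) =
      ((2 : ℂ) ^ s + η) * ((2 : ℂ) ^ s)⁻¹ := by
    rw [inv_mul_eq_iff_eq_mul₀ h1q]
    field_simp
    linear_combination hη2
  -- Only powers of 2 and π remain; substituting w = s + l/2 + 1/2 balances both exponents.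
  have hpow : (Real.pi : ℂ) ^ (-2 * w) * ((2 : ℂ) ^ s)⁻¹ =
      (2 : ℂ) ^ (1 - (l : ℂ) / 2) * (Real.pi : ℂ) ^ (-((l : ℂ) + 1)) *
      (((4 * Real.pi : ℝ) : ℂ) ^ ((l : ℂ) / 2) * (Real.pi : ℂ) ^ (-s) * (1 / 2)) *
      (((Real.sqrt 2 : ℝ) : ℂ) * (Real.pi : ℂ) ^ (-w) * (Real.sqrt Real.pi * 2 ^ (-w))) := by
    have e1 : ((Real.sqrt 2 : ℝ) : ℂ) = (2 : ℂ) ^ (1 / 2 : ℂ) := by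
      rw [Real.sqrt_eq_rpow, Complex.ofReal_cpow two_pos.le]
      push_cast
      rfl
    have e2 : ((Real.sqrt Real.pi : ℝ) : ℂ) = (Real.pi : ℂ) ^ (1 / 2 : ℂ) := by
      rw [Real.sqrt_eq_rpow, Complex.ofReal_cpow Real.pi_pos.le]
      push_cast
      rfl
    have e3 : ((4 * Real.pi : ℝ) : ℂ) ^ ((l : ℂ) / 2) =
        (2 : ℂ) ^ (l : ℂ) * (Real.pi : ℂ) ^ ((l : ℂ) / 2) := by
      rw [Complex.ofReal_mul, Complex.mul_cpow_ofReal_nonneg (by norm_num) Real.pi_pos.le]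
      congr 1
      rw [show ((4 : ℝ) : ℂ) = ((2 : ℝ) : ℂ) * ((2 : ℝ) : ℂ) by norm_num,
        Complex.mul_cpow_ofReal_nonneg two_pos.le two_pos.le, Complex.ofReal_ofNat,
        ← Complex.cpow_add _ _ h2]
      congr 1
      ring
    have e4 : (1 / 2 : ℂ) = (2 : ℂ) ^ (-1 : ℂ) := by rw [Complex.cpow_neg_one]; norm_num
    rw [e1, e2, e3, ← Complex.cpow_neg]
    have hL : (Real.pi : ℂ) ^ (-2 * w) = (Real.pi : ℂ) ^ (-((l : ℂ) + 1)) *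
        (Real.pi : ℂ) ^ ((l : ℂ) / 2) * (Real.pi : ℂ) ^ (-s) * (Real.pi : ℂ) ^ (-w) *
        (Real.pi : ℂ) ^ (1 / 2 : ℂ) := by
      rw [← Complex.cpow_add _ _ hpi, ← Complex.cpow_add _ _ hpi, ← Complex.cpow_add _ _ hpi,
        ← Complex.cpow_add _ _ hpi]
      congr 1
      rw [hw]
      ring
    have hR : (2 : ℂ) ^ (-s) = (2 : ℂ) ^ (1 - (l : ℂ) / 2) * (2 : ℂ) ^ (l : ℂ) * (2 : ℂ) ^ (-1 : ℂ) *
        (2 : ℂ) ^ (1 / 2 : ℂ) * (2 : ℂ) ^ (-w) := by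
      rw [← Complex.cpow_add _ _ h2, ← Complex.cpow_add _ _ h2, ← Complex.cpow_add _ _ h2,
        ← Complex.cpow_add _ _ h2]
      congr 1
      rw [hw]
      ring
    rw [hL, hR, ← e4]
    ring
  set G := Complex.Gamma (w + Complex.I * r / 2) * Complex.Gamma (w - Complex.I * r / 2) with hG
  set D := ∑' γ, baseTerm c (evalQ P) w γ with hD
  set Z := riemannZeta (2 * s) with hZ
  have hGG : Complex.Gamma (w + 1 / 2) * (G / Complex.Gamma (w + 1 / 2)) = G :=
    mul_div_cancel₀ _ hΓ
  linear_combination ((Real.pi : ℂ) ^ (-2 * w) * G * Z * D) * hcancel +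
    (((2 : ℂ) ^ s + η) * G * Z * D) * hpow -
    ((2 : ℂ) ^ (1 - (l : ℂ) / 2) * (Real.pi : ℂ) ^ (-((l : ℂ) + 1)) *
      (((4 * Real.pi : ℝ) : ℂ) ^ ((l : ℂ) / 2) * (Real.pi : ℂ) ^ (-s) * (1 / 2)) *
      (((Real.sqrt 2 : ℝ) : ℂ) * (Real.pi : ℂ) ^ (-w) * (Real.sqrt Real.pi * 2 ^ (-w))) *
      ((2 : ℂ) ^ s + η) * Z * D) * hGG

/-- The continuation of the Dirichlet series, as a Mellin transform. -/
def xiContinuation (l : ℕ) (η : ℂ) (H : UpperHalfPlane → ℂ) (w : ℂ) : ℂ :=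
  (2 : ℂ) ^ (1 - (l : ℂ) / 2) * (Real.pi : ℂ) ^ (-((l : ℂ) + 1)) *
    (η * (((4 * Real.pi : ℝ) : ℂ) ^ ((l : ℂ) / 2) / 4 * (Real.pi : ℂ) ^ ((l : ℂ) / 2 + 1))) *
    mellin (foldedTheta (l + 2) η H) (w + 1 / 2)

section Continuation

variable {η : ℂ} {H : UpperHalfPlane → ℂ}

theorem xiContinuation_eq (h : IsDecayingForm (l + 2) η H) {s : ℂ} (hs : (2 : ℂ) ^ (2 * s) ≠ 1) :
    xiContinuation l η H (s + l / 2 + 1 / 2) =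
      (2 : ℂ) ^ (1 - (l : ℂ) / 2) * (Real.pi : ℂ) ^ (-((l : ℂ) + 1)) * ((2 : ℂ) ^ s + η) *
        ∫ z in fordDomain, H z * eisContinuation l z s := by
  have h1 := (h.integral_mul_eisContinuation hs).2
  have h2 : s + (l : ℂ) / 2 + 1 / 2 + 1 / 2 = s + ((l + 2 : ℕ) : ℂ) / 2 := by push_cast; ring
  rw [xiContinuation, h2]
  linear_combination (-((2 : ℂ) ^ (1 - (l : ℂ) / 2) * (Real.pi : ℂ) ^ (-((l : ℂ) + 1)))) * h1

theorem differentiable_xiContinuation (h : IsDecayingForm (l + 2) η H) :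
    Differentiable ℂ (xiContinuation l η H) :=
  ((h.isSelfDualDecaying_foldedTheta (by omega)).differentiable_mellin.comp
    (differentiable_id.add_const _)).const_mul _

theorem boundedOnVerticalStrips_xiContinuation (h : IsDecayingForm (l + 2) η H) :
    BoundedOnVerticalStrips (xiContinuation l η H) := by
  intro a b
  obtain ⟨M, hM⟩ := (h.isSelfDualDecaying_foldedTheta (by omega)).exists_norm_mellin_le
    (a + 1 / 2) (b + 1 / 2)
  refine ⟨‖(2 : ℂ) ^ (1 - (l : ℂ) / 2) * (Real.pi : ℂ) ^ (-((l : ℂ) + 1)) *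
    (η * (((4 * Real.pi : ℝ) : ℂ) ^ ((l : ℂ) / 2) / 4 * (Real.pi : ℂ) ^ ((l : ℂ) / 2 + 1)))‖ * M,
    fun s ha hb => ?_⟩
  rw [xiContinuation, norm_mul]
  refine mul_le_mul_of_nonneg_left (hM _ ?_ ?_) (norm_nonneg _) <;> simp <;> linarith

/-- The Mellin transform is symmetric under u ↦ (l+2)+1-u; with u = s + 1/2 this is s ↦ 2+l-s. -/
theorem xiContinuation_symm (h : IsDecayingForm (l + 2) η H) (s : ℂ) :
    xiContinuation l η H (2 + l - s) = xiContinuation l η H s := by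
  have h1 := (h.isSelfDualDecaying_foldedTheta (by omega)).mellin_symm (s + 1 / 2)
  rw [xiContinuation, xiContinuation, ← h1]
  congr 2
  push_cast
  ring

end Continuation

theorem two_cpow_ne_one {s : ℂ} (hs : 0 < s.re) : (2 : ℂ) ^ s ≠ 1 := fun h => by
  have := congrArg norm h
  rw [← Complex.ofReal_ofNat, Complex.norm_cpow_eq_rpow_re_of_pos two_pos, norm_one] at this
  exact (Real.one_lt_rpow one_lt_two hs).ne' this

/-- S and A are stable under conjugation, so the series for P̂ is a rearrangement of the one for P
and has the same continuation. -/
theorem isXiContinuation_star {κ : ℝ} {Q : ℍ[ℝ] → ℂ} {Ξ : ℂ → ℂ}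
    (h : IsXiContinuation r (liftCoeff ε c) κ l Q Ξ) :
    IsXiContinuation r (liftCoeff ε c) κ l (fun x => Q (star x)) Ξ :=
  ⟨h.1, fun s hs => ⟨(summable_xiTerm_star_iff ε c Q s).2 (h.2 s hs).1,
    (xiSeries_star r ε c Q s).symm ▸ (h.2 s hs).2⟩⟩

end MaassLift

end

/-! ### Assembly of the proposition -/

open MaassLift in
theorem proposition4p2 (r : ℂ) (f : UpperHalfPlane → ℂ) (hf : IsMaassCuspForm r f)
    (c : ℤ → ℂ) (hc : HasFourierCoeffs r f c)
    (ε : ℂ) (hε : ε = 1 ∨ ε = -1) (hAL : HasAtkinLehnerEigenvalue f ε) :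
    -- `A(β)` is well defined on `S ∖ {0}`
    (∀ β ∈ latticeS, β ≠ 0 → ∃ u d β₀, IsPrimDecomp β u d β₀) ∧
    (∀ β u d β₀, IsPrimDecomp β u d β₀ → liftCoeff ε c β = liftSum ε c β u d) ∧
    -- polynomial growth, which makes the Dirichlet series converge
    ∃ κ : ℝ, 0 < κ ∧
      (∃ C : ℝ, ∀ β ∈ latticeS, β ≠ 0 → ‖liftCoeff ε c β‖ ≤ C * ‖β‖ ^ κ) ∧
      ∀ (l : ℕ) (P : MvPolynomial (Fin 4) ℂ) (εP : ℂ),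
        IsHarmonicPoly l P → P ≠ 0 → IsEigenPoly P εP →
        ∃ Ξ Ξhat : ℂ → ℂ,
          -- analytic continuation of `ξ(s, P)` and of `ξ(s, P̂)`
          IsXiContinuation r (liftCoeff ε c) κ l (evalQ P) Ξ ∧
          IsXiContinuation r (liftCoeff ε c) κ l (fun x => evalQ P (star x)) Ξhat ∧
          BoundedOnVerticalStrips Ξ ∧
          (∀ s : ℂ, Ξ (2 + l - s) = (-1) ^ l * Ξhat s) ∧
          -- the formula for `ξ(s + l/2 + 1/2, P)`
          (εP = 1 ∨ εP = -1 →
            (∃ E, IsEisContinuation l E) ∧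
            ∀ E, IsEisContinuation l E → ∀ s : ℂ, (2 : ℂ) ^ (2 * s) ≠ 1 →
              MeasureTheory.IntegrableOn (zetaIntegrand l f (evalQ P) E s) fordDomain ∧
              Ξ (s + l / 2 + 1 / 2) =
                (2 : ℂ) ^ (1 - (l : ℂ) / 2) * (Real.pi : ℂ) ^ (-((l : ℂ) + 1)) *
                  ((2 : ℂ) ^ s - ε * εP) * zetaIntegral l f (evalQ P) E s) ∧
          (¬ (εP = 1 ∨ εP = -1) → ∀ s : ℂ, Ξ (s + l / 2 + 1 / 2) = 0) := by
  obtain ⟨C, N, hC0, hcoeff⟩ := hf.exists_norm_coeff_le hε hAL hc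
  have hcoeff' : ∀ m : ℕ, 0 < m → ‖c (-m)‖ ≤ C * (m : ℝ) ^ N := fun m hm => by
    have := hcoeff (-m) (by omega)
    simpa using this
  set ρ := |(Complex.I * r / 2).re| with hρ
  have hρ0 : 0 ≤ ρ := abs_nonneg _
  -- The surplus 2ρ in the exponent ensures that the half plane of the statement lies in the range
  -- Re w > ρ where the Bessel integral converges; the rest already gives Re s > 1 and convergence
  -- of the base series.
  have hA : ∀ β ∈ latticeS, β ≠ 0 → ‖liftCoeff ε c β‖ ≤ C * ‖β‖ ^ (2 * N + 5 + 2 * ρ) := by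
    intro β hβ hβ0
    refine (norm_liftCoeff_le hε hcoeff' hβ hβ0).trans ?_
    have h1 := rpow_le_rpow_norm_latticeS hβ hβ0 (a := ((2 * N + 5 : ℕ) : ℝ))
      (b := 2 * N + 5 + 2 * ρ) (by push_cast; linarith)
    rw [Real.rpow_natCast] at h1
    gcongr
  refine ⟨fun β hβ hβ0 => exists_isPrimDecomp hβ hβ0, fun β u d β₀ h => liftCoeff_eq ε c h,
    2 * N + 5 + 2 * ρ, by positivity, ⟨C, hA⟩, ?_⟩
  intro l P εP hP hP0 hE
  obtain ⟨D, hD0, hD⟩ := exists_norm_evalQ_le hP.1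
  by_cases hεP : εP = 1 ∨ εP = -1
  · have hl : Even l := hE.even hP.1 hP0 hεP
    have hH := isDecayingForm_formProduct hf hε hAL hc hP hE hεP hl
    have hxi : IsXiContinuation r (liftCoeff ε c) (2 * N + 5 + 2 * ρ) l (evalQ P)
        (xiContinuation l (-(ε * εP)) (formProduct l f P)) := by
      refine ⟨differentiable_xiContinuation hH, fun w hw => ⟨summable_xiTerm hA hD hw, ?_⟩⟩
      have hw' : w = (w - l / 2 - 1 / 2) + (l : ℂ) / 2 + 1 / 2 := by ring
      have hre : (w - (l : ℂ) / 2 - 1 / 2).re = w.re - l / 2 - 1 / 2 := by simp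
      have hN : (0 : ℝ) ≤ N := Nat.cast_nonneg N
      have hl0 : (0 : ℝ) ≤ l := Nat.cast_nonneg l
      have hs : 1 < (w - (l : ℂ) / 2 - 1 / 2).re := by rw [hre]; linarith
      have h1 := xiContinuation_eq hH (s := w - l / 2 - 1 / 2)
        (two_cpow_ne_one (by
          rw [show (2 : ℂ) * (w - l / 2 - 1 / 2) = ((2 : ℝ) : ℂ) * (w - l / 2 - 1 / 2) by norm_num,
            Complex.re_ofReal_mul]
          linarith))
      rw [← hw'] at h1
      rw [h1]
      exact (xiSeries_eq_integral hf hε hAL hc hP hE hεP hl hw' hs (by rw [← hρ]; linarith)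
        (summable_baseTerm hcoeff' hD (by linarith))).symm
    refine ⟨_, _, hxi, isXiContinuation_star hxi, boundedOnVerticalStrips_xiContinuation hH,
      fun s => ?_, fun _ => ⟨⟨_, isEisContinuation_eisContinuation hl⟩, fun E hEis s hs => ?_⟩,
      fun h => absurd hεP h⟩
    · rw [xiContinuation_symm hH, hl.neg_one_pow, one_mul]
    · have heq : zetaIntegrand l f (evalQ P) E s =
          fun z => formProduct l f P z * eisContinuation l z s := by
        ext z
        rw [zetaIntegrand_eq, hEis.eq_eisContinuation hl z hs]
      rw [zetaIntegral, heq]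
      refine ⟨(hH.integral_mul_eisContinuation hs).1, ?_⟩
      rw [xiContinuation_eq hH hs, ← sub_eq_add_neg]
  -- Here the series vanishes wherever it converges, so its continuation is identically 0.
  · have hsq : εP ^ 2 ≠ 1 := fun h => hεP (mul_self_eq_one_iff.1 (by rw [← sq, h]))
    have hxi : IsXiContinuation r (liftCoeff ε c) (2 * N + 5 + 2 * ρ) l (evalQ P) fun _ => 0 :=
      ⟨differentiable_const 0, fun w hw => ⟨summable_xiTerm hA hD hw,
        (xiSeries_eq_zero r ε c hE hsq w).symm⟩⟩
    exact ⟨_, _, hxi, isXiContinuation_star hxi, fun _ _ => ⟨0, fun _ _ _ => by simp⟩,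
      fun s => by simp, fun h => absurd h hεP, fun _ _ => rfl⟩
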